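/- A cactus is a finite simple connected graph each of whose $2$-vertex-connected components (blocks, a bridge being a block) is a single edge or a cycle. A truly integral Fáry embedding of a graph is a crossing-free straight-line drawing in the Euclidean plane in which all vertices have integer coordinates and all edges have integer length. Let $C=(V,E)$ be a cactus with root $r\in V$, with $n$ vertices, $t$ leaves (vertices of degree $1$ other than $r$), diameter $d$, and $o$ cycles, $\delta$ of which are triangles, and let $$S=\frac{2\pi^2}{3}\,(d+o)(t+2o)+\delta\cdot 2\Bigl(\frac{\pi^2}{3}(t+2o)\Bigr)^2 .$$ Then $C$ has a truly integral Fáry embedding on a grid of side $S$, that is, with all vertices in $\{0,1,\dots,\lfloor S\rfloor\}^2$, and $S\in\mathcal O(n^3)$. Moreover, there is a single algorithm that, given $n$, $r$ and adjacency lists of $C$ (with the vertices numbered $0,\dots,n-1$ and the lists ordered in any way), finds such an embedding in $\mathcal O\bigl(n+(t+2o)^{3/2}\bigr)$ time on a random access machine with unit-cost arithmetic on words of $\mathcal O(\log n)$ bits ($\mathcal O(1)$ bits if $n=1$). The constants hidden in the $\mathcal O$-notation are absolute. -/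

import Mathlib

/-! ## Cacti and their parameters -/

namespace Cactus

/-- The subgraph induced by `s` has at least two vertices, is connected and has no cut vertex. -/
def IsNonseparable {V : Type*} (G : SimpleGraph V) (s : Set V) : Prop :=
  s.Nontrivial ∧ (G.induce s).Connected ∧ ∀ v ∈ s, (G.induce (s \ {v})).Connected

/-- The vertex sets of the 2-vertex-connected components (blocks); a bridge counts as a block. -/
def IsBlock {V : Type*} (G : SimpleGraph V) (s : Set V) : Prop :=
  Maximal (IsNonseparable G) s

/-- A connected graph each of whose 2-vertex-connected components is a single edge or a cycle. -/
def IsCactus {V : Type*} (G : SimpleGraph V) : Prop :=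
  G.Connected ∧ ∀ s : Set V, IsBlock G s →
    s.ncard = 2 ∨ ∃ k : ℕ, 3 ≤ k ∧ Nonempty (G.induce s ≃g SimpleGraph.cycleGraph k)

/-- The cycles of `G`, each one given by its set of edges. -/
def cycles {V : Type*} (G : SimpleGraph V) : Set (Set (Sym2 V)) :=
  {E | ∃ (v : V) (w : G.Walk v v), w.IsCycle ∧ E = {e | e ∈ w.edges}}

/-- The number of cycles. -/
noncomputable def numCycles {V : Type*} (G : SimpleGraph V) : ℕ :=
  (cycles G).ncard

/-- The number of cycles of length three. -/
noncomputable def numTriangles {V : Type*} (G : SimpleGraph V) : ℕ :=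
  {E ∈ cycles G | E.ncard = 3}.ncard

/-- The number of leaves of `G` rooted at `r`: the vertices of degree one without a successor,
i.e. the vertices of degree one other than the root. -/
noncomputable def numLeaves {V : Type*} (G : SimpleGraph V) (r : V) : ℕ :=
  {v : V | v ≠ r ∧ (G.neighborSet v).ncard = 1}.ncard

/-- The number `t + 2 o`. -/
noncomputable def numSlopes {V : Type*} (G : SimpleGraph V) (r : V) : ℕ :=
  numLeaves G r + 2 * numCycles G

/-- The side `(2π²/3) (d + o) (t + 2o) + δ · 2 ((π²/3) (t + 2o))²` of the grid. -/
noncomputable def gridSide {V : Type*} (G : SimpleGraph V) (r : V) : ℝ :=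
  2 * Real.pi ^ 2 / 3 * ((G.diam : ℝ) + numCycles G) * numSlopes G r +
    numTriangles G * (2 * (Real.pi ^ 2 / 3 * numSlopes G r) ^ 2)

/-! ## Straight-line drawings -/

/-- An integer point as a point of the Euclidean plane. -/
noncomputable def toPlane (z : ℤ × ℤ) : EuclideanSpace ℝ (Fin 2) :=
  !₂[(z.1 : ℝ), (z.2 : ℝ)]

/-- The straight-line drawing of `G` with the vertices at the integer points `p v` is crossing-free
and all its edges have integer length. -/
structure IsTrulyIntegralFary {V : Type*} (G : SimpleGraph V) (p : V → ℤ × ℤ) : Prop where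
  /-- Distinct vertices are at distinct points. -/
  injective : Function.Injective p
  /-- The Euclidean length of every edge is an integer. -/
  integer_length : ∀ u v, G.Adj u v → ∃ l : ℕ, dist (toPlane (p u)) (toPlane (p v)) = l
  /-- No vertex lies on an edge that is not incident to it. -/
  vertex_off_edge : ∀ u v w, G.Adj u v → w ≠ u → w ≠ v →
    toPlane (p w) ∉ segment ℝ (toPlane (p u)) (toPlane (p v))
  /-- Two distinct edges meet at most in a common end vertex. -/
  crossing_free : ∀ u v x y, G.Adj u v → G.Adj x y → s(u, v) ≠ s(x, y) →
    ∀ q ∈ segment ℝ (toPlane (p u)) (toPlane (p v)),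
      q ∈ segment ℝ (toPlane (p x)) (toPlane (p y)) →
      ∃ w, (w = u ∨ w = v) ∧ (w = x ∨ w = y) ∧ q = toPlane (p w)

end Cactus

/-! ## A random access machine

Structured programs over natural-number registers and finitely many random access arrays, with
unit-cost arithmetic on words of bounded size. -/

namespace RAM

/-- The memory: registers `reg i` and arrays `mem a`, the cells of which are `mem a j`. -/
structure State where
  reg : ℕ → ℕ
  mem : ℕ → ℕ → ℕ

/-- Overwrite register `i`. -/
def State.setReg (s : State) (i x : ℕ) : State :=
  { s with reg := Function.update s.reg i x }

/-- Overwrite cell `j` of array `a`. -/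
def State.setMem (s : State) (a j x : ℕ) : State :=
  { s with mem := Function.update s.mem a (Function.update (s.mem a) j x) }

/-- Binary operations on words. -/
inductive Op
  | add | sub | mul | div | mod | lt | eq

/-- Subtraction is truncated, division by zero gives zero, comparisons give `1` or `0`. -/
def Op.apply : Op → ℕ → ℕ → ℕ
  | .add, x, y => x + y
  | .sub, x, y => x - y
  | .mul, x, y => x * y
  | .div, x, y => x / y
  | .mod, x, y => x % y
  | .lt, x, y => if x < y then 1 else 0
  | .eq, x, y => if x = y then 1 else 0

/-- Expressions: constants, registers, array cells with a computed index, binary operations. -/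
inductive Exp
  | lit (k : ℕ)
  | reg (i : ℕ)
  | load (a : ℕ) (e : Exp)
  | op (o : Op) (e₁ e₂ : Exp)

namespace Exp

/-- The value of an expression. -/
def eval (s : State) : Exp → ℕ
  | lit k => k
  | reg i => s.reg i
  | load a e => s.mem a (e.eval s)
  | op o e₁ e₂ => o.apply (e₁.eval s) (e₂.eval s)

/-- The time for evaluating an expression: one unit for each constant, access or operation. -/
def cost : Exp → ℕ
  | lit _ => 1
  | reg _ => 1
  | load _ e => e.cost + 1
  | op _ e₁ e₂ => e₁.cost + e₂.cost + 1

/-- All values that occur in the evaluation (also as indices) are at most `W`. -/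
def Fits (W : ℕ) (s : State) : Exp → Prop
  | lit k => k ≤ W
  | reg i => s.reg i ≤ W
  | load a e => e.Fits W s ∧ s.mem a (e.eval s) ≤ W
  | op o e₁ e₂ => e₁.Fits W s ∧ e₂.Fits W s ∧ o.apply (e₁.eval s) (e₂.eval s) ≤ W

end Exp

/-- Programs. -/
inductive Prog
  | skip
  /-- Put the value of `e` into register `i`. -/
  | assign (i : ℕ) (e : Exp)
  /-- Put the value of `e` into the cell of array `a` with index the value of `j`. -/
  | store (a : ℕ) (j e : Exp)
  | seq (P Q : Prog)
  /-- Run `P` if `e` is nonzero, and `Q` otherwise. -/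
  | branch (e : Exp) (P Q : Prog)
  /-- Run `P` as long as `e` is nonzero. -/
  | loop (e : Exp) (P : Prog)

/-- `Exec W P s T s'`: started in `s`, the program `P` halts in `s'` after `T` units of time, and
no value larger than `W` occurs in the computation. -/
inductive Exec (W : ℕ) : Prog → State → ℕ → State → Prop
  | skip (s : State) : Exec W .skip s 1 s
  | assign (s : State) (i : ℕ) (e : Exp) (he : e.Fits W s) :
      Exec W (.assign i e) s (e.cost + 1) (s.setReg i (e.eval s))
  | store (s : State) (a : ℕ) (j e : Exp) (hj : j.Fits W s) (he : e.Fits W s) :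
      Exec W (.store a j e) s (j.cost + e.cost + 1)
        (s.setMem a (j.eval s) (e.eval s))
  | seq {P Q : Prog} {s₁ s₂ s₃ : State} {T₁ T₂ : ℕ}
      (hP : Exec W P s₁ T₁ s₂) (hQ : Exec W Q s₂ T₂ s₃) :
      Exec W (.seq P Q) s₁ (T₁ + T₂) s₃
  | branch_true {e : Exp} {P Q : Prog} {s s' : State} {T : ℕ}
      (hf : e.Fits W s) (he : e.eval s ≠ 0) (hP : Exec W P s T s') :
      Exec W (.branch e P Q) s (e.cost + 1 + T) s'
  | branch_false {e : Exp} {P Q : Prog} {s s' : State} {T : ℕ}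
      (hf : e.Fits W s) (he : e.eval s = 0) (hQ : Exec W Q s T s') :
      Exec W (.branch e P Q) s (e.cost + 1 + T) s'
  | loop_true {e : Exp} {P : Prog} {s₁ s₂ s₃ : State} {T₁ T₂ : ℕ}
      (hf : e.Fits W s₁) (he : e.eval s₁ ≠ 0)
      (hP : Exec W P s₁ T₁ s₂) (hL : Exec W (.loop e P) s₂ T₂ s₃) :
      Exec W (.loop e P) s₁ (e.cost + 1 + T₁ + T₂) s₃
  | loop_false {e : Exp} {P : Prog} {s : State}
      (hf : e.Fits W s) (he : e.eval s = 0) :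
      Exec W (.loop e P) s (e.cost + 1) s

/-- `adj` consists of adjacency lists, in any order, of the graph `G` whose vertices are numbered
by `num`. -/
def IsAdjacencyLists {V : Type*} {n : ℕ} (G : SimpleGraph V) (num : Fin n ≃ V)
    (adj : Fin n → List (Fin n)) : Prop :=
  ∀ i, (adj i).Nodup ∧ ∀ j, j ∈ adj i ↔ G.Adj (num i) (num j)

/-- The input: register `0` holds the number `n` of vertices and register `1` the root. Array `1`
holds the adjacency lists of the vertices `0, …, n - 1`, one after the other, and cell `i ≤ n` of
array `0` the total length of the first `i` lists. All other cells hold `0`. -/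
def inputState {n : ℕ} (adj : Fin n → List (Fin n)) (r : Fin n) : State where
  reg i := if i = 0 then n else if i = 1 then r else 0
  mem a j :=
    if a = 0 then
      if j ≤ n then (((List.ofFn adj).take j).map List.length).sum else 0
    else if a = 1 then (((List.ofFn adj).flatten).map Fin.val).getD j 0
    else 0

/-- The output: cell `i` of the arrays `2` and `3` holds the two coordinates of vertex `i`. -/
def outputDrawing {V : Type*} {n : ℕ} (num : Fin n ≃ V) (s : State) (v : V) : ℤ × ℤ :=
  ((s.mem 2 (num.symm v) : ℤ), (s.mem 3 (num.symm v) : ℤ))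

end RAM

/-! ### Cycles and blocks of a cactus. -/

namespace Cactus

open SimpleGraph

section CyclesOfCacti

variable {V : Type*} {G : SimpleGraph V}

/-! The drawing grows from the root inside nested cones. Take primitive Pythagorean vectors, sorted
by slope, as directions. Every vertex receives an interval of consecutive directions (its slots),
and everything that hangs below the vertex is drawn inside the cone which these directions span at
the vertex. Different blocks with the same root use disjoint intervals, so the cones are either
nested or disjoint and nothing can cross. A leaf consumes one slot, a bridge reuses the first slot
of its lower end, and a cycle consumes two slots of its own, one for each of two sides leaving its
root. Hence `T ≤ t + 2o` directions suffice.

A cycle with `k ≠ 3` vertices is drawn as a parallelogram whose edges are integer multiples of its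
two sides `a` and `b`, so all its lengths are integers. The vertices on the left boundary have cones
directed between `a` and `b`, those on the right boundary have cones to the right of `b`; slots grow
clockwise. In a triangle both sides are scaled to the same height, which makes the third side
horizontal, with integer length.

The grid is small because `T` primitive Pythagorean vectors already exist in the square `[1, X]²`
with `X = 9T/2` (`Slopes.le_card_params`): a sieve gives a density larger than needed for `T ≥ 100`,
and smaller cases are computed. On the way from the root to a vertex, each unit of distance costs at
most `X`, each cycle at most `X` more, and each triangle at most `X²` instead. The constant `9/2`
lies below `2π²/3`, and its square below `2(π²/3)²`, which gives both terms of `S`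
(`Construction.coord_le_gridSide`).

The algorithm is a depth-first search, two passes over the tree from the bottom to the top, the
generation of the directions, and a pass from the top to the bottom. In a cactus two different
cycles share no edge (`IsCactus.cycle_eq_of_common_edge`), so every cycle is closed by exactly one
back edge, a vertex has at most one back edge upwards, and a tree edge lies on at most one
fundamental cycle; two arrays therefore describe the whole graph. The directions are read off a
Farey sequence of order about `√(2X)`, which delivers them already sorted in `O(X)` steps. So the
total time is even `O(n)`. The program is verified with weakest preconditions, which reduce each
pass to one invariant. The geometric half ends in `Construction.isTrulyIntegralFary`, the
algorithmic half in `RAM.drawProg_runs`. -/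

theorem connected_induce_support_diff_of_isCycle {v : V} {w : G.Walk v v} (hw : w.IsCycle) :
    (G.induce ({z | z ∈ w.support} \ {v})).Connected := by
  cases w with
  | nil => exact absurd hw Walk.not_isCycle_nil
  | @cons _ x _ h q =>
    have hq := (Walk.cons_isCycle_iff q h).1 hw
    -- A cycle without its base vertex is a path: the first edge is split off, the rest is reversed,
    -- and the first edge is split off again. The support of what remains is connected.
    have hr : q.reverse.IsPath := hq.1.reverse
    have hs : ∀ z, z ∈ q.support ↔ z ∈ q.reverse.support := by simp
    generalize q.reverse = q' at hr hs
    cases q' with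
    | nil => exact absurd h G.irrefl
    | @cons _ y _ h' r =>
      have hr' := (Walk.cons_isPath_iff h' r).1 hr
      convert r.connected_induce_support using 2
      all_goals
        ext z
        simp only [Walk.support_cons, List.mem_cons, Set.mem_sdiff, Set.mem_ofPred_eq,
          Set.mem_singleton_iff, hs]
        constructor
        · rintro ⟨h1 | h1 | h1, h2⟩
          · exact absurd h1 h2
          · exact absurd h1 h2
          · exact h1
        · intro h1
          refine ⟨Or.inr (Or.inr h1), ?_⟩
          rintro rfl
          exact hr'.2 h1

theorem isNonseparable_support_of_isCycle {v : V} {w : G.Walk v v} (hw : w.IsCycle) :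
    IsNonseparable G {z | z ∈ w.support} := by
  classical
  refine ⟨?_, w.connected_induce_support, ?_⟩
  · refine ⟨v, w.start_mem_support, w.snd, ?_, (w.adj_snd hw.not_nil).ne⟩
    exact w.getVert_mem_support 1
  · intro z hz
    have := connected_induce_support_diff_of_isCycle (hw.rotate hz)
    have hs : {x | x ∈ (w.rotate z hz).support} = {x | x ∈ w.support} := by
      ext x
      exact w.mem_support_rotate_iff _ hz
    rwa [hs] at this

/-- With two common vertices, one of them survives the removal of any single vertex and still joins
the two connected remainders. -/
theorem IsNonseparable.union {s t : Set V} (hs : IsNonseparable G s) (ht : IsNonseparable G t)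
    {a b : V} (hab : a ≠ b) (ha : a ∈ s ∩ t) (hb : b ∈ s ∩ t) : IsNonseparable G (s ∪ t) := by
  refine ⟨hs.1.mono Set.subset_union_left,
    induce_union_connected hs.2.1.preconnected ht.2.1.preconnected ⟨a, ha⟩, ?_⟩
  have key : ∀ r : Set V, IsNonseparable G r → ∀ v, (G.induce (r \ {v})).Connected := by
    intro r hr v
    by_cases hv : v ∈ r
    · exact hr.2.2 v hv
    · rw [Set.sdiff_singleton_eq_self hv]
      exact hr.2.1
  intro v _
  rw [Set.union_sdiff_distrib]
  refine induce_union_connected (key s hs v).preconnected (key t ht v).preconnected ?_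
  by_cases hav : a = v
  · exact ⟨b, ⟨hb.1, fun h => hab (hav.trans h.symm)⟩, ⟨hb.2, fun h => hab (hav.trans h.symm)⟩⟩
  · exact ⟨a, ⟨ha.1, hav⟩, ⟨ha.2, hav⟩⟩

theorem ncard_adj_of_iso_cycleGraph {s : Set V} {k : ℕ} (hk : 3 ≤ k)
    (f : G.induce s ≃g cycleGraph k) {v : V} (hv : v ∈ s) :
    {x | x ∈ s ∧ G.Adj v x}.ncard = 2 := by
  obtain ⟨k, rfl⟩ := Nat.exists_eq_add_of_le' hk
  have h1 : ((cycleGraph (k + 3)).neighborSet (f ⟨v, hv⟩)).ncard = 2 := by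
    have h := cycleGraph_degree_three_le (v := f ⟨v, hv⟩)
    rw [← card_neighborFinset_eq_degree] at h
    rw [← Set.ncard_coe_finset, coe_neighborFinset] at h
    exact h
  rw [← h1]
  symm
  refine Set.ncard_congr (fun x _ => ((f.symm x : s) : V)) ?_ ?_ ?_
  · intro x hx
    refine ⟨(f.symm x).2, ?_⟩
    have : (G.induce s).Adj (f.symm (f ⟨v, hv⟩)) (f.symm x) := f.symm.map_adj_iff.2 hx
    simpa using this
  · intro x y _ _ hxy
    exact f.symm.injective (Subtype.ext hxy)
  · rintro x ⟨hx, hvx⟩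
    refine ⟨f ⟨x, hx⟩, ?_, by simp⟩
    exact f.map_adj_iff.2 hvx

/-- A vertex of `w` has two neighbours on `w` and only two in `s`, so these coincide. The support of
`w` is then closed under adjacency in the connected set `s` and exhausts it. Consequently a block
that is a cycle contains no other cycle. -/
theorem edges_eq_of_isCycle_of_iso_cycleGraph {s : Set V} {k : ℕ} (hk : 3 ≤ k)
    (f : G.induce s ≃g cycleGraph k) (hs : (G.induce s).Connected) {v : V} {w : G.Walk v v}
    (hw : w.IsCycle) (hws : ∀ z ∈ w.support, z ∈ s) :
    {e | e ∈ w.edges} = {e | ∃ a ∈ s, ∃ b ∈ s, G.Adj a b ∧ e = s(a, b)} := by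
  have hnb : ∀ z ∈ w.support, w.toSubgraph.neighborSet z = {x | x ∈ s ∧ G.Adj z x} := by
    intro z hz
    have h2 := ncard_adj_of_iso_cycleGraph hk f (hws z hz)
    refine Set.eq_of_subset_of_ncard_le ?_ ?_ (Set.finite_of_ncard_ne_zero (by omega))
    · intro x hx
      have hx' : w.toSubgraph.Adj z x := hx
      exact ⟨hws x (w.mem_verts_toSubgraph.1 hx'.snd_mem), hx'.adj_sub⟩
    · rw [h2, hw.ncard_neighborSet_toSubgraph_eq_two hz]
  have hstep : ∀ z ∈ w.support, ∀ x ∈ s, G.Adj z x → w.toSubgraph.Adj z x := by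
    intro z hz x hx hzx
    have : x ∈ w.toSubgraph.neighborSet z := by
      rw [hnb z hz]
      exact ⟨hx, hzx⟩
    exact this
  have hall : ∀ z ∈ s, z ∈ w.support := by
    have hvs : v ∈ s := hws v w.start_mem_support
    have : ∀ x y : s, (G.induce s).Walk x y → (x : V) ∈ w.support → (y : V) ∈ w.support := by
      intro x y q
      induction q with
      | nil => exact id
      | @cons a b c h q ih =>
        intro ha
        exact ih (w.mem_verts_toSubgraph.1 (hstep _ ha _ b.2 h).snd_mem)
    intro z hz
    obtain ⟨q⟩ := hs.preconnected ⟨v, hvs⟩ ⟨z, hz⟩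
    exact this _ _ q w.start_mem_support
  ext e
  constructor
  · intro he
    induction e with
    | _ a b =>
      exact ⟨a, hws _ (w.fst_mem_support_of_mem_edges he), b,
        hws _ (w.snd_mem_support_of_mem_edges he), w.adj_of_mem_edges he, rfl⟩
  · rintro ⟨a, ha, b, hb, hab, rfl⟩
    have := hstep a (hall a ha) b hb hab
    exact (Walk.mem_edges_toSubgraph w).1 (Subgraph.mem_edgeSet.2 this)

/-- Two cycles of a cactus with a common edge are equal. -/
theorem IsCactus.cycle_eq_of_common_edge [Finite V] (hG : IsCactus G) {E F : Set (Sym2 V)}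
    (hE : E ∈ cycles G) (hF : F ∈ cycles G) {e : Sym2 V} (he : e ∈ E) (hf : e ∈ F) : E = F := by
  classical
  obtain ⟨v, w, hw, rfl⟩ := hE
  obtain ⟨v', w', hw', rfl⟩ := hF
  obtain ⟨a, b⟩ := e
  have hab : a ≠ b := (w.adj_of_mem_edges he).ne
  -- A common edge provides two common vertices, so both cycles lie in a single block. That block
  -- has at least three vertices, hence is a cycle, and its edge set is that of either given cycle.
  have hu := (isNonseparable_support_of_isCycle hw).union (isNonseparable_support_of_isCycle hw')
    hab ⟨w.fst_mem_support_of_mem_edges he, w'.fst_mem_support_of_mem_edges hf⟩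
    ⟨w.snd_mem_support_of_mem_edges he, w'.snd_mem_support_of_mem_edges hf⟩
  obtain ⟨s, hs, hmax⟩ := Set.Finite.exists_le_maximal (s := {s | IsNonseparable G s})
    (Set.toFinite _) hu
  have hsub : ∀ z ∈ w.support, z ∈ s := fun z hz => hs (Or.inl hz)
  have hsub' : ∀ z ∈ w'.support, z ∈ s := fun z hz => hs (Or.inr hz)
  rcases hG.2 s hmax with h2 | ⟨k, hk, ⟨f⟩⟩
  · exfalso
    have h3 : 3 ≤ s.ncard := by
      have hle : w.support.tail.toFinset.card ≤ s.ncard := by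
        rw [← Set.ncard_coe_finset]
        refine Set.ncard_le_ncard ?_ (Set.toFinite s)
        intro z hz
        exact hsub z (List.mem_of_mem_tail (List.mem_toFinset.1 (Finset.mem_coe.1 hz)))
      rw [List.toFinset_card_of_nodup hw.support_nodup, List.length_tail,
        Walk.length_support] at hle
      have := hw.three_le_length
      omega
    omega
  · rw [edges_eq_of_isCycle_of_iso_cycleGraph hk f hmax.prop.2.1 hw hsub,
      edges_eq_of_isCycle_of_iso_cycleGraph hk f hmax.prop.2.1 hw' hsub']

end CyclesOfCacti

end Cactus

/-! ### Depth-first search trees: cycles, triangles, leaves and distances in terms of parents and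
back edges. -/

namespace Cactus

open SimpleGraph

section PalmTree

/-- A depth first search tree of `G` in preorder: the `i`-th vertex is `lab i`, its parent is
`lab (P i)`, all other edges connect a vertex with an ancestor, and if there are such edges from
`lab j` upwards then `U j - 1` is the index of one of their upper ends; otherwise `U j = 0`. -/
structure IsPalmTree {V : Type*} (G : SimpleGraph V) (n : ℕ) (lab : ℕ → V) (P U : ℕ → ℕ) :
    Prop where
  inj : ∀ i < n, ∀ j < n, lab i = lab j → i = j
  surj : ∀ v, ∃ i < n, lab i = v
  parent_zero : P 0 = 0
  parent_lt : ∀ i, 0 < i → i < n → P i < i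
  adj_parent : ∀ i, 0 < i → i < n → G.Adj (lab (P i)) (lab i)
  ancestor : ∀ i j, i < j → j < n → G.Adj (lab i) (lab j) → ∃ t, P^[t] j = i
  up : ∀ j < n, U j ≠ 0 → U j - 1 < j ∧ U j - 1 ≠ P j ∧ G.Adj (lab (U j - 1)) (lab j)
  exists_up : ∀ i j, i < j → j < n → G.Adj (lab i) (lab j) → i ≠ P j → U j ≠ 0

variable {V : Type*} {G : SimpleGraph V} {n : ℕ} {lab : ℕ → V} {P U : ℕ → ℕ}

/-- The edges of the cycle closed by the edge between `lab x` and its ancestor `lab v`. -/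
def fundamentalCycle (lab : ℕ → V) (P : ℕ → ℕ) (v x : ℕ) : Set (Sym2 V) :=
  insert s(lab v, lab x) {e | ∃ c t, P^[t] x = c ∧ v < c ∧ e = s(lab c, lab (P c))}

namespace IsPalmTree

theorem parent_le (h : IsPalmTree G n lab P U) {i : ℕ} (hi : i < n) : P i ≤ i := by
  rcases Nat.eq_zero_or_pos i with rfl | h0
  · exact h.parent_zero.le
  · exact (h.parent_lt i h0 hi).le

theorem iterate_le (h : IsPalmTree G n lab P U) (t : ℕ) {i : ℕ} (hi : i < n) : P^[t] i ≤ i := by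
  induction t generalizing i with
  | zero => exact le_rfl
  | succ t ih =>
    rw [Function.iterate_succ_apply]
    have h1 := h.parent_le hi
    exact (ih (lt_of_le_of_lt h1 hi)).trans h1

/-- Climbing along parents strictly lowers the index until `0` is reached, so no vertex repeats. The
condition `v < c` selects the tree edges that are passed before `v` is reached. -/
theorem exists_path (h : IsPalmTree G n lab P U) (t : ℕ) {v x : ℕ} (hx : x < n)
    (ht : P^[t] x = v) :
    ∃ p : G.Walk (lab x) (lab v), p.IsPath ∧ (∀ z ∈ p.support, ∃ c ≤ x, z = lab c) ∧
      ∀ e, e ∈ p.edges ↔ ∃ c t, P^[t] x = c ∧ v < c ∧ e = s(lab c, lab (P c)) := by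
  induction t generalizing x with
  | zero =>
    obtain rfl : x = v := ht
    refine ⟨Walk.nil, Walk.IsPath.nil, ?_, ?_⟩
    · intro z hz
      exact ⟨x, le_rfl, by simpa using hz⟩
    · intro e
      simp only [Walk.edges_nil, List.not_mem_nil, false_iff]
      rintro ⟨c, s, hs, hc, -⟩
      have := h.iterate_le s hx
      omega
  | succ t ih =>
    rw [Function.iterate_succ_apply] at ht
    rcases Nat.eq_zero_or_pos x with rfl | h0
    · rw [h.parent_zero] at ht
      exact ih hx ht
    · have hlt := h.parent_lt x h0 hx
      obtain ⟨p, hp, hsup, hed⟩ := ih (hlt.trans hx) ht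
      refine ⟨Walk.cons (h.adj_parent x h0 hx).symm p, ?_, ?_, ?_⟩
      · refine hp.cons ?_
        intro hmem
        obtain ⟨c, hc, hcx⟩ := hsup _ hmem
        have := h.inj x hx c (by omega) hcx
        omega
      · intro z hz
        rw [Walk.support_cons, List.mem_cons] at hz
        rcases hz with rfl | hz
        · exact ⟨x, le_rfl, rfl⟩
        · obtain ⟨c, hc, hcx⟩ := hsup _ hz
          exact ⟨c, by omega, hcx⟩
      · intro e
        rw [Walk.edges_cons, List.mem_cons, hed]
        have hvx : v < x := by
          have := h.iterate_le t (hlt.trans hx)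
          omega
        constructor
        · rintro (rfl | ⟨c, s, hs, hc, rfl⟩)
          · exact ⟨x, 0, rfl, hvx, rfl⟩
          · exact ⟨c, s + 1, by rw [Function.iterate_succ_apply, hs], hc, rfl⟩
        · rintro ⟨c, s, hs, hc, rfl⟩
          cases s with
          | zero =>
            obtain rfl : x = c := hs
            exact Or.inl rfl
          | succ s =>
            rw [Function.iterate_succ_apply] at hs
            exact Or.inr ⟨c, s, hs, hc, rfl⟩

theorem eq_of_edge_eq (h : IsPalmTree G n lab P U) {a b c d : ℕ} (hab : a < b) (hb : b < n)
    (hcd : c < d) (hd : d < n) (he : s(lab a, lab b) = s(lab c, lab d)) : a = c ∧ b = d := by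
  rcases Sym2.eq_iff.1 he with ⟨h1, h2⟩ | ⟨h1, h2⟩
  · exact ⟨h.inj _ (by omega) _ (by omega) h1, h.inj _ (by omega) _ (by omega) h2⟩
  · have h3 := h.inj _ (by omega) _ (by omega) h1
    have h4 := h.inj _ (by omega) _ (by omega) h2
    omega

theorem fundamentalCycle_mem_cycles (h : IsPalmTree G n lab P U) {v x : ℕ} (hvx : v < x)
    (hx : x < n) (hadj : G.Adj (lab v) (lab x)) (hne : v ≠ P x) :
    fundamentalCycle lab P v x ∈ cycles G := by
  obtain ⟨t, ht⟩ := h.ancestor v x hvx hx hadj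
  obtain ⟨p, hp, -, hed⟩ := h.exists_path t hx ht
  refine ⟨lab v, Walk.cons hadj p, ?_, ?_⟩
  · rw [Walk.cons_isCycle_iff]
    refine ⟨hp, ?_⟩
    rw [hed]
    rintro ⟨c, s, hs, hc, he⟩
    have hcx : c ≤ x := hs ▸ h.iterate_le s hx
    have hpc := h.parent_lt c (by omega) (by omega)
    rw [Sym2.eq_swap (a := lab c)] at he
    obtain ⟨h1, h2⟩ := h.eq_of_edge_eq hvx hx hpc (by omega) he
    exact hne (h2 ▸ h1)
  · ext e
    simp only [fundamentalCycle, Set.mem_insert_iff, Set.mem_ofPred_eq, Walk.edges_cons,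
      List.mem_cons, hed]

/-- All edges of a fundamental cycle except the closing one are tree edges. A back edge is therefore
found only on the cycle that it closes itself, which identifies a fundamental cycle by its back
edge. -/
theorem mem_fundamentalCycle (h : IsPalmTree G n lab P U) {v x a b : ℕ} (hvx : v < x)
    (hx : x < n) (hab : a < b) (hb : b < n)
    (he : s(lab a, lab b) ∈ fundamentalCycle lab P v x) : (a = v ∧ b = x) ∨ a = P b := by
  rcases he with he | ⟨c, s, hs, hc, he⟩
  · exact Or.inl (h.eq_of_edge_eq hab hb hvx hx he)
  · have hcx : c ≤ x := hs ▸ h.iterate_le s hx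
    have hpc := h.parent_lt c (by omega) (by omega)
    rw [Sym2.eq_swap (a := lab c)] at he
    obtain ⟨h1, h2⟩ := h.eq_of_edge_eq hab hb hpc (by omega) he
    exact Or.inr (h2 ▸ h1)

theorem tree_edge_mem_fundamentalCycle {v x c t : ℕ} (ht : P^[t] x = c) (hc : v < c) :
    s(lab c, lab (P c)) ∈ fundamentalCycle lab P v x :=
  Or.inr ⟨c, t, ht, hc, rfl⟩

/-- In a cactus, a tree edge lies on at most one fundamental cycle. -/
theorem back_edge_unique [Finite V] (h : IsPalmTree G n lab P U) (hG : IsCactus G)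
    {v x v' x' c t t' : ℕ}
    (hvx : v < x) (hx : x < n) (hadj : G.Adj (lab v) (lab x)) (hne : v ≠ P x)
    (hvx' : v' < x') (hx' : x' < n) (hadj' : G.Adj (lab v') (lab x')) (hne' : v' ≠ P x')
    (ht : P^[t] x = c) (hc : v < c) (ht' : P^[t'] x' = c) (hc' : v' < c) : v = v' ∧ x = x' := by
  have heq := hG.cycle_eq_of_common_edge (h.fundamentalCycle_mem_cycles hvx hx hadj hne)
    (h.fundamentalCycle_mem_cycles hvx' hx' hadj' hne')
    (tree_edge_mem_fundamentalCycle ht hc) (tree_edge_mem_fundamentalCycle ht' hc')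
  have hm : s(lab v, lab x) ∈ fundamentalCycle lab P v' x' := heq ▸ Set.mem_insert _ _
  rcases h.mem_fundamentalCycle hvx' hx' hvx hx hm with h1 | h1
  · exact h1
  · exact absurd h1 hne

/-- Two back edges going up from the same vertex would close two cycles through the tree edge above
it. So the single entry `U j` loses nothing, and `P` and `U` together know all edges of the graph.
-/
theorem eq_parent_or_eq_up [Finite V] (h : IsPalmTree G n lab P U) (hG : IsCactus G) {i j : ℕ}
    (hij : i < j) (hj : j < n) (hadj : G.Adj (lab i) (lab j)) : i = P j ∨ U j = i + 1 := by
  by_cases hp : i = P j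
  · exact Or.inl hp
  · right
    have hU := h.exists_up i j hij hj hadj hp
    obtain ⟨h1, h2, h3⟩ := h.up j hj hU
    have := h.back_edge_unique hG hij hj hadj hp h1 hj h3 h2 (t := 0) rfl hij (t' := 0) rfl h1
    omega

theorem cover_unique [Finite V] (h : IsPalmTree G n lab P U) (hG : IsCactus G) {x x' c t t' : ℕ}
    (hx : x < n) (hU : U x ≠ 0) (hx' : x' < n) (hU' : U x' ≠ 0)
    (ht : P^[t] x = c) (hc : U x ≤ c) (ht' : P^[t'] x' = c) (hc' : U x' ≤ c) : x = x' := by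
  obtain ⟨h1, h2, h3⟩ := h.up x hx hU
  obtain ⟨h1', h2', h3'⟩ := h.up x' hx' hU'
  exact (h.back_edge_unique hG h1 hx h3 h2 h1' hx' h3' h2' ht (by omega) ht' (by omega)).2

/-- The cycle closed by the back edge from `lab x` upwards. -/
theorem fundamentalCycle_up_mem (h : IsPalmTree G n lab P U) {x : ℕ} (hx : x < n)
    (hU : U x ≠ 0) : fundamentalCycle lab P (U x - 1) x ∈ cycles G := by
  obtain ⟨h1, h2, h3⟩ := h.up x hx hU
  exact h.fundamentalCycle_mem_cycles h1 hx h3 h2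

theorem fundamentalCycle_injOn (h : IsPalmTree G n lab P U) :
    Set.InjOn (fun x => fundamentalCycle lab P (U x - 1) x) {x | x < n ∧ U x ≠ 0} := by
  rintro x ⟨hx, hU⟩ x' ⟨hx', hU'⟩ heq
  obtain ⟨h1, h2, h3⟩ := h.up x hx hU
  obtain ⟨h1', h2', h3'⟩ := h.up x' hx' hU'
  have hm : s(lab (U x - 1), lab x) ∈ fundamentalCycle lab P (U x' - 1) x' := by
    have : s(lab (U x - 1), lab x) ∈ fundamentalCycle lab P (U x - 1) x := Set.mem_insert _ _
    have heq' : fundamentalCycle lab P (U x - 1) x = fundamentalCycle lab P (U x' - 1) x' := heq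
    exact heq' ▸ this
  rcases h.mem_fundamentalCycle h1' hx' h1 hx hm with h4 | h4
  · exact h4.2
  · exact absurd h4 h2

/-- Every cycle of a cactus is closed by exactly one back edge. -/
theorem cycles_eq_image [Finite V] (h : IsPalmTree G n lab P U) (hG : IsCactus G) :
    cycles G = (fun x => fundamentalCycle lab P (U x - 1) x) '' {x | x < n ∧ U x ≠ 0} := by
  ext E
  constructor
  · intro hE
    obtain ⟨v, w, hw, hEw⟩ := id hE
    classical
    let S : Finset ℕ := (Finset.range n).filter fun i => lab i ∈ w.support
    have hS : S.Nonempty := by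
      obtain ⟨i, hi, hiv⟩ := h.surj v
      exact ⟨i, by simp [S, hi, hiv]⟩
    -- At the vertex of largest index on the cycle both neighbours on the cycle have smaller
    -- indices. Only one of them can be the parent, so the other one is reached by a back edge, and
    -- that edge determines the cycle.
    obtain ⟨j, hjS, hmax⟩ := S.exists_max_image id hS
    have hjn : j < n := Finset.mem_range.1 (Finset.mem_filter.1 hjS).1
    have hjw : lab j ∈ w.support := (Finset.mem_filter.1 hjS).2
    have hnb : ∀ y, w.toSubgraph.Adj (lab j) y →
        ∃ i, i < j ∧ y = lab i ∧ (i = P j ∨ U j = i + 1) := by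
      intro y hy
      obtain ⟨i, hi, rfl⟩ := h.surj y
      have hiw : lab i ∈ w.support := w.mem_verts_toSubgraph.1 hy.snd_mem
      have hle : i ≤ j := hmax i (by simp [S, hi, hiw])
      have hlt : i < j := by
        refine lt_of_le_of_ne hle ?_
        rintro rfl
        exact hy.adj_sub.ne rfl
      exact ⟨i, hlt, rfl, h.eq_parent_or_eq_up hG hlt hjn hy.adj_sub.symm⟩
    obtain ⟨y, z, hyz, hset⟩ := Set.ncard_eq_two.1 (hw.ncard_neighborSet_toSubgraph_eq_two hjw)
    have hy : w.toSubgraph.Adj (lab j) y := by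
      have : y ∈ w.toSubgraph.neighborSet (lab j) := by simp [hset]
      exact this
    have hz : w.toSubgraph.Adj (lab j) z := by
      have : z ∈ w.toSubgraph.neighborSet (lab j) := by simp [hset]
      exact this
    have hup : ∃ i, U j = i + 1 ∧ w.toSubgraph.Adj (lab j) (lab i) := by
      obtain ⟨i, hi, rfl, hi' | hi'⟩ := hnb y hy
      · obtain ⟨i₂, hi₂, rfl, hi₂' | hi₂'⟩ := hnb z hz
        · exact absurd (by rw [hi', hi₂']) hyz
        · exact ⟨i₂, hi₂', hz⟩
      · exact ⟨i, hi', hy⟩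
    obtain ⟨i, hi, hadj⟩ := hup
    refine ⟨j, ⟨hjn, by omega⟩, ?_⟩
    refine hG.cycle_eq_of_common_edge (h.fundamentalCycle_up_mem hjn (by omega)) hE
      (Set.mem_insert _ _) ?_
    rw [hEw, hi, Nat.add_sub_cancel, Sym2.eq_swap]
    exact (Walk.mem_edges_toSubgraph w).1 (Subgraph.mem_edgeSet.2 hadj)
  · rintro ⟨x, ⟨hx, hU⟩, rfl⟩
    exact h.fundamentalCycle_up_mem hx hU

theorem numCycles_eq [Finite V] (h : IsPalmTree G n lab P U) (hG : IsCactus G) :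
    numCycles G = ((Finset.range n).filter fun x => U x ≠ 0).card := by
  rw [numCycles, h.cycles_eq_image hG, Set.InjOn.ncard_image h.fundamentalCycle_injOn,
    ← Set.ncard_coe_finset]
  congr 1
  ext x
  simp

/-- A back edge to the grandparent closes a cycle of exactly three edges, and different back edges
close different cycles. -/
theorem card_triangles_le [Finite V] (h : IsPalmTree G n lab P U) :
    ((Finset.range n).filter fun x => U x ≠ 0 ∧ U x = P (P x) + 1).card ≤ numTriangles G := by
  rw [numTriangles, ← Set.ncard_coe_finset]
  refine Set.ncard_le_ncard_of_injOn (fun x => fundamentalCycle lab P (U x - 1) x) ?_ ?_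
    (Set.toFinite _)
  · intro x hx
    simp only [Finset.coe_filter, Finset.mem_range, Set.mem_ofPred_eq] at hx
    obtain ⟨hx, hU, hpp⟩ := hx
    obtain ⟨h1, h2, h3⟩ := h.up x hx hU
    refine ⟨h.fundamentalCycle_up_mem hx hU, ?_⟩
    have hv : U x - 1 = P (P x) := by omega
    rw [hv] at h1 h2 h3 ⊢
    have hx0 : 0 < x := by omega
    have hp1 := h.parent_lt x hx0 hx
    have hp0 : 0 < P x := by
      rcases Nat.eq_zero_or_pos (P x) with h0 | h0
      · rw [h0, h.parent_zero] at h2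
        exact absurd rfl h2
      · exact h0
    have hp2 := h.parent_lt (P x) hp0 (by omega)
    have hset : fundamentalCycle lab P (P (P x)) x =
        {s(lab (P (P x)), lab x), s(lab (P x), lab x), s(lab (P (P x)), lab (P x))} := by
      ext e
      simp only [fundamentalCycle, Set.mem_insert_iff, Set.mem_ofPred_eq, Set.mem_singleton_iff]
      refine or_congr_right ?_
      constructor
      · rintro ⟨c, t, ht, hc, rfl⟩
        rcases t with - | - | t
        · obtain rfl : x = c := ht
          exact Or.inl Sym2.eq_swap
        · obtain rfl : P x = c := ht
          exact Or.inr Sym2.eq_swap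
        · have := h.iterate_le t (i := P (P x)) (by omega)
          rw [Function.iterate_succ_apply, Function.iterate_succ_apply] at ht
          omega
      · rintro (rfl | rfl)
        · exact ⟨x, 0, rfl, h1, Sym2.eq_swap⟩
        · exact ⟨P x, 1, rfl, hp2, Sym2.eq_swap⟩
    rw [hset, Set.ncard_eq_three]
    refine ⟨_, _, _, ?_, ?_, ?_, rfl⟩
    · intro he
      have := h.eq_of_edge_eq h1 hx hp1 hx he
      omega
    · intro he
      have := h.eq_of_edge_eq h1 hx hp2 (by omega) he
      omega
    · intro he
      have := h.eq_of_edge_eq hp1 hx hp2 (by omega) he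
      omega
  · intro x hx y hy hxy
    simp only [Finset.coe_filter, Finset.mem_range, Set.mem_ofPred_eq] at hx hy
    exact h.fundamentalCycle_injOn ⟨hx.1, hx.2.1⟩ ⟨hy.1, hy.2.1⟩ hxy

/-- A potential that changes by at most one along each edge is bounded by the diameter. -/
theorem le_diam_of_lipschitz [Finite V] (h : IsPalmTree G n lab P U) (hG : IsCactus G) {lev : ℕ → ℕ}
    (h0 : lev 0 = 0)
    (hlip : ∀ i < n, ∀ j < n, G.Adj (lab i) (lab j) → lev j ≤ lev i + 1) {i : ℕ} (hi : i < n) :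
    lev i ≤ G.diam := by
  have key : ∀ a b : V, ∀ w : G.Walk a b, ∀ i < n, ∀ j < n, lab i = a → lab j = b →
      lev j ≤ lev i + w.length := by
    intro a b w
    induction w with
    | nil =>
      intro i hi j hj hia hja
      rw [h.inj i hi j hj (hia.trans hja.symm)]
      exact Nat.le_add_right _ _
    | @cons a c b hac w ih =>
      intro i hi j hj hia hjb
      obtain ⟨k, hk, hkc⟩ := h.surj c
      have h1 := ih k hk j hj hkc hjb
      have h2 := hlip i hi k hk (by rw [hia, hkc]; exact hac)
      rw [Walk.length_cons]
      omega
  obtain ⟨w, hw⟩ := hG.1.exists_walk_length_eq_dist (lab 0) (lab i)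
  have h1 := key _ _ w 0 (by omega) i hi rfl rfl
  have : Nonempty V := ⟨lab 0⟩
  have h2 : G.dist (lab 0) (lab i) ≤ G.diam := dist_le_diam (connected_iff_ediam_ne_top.1 hG.1)
  omega

theorem card_leaves_le [Finite V] (h : IsPalmTree G n lab P U) (S : Finset ℕ)
    (hS : ∀ i ∈ S, 0 < i ∧ i < n ∧ ∀ j < n, G.Adj (lab i) (lab j) → j = P i) :
    S.card ≤ numLeaves G (lab 0) := by
  rw [numLeaves, ← Set.ncard_coe_finset]
  refine Set.ncard_le_ncard_of_injOn lab ?_ ?_ (Set.toFinite _)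
  · intro i hi
    obtain ⟨h0, hn, hnb⟩ := hS i hi
    refine ⟨fun he => ?_, ?_⟩
    · have := h.inj i hn 0 (by omega) he
      omega
    · rw [Set.ncard_eq_one]
      refine ⟨lab (P i), ?_⟩
      ext y
      simp only [mem_neighborSet, Set.mem_singleton_iff]
      constructor
      · intro hy
        obtain ⟨j, hj, rfl⟩ := h.surj y
        rw [hnb j hj hy]
      · rintro rfl
        exact (h.adj_parent i h0 hn).symm
  · intro i hi j hj hij
    exact h.inj i (hS i hi).2.1 j (hS j hj).2.1 hij

end IsPalmTree

end PalmTree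

end Cactus

/-! ### Counting primitive Pythagorean vectors in a square. -/

namespace Slopes

/-- The coordinates of the primitive Pythagorean vector with the parameters `k < m`. -/
def vecX (m k : ℕ) : ℕ := 2 * m * k / (2 - (m + k) % 2)

/-- The divisor is `1` for parameters of opposite parity and `2` for parameters of equal parity. For
coprime parameters both cases give primitive vectors; they differ in which coordinate is the even
one, so both are needed to have every primitive vector together with its mirror image. -/
def vecY (m k : ℕ) : ℕ := (m * m - k * k) / (2 - (m + k) % 2)

/-- The parameters `(m, k)` with `m ≤ N` of the primitive Pythagorean vectors in the square
`[1, X]²`. -/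
def params (X N : ℕ) : Finset (ℕ × ℕ) :=
  (Finset.range (N + 1) ×ˢ Finset.range (N + 1)).filter fun q =>
    0 < q.2 ∧ q.2 < q.1 ∧ Nat.gcd q.1 q.2 = 1 ∧ vecX q.1 q.2 ≤ X ∧ vecY q.1 q.2 ≤ X

theorem mem_params {X N m k : ℕ} : (m, k) ∈ params X N ↔
    m ≤ N ∧ 0 < k ∧ k < m ∧ Nat.gcd m k = 1 ∧ vecX m k ≤ X ∧ vecY m k ≤ X := by
  simp only [params, Finset.mem_filter, Finset.mem_product, Finset.mem_range]
  constructor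
  · rintro ⟨⟨h1, h2⟩, h3⟩
    exact ⟨by omega, h3⟩
  · rintro ⟨h1, h3⟩
    exact ⟨⟨by omega, by omega⟩, h3⟩

theorem params_mono {X X' N N' : ℕ} (hX : X ≤ X') (hN : N ≤ N') : params X N ⊆ params X' N' := by
  rintro ⟨m, k⟩ h
  rw [mem_params] at h ⊢
  obtain ⟨h1, h2, h3, h4, h5, h6⟩ := h
  exact ⟨h1.trans hN, h2, h3, h4, h5.trans hX, h6.trans hX⟩

theorem vecX_of_odd {m k : ℕ} (h : (m + k) % 2 = 1) : vecX m k = 2 * m * k := by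
  simp [vecX, h]

theorem vecY_of_odd {m k : ℕ} (h : (m + k) % 2 = 1) : vecY m k = m * m - k * k := by
  simp [vecY, h]

theorem vecX_of_even {m k : ℕ} (h : (m + k) % 2 = 0) : vecX m k = m * k := by
  rw [vecX, h, mul_assoc]
  simp

theorem vecY_of_even {m k : ℕ} (h : (m + k) % 2 = 0) : vecY m k = (m * m - k * k) / 2 := by
  simp [vecY, h]

/-! ### Counting pairs in a triangle -/

/-- The pairs `(m, k)` with `m ≤ N`, `0 < k ≤ 2m/5` and a property `Q`. -/
def tri (Q : ℕ → ℕ → Prop) [∀ m k, Decidable (Q m k)] (N : ℕ) : Finset (ℕ × ℕ) :=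
  (Finset.range (N + 1) ×ˢ Finset.range (N + 1)).filter fun q =>
    0 < q.2 ∧ 5 * q.2 ≤ 2 * q.1 ∧ Q q.1 q.2

theorem mem_tri {Q : ℕ → ℕ → Prop} [∀ m k, Decidable (Q m k)] {N m k : ℕ} :
    (m, k) ∈ tri Q N ↔ m ≤ N ∧ 0 < k ∧ 5 * k ≤ 2 * m ∧ Q m k := by
  simp only [tri, Finset.mem_filter, Finset.mem_product, Finset.mem_range]
  constructor
  · rintro ⟨⟨h1, h2⟩, h3⟩
    exact ⟨by omega, h3⟩
  · rintro ⟨h1, h3⟩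
    exact ⟨⟨by omega, by omega⟩, h3⟩

/-- Counting by columns: for fixed `m` the admissible `k` form an arithmetic progression with
difference `2`, first term `e m` and `f m` terms. -/
theorem card_tri {Q : ℕ → ℕ → Prop} [∀ m k, Decidable (Q m k)] {f e : ℕ → ℕ}
    (h : ∀ m k, (0 < k ∧ 5 * k ≤ 2 * m ∧ Q m k) ↔ ∃ j < f m, 2 * j + e m = k) (N : ℕ) :
    (tri Q N).card = ∑ m ∈ Finset.range (N + 1), f m := by
  have h1 : tri Q N = (Finset.range (N + 1)).biUnion fun m =>
      (Finset.range (f m)).image fun j => (m, 2 * j + e m) := by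
    ext ⟨m, k⟩
    simp only [mem_tri, h, Finset.mem_biUnion, Finset.mem_range, Finset.mem_image, Prod.mk.injEq]
    constructor
    · rintro ⟨h1, j, hj, hk⟩
      exact ⟨m, by omega, j, hj, rfl, hk⟩
    · rintro ⟨m', h1, j, hj, rfl, hk⟩
      exact ⟨by omega, j, hj, hk⟩
  rw [h1, Finset.card_biUnion]
  · refine Finset.sum_congr rfl fun m _ => ?_
    rw [Finset.card_image_of_injective, Finset.card_range]
    intro a b hab
    simpa using hab
  · intro m _ m' _ hmm
    rw [Function.onFun, Finset.disjoint_left]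
    intro q hq hq'
    obtain ⟨j, -, rfl⟩ := Finset.mem_image.1 hq
    obtain ⟨j', -, hj'⟩ := Finset.mem_image.1 hq'
    exact hmm (by simpa using (congrArg Prod.fst hj').symm)

/-- A sieve by all odd numbers. -/
theorem card_tri_le_sieve {Q : ℕ → ℕ → Prop} [∀ m k, Decidable (Q m k)]
    (hodd : ∀ m k, Q m k → Nat.gcd m k % 2 = 1)
    (hmul : ∀ g m k, g % 2 = 1 → Q (g * m) (g * k) → Q m k) (N : ℕ) :
    (tri Q N).card ≤ (tri (fun m k => Q m k ∧ Nat.gcd m k = 1) N).card +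
      ∑ h ∈ Finset.range (N / 2), (tri Q (N / (2 * h + 3))).card := by
  have hsub : tri Q N ⊆ tri (fun m k => Q m k ∧ Nat.gcd m k = 1) N ∪
      (Finset.range (N / 2)).biUnion fun h =>
        (tri Q (N / (2 * h + 3))).image fun q => ((2 * h + 3) * q.1, (2 * h + 3) * q.2) := by
    rintro ⟨m, k⟩ hq
    rw [mem_tri] at hq
    obtain ⟨hm, hk, hmk, hQ⟩ := hq
    rw [Finset.mem_union]
    by_cases hg : Nat.gcd m k = 1
    · exact Or.inl (mem_tri.2 ⟨hm, hk, hmk, hQ, hg⟩)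
    · right
      obtain ⟨m', hm'⟩ := Nat.gcd_dvd_left m k
      obtain ⟨k', hk'⟩ := Nat.gcd_dvd_right m k
      have ho := hodd m k hQ
      set g := Nat.gcd m k
      have hgm : g ≤ m := Nat.le_of_dvd (by omega) ⟨m', hm'⟩
      rw [Finset.mem_biUnion]
      -- The gcd is odd and not `1`, hence of the form `2h + 3`. A union bound over all such
      -- numbers, not only primes, is precise enough for the constants below.
      refine ⟨(g - 3) / 2, ?_, ?_⟩
      · rw [Finset.mem_range]
        omega
      · have hg3 : 2 * ((g - 3) / 2) + 3 = g := by omega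
        rw [hg3, Finset.mem_image]
        refine ⟨(m', k'), ?_, by simp [← hm', ← hk']⟩
        have hgp : 0 < g := by omega
        rw [mem_tri]
        refine ⟨?_, ?_, ?_, hmul g m' k' ho (by rwa [← hm', ← hk'])⟩
        · rw [Nat.le_div_iff_mul_le hgp, mul_comm, ← hm']
          exact hm
        · rcases Nat.eq_zero_or_pos k' with rfl | h0
          · omega
          · exact h0
        · by_contra hcon
          have : g * (2 * m') < g * (5 * k') := Nat.mul_lt_mul_of_pos_left (by omega) hgp
          have e1 : g * (2 * m') = 2 * m := by rw [hm']; ring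
          have e2 : g * (5 * k') = 5 * k := by rw [hk']; ring
          omega
  refine (Finset.card_le_card hsub).trans ((Finset.card_union_le _ _).trans ?_)
  refine Nat.add_le_add_left (Finset.card_biUnion_le.trans ?_) _
  exact Finset.sum_le_sum fun h _ => Finset.card_image_le

/-! ### Pairs of opposite parity and pairs of odd numbers -/

theorem card_tri_opp (N : ℕ) : (tri (fun m k => (m + k) % 2 = 1) N).card =
    ∑ m ∈ Finset.range (N + 1), (2 * m / 5 + (1 - m % 2)) / 2 := by
  refine card_tri (e := fun m => 1 + m % 2) ?_ N
  intro m k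
  rcases Nat.mod_two_eq_zero_or_one m with hm | hm
  · simp only [hm]
    constructor
    · rintro ⟨h1, h2, h3⟩
      exact ⟨(k - 1) / 2, by omega, by omega⟩
    · rintro ⟨j, h1, h2⟩
      omega
  · simp only [hm]
    constructor
    · rintro ⟨h1, h2, h3⟩
      exact ⟨(k - 1) / 2, by omega, by omega⟩
    · rintro ⟨j, h1, h2⟩
      omega

theorem card_tri_odd (N : ℕ) : (tri (fun m k => m % 2 = 1 ∧ k % 2 = 1) N).card =
    ∑ m ∈ Finset.range (N + 1), (2 * m / 5 + 1) / 2 * (m % 2) := by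
  refine card_tri (e := fun m => 1) ?_ N
  intro m k
  rcases Nat.mod_two_eq_zero_or_one m with hm | hm
  · simp [hm]
  · rw [hm, mul_one]
    constructor
    · rintro ⟨h1, h2, h3⟩
      exact ⟨(k - 1) / 2, by omega, by omega⟩
    · rintro ⟨j, h1, h2⟩
      omega

/-- The column lengths depend on `m` modulo `10 = 2 · 5` up to a linear term. This recurrence turns
the quadratic bounds into an induction with step ten, whose ten base cases are computed. -/
theorem card_tri_opp_add_ten (M : ℕ) : (tri (fun m k => (m + k) % 2 = 1) (M + 10)).card =
    (tri (fun m k => (m + k) % 2 = 1) M).card + 2 * M + 9 := by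
  simp only [card_tri_opp]
  induction M with
  | zero => decide +kernel
  | succ M ih =>
    rw [show M + 1 + 10 + 1 = M + 10 + 1 + 1 by ring, Finset.sum_range_succ,
      Finset.sum_range_succ _ (M + 1), ih]
    omega

theorem card_tri_odd_add_ten (M : ℕ) :
    (tri (fun m k => m % 2 = 1 ∧ k % 2 = 1) (M + 10)).card =
      (tri (fun m k => m % 2 = 1 ∧ k % 2 = 1) M).card + M + 5 + M % 2 := by
  simp only [card_tri_odd]
  induction M with
  | zero => decide +kernel
  | succ M ih =>
    rw [show M + 1 + 10 + 1 = M + 10 + 1 + 1 by ring, Finset.sum_range_succ,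
      Finset.sum_range_succ _ (M + 1), ih]
    rcases Nat.mod_two_eq_zero_or_one M with hm | hm
    · have h1 : (M + 1) % 2 = 1 := by omega
      have h2 : (M + 10 + 1) % 2 = 1 := by omega
      rw [h1, h2, hm]
      omega
    · have h1 : (M + 1) % 2 = 0 := by omega
      have h2 : (M + 10 + 1) % 2 = 0 := by omega
      rw [h1, h2, hm]
      omega

/-- The triangle `k ≤ 2m/5`, `m ≤ M` has area `M²/5`, and half of its integer points have opposite
parity. -/
theorem card_tri_opp_bounds (M : ℕ) :
    10 * (tri (fun m k => (m + k) % 2 = 1) M).card ≤ M ^ 2 ∧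
      M ^ 2 ≤ 10 * (tri (fun m k => (m + k) % 2 = 1) M).card + M + 6 := by
  induction M using Nat.strong_induction_on with
  | _ M ih =>
    rcases Nat.lt_or_ge M 10 with h | h
    · clear ih
      revert M
      decide +kernel
    · obtain ⟨M, rfl⟩ := Nat.exists_eq_add_of_le' h
      obtain ⟨h1, h2⟩ := ih M (by omega)
      rw [card_tri_opp_add_ten]
      constructor <;> nlinarith

/-- A quarter of the points of the triangle have two odd coordinates, so the true density is `1/20`.
The upper bound uses `1/15` to absorb a linear excess; it only enters the subtracted terms of the
sieve. -/
theorem card_tri_odd_bounds (M : ℕ) :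
    15 * (tri (fun m k => m % 2 = 1 ∧ k % 2 = 1) M).card ≤ M ^ 2 + 6 ∧
      M ^ 2 ≤ 20 * (tri (fun m k => m % 2 = 1 ∧ k % 2 = 1) M).card + 4 := by
  induction M using Nat.strong_induction_on with
  | _ M ih =>
    rcases Nat.lt_or_ge M 10 with h | h
    · clear ih
      revert M
      decide +kernel
    · obtain ⟨M, rfl⟩ := Nat.exists_eq_add_of_le' h
      obtain ⟨h1, h2⟩ := ih M (by omega)
      rw [card_tri_odd_add_ten]
      have h3 : M % 2 ≤ 1 := by omega
      have h4 : 0 ≤ M % 2 := Nat.zero_le _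
      constructor <;> nlinarith

/-- The infinite sum is `π²/8 - 1 ≈ 0.2337`. Three terms are taken exactly, and the tail telescopes
because `(2h + 3)²` exceeds `4(h + 1)(h + 2)`. -/
theorem sum_inv_odd_sq_le (H : ℕ) :
    ∑ h ∈ Finset.range H, 1 / ((2 * h + 3 : ℕ) : ℝ) ^ 2 ≤ 47 / 200 := by
  have key : ∀ H, ∑ h ∈ Finset.range (H + 3), 1 / ((2 * h + 3 : ℕ) : ℝ) ^ 2 ≤
      (47 / 200 - 1 / (4 * ((H : ℝ) + 4)) : ℝ) := by
    intro H
    induction H with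
    | zero => norm_num [Finset.sum_range_succ]
    | succ H ih =>
      rw [show H + 1 + 3 = H + 3 + 1 by ring, Finset.sum_range_succ]
      have : 1 / ((2 * (H + 3) + 3 : ℕ) : ℝ) ^ 2 ≤ 1 / (4 * ((H : ℝ) + 4)) - 1 / (4 * ((H : ℝ) + 1 + 4)) := by
        have hH : (0 : ℝ) ≤ H := Nat.cast_nonneg H
        rw [div_sub_div _ _ (by positivity) (by positivity), div_le_div_iff₀ (by positivity)
          (by positivity)]
        push_cast
        nlinarith
      push_cast at this ih ⊢
      linarith
  refine le_trans ?_ ((key H).trans ?_)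
  · refine Finset.sum_le_sum_of_subset_of_nonneg ?_ fun _ _ _ => by positivity
    exact Finset.range_subset_range.2 (by omega)
  · have : (0 : ℝ) ≤ 1 / (4 * ((H : ℝ) + 4)) := by positivity
    linarith

/-- The leading constant is `(1/10)(1 - 47/200)`: the density of the pairs, reduced by the sieve. -/
theorem card_coprime_opp_ge (N : ℕ) : (0.0765 : ℝ) * N ^ 2 - 0.1 * N - 0.6 ≤
    (tri (fun m k => (m + k) % 2 = 1 ∧ Nat.gcd m k = 1) N).card := by
  have h1 := card_tri_le_sieve (Q := fun m k => (m + k) % 2 = 1) ?_ ?_ N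
  · have h2 : ((∑ h ∈ Finset.range (N / 2),
        (tri (fun m k => (m + k) % 2 = 1) (N / (2 * h + 3))).card : ℕ) : ℝ) ≤
          N ^ 2 / 10 * (47 / 200) := by
      refine le_trans ?_ (mul_le_mul_of_nonneg_left (sum_inv_odd_sq_le (N / 2)) (by positivity))
      rw [Nat.cast_sum, Finset.mul_sum]
      refine Finset.sum_le_sum fun h _ => ?_
      have h3 : (10 * ((tri (fun m k => (m + k) % 2 = 1) (N / (2 * h + 3))).card : ℝ)) ≤
          ((N / (2 * h + 3) : ℕ) : ℝ) ^ 2 := by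
        exact_mod_cast (card_tri_opp_bounds (N / (2 * h + 3))).1
      have h4 : ((N / (2 * h + 3) : ℕ) : ℝ) ≤ N / (2 * h + 3 : ℕ) := Nat.cast_div_le
      have h5 : ((N / (2 * h + 3) : ℕ) : ℝ) ^ 2 ≤ (N / (2 * h + 3 : ℕ)) ^ 2 := by gcongr
      rw [div_pow] at h5
      calc _ ≤ (N : ℝ) ^ 2 / ((2 * h + 3 : ℕ) : ℝ) ^ 2 / 10 := by linarith
        _ = _ := by ring
    have h3 := (card_tri_opp_bounds N).2
    have h1' : ((tri (fun m k => (m + k) % 2 = 1) N).card : ℝ) ≤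
        (tri (fun m k => (m + k) % 2 = 1 ∧ Nat.gcd m k = 1) N).card +
        ((∑ h ∈ Finset.range (N / 2),
          (tri (fun m k => (m + k) % 2 = 1) (N / (2 * h + 3))).card : ℕ) : ℝ) := by
      exact_mod_cast h1
    have h3' : (N : ℝ) ^ 2 ≤ 10 * (tri (fun m k => (m + k) % 2 = 1) N).card + N + 6 := by
      exact_mod_cast h3
    linarith
  · intro m k h
    have h1 := Nat.gcd_dvd_left m k
    have h2 := Nat.gcd_dvd_right m k
    by_contra hc
    have h3 : 2 ∣ Nat.gcd m k := by omega
    have h4 := h3.trans h1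
    have h5 := h3.trans h2
    omega
  · intro g m k hg h
    rw [← mul_add, Nat.mul_mod, hg, one_mul, Nat.mod_mod] at h
    exact h

/-- The leading constant is just below `1/20 - (1/15)(47/200)`. The linear term comes from the
additive `6/15` in the upper bound, summed over at most `N/2` divisors. -/
theorem card_coprime_odd_ge (N : ℕ) : (0.0343 : ℝ) * N ^ 2 - 0.2 * N - 0.2 ≤
    (tri (fun m k => (m % 2 = 1 ∧ k % 2 = 1) ∧ Nat.gcd m k = 1) N).card := by
  have h1 := card_tri_le_sieve (Q := fun m k => m % 2 = 1 ∧ k % 2 = 1) ?_ ?_ N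
  · have h2 : ((∑ h ∈ Finset.range (N / 2),
        (tri (fun m k => m % 2 = 1 ∧ k % 2 = 1) (N / (2 * h + 3))).card : ℕ) : ℝ) ≤
          N ^ 2 / 15 * (47 / 200) + 0.2 * N := by
      have h6 : ((N / 2 : ℕ) : ℝ) ≤ N / 2 := Nat.cast_div_le
      have h7 := mul_le_mul_of_nonneg_left (sum_inv_odd_sq_le (N / 2))
        (show (0 : ℝ) ≤ (N : ℝ) ^ 2 / 15 by positivity)
      have h8 : ((∑ h ∈ Finset.range (N / 2),
          (tri (fun m k => m % 2 = 1 ∧ k % 2 = 1) (N / (2 * h + 3))).card : ℕ) : ℝ) ≤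
          ∑ h ∈ Finset.range (N / 2), ((N : ℝ) ^ 2 / 15 * (1 / ((2 * h + 3 : ℕ) : ℝ) ^ 2) + 0.4) := by
        rw [Nat.cast_sum]
        refine Finset.sum_le_sum fun h _ => ?_
        have h3 : (15 * ((tri (fun m k => m % 2 = 1 ∧ k % 2 = 1) (N / (2 * h + 3))).card : ℝ)) ≤
            ((N / (2 * h + 3) : ℕ) : ℝ) ^ 2 + 6 := by
          exact_mod_cast (card_tri_odd_bounds (N / (2 * h + 3))).1
        have h4 : ((N / (2 * h + 3) : ℕ) : ℝ) ≤ N / (2 * h + 3 : ℕ) := Nat.cast_div_le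
        have h5 : ((N / (2 * h + 3) : ℕ) : ℝ) ^ 2 ≤ (N / (2 * h + 3 : ℕ)) ^ 2 := by gcongr
        rw [div_pow] at h5
        calc _ ≤ (N : ℝ) ^ 2 / ((2 * h + 3 : ℕ) : ℝ) ^ 2 / 15 + 0.4 := by linarith
          _ = _ := by ring
      rw [Finset.sum_add_distrib, ← Finset.mul_sum, Finset.sum_const, Finset.card_range,
        nsmul_eq_mul] at h8
      linarith
    have h3 := (card_tri_odd_bounds N).2
    have h1' : ((tri (fun m k => m % 2 = 1 ∧ k % 2 = 1) N).card : ℝ) ≤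
        (tri (fun m k => (m % 2 = 1 ∧ k % 2 = 1) ∧ Nat.gcd m k = 1) N).card +
        ((∑ h ∈ Finset.range (N / 2),
          (tri (fun m k => m % 2 = 1 ∧ k % 2 = 1) (N / (2 * h + 3))).card : ℕ) : ℝ) := by
      exact_mod_cast h1
    have h3' : (N : ℝ) ^ 2 ≤ 20 * (tri (fun m k => m % 2 = 1 ∧ k % 2 = 1) N).card + 4 := by
      exact_mod_cast h3
    linarith [sq_nonneg (N : ℝ)]
  · rintro m k ⟨h, -⟩
    have h1 := Nat.gcd_dvd_left m k
    by_contra hc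
    have h3 : 2 ∣ Nat.gcd m k := by omega
    have h4 := h3.trans h1
    omega
  · rintro g m k hg ⟨h1, h2⟩
    rw [Nat.mul_mod, hg, one_mul, Nat.mod_mod] at h1 h2
    exact ⟨h1, h2⟩

/-! ### Enough vectors -/

theorem vec_sub_sq (m k : ℕ) : (m + k) * (m - k) = m * m - k * k := by
  rw [Nat.mul_self_sub_mul_self_eq]

theorem mem_params_of_opp {X a m k : ℕ} (ha : a * a ≤ X)
    (h : (m, k) ∈ tri (fun m k => (m + k) % 2 = 1 ∧ Nat.gcd m k = 1) a) :
    vecX m k ≤ X ∧ vecY m k ≤ X ∧ 4 * (m * k) ≤ 2 * X ∧ (m + k) * (m + k) ≤ 2 * X := by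
  obtain ⟨h1, h2, h3, h4, h5⟩ := mem_tri.1 h
  have hm : m * m ≤ X := (Nat.mul_self_le_mul_self h1).trans ha
  have hk : 5 * (m * k) ≤ 2 * (m * m) := by nlinarith
  have hkk : 25 * (k * k) ≤ 4 * (m * m) := by nlinarith
  rw [vecX_of_odd h4, vecY_of_odd h4]
  refine ⟨by nlinarith, (Nat.sub_le _ _).trans hm, by omega, by nlinarith⟩

theorem gcd_add_sub_of_opp {m k : ℕ} (hkm : k ≤ m) (h : (m + k) % 2 = 1)
    (hg : Nat.gcd m k = 1) : Nat.gcd (m + k) (m - k) = 1 := by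
  obtain ⟨d, rfl⟩ := Nat.exists_eq_add_of_le hkm
  have h1 : Nat.gcd d k = 1 := by
    rw [Nat.gcd_comm] at hg
    rw [Nat.gcd_comm, ← hg]
    simp
  have hd : d % 2 = 1 := by omega
  rw [Nat.add_sub_cancel_left, show k + d + k = 2 * k + d by ring, Nat.gcd_add_self_left]
  exact Nat.Coprime.mul_left (Nat.coprime_two_left.2 (Nat.odd_iff.2 hd)) (Nat.Coprime.symm h1)

/-- Because `2/5 < √2 - 1`, the condition `5k ≤ 2m` makes the second coordinate the larger one, so
only `m² ≤ X` (opposite parity) or `m² ≤ 2X` (both odd) has to be required. The map `(m, k) ↦ (m +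
k, m - k)`, halved on odd pairs, exchanges the two coordinates and the two parity classes. The
images satisfy `k/m ≥ 3/7 > 2/5`, so the two families and their mirror images are four disjoint
sets. -/
theorem card_params_ge {X N a b : ℕ} (ha : a * a ≤ X) (hb : b * b ≤ 2 * X)
    (hN : 2 * X < (N + 1) * (N + 1)) :
    2 * (tri (fun m k => (m + k) % 2 = 1 ∧ Nat.gcd m k = 1) a).card +
      2 * (tri (fun m k => (m % 2 = 1 ∧ k % 2 = 1) ∧ Nat.gcd m k = 1) b).card ≤
      (params X N).card := by
  set A := tri (fun m k => (m + k) % 2 = 1 ∧ Nat.gcd m k = 1) a with hA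
  set B := tri (fun m k => (m % 2 = 1 ∧ k % 2 = 1) ∧ Nat.gcd m k = 1) b with hB
  have hNle : ∀ m, m * m ≤ 2 * X → m ≤ N := by
    intro m hm
    have : m < N + 1 := Nat.mul_self_lt_mul_self_iff.1 (hm.trans_lt hN)
    omega
  let f : ℕ × ℕ → ℕ × ℕ := fun q => (q.1 + q.2, q.1 - q.2)
  let g : ℕ × ℕ → ℕ × ℕ := fun q => ((q.1 + q.2) / 2, (q.1 - q.2) / 2)
  have hfc : (A.image f).card = A.card := by
    refine Finset.card_image_of_injOn ?_
    rintro ⟨m, k⟩ h ⟨m', k'⟩ h' he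
    have h1 := mem_tri.1 (Finset.mem_coe.1 h)
    have h2 := mem_tri.1 (Finset.mem_coe.1 h')
    simp only [f, Prod.mk.injEq] at he ⊢
    omega
  have hgc : (B.image g).card = B.card := by
    refine Finset.card_image_of_injOn ?_
    rintro ⟨m, k⟩ h ⟨m', k'⟩ h' he
    have h1 := mem_tri.1 (Finset.mem_coe.1 h)
    have h2 := mem_tri.1 (Finset.mem_coe.1 h')
    simp only [g, Prod.mk.injEq] at he ⊢
    omega
  have hd1 : Disjoint A B := by
    rw [Finset.disjoint_left]
    rintro ⟨m, k⟩ h h'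
    have h1 := mem_tri.1 h
    have h2 := mem_tri.1 h'
    omega
  have hd2 : Disjoint (A.image f) (B.image g) := by
    rw [Finset.disjoint_left]
    rintro q h h'
    obtain ⟨⟨m, k⟩, hq, rfl⟩ := Finset.mem_image.1 h
    obtain ⟨⟨m', k'⟩, hq', he⟩ := Finset.mem_image.1 h'
    have h1 := mem_tri.1 hq
    have h2 := mem_tri.1 hq'
    simp only [f, g, Prod.mk.injEq] at he
    omega
  have hd3 : Disjoint (A ∪ B) (A.image f ∪ B.image g) := by
    rw [Finset.disjoint_left]
    rintro ⟨m, k⟩ h h'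
    have h3 : 5 * k ≤ 2 * m ∧ 0 < k := by
      rcases Finset.mem_union.1 h with h | h
      · exact ⟨(mem_tri.1 h).2.2.1, (mem_tri.1 h).2.1⟩
      · exact ⟨(mem_tri.1 h).2.2.1, (mem_tri.1 h).2.1⟩
    rcases Finset.mem_union.1 h' with h' | h'
    · obtain ⟨⟨m', k'⟩, hq', he⟩ := Finset.mem_image.1 h'
      have h2 := mem_tri.1 hq'
      simp only [f, Prod.mk.injEq] at he
      omega
    · obtain ⟨⟨m', k'⟩, hq', he⟩ := Finset.mem_image.1 h'
      have h2 := mem_tri.1 hq'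
      simp only [g, Prod.mk.injEq] at he
      omega
  have hsub : (A ∪ B) ∪ (A.image f ∪ B.image g) ⊆ params X N := by
    intro q hq
    rcases Finset.mem_union.1 hq with hq | hq <;> rcases Finset.mem_union.1 hq with hq | hq
    · obtain ⟨m, k⟩ := q
      obtain ⟨h1, h2, h3, h4, h5⟩ := mem_tri.1 hq
      obtain ⟨h6, h7, -, -⟩ := mem_params_of_opp ha hq
      exact mem_params.2 ⟨hNle m (by nlinarith), h2, by omega, h5, h6, h7⟩
    · obtain ⟨m, k⟩ := q
      obtain ⟨h1, h2, h3, h4, h5⟩ := mem_tri.1 hq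
      have hm : m * m ≤ 2 * X := (Nat.mul_self_le_mul_self h1).trans hb
      have hk : 5 * (m * k) ≤ 2 * (m * m) := by nlinarith
      refine mem_params.2 ⟨hNle m hm, h2, by omega, h5, ?_, ?_⟩
      · rw [vecX_of_even (by omega)]
        omega
      · rw [vecY_of_even (by omega)]
        omega
    · obtain ⟨⟨m, k⟩, hq', rfl⟩ := Finset.mem_image.1 hq
      obtain ⟨h1, h2, h3, h4, h5⟩ := mem_tri.1 hq'
      obtain ⟨h6, h7, h8, h9⟩ := mem_params_of_opp ha hq'
      rw [vecX_of_odd h4] at h6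
      rw [vecY_of_odd h4] at h7
      refine mem_params.2 ⟨hNle _ h9, by omega, by omega, gcd_add_sub_of_opp (by omega) h4 h5,
        ?_, ?_⟩
      · rw [vecX_of_even (by omega), vec_sub_sq _ _]
        exact h7
      · rw [vecY_of_even (by omega), Nat.mul_self_sub_mul_self_eq,
          show m + k + (m - k) = 2 * m by omega, show m + k - (m - k) = 2 * k by omega]
        have : 2 * m * (2 * k) / 2 = 2 * m * k := by
          rw [show 2 * m * (2 * k) = 2 * (2 * m * k) by ring]
          simp
        omega
    · obtain ⟨⟨m, k⟩, hq', rfl⟩ := Finset.mem_image.1 hq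
      obtain ⟨h1, h2, h3, h4, h5⟩ := mem_tri.1 hq'
      have hm : m * m ≤ 2 * X := (Nat.mul_self_le_mul_self h1).trans hb
      have hk : 5 * (m * k) ≤ 2 * (m * m) := by nlinarith
      obtain ⟨u, hu⟩ : ∃ u, m + k = 2 * u := ⟨(m + k) / 2, by omega⟩
      obtain ⟨v, hv⟩ : ∃ v, m - k = 2 * v := ⟨(m - k) / 2, by omega⟩
      have hmu : m = u + v := by omega
      have hku : k = u - v := by omega
      have hgu : g (m, k) = (u, v) := by
        simp only [g, Prod.mk.injEq]
        omega
      simp only [hgu]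
      have ho : (u + v) % 2 = 1 := by omega
      refine mem_params.2 ⟨?_, by omega, by omega, ?_, ?_, ?_⟩
      · exact (show u ≤ m by omega).trans (hNle m hm)
      · rw [← Nat.dvd_one, ← h5]
        refine Nat.dvd_gcd ?_ ?_
        · rw [hmu]
          exact dvd_add (Nat.gcd_dvd_left u v) (Nat.gcd_dvd_right u v)
        · rw [hku]
          exact Nat.dvd_sub (Nat.gcd_dvd_left u v) (Nat.gcd_dvd_right u v)
      · rw [vecX_of_odd ho]
        have : (m + k) * (m - k) = m * m - k * k := vec_sub_sq _ _
        rw [hu, hv] at this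
        have e : 2 * u * (2 * v) = 2 * (2 * u * v) := by ring
        omega
      · rw [vecY_of_odd ho, ← vec_sub_sq u v, ← hmu, ← hku]
        omega
  calc 2 * A.card + 2 * B.card = ((A ∪ B) ∪ (A.image f ∪ B.image g)).card := by
        rw [Finset.card_union_of_disjoint hd3, Finset.card_union_of_disjoint hd1,
          Finset.card_union_of_disjoint hd2, hfc, hgc]
        ring
    _ ≤ _ := Finset.card_le_card hsub

/-- The count grows with `T`, so one computed value at `T₀` that already reaches `T₁` settles the
whole interval from `T₀` to `T₁`. -/
theorem le_card_params_of_checkpoint (T₀ N₀ T₁ : ℕ) (hc : T₁ ≤ (params (9 * T₀ / 2) N₀).card)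
    (hN₀ : N₀ * N₀ ≤ 2 * (9 * T₀ / 2)) {T N : ℕ} (h0 : T₀ ≤ T) (h1 : T ≤ T₁)
    (hN : 2 * (9 * T / 2) < (N + 1) * (N + 1)) : T ≤ (params (9 * T / 2) N).card := by
  refine h1.trans (hc.trans (Finset.card_le_card (params_mono (by omega) ?_)))
  have : N₀ < N + 1 := Nat.mul_self_lt_mul_self_iff.1 (by omega)
  omega

/-- There are at least `T` primitive Pythagorean vectors in the square `[1, 9T/2]²`. -/
theorem le_card_params {T N : ℕ} (hN : 2 * (9 * T / 2) < (N + 1) * (N + 1)) :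
    T ≤ (params (9 * T / 2) N).card := by
  -- For small `T` the linear error terms of the sieve are too large. There, ten computed counts
  -- cover all values.
  rcases Nat.lt_or_ge T 100 with hT | hT
  · rcases Nat.eq_zero_or_pos T with rfl | h0
    · exact Nat.zero_le _
    rcases Nat.lt_or_ge 1 T with h | h
    swap
    · exact le_card_params_of_checkpoint 1 2 1 (by decide +kernel) (by norm_num) h0 h hN
    rcases Nat.lt_or_ge 2 T with h | h
    swap
    · exact le_card_params_of_checkpoint 2 4 2 (by decide +kernel) (by norm_num) (by omega) h hN
    rcases Nat.lt_or_ge 4 T with h | h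
    swap
    · exact le_card_params_of_checkpoint 3 5 4 (by decide +kernel) (by norm_num) (by omega) h hN
    rcases Nat.lt_or_ge 7 T with h | h
    swap
    · exact le_card_params_of_checkpoint 5 6 7 (by decide +kernel) (by norm_num) (by omega) h hN
    rcases Nat.lt_or_ge 12 T with h | h
    swap
    · exact le_card_params_of_checkpoint 8 8 12 (by decide +kernel) (by norm_num) (by omega) h hN
    rcases Nat.lt_or_ge 18 T with h | h
    swap
    · exact le_card_params_of_checkpoint 13 10 18 (by decide +kernel) (by norm_num) (by omega) h hN
    rcases Nat.lt_or_ge 32 T with h | h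
    swap
    · exact le_card_params_of_checkpoint 19 13 32 (by decide +kernel) (by norm_num) (by omega) h hN
    rcases Nat.lt_or_ge 52 T with h | h
    swap
    · exact le_card_params_of_checkpoint 33 17 52 (by decide +kernel) (by norm_num) (by omega) h hN
    rcases Nat.lt_or_ge 81 T with h | h
    swap
    · exact le_card_params_of_checkpoint 53 21 81 (by decide +kernel) (by norm_num) (by omega) h hN
    · exact le_card_params_of_checkpoint 82 27 131 (by decide +kernel) (by norm_num) (by omega)
        (by omega) hN
  -- The main terms add up to about `2 · 0.0765 X + 2 · 0.0343 · 2X ≈ 0.29 X ≈ 1.3 T`. From `T =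
  -- 100` on, the surplus exceeds the linear errors and the losses from rounding the two square
  -- roots.
  · set X := 9 * T / 2 with hX
    have h1 := card_params_ge (Nat.sqrt_le X) (Nat.sqrt_le (2 * X)) hN
    have h2 := card_coprime_opp_ge (Nat.sqrt X)
    have h3 := card_coprime_odd_ge (Nat.sqrt (2 * X))
    have h4 : X < (Nat.sqrt X + 1) * (Nat.sqrt X + 1) := Nat.lt_succ_sqrt X
    have h5 : 2 * X < (Nat.sqrt (2 * X) + 1) * (Nat.sqrt (2 * X) + 1) :=
      Nat.lt_succ_sqrt _
    have h6 : 21 ≤ Nat.sqrt X := Nat.le_sqrt.2 (by omega)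
    generalize Nat.sqrt X = a at *
    generalize Nat.sqrt (2 * X) = b at *
    generalize (tri (fun m k => (m + k) % 2 = 1 ∧ Nat.gcd m k = 1) a).card = α at *
    generalize (tri (fun m k => (m % 2 = 1 ∧ k % 2 = 1) ∧ Nat.gcd m k = 1) b).card = β at *
    have hTX : (9 : ℝ) * T ≤ 2 * X + 1 := by
      have : 9 * T ≤ 2 * X + 1 := by omega
      exact_mod_cast this
    have h4' : (X : ℝ) ≤ a * a + 2 * a := by
      have : X ≤ a * a + 2 * a := by nlinarith
      exact_mod_cast this
    have h5' : (2 : ℝ) * X ≤ b * b + 2 * b := by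
      have : 2 * X ≤ b * b + 2 * b := by nlinarith
      exact_mod_cast this
    have h6' : (21 : ℝ) ≤ a := by exact_mod_cast h6
    have h7 : (T : ℝ) ≤ 2 * α + 2 * β := by
      nlinarith [sq_nonneg ((b : ℝ) - 20), mul_nonneg (sub_nonneg.2 h6') (sub_nonneg.2 h6')]
    have h8 : T ≤ 2 * α + 2 * β := by exact_mod_cast h7
    omega

end Slopes

/-! ### Enumeration of the directions by a Farey sequence. -/

namespace Slopes

theorem two_sub_mod_mul_vecX (m k : ℕ) : (2 - (m + k) % 2) * vecX m k = 2 * (m * k) := by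
  rcases Nat.mod_two_eq_zero_or_one (m + k) with h | h
  · rw [vecX_of_even h, h]
  · rw [vecX_of_odd h, h]
    ring

theorem two_sub_mod_mul_vecY (m k : ℕ) : (2 - (m + k) % 2) * vecY m k = m * m - k * k := by
  rcases Nat.mod_two_eq_zero_or_one (m + k) with h | h
  · rw [vecY_of_even h, h]
    have : 2 ∣ m * m - k * k := by
      rw [Nat.mul_self_sub_mul_self_eq]
      exact Dvd.dvd.mul_right (Nat.dvd_of_mod_eq_zero h) _
    omega
  · rw [vecY_of_odd h, h]
    ring

theorem vecX_pos {m k : ℕ} (hk : 0 < k) (hm : k < m) : 0 < vecX m k := by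
  have h := two_sub_mod_mul_vecX m k
  have : 0 < m * k := Nat.mul_pos (by omega) hk
  rcases Nat.eq_zero_or_pos (vecX m k) with h0 | h0
  · rw [h0] at h
    omega
  · exact h0

theorem vecY_pos {m k : ℕ} (hm : k < m) : 0 < vecY m k := by
  have h := two_sub_mod_mul_vecY m k
  have : k * k < m * m := Nat.mul_self_lt_mul_self hm
  rcases Nat.eq_zero_or_pos (vecY m k) with h0 | h0
  · rw [h0] at h
    omega
  · exact h0

/-- The quotient of the coordinates is `tan (2 arctan (k/m))`, increasing in `k/m`. After clearing
denominators the difference of the two sides is `2(mm' + kk')(k'm - km')`. Thus the order of the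
fractions `k/m` is the order of the directions. -/
theorem vecX_mul_vecY_lt {m k m' k' : ℕ} (hm : k < m) (hm' : k' < m')
    (h : k * m' < k' * m) : vecX m k * vecY m' k' < vecX m' k' * vecY m k := by
  have h1 := two_sub_mod_mul_vecX m k
  have h2 := two_sub_mod_mul_vecY m k
  have h1' := two_sub_mod_mul_vecX m' k'
  have h2' := two_sub_mod_mul_vecY m' k'
  set g := 2 - (m + k) % 2 with hg
  set g' := 2 - (m' + k') % 2 with hg'
  have hgp : 0 < g * g' := Nat.mul_pos (by omega) (by omega)
  refine lt_of_mul_lt_mul_left (a := g * g') ?_ hgp.le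
  have e1 : g * g' * (vecX m k * vecY m' k') = 2 * (m * k) * (m' * m' - k' * k') := by
    rw [← h1, ← h2']
    ring
  have e2 : g * g' * (vecX m' k' * vecY m k) = 2 * (m' * k') * (m * m - k * k) := by
    rw [← h1', ← h2]
    ring
  rw [e1, e2]
  have l1 : k * k ≤ m * m := Nat.mul_self_le_mul_self hm.le
  have l2 : k' * k' ≤ m' * m' := Nat.mul_self_le_mul_self hm'.le
  zify [l1, l2] at h ⊢
  have hmm : (0 : ℤ) < m * m' := by
    have : 0 < m * m' := Nat.mul_pos (by omega) (by omega)
    exact_mod_cast this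
  have hkk : (0 : ℤ) ≤ k * k' := by positivity
  nlinarith [mul_pos (add_pos_of_pos_of_nonneg hmm hkk) (sub_pos.2 h)]

theorem vec_length (m k : ℕ) (hm : k < m) :
    ∃ l : ℕ, vecX m k ^ 2 + vecY m k ^ 2 = l ^ 2 := by
  have h1 := two_sub_mod_mul_vecX m k
  have h2 := two_sub_mod_mul_vecY m k
  have hg : 0 < 2 - (m + k) % 2 := by omega
  have h3 : (2 - (m + k) % 2) ∣ m * m + k * k := by
    rcases Nat.mod_two_eq_zero_or_one (m + k) with h | h
    · rw [h]
      have e : (m + k) * (m + k) = m * m + k * k + 2 * (m * k) := by ring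
      have : 2 ∣ (m + k) * (m + k) := Dvd.dvd.mul_right (Nat.dvd_of_mod_eq_zero h) _
      omega
    · rw [h]
      exact one_dvd _
  obtain ⟨l, hl⟩ := h3
  refine ⟨l, ?_⟩
  set g := 2 - (m + k) % 2
  refine Nat.eq_of_mul_eq_mul_left (Nat.mul_pos hg hg) ?_
  have l1 : k * k ≤ m * m := Nat.mul_self_le_mul_self hm.le
  have e : g * g * (vecX m k ^ 2 + vecY m k ^ 2) = (g * vecX m k) ^ 2 + (g * vecY m k) ^ 2 := by
    ring
  rw [e, show g * g * l ^ 2 = (g * l) ^ 2 by ring, h1, h2, ← hl]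
  zify [l1]
  ring

/-- The state of the enumeration of the Farey sequence of order `N`: the fractions `a / b` and
`c / d` are consecutive, and the vectors of all parameters `k / m ≤ a / b` have been stored. -/
structure FareyInv (X N a b c d i : ℕ) (Dx Dy : ℕ → ℕ) : Prop where
  b_pos : 0 < b
  d_pos : 0 < d
  b_le : b ≤ N
  d_le : d ≤ N
  det : b * c = a * d + 1
  gap : N < b + d
  c_le : c ≤ d
  count : i = ((params X N).filter fun q => q.2 * b ≤ a * q.1).card
  stored : ∀ j < i, ∃ m k, (m, k) ∈ params X N ∧ Dx j = vecX m k ∧ Dy j = vecY m k ∧ k * b ≤ a * m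
  sorted : ∀ j j', j < j' → j' < i → Dx j * Dy j' < Dx j' * Dy j

namespace FareyInv

variable {X N a b c d i : ℕ} {Dx Dy : ℕ → ℕ}

theorem start (hN : 0 < N) (X : ℕ) (Dx Dy : ℕ → ℕ) : FareyInv X N 0 1 1 N 0 Dx Dy where
  b_pos := one_pos
  d_pos := hN
  b_le := hN
  d_le := le_rfl
  det := by simp
  gap := by omega
  c_le := hN
  count := by
    symm
    rw [Finset.card_eq_zero, Finset.filter_eq_empty_iff]
    rintro ⟨m, k⟩ h
    have := mem_params.1 h
    simp
    omega
  stored := fun j hj => absurd hj (Nat.not_lt_zero j)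
  sorted := fun j j' _ hj => absurd hj (Nat.not_lt_zero j')

/-- Since `bc - ad = 1`, a fraction `k/m` in the interval above `a/b` and up to `c/d` has the form
`(m, k) = v (b, a) + (u + 1)(d, c)` with natural numbers `u`, `v`. If `v > 0`, then `m ≥ b + d > N`;
if `v = 0`, coprimality leaves only `(d, c)`. So no parameter is skipped between consecutive
fractions. -/
theorem le_or_eq_or_lt (h : FareyInv X N a b c d i Dx Dy) {m k : ℕ} (hm : m ≤ N)
    (hg : Nat.gcd m k = 1) : k * b ≤ a * m ∨ (m = d ∧ k = c) ∨ c * m < k * d := by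
  by_contra! hc
  obtain ⟨h1, h2, h3⟩ := hc
  have hdet := h.det
  obtain ⟨u, hu⟩ := Nat.exists_eq_add_of_lt h1
  obtain ⟨v, hv⟩ := Nat.exists_eq_add_of_le h3
  have e : m = b * v + d * (u + 1) := by
    have : m * (b * c) = m * (a * d) + b * v + d * (u + 1) := by
      calc m * (b * c) = b * (c * m) := by ring
        _ = (k * b) * d + b * v := by rw [hv]; ring
        _ = _ := by rw [hu]; ring
    rw [hdet] at this
    linarith
  have e' : k = a * v + c * (u + 1) := by
    have : k * (b * c) = k * (a * d) + a * v + c * (u + 1) := by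
      calc k * (b * c) = (k * b) * c := by ring
        _ = a * (c * m) + c * (u + 1) := by rw [hu]; ring
        _ = _ := by rw [hv]; ring
    rw [hdet] at this
    linarith
  rcases Nat.eq_zero_or_pos v with rfl | hv0
  · have hdvd : (u + 1) ∣ Nat.gcd m k := by
      refine Nat.dvd_gcd ⟨d, ?_⟩ ⟨c, ?_⟩
      · rw [e]; ring
      · rw [e']; ring
    rw [hg, Nat.dvd_one] at hdvd
    refine h2 ?_ ?_
    · rw [e, hdvd]; ring
    · rw [e', hdvd]; ring
  · have : b + d ≤ m := by
      rw [e]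
      nlinarith [h.b_pos, h.d_pos]
    have := h.gap
    omega

/-- If `c/d` were already `1`, every parameter, having `k < m`, would lie at or before `a/b`, and
nothing would be missing. A missing vector thus guarantees that the sequence can be continued. -/
theorem lt_of_count_lt (h : FareyInv X N a b c d i Dx Dy) (hi : i < (params X N).card) :
    c < d := by
  refine lt_of_le_of_ne h.c_le ?_
  rintro rfl
  rw [h.count] at hi
  refine absurd hi (not_lt.2 (Finset.card_le_card ?_))
  rintro ⟨m, k⟩ hq
  obtain ⟨h1, h2, h3, h4, -, -⟩ := mem_params.1 hq
  rw [Finset.mem_filter]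
  refine ⟨hq, ?_⟩
  rcases h.le_or_eq_or_lt h1 h4 with h5 | h5 | h5
  · exact h5
  · omega
  · rw [mul_comm] at h5
    have := lt_of_mul_lt_mul_right h5 (Nat.zero_le _)
    omega

theorem params_filter (h : FareyInv X N a b c d i Dx Dy) :
    (params X N).filter (fun q => q.2 * d ≤ c * q.1) =
      if (d, c) ∈ params X N then
        insert (d, c) ((params X N).filter fun q => q.2 * b ≤ a * q.1)
      else (params X N).filter fun q => q.2 * b ≤ a * q.1 := by
  have hdet := h.det
  have key : ∀ q ∈ params X N, q.2 * d ≤ c * q.1 ↔ q = (d, c) ∨ q.2 * b ≤ a * q.1 := by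
    rintro ⟨m, k⟩ hq
    obtain ⟨h1, h2, h3, h4, -, -⟩ := mem_params.1 hq
    simp only [Prod.mk.injEq]
    constructor
    · intro h5
      rcases h.le_or_eq_or_lt h1 h4 with h6 | h6 | h6
      · exact Or.inr h6
      · exact Or.inl h6
      · omega
    · rintro (⟨rfl, rfl⟩ | h5)
      · exact le_rfl
      · refine le_of_mul_le_mul_left (a := b) ?_ h.b_pos
        calc b * (k * d) = (k * b) * d := by ring
          _ ≤ (a * m) * d := Nat.mul_le_mul_right _ h5
          _ ≤ (a * d + 1) * m := by nlinarith
          _ = b * (c * m) := by rw [← hdet]; ring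
  split_ifs with hm
  · ext q
    rw [Finset.mem_filter, Finset.mem_insert, Finset.mem_filter]
    constructor
    · rintro ⟨hq, h5⟩
      rcases (key q hq).1 h5 with rfl | h6
      · exact Or.inl rfl
      · exact Or.inr ⟨hq, h6⟩
    · rintro (rfl | ⟨hq, h5⟩)
      · exact ⟨hm, (key _ hm).2 (Or.inl rfl)⟩
      · exact ⟨hq, (key q hq).2 (Or.inr h5)⟩
  · refine Finset.filter_congr ?_
    intro q hq
    rw [key q hq]
    constructor
    · rintro (rfl | h5)
      · exact absurd hq hm
      · exact h5
    · exact Or.inr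

/-- The next term of the Farey sequence. -/
theorem next_fraction (h : FareyInv X N a b c d i Dx Dy) (hcd : c < d) :
    a ≤ (N + b) / d * c ∧ b ≤ (N + b) / d * d ∧ 0 < (N + b) / d * d - b ∧
      (N + b) / d * d - b ≤ N ∧
      d * ((N + b) / d * c - a) = c * ((N + b) / d * d - b) + 1 ∧
      N < d + ((N + b) / d * d - b) ∧ (N + b) / d * c - a ≤ (N + b) / d * d - b := by
  have hdet := h.det
  have h1 := Nat.div_mul_le_self (N + b) d
  have h2 := Nat.lt_div_mul_add h.d_pos (a := N + b)
  set q := (N + b) / d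
  have hd := h.d_le
  have hb : b < q * d := by omega
  have ha : a < q * c := by
    refine lt_of_mul_lt_mul_right (a := d) ?_ (Nat.zero_le d)
    calc a * d < b * c := by omega
      _ ≤ q * d * c := Nat.mul_le_mul_right _ hb.le
      _ = q * c * d := by ring
  obtain ⟨x, hx⟩ := Nat.exists_eq_add_of_le ha.le
  obtain ⟨y, hy⟩ := Nat.exists_eq_add_of_le hb.le
  have hdx : d * x = c * y + 1 := by
    have : d * (q * c) = c * (q * d) := by ring
    rw [hx, hy] at this
    nlinarith
  rw [hx, hy, Nat.add_sub_cancel_left, Nat.add_sub_cancel_left]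
  refine ⟨by omega, by omega, by omega, by omega, hdx, by omega, ?_⟩
  by_contra hc
  have h3 : d * (y + 1) ≤ d * x := Nat.mul_le_mul_left _ (by omega)
  have h4 : (c + 1) * y ≤ d * y := Nat.mul_le_mul_right _ hcd
  have h5 : d * (y + 1) = d * y + d := by ring
  have h6 : (c + 1) * y = c * y + y := by ring
  omega

theorem step_keep (h : FareyInv X N a b c d i Dx Dy) (hcd : c < d)
    (hX : vecX d c ≤ X) (hY : vecY d c ≤ X) :
    FareyInv X N c d ((N + b) / d * c - a) ((N + b) / d * d - b) (i + 1)
      (Function.update Dx i (vecX d c)) (Function.update Dy i (vecY d c)) := by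
  obtain ⟨h1, h2, h3, h4, h5, h6, h7⟩ := h.next_fraction hcd
  have hdet := h.det
  have hc0 : 0 < c := by
    rcases Nat.eq_zero_or_pos c with rfl | h0
    · omega
    · exact h0
  have hg : Nat.gcd d c = 1 := by
    have e1 : Nat.gcd d c ∣ a * d + 1 := hdet ▸ Dvd.dvd.mul_left (Nat.gcd_dvd_right d c) b
    have e2 : Nat.gcd d c ∣ a * d := Dvd.dvd.mul_left (Nat.gcd_dvd_left d c) a
    exact Nat.dvd_one.1 ((Nat.dvd_add_right e2).1 e1)
  have hmem : (d, c) ∈ params X N := mem_params.2 ⟨h.d_le, hc0, hcd, hg, hX, hY⟩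
  have hmono : ∀ m k, k * b ≤ a * m → 0 < m → k * d < c * m := by
    intro m k hk hm
    refine lt_of_mul_lt_mul_left (a := b) ?_ (Nat.zero_le _)
    calc b * (k * d) = (k * b) * d := by ring
      _ ≤ (a * m) * d := Nat.mul_le_mul_right _ hk
      _ < (a * d + 1) * m := by nlinarith
      _ = b * (c * m) := by rw [← hdet]; ring
  refine ⟨h.d_pos, h3, h.d_le, h4, h5, h6, h7, ?_, ?_, ?_⟩
  · rw [h.params_filter, if_pos hmem, Finset.card_insert_of_notMem, ← h.count]
    rw [Finset.mem_filter]
    rintro ⟨-, hle⟩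
    have := hmono d c hle h.d_pos
    omega
  · intro j hj
    rcases Nat.lt_succ_iff_lt_or_eq.1 hj with hj | rfl
    · obtain ⟨m, k, hm, e1, e2, e3⟩ := h.stored j hj
      have hm' := mem_params.1 hm
      refine ⟨m, k, hm, ?_, ?_, (hmono m k e3 (by omega)).le⟩
      · rw [Function.update_of_ne hj.ne, e1]
      · rw [Function.update_of_ne hj.ne, e2]
    · exact ⟨d, c, hmem, by simp, by simp, le_rfl⟩
  · intro j j' hjj hj'
    rcases Nat.lt_succ_iff_lt_or_eq.1 hj' with hj' | rfl
    · rw [Function.update_of_ne hj'.ne, Function.update_of_ne hj'.ne,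
        Function.update_of_ne (hjj.trans hj').ne, Function.update_of_ne (hjj.trans hj').ne]
      exact h.sorted j j' hjj hj'
    · obtain ⟨m, k, hm, e1, e2, e3⟩ := h.stored j hjj
      have hm' := mem_params.1 hm
      rw [Function.update_of_ne hjj.ne, Function.update_of_ne hjj.ne, Function.update_self,
        Function.update_self, e1, e2]
      exact vecX_mul_vecY_lt hm'.2.2.1 hcd (hmono m k e3 (by omega))

theorem step_skip (h : FareyInv X N a b c d i Dx Dy) (hcd : c < d)
    (hX : ¬ (vecX d c ≤ X ∧ vecY d c ≤ X)) :
    FareyInv X N c d ((N + b) / d * c - a) ((N + b) / d * d - b) i Dx Dy := by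
  obtain ⟨h1, h2, h3, h4, h5, h6, h7⟩ := h.next_fraction hcd
  have hdet := h.det
  have hmem : (d, c) ∉ params X N := by
    intro hm
    exact hX (mem_params.1 hm).2.2.2.2
  refine ⟨h.d_pos, h3, h.d_le, h4, h5, h6, h7, ?_, ?_, h.sorted⟩
  · rw [h.params_filter, if_neg hmem, ← h.count]
  · intro j hj
    obtain ⟨m, k, hm, e1, e2, e3⟩ := h.stored j hj
    refine ⟨m, k, hm, e1, e2, ?_⟩
    refine le_of_mul_le_mul_left (a := b) ?_ h.b_pos
    calc b * (k * d) = (k * b) * d := by ring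
      _ ≤ (a * m) * d := Nat.mul_le_mul_right _ e3
      _ ≤ (a * d + 1) * m := by nlinarith
      _ = b * (c * m) := by rw [← hdet]; ring

/-- Each step of the enumeration increases the fraction by at least `1 / N²`. -/
theorem potential (h : FareyInv X N a b c d i Dx Dy) (hcd : c < d) {k : ℕ}
    (hk : N ^ 2 * b ≤ a * N ^ 2 + k * b) : ∃ k', k = k' + 1 ∧ N ^ 2 * d ≤ c * N ^ 2 + k' * d := by
  have hdet := h.det
  have hab : a < b := by
    refine lt_of_mul_lt_mul_right (a := d) ?_ (Nat.zero_le d)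
    have : b * c ≤ b * d := Nat.mul_le_mul_left _ hcd.le
    omega
  have hN : 0 < N := h.b_pos.trans_le h.b_le
  rcases k with - | k
  · exfalso
    have : a * N ^ 2 < b * N ^ 2 := Nat.mul_lt_mul_of_pos_right hab (by positivity)
    nlinarith
  · refine ⟨k, rfl, ?_⟩
    refine le_of_mul_le_mul_left (a := b) ?_ h.b_pos
    -- The hypothesis `hk` says `1 - a/b ≤ k/N²`. The fraction grows by `1/(bd) ≥ 1/N²`, so the
    -- budget `k` can drop by one; a budget of zero would mean `a/b ≥ 1`.
    have hbd : b * d ≤ N ^ 2 := by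
      rw [pow_two]
      exact Nat.mul_le_mul h.b_le h.d_le
    calc b * (N ^ 2 * d) = (N ^ 2 * b) * d := by ring
      _ ≤ (a * N ^ 2 + (k + 1) * b) * d := Nat.mul_le_mul_right _ hk
      _ = a * d * N ^ 2 + k * b * d + b * d := by ring
      _ ≤ a * d * N ^ 2 + k * b * d + N ^ 2 := by omega
      _ = (a * d + 1) * N ^ 2 + k * b * d := by ring
      _ = b * (c * N ^ 2 + k * d) := by rw [← hdet]; ring

end FareyInv

end Slopes

/-! ### Marking the cycles on the search tree. -/

namespace Cactus

/-- A rooted tree on `0, …, n - 1` with root `0` and back edges, such that each tree edge lies on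
at most one of the cycles closed by the back edges. -/
structure CactusTree (n : ℕ) (P U : ℕ → ℕ) : Prop where
  parent_zero : P 0 = 0
  parent_lt : ∀ i, 0 < i → i < n → P i < i
  up_lt : ∀ x < n, U x ≠ 0 → U x - 1 < x
  up_ne : ∀ x < n, U x ≠ 0 → U x - 1 ≠ P x
  up_ancestor : ∀ x < n, U x ≠ 0 → ∃ t, P^[t] x = U x - 1
  cover_unique : ∀ x < n, ∀ x' < n, ∀ c t t', U x ≠ 0 → U x' ≠ 0 → P^[t] x = c → U x ≤ c →
    P^[t'] x' = c → U x' ≤ c → x = x'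

/-- The tree edge above `c` lies on the cycle closed by the back edge at `x`, at distance `j`
from `x`. -/
def Cov (n : ℕ) (P U : ℕ → ℕ) (x c j : ℕ) : Prop :=
  x < n ∧ U x ≠ 0 ∧ P^[j] x = c ∧ U x ≤ c

namespace CactusTree

variable {n : ℕ} {P U : ℕ → ℕ}

theorem parent_le (h : CactusTree n P U) {i : ℕ} (hi : i < n) : P i ≤ i := by
  rcases Nat.eq_zero_or_pos i with rfl | h0
  · exact h.parent_zero.le
  · exact (h.parent_lt i h0 hi).le

theorem iterate_le (h : CactusTree n P U) (t : ℕ) {i : ℕ} (hi : i < n) : P^[t] i ≤ i := by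
  induction t generalizing i with
  | zero => exact le_rfl
  | succ t ih =>
    rw [Function.iterate_succ_apply]
    have h1 := h.parent_le hi
    exact (ih (lt_of_le_of_lt h1 hi)).trans h1

theorem iterate_lt (h : CactusTree n P U) {t i : ℕ} (hi : i < n) (h0 : 0 < i) (ht : 0 < t) :
    P^[t] i < i := by
  obtain ⟨t, rfl⟩ := Nat.exists_eq_succ_of_ne_zero ht.ne'
  rw [Function.iterate_succ_apply]
  have h1 := h.parent_lt i h0 hi
  exact (h.iterate_le t (h1.trans hi)).trans_lt h1

end CactusTree

namespace Cov

variable {n : ℕ} {P U : ℕ → ℕ} {x x' c j j' : ℕ}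

theorem pos (hc : Cov n P U x c j) : 0 < c :=
  (Nat.pos_of_ne_zero hc.2.1).trans_le hc.2.2.2

theorem le (h : CactusTree n P U) (hc : Cov n P U x c j) : c ≤ x :=
  hc.2.2.1 ▸ h.iterate_le j hc.1

theorem lt (h : CactusTree n P U) (hc : Cov n P U x c j) : c < n :=
  (hc.le h).trans_lt hc.1

theorem start (hx : x < n) (hU : U x ≠ 0) (h : CactusTree n P U) : Cov n P U x x 0 :=
  ⟨hx, hU, rfl, by have := h.up_lt x hx hU; omega⟩

/-- The back edge is unique in a cactus tree. The distance is unique because iterated parents of the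
positive index `c` stay strictly below `c`. -/
theorem unique (h : CactusTree n P U) (hc : Cov n P U x c j) (hc' : Cov n P U x' c j') :
    x = x' ∧ j = j' := by
  have hxx := h.cover_unique x hc.1 x' hc'.1 c j j' hc.2.1 hc'.2.1 hc.2.2.1 hc.2.2.2 hc'.2.2.1
    hc'.2.2.2
  subst hxx
  refine ⟨rfl, ?_⟩
  have key : ∀ a b, P^[a] x = c → P^[b] x = c → ¬ a < b := by
    intro a b ha hb hab
    obtain ⟨t, rfl⟩ := Nat.exists_eq_add_of_lt hab
    rw [show a + t + 1 = (t + 1) + a by ring, Function.iterate_add_apply, ha] at hb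
    exact (h.iterate_lt (hc.lt h) hc.pos (Nat.succ_pos t)).ne hb
  have h1 := key j j' hc.2.2.1 hc'.2.2.1
  have h2 := key j' j hc'.2.2.1 hc.2.2.1
  omega

/-- The upper end of the back edge is an ancestor of `x` with a smaller index than `c`. On the way
up from `x` it comes after `c`, hence at the parent of `c` or above. -/
theorem up_le_parent (h : CactusTree n P U) (hc : Cov n P U x c j) : U x ≤ P c + 1 := by
  obtain ⟨t, ht⟩ := h.up_ancestor x hc.1 hc.2.1
  have hU := hc.2.1
  have hcU := hc.2.2.2
  have hjt : j < t := by
    by_contra hcon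
    obtain ⟨s, rfl⟩ := Nat.exists_eq_add_of_le (not_lt.1 hcon)
    have h1 := hc.2.2.1
    rw [add_comm, Function.iterate_add_apply, ht] at h1
    have h2 := h.up_lt x hc.1 hU
    have h3 := h.iterate_le s (h2.trans hc.1)
    omega
  obtain ⟨s, rfl⟩ := Nat.exists_eq_add_of_lt hjt
  rw [show j + s + 1 = s + 1 + j by ring, Function.iterate_add_apply, hc.2.2.1,
    Function.iterate_succ_apply] at ht
  have h1 := h.iterate_le s ((h.parent_lt c hc.pos (hc.lt h)).trans (hc.lt h))
  omega

theorem parent (h : CactusTree n P U) (hc : Cov n P U x c j) (hne : P c + 1 ≠ U x) :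
    Cov n P U x (P c) (j + 1) := by
  refine ⟨hc.1, hc.2.1, ?_, ?_⟩
  · rw [Function.iterate_succ_apply', hc.2.2.1]
  · have := hc.up_le_parent h
    omega

theorem child (h : CactusTree n P U) (hc : Cov n P U x c (j + 1)) :
    ∃ d, Cov n P U x d j ∧ P d = c ∧ c < d ∧ P d + 1 ≠ U x := by
  have h1 := hc.2.2.1
  have h2 := hc.2.2.2
  rw [Function.iterate_succ_apply'] at h1
  set d := P^[j] x with hd
  have hdx : d < n := (h.iterate_le j hc.1).trans_lt hc.1
  have hd0 : 0 < d := by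
    rcases Nat.eq_zero_or_pos d with h0 | h0
    · rw [h0, h.parent_zero] at h1
      have := hc.pos
      omega
    · exact h0
  have h3 := h.parent_lt d hd0 hdx
  exact ⟨d, ⟨hc.1, hc.2.1, rfl, by omega⟩, h1, by omega, by omega⟩

end Cov

/-- The state of the marking of the cycles after the vertices above `i` have been treated. -/
structure MarkInv (n : ℕ) (P U : ℕ → ℕ) (i : ℕ) (cyc idx len : ℕ → ℕ) : Prop where
  complete : ∀ x c j, Cov n P U x c j → i < c → cyc c = x ∧ idx c = j + 1
  pushed : ∀ x c j, Cov n P U x c j → i < c → P c + 1 ≠ U x →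
    cyc (P c) = x ∧ idx (P c) = j + 2
  sound : ∀ c, cyc c ≠ 0 → ∃ j, Cov n P U (cyc c) c j ∧ idx c = j + 1
  length : ∀ x c j, Cov n P U x c j → i < c → P c + 1 = U x → len x = j + 2

namespace MarkInv

variable {n i : ℕ} {P U cyc idx len : ℕ → ℕ}

theorem initial (h : CactusTree n P U) (idx len : ℕ → ℕ) :
    MarkInv n P U (n - 1) (fun _ => 0) idx len where
  complete x c j hc hi := by
    have := hc.lt h
    omega
  pushed x c j hc hi := by
    have := hc.lt h
    omega
  sound c hc := absurd rfl hc
  length x c j hc hi := by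
    have := hc.lt h
    omega

/-- Marking the lower end of a back edge. -/
theorem mark_bottom (h : CactusTree n P U) (hI : MarkInv n P U i cyc idx len) (hi : i < n)
    (hU : U i ≠ 0) :
    MarkInv n P U i (Function.update cyc i i) (Function.update idx i 1) len := by
  have hs := Cov.start hi hU h
  have key : ∀ x j, Cov n P U x i j → x = i ∧ j = 0 := fun x j hc => hc.unique h hs
  refine ⟨?_, ?_, ?_, hI.length⟩
  · intro x c j hc hic
    rw [Function.update_of_ne hic.ne', Function.update_of_ne hic.ne']
    exact hI.complete x c j hc hic
  · intro x c j hc hic hne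
    have hp := hc.parent h hne
    have hpi : P c ≠ i := by
      intro he
      have := (key x (j + 1) (he ▸ hp)).2
      omega
    rw [Function.update_of_ne hpi, Function.update_of_ne hpi]
    exact hI.pushed x c j hc hic hne
  · intro c hc
    by_cases hci : c = i
    · subst hci
      exact ⟨0, by simpa using hs, by simp⟩
    · rw [Function.update_of_ne hci] at hc ⊢
      rw [Function.update_of_ne hci]
      exact hI.sound c hc

/-- After the treatment of the lower ends, the mark of `i` is known. -/
theorem complete_self (h : CactusTree n P U) (hI : MarkInv n P U i cyc idx len)
    (hb : U i ≠ 0 → cyc i = i ∧ idx i = 1) {x j : ℕ} (hc : Cov n P U x i j) :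
    cyc i = x ∧ idx i = j + 1 := by
  cases j with
  | zero =>
    have : x = i := hc.2.2.1
    subst this
    exact hb hc.2.1
  | succ j =>
    obtain ⟨d, hd, hdi, hlt, hne⟩ := hc.child h
    have := hI.pushed x d j hd hlt hne
    rwa [hdi] at this

/-- A covered vertex would carry the lower end `x ≥ i > 0` as its mark. So `0` safely encodes that
the tree edge above `i` is a bridge. -/
theorem step_zero (h : CactusTree n P U) (hI : MarkInv n P U i cyc idx len) (hi0 : 0 < i)
    (hb : U i ≠ 0 → cyc i = i ∧ idx i = 1) (h0 : cyc i = 0) :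
    MarkInv n P U (i - 1) cyc idx len := by
  have hno : ∀ x j, ¬ Cov n P U x i j := by
    intro x j hc
    have h1 := (hI.complete_self h hb hc).1
    have h2 := hc.le h
    omega
  have key : ∀ {x c j}, Cov n P U x c j → i - 1 < c → i < c := by
    intro x c j hc hic
    rcases Nat.lt_or_ge i c with h1 | h1
    · exact h1
    · obtain rfl : c = i := by omega
      exact absurd hc (hno x j)
  exact ⟨fun x c j hc hic => hI.complete x c j hc (key hc hic),
    fun x c j hc hic => hI.pushed x c j hc (key hc hic), hI.sound,
    fun x c j hc hic => hI.length x c j hc (key hc hic)⟩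

theorem step_top (h : CactusTree n P U) (hI : MarkInv n P U i cyc idx len) (hi0 : 0 < i)
    (hb : U i ≠ 0 → cyc i = i ∧ idx i = 1) (h0 : cyc i ≠ 0) (hp : P i + 1 = U (cyc i)) :
    MarkInv n P U (i - 1) cyc idx (Function.update len (cyc i) (idx i + 1)) := by
  obtain ⟨j₀, hc₀, hj₀⟩ := hI.sound i h0
  refine ⟨?_, ?_, hI.sound, ?_⟩
  · intro x c j hc hic
    rcases Nat.lt_or_ge i c with h1 | h1
    · exact hI.complete x c j hc h1
    · obtain rfl : c = i := by omega
      exact hI.complete_self h hb hc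
  · intro x c j hc hic hne
    rcases Nat.lt_or_ge i c with h1 | h1
    · exact hI.pushed x c j hc h1 hne
    · obtain rfl : c = i := by omega
      rw [(hI.complete_self h hb hc).1] at hp
      exact absurd hp hne
  · intro x c j hc hic hpc
    rcases Nat.lt_or_ge i c with h1 | h1
    · by_cases hx : x = cyc i
      -- The length is written only once. Another vertex `c > i` of this cycle next to its root
      -- would have `i` as an iterated parent, and `i ≤ P c < U x` contradicts that `i` is covered.
      · exfalso
        subst hx
        have hlt : j < j₀ := by
          by_contra hcon
          obtain ⟨s, rfl⟩ := Nat.exists_eq_add_of_le (not_lt.1 hcon)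
          have h3 := hc.2.2.1
          rw [add_comm, Function.iterate_add_apply, hc₀.2.2.1] at h3
          have := h.iterate_le s (hc₀.lt h)
          omega
        obtain ⟨s, rfl⟩ := Nat.exists_eq_add_of_lt hlt
        have h3 := hc₀.2.2.1
        rw [show j + s + 1 = s + 1 + j by ring, Function.iterate_add_apply, hc.2.2.1,
          Function.iterate_succ_apply] at h3
        have hpc' := h.parent_lt c hc.pos (hc.lt h)
        have := h.iterate_le s (hpc'.trans (hc.lt h))
        have := hc₀.2.2.2
        omega
      · rw [Function.update_of_ne hx]
        exact hI.length x c j hc h1 hpc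
    · obtain rfl : c = i := by omega
      obtain ⟨e1, e2⟩ := hI.complete_self h hb hc
      rw [e1, Function.update_self, e2]

theorem step_push (h : CactusTree n P U) (hI : MarkInv n P U i cyc idx len) (hi0 : 0 < i)
    (hb : U i ≠ 0 → cyc i = i ∧ idx i = 1) (h0 : cyc i ≠ 0) (hp : P i + 1 ≠ U (cyc i)) :
    MarkInv n P U (i - 1) (Function.update cyc (P i) (cyc i))
      (Function.update idx (P i) (idx i + 1)) len := by
  obtain ⟨j₀, hc₀, hj₀⟩ := hI.sound i h0
  have hpar := hc₀.parent h hp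
  have hlt := h.parent_lt i hi0 (hc₀.lt h)
  refine ⟨?_, ?_, ?_, ?_⟩
  · intro x c j hc hic
    rw [Function.update_of_ne (by omega), Function.update_of_ne (by omega)]
    rcases Nat.lt_or_ge i c with h1 | h1
    · exact hI.complete x c j hc h1
    · obtain rfl : c = i := by omega
      exact hI.complete_self h hb hc
  · intro x c j hc hic hne
    -- Two vertices pushing their marks to the same parent cover the same tree edge above it, so the
    -- cycles and the positions agree and overwriting is harmless.
    by_cases hpc : P c = P i
    · have h1 := hc.parent h hne
      rw [hpc] at h1
      obtain ⟨h2, h3⟩ := h1.unique h hpar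
      rw [hpc, Function.update_self, Function.update_self, h2, hj₀]
      exact ⟨rfl, by omega⟩
    · rw [Function.update_of_ne hpc, Function.update_of_ne hpc]
      refine hI.pushed x c j hc ?_ hne
      rcases Nat.lt_or_ge i c with h1 | h1
      · exact h1
      · obtain rfl : c = i := by omega
        exact absurd rfl hpc
  · intro c hc
    by_cases hci : c = P i
    · subst hci
      exact ⟨j₀ + 1, by simpa using hpar, by simp [hj₀]⟩
    · rw [Function.update_of_ne hci] at hc ⊢
      rw [Function.update_of_ne hci]
      exact hI.sound c hc
  · intro x c j hc hic hpc
    rcases Nat.lt_or_ge i c with h1 | h1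
    · exact hI.length x c j hc h1 hpc
    · obtain rfl : c = i := by omega
      rw [(hI.complete_self h hb hc).1] at hp
      exact absurd hpc hp

end MarkInv

/-- The final state of the marking, in a local form: `cyc c` is the lower end of the back edge
whose cycle contains the tree edge above `c` (or `0`), `idx c` is the position of `c` on the cycle,
and `len x` is the length of the cycle. -/
structure Marked (n : ℕ) (P U cyc idx len : ℕ → ℕ) : Prop where
  tree : CactusTree n P U
  cover : ∀ c, cyc c ≠ 0 → cyc c < n ∧ U (cyc c) ≠ 0 ∧ U (cyc c) ≤ c ∧ c ≤ cyc c ∧ 1 ≤ idx c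
  top : ∀ c, cyc c ≠ 0 → P c + 1 = U (cyc c) → len (cyc c) = idx c + 1
  up_le : ∀ c, cyc c ≠ 0 → U (cyc c) ≤ P c + 1
  step : ∀ c, cyc c ≠ 0 → P c + 1 ≠ U (cyc c) → cyc (P c) = cyc c ∧ idx (P c) = idx c + 1
  bottom : ∀ x < n, U x ≠ 0 → cyc x = x ∧ idx x = 1
  eq_bottom : ∀ c, cyc c ≠ 0 → idx c = 1 → cyc c = c
  inj : ∀ c c', cyc c ≠ 0 → cyc c = cyc c' → idx c = idx c' → c = c'
  child : ∀ c, cyc c ≠ 0 → 2 ≤ idx c → ∃ d, cyc d = cyc c ∧ P d = c ∧ idx c = idx d + 1 ∧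
    P d + 1 ≠ U (cyc d)

theorem MarkInv.marked {n : ℕ} {P U cyc idx len : ℕ → ℕ} (h : CactusTree n P U)
    (hI : MarkInv n P U 0 cyc idx len) : Marked n P U cyc idx len where
  tree := h
  cover c hc := by
    obtain ⟨j, h1, h2⟩ := hI.sound c hc
    exact ⟨h1.1, h1.2.1, h1.2.2.2, h1.le h, by omega⟩
  top c hc hp := by
    obtain ⟨j, h1, h2⟩ := hI.sound c hc
    rw [hI.length _ c j h1 h1.pos hp, h2]
  up_le c hc := by
    obtain ⟨j, h1, h2⟩ := hI.sound c hc
    exact h1.up_le_parent h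
  step c hc hp := by
    obtain ⟨j, h1, h2⟩ := hI.sound c hc
    have := hI.pushed _ c j h1 h1.pos hp
    omega
  bottom x hx hU := by
    have h1 := Cov.start hx hU h
    exact hI.complete x x 0 h1 h1.pos
  eq_bottom c hc h1 := by
    obtain ⟨j, h2, h3⟩ := hI.sound c hc
    obtain rfl : j = 0 := by omega
    exact h2.2.2.1
  inj c c' hc hcc hi := by
    obtain ⟨j, h2, h3⟩ := hI.sound c hc
    obtain ⟨j', h2', h3'⟩ := hI.sound c' (hcc ▸ hc)
    obtain rfl : j = j' := by omega
    rw [← h2.2.2.1, ← h2'.2.2.1, hcc]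
  child c hc h1 := by
    obtain ⟨j, h2, h3⟩ := hI.sound c hc
    obtain ⟨j, rfl⟩ : ∃ j', j = j' + 1 := ⟨j - 1, by omega⟩
    obtain ⟨d, hd, hdc, hlt, hne⟩ := h2.child h
    obtain ⟨e1, e2⟩ := hI.complete _ d j hd hd.pos
    exact ⟨d, e1, hdc, by omega, by rw [e1]; exact hne⟩

namespace Marked

variable {n : ℕ} {P U cyc idx len : ℕ → ℕ}

theorem pos (h : Marked n P U cyc idx len) {c : ℕ} (hc : cyc c ≠ 0) : 0 < c := by
  have := h.cover c hc
  omega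

theorem lt (h : Marked n P U cyc idx len) {c : ℕ} (hc : cyc c ≠ 0) : c < n := by
  have := h.cover c hc
  omega

theorem parent_lt (h : Marked n P U cyc idx len) {c : ℕ} (hc : cyc c ≠ 0) : P c < c :=
  h.tree.parent_lt c (h.pos hc) (h.lt hc)

theorem exists_top (h : Marked n P U cyc idx len) {c : ℕ} (hc : cyc c ≠ 0) :
    ∃ w, cyc w = cyc c ∧ P w + 1 = U (cyc c) := by
  induction c using Nat.strong_induction_on with
  | _ c ih =>
    by_cases hp : P c + 1 = U (cyc c)
    · exact ⟨c, rfl, hp⟩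
    · obtain ⟨h1, h2⟩ := h.step c hc hp
      obtain ⟨w, hw, hw'⟩ := ih (P c) (h.parent_lt hc) (h1 ▸ hc)
      exact ⟨w, hw.trans h1, h1 ▸ hw'⟩

theorem idx_lt_len (h : Marked n P U cyc idx len) {c : ℕ} (hc : cyc c ≠ 0) :
    idx c + 1 ≤ len (cyc c) := by
  induction c using Nat.strong_induction_on with
  | _ c ih =>
    by_cases hp : P c + 1 = U (cyc c)
    · exact (h.top c hc hp).ge
    · obtain ⟨h1, h2⟩ := h.step c hc hp
      have := ih (P c) (h.parent_lt hc) (h1 ▸ hc)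
      rw [h1, h2] at this
      omega

/-- The back edge does not end at the parent of its lower end, so that parent is a further vertex of
the cycle, at position `2`, below the root. -/
theorem three_le_len (h : Marked n P U cyc idx len) {c : ℕ} (hc : cyc c ≠ 0) :
    3 ≤ len (cyc c) := by
  obtain ⟨hx, hU, -, -, -⟩ := h.cover c hc
  obtain ⟨h1, h2⟩ := h.bottom _ hx hU
  have hne := h.tree.up_ne _ hx hU
  have h0 : cyc (cyc c) ≠ 0 := h1.symm ▸ hc
  obtain ⟨h3, h4⟩ := h.step (cyc c) h0 (by rw [h1]; omega)
  have := h.idx_lt_len (c := P (cyc c)) (by rw [h3]; exact h0)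
  rw [h3, h1] at this
  omega

theorem top_of_idx (h : Marked n P U cyc idx len) {c : ℕ} (hc : cyc c ≠ 0)
    (hi : idx c + 1 = len (cyc c)) : P c + 1 = U (cyc c) := by
  by_contra hp
  obtain ⟨h1, h2⟩ := h.step c hc hp
  have := h.idx_lt_len (c := P c) (h1 ▸ hc)
  rw [h1] at this
  omega

end Marked

end Cactus

/-! ### Allocation of the slots from the bottom to the top. -/

namespace Cactus

/-- The block below whose root the tree edge above `c` lies: a bridge is denoted by its lower end
and a cycle by the lower end of its back edge. -/
def bid (cyc : ℕ → ℕ) (c : ℕ) : ℕ := if cyc c = 0 then c else cyc c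

/-- The tree edge above `w` is incident to the root of its block, and not a back edge. -/
def IsTop (n : ℕ) (P U cyc : ℕ → ℕ) (w : ℕ) : Prop :=
  0 < w ∧ w < n ∧ (cyc w = 0 ∨ P w + 1 = U (cyc w))

/-- The first slot behind `c` on its cycle. -/
def nextSlot (cyc idx len size rel : ℕ → ℕ) (c : ℕ) : ℕ :=
  rel c + size c + if idx c = len (cyc c) / 2 then 1 else 0

theorem bid_of_bridge {cyc : ℕ → ℕ} {c : ℕ} (h : cyc c = 0) : bid cyc c = c := if_pos h

theorem bid_of_cycle {cyc : ℕ → ℕ} {c : ℕ} (h : cyc c ≠ 0) : bid cyc c = cyc c := if_neg h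

namespace Marked

variable {n : ℕ} {P U cyc idx len : ℕ → ℕ}

/-- The lower end of a back edge carries its own index as a mark, while the lower end of a bridge
carries `0`. Hence the names of bridges and cycles do not collide. -/
theorem bid_eq_bid (h : Marked n P U cyc idx len) {c c' : ℕ} (hb : bid cyc c = bid cyc c')
    (hc : cyc c = 0) : c = c' := by
  rw [bid_of_bridge hc] at hb
  by_cases hc' : cyc c' = 0
  · rwa [bid_of_bridge hc'] at hb
  · rw [bid_of_cycle hc'] at hb
    obtain ⟨hx, hU, -, -, -⟩ := h.cover c' hc'
    have := (h.bottom _ hx hU).1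
    rw [← hb, hc] at this
    exact absurd (hb.symm.trans this.symm) hc'

theorem cyc_eq_of_bid_eq (h : Marked n P U cyc idx len) {c c' : ℕ} (hb : bid cyc c = bid cyc c')
    : cyc c = cyc c' := by
  by_cases hc : cyc c = 0
  · rw [h.bid_eq_bid hb hc]
  · by_cases hc' : cyc c' = 0
    · rw [h.bid_eq_bid hb.symm hc']
    · rwa [bid_of_cycle hc, bid_of_cycle hc'] at hb

/-- Each block has exactly one representative among the tops: a bridge itself, or the vertex of the
cycle in the last position. The containment and disjointness of the blocks at a vertex can therefore
be stated for tops. -/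
theorem top_unique (h : Marked n P U cyc idx len) {w w' : ℕ} (hw : IsTop n P U cyc w)
    (hw' : IsTop n P U cyc w') (hb : bid cyc w = bid cyc w') : w = w' := by
  have hc := h.cyc_eq_of_bid_eq hb
  by_cases h0 : cyc w = 0
  · exact h.bid_eq_bid hb h0
  · have h1 := hw.2.2.resolve_left h0
    have h2 := hw'.2.2.resolve_left (hc ▸ h0)
    have h3 := h.top w h0 h1
    have h4 := h.top w' (hc ▸ h0) h2
    rw [hc] at h3
    exact h.inj w w' h0 hc (by omega)

end Marked

/-- The state of the allocation of the slots after the vertices above `i` have been treated. -/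
structure SizeInv (n : ℕ) (P U cyc idx len : ℕ → ℕ) (i : ℕ) (size rel base boff : ℕ → ℕ) (T : ℕ)
    (tot : ℕ → ℕ) (L : Finset ℕ) : Prop where
  bridge : ∀ c, i < c → c < n → cyc c = 0 → 1 ≤ size c ∧ tot c = size c
  step : ∀ c, i < c → cyc c ≠ 0 → P c + 1 ≠ U (cyc c) →
    rel (P c) = nextSlot cyc idx len size rel c
  top : ∀ c, i < c → cyc c ≠ 0 → P c + 1 = U (cyc c) →
    tot (cyc c) = nextSlot cyc idx len size rel c
  bottom : ∀ c, i < c → c < n → U c ≠ 0 → rel c = 1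
  rel_pos : ∀ c, i < c → cyc c ≠ 0 → 1 ≤ rel c
  mid : ∀ c, i < c → cyc c ≠ 0 → idx c = len (cyc c) / 2 → boff (cyc c) = rel c + size c
  fit : ∀ w, IsTop n P U cyc w → i < w → base (bid cyc w) + tot (bid cyc w) ≤ size (P w)
  disj : ∀ w w', IsTop n P U cyc w → IsTop n P U cyc w' → i < w → i < w' → w ≠ w' → P w = P w' →
    base (bid cyc w) + tot (bid cyc w) ≤ base (bid cyc w') ∨
      base (bid cyc w') + tot (bid cyc w') ≤ base (bid cyc w)
  sum_le : ∑ c ∈ Finset.range (i + 1), (size c + rel c) ≤ T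
  count : T = L.card + ((Finset.range n).filter fun c => i < c ∧ U c ≠ 0).card +
    ((Finset.range n).filter fun c => i < c ∧ cyc c ≠ 0 ∧ idx c = len (cyc c) / 2).card
  leaf : ∀ c ∈ L, i < c ∧ c < n ∧ cyc c = 0 ∧ ∀ w, IsTop n P U cyc w → P w ≠ c

namespace SizeInv

variable {n i T : ℕ} {P U cyc idx len size rel base boff tot : ℕ → ℕ} {L : Finset ℕ}

theorem initial (h : Marked n P U cyc idx len) (base boff tot : ℕ → ℕ) :
    SizeInv n P U cyc idx len (n - 1) (fun _ => 0) (fun _ => 0) base boff 0 tot ∅ where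
  bridge c h1 h2 := by omega
  step c h1 h2 := by have := h.lt h2; omega
  top c h1 h2 := by have := h.lt h2; omega
  bottom c h1 h2 := by omega
  rel_pos c h1 h2 := by have := h.lt h2; omega
  mid c h1 h2 := by have := h.lt h2; omega
  fit w h1 h2 := by have := h1.2.1; omega
  disj w w' h1 h2 h3 := by have := h1.2.1; omega
  sum_le := by simp
  count := by
    have h1 : ((Finset.range n).filter fun c => n - 1 < c ∧ U c ≠ 0) = ∅ := by
      rw [Finset.filter_eq_empty_iff]
      intro c hc
      rw [Finset.mem_range] at hc
      omega
    have h2 : ((Finset.range n).filter fun c => n - 1 < c ∧ cyc c ≠ 0 ∧ idx c = len (cyc c) / 2) =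
        ∅ := by
      rw [Finset.filter_eq_empty_iff]
      intro c hc
      rw [Finset.mem_range] at hc
      omega
    rw [h1, h2]
    rfl
  leaf c hc := absurd hc (Finset.notMem_empty c)

theorem card_filter_pred (hi0 : 0 < i) (hi : i < n) (Q : ℕ → Prop) [DecidablePred Q] :
    ((Finset.range n).filter fun c => i - 1 < c ∧ Q c).card =
      ((Finset.range n).filter fun c => i < c ∧ Q c).card + if Q i then 1 else 0 := by
  split_ifs with hQ
  · have : ((Finset.range n).filter fun c => i - 1 < c ∧ Q c) =
        insert i ((Finset.range n).filter fun c => i < c ∧ Q c) := by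
      ext c
      simp only [Finset.mem_filter, Finset.mem_range, Finset.mem_insert]
      constructor
      · rintro ⟨h1, h2, h3⟩
        by_cases hc : c = i
        · exact Or.inl hc
        · exact Or.inr ⟨h1, by omega, h3⟩
      · rintro (rfl | ⟨h1, h2, h3⟩)
        · exact ⟨hi, by omega, hQ⟩
        · exact ⟨h1, by omega, h3⟩
    rw [this, Finset.card_insert_of_notMem]
    intro hmem
    exact lt_irrefl i (Finset.mem_filter.1 hmem).2.1
  · rw [Nat.add_zero]
    refine congrArg Finset.card (Finset.filter_congr ?_)
    intro c _
    constructor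
    · rintro ⟨h2, h3⟩
      refine ⟨?_, h3⟩
      rcases Nat.lt_or_ge i c with h4 | h4
      · exact h4
      · obtain rfl : c = i := by omega
        exact absurd h3 hQ
    · rintro ⟨h2, h3⟩
      exact ⟨by omega, h3⟩

theorem sum_update_add {f g : ℕ → ℕ} {i p δ : ℕ} (hp : p < i) :
    ∑ c ∈ Finset.range i, (Function.update f p (f p + δ) c + g c) =
      ∑ c ∈ Finset.range i, (f c + g c) + δ := by
  rw [Finset.sum_add_distrib, Finset.sum_add_distrib,
    Finset.sum_update_of_mem (Finset.mem_range.2 hp),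
    ← Finset.sum_sdiff (Finset.singleton_subset_iff.2 (Finset.mem_range.2 hp)) (f := f),
    Finset.sum_singleton]
  ring

/-- A bridge takes over the slots of its lower end, whose first slot will be the direction of the
bridge. Only a lower end that received no slots gets a new one, and it is recorded in `L` as a leaf.
The sum in `sum_le` runs over the vertices not yet treated: a step moves slots from `i` to its
parent and increases the sum by no more than the counter `T`. -/
theorem step_bridge (h : Marked n P U cyc idx len)
    (hI : SizeInv n P U cyc idx len i size rel base boff T tot L) (hi0 : 0 < i) (hi : i < n)
    (hc : cyc i = 0) {s T' : ℕ} (hs : s = if size i = 0 then 1 else size i)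
    (hT : T' = T + if size i = 0 then 1 else 0) :
    SizeInv n P U cyc idx len (i - 1)
      (Function.update (Function.update size i s) (P i) (size (P i) + s)) rel
      (Function.update base i (size (P i))) boff T' (Function.update tot i s)
      (if size i = 0 then insert i L else L) := by
  have hlt := h.tree.parent_lt i hi0 hi
  have hs1 : 1 ≤ s := by split_ifs at hs <;> omega
  have hU : U i = 0 := by
    by_contra hU
    have := (h.bottom i hi hU).1
    omega
  have hcase : ∀ c, i - 1 < c → c = i ∨ i < c := by intro c; omega
  have hsz : ∀ c, i < c → Function.update (Function.update size i s) (P i) (size (P i) + s) c =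
      size c := by
    intro c hic
    rw [Function.update_of_ne (by omega), Function.update_of_ne (by omega)]
  have hnx : ∀ c, i < c → nextSlot cyc idx len
      (Function.update (Function.update size i s) (P i) (size (P i) + s)) rel c =
        nextSlot cyc idx len size rel c := by
    intro c hic
    rw [nextSlot, nextSlot, hsz c hic]
  have htop : IsTop n P U cyc i := ⟨hi0, hi, Or.inl hc⟩
  have hbid : bid cyc i = i := bid_of_bridge hc
  have hbidne : ∀ w, IsTop n P U cyc w → w ≠ i → bid cyc w ≠ i := by
    intro w hw hne he
    exact hne (h.top_unique hw htop (he.trans hbid.symm))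
  have hx : ∀ c, cyc c ≠ 0 → cyc c ≠ i := by
    intro c hcc he
    obtain ⟨h1, h2, -⟩ := h.cover c hcc
    rw [he] at h2
    exact h2 hU
  refine ⟨?_, ?_, ?_, ?_, ?_, ?_, ?_, ?_, ?_, ?_, ?_⟩
  · intro c hic hcn hcc
    rcases hcase c hic with rfl | hic
    · rw [Function.update_of_ne hlt.ne', Function.update_self, Function.update_self]
      exact ⟨hs1, rfl⟩
    · rw [hsz c hic, Function.update_of_ne hic.ne']
      exact hI.bridge c hic hcn hcc
  · intro c hic hcc hp
    rcases hcase c hic with rfl | hic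
    · exact absurd hc hcc
    · rw [hnx c hic]
      exact hI.step c hic hcc hp
  · intro c hic hcc hp
    rcases hcase c hic with rfl | hic
    · exact absurd hc hcc
    · rw [hnx c hic, Function.update_of_ne (hx c hcc)]
      exact hI.top c hic hcc hp
  · intro c hic hcn hcc
    rcases hcase c hic with rfl | hic
    · exact absurd hU hcc
    · exact hI.bottom c hic hcn hcc
  · intro c hic hcc
    rcases hcase c hic with rfl | hic
    · exact absurd hc hcc
    · exact hI.rel_pos c hic hcc
  · intro c hic hcc hm
    rcases hcase c hic with rfl | hic
    · exact absurd hc hcc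
    · rw [hsz c hic]
      exact hI.mid c hic hcc hm
  · intro w hw hiw
    rcases hcase w hiw with rfl | hiw
    · rw [hbid, Function.update_self, Function.update_self, Function.update_self]
    · rw [Function.update_of_ne (hbidne w hw hiw.ne'), Function.update_of_ne (hbidne w hw hiw.ne')]
      have h1 := hI.fit w hw hiw
      by_cases hp : P w = P i
      · rw [hp, Function.update_self]
        rw [hp] at h1
        omega
      · rw [Function.update_of_ne hp]
        by_cases hp' : P w = i
        · rw [hp', Function.update_self, hs]
          rw [hp'] at h1
          split_ifs <;> omega
        · rw [Function.update_of_ne hp']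
          exact h1
  -- A new block at a vertex starts where the slots used so far end, so it comes after all earlier
  -- blocks at the same vertex.
  · have aux : ∀ w, IsTop n P U cyc w → i < w → P i = P w →
        Function.update base i (size (P i)) (bid cyc w) +
          Function.update tot i s (bid cyc w) ≤ Function.update base i (size (P i)) i := by
      intro w hw hiw hp
      rw [Function.update_of_ne (hbidne w hw hiw.ne'),
        Function.update_of_ne (hbidne w hw hiw.ne'), Function.update_self, hp]
      exact hI.fit w hw hiw
    intro w w' hw hw' hiw hiw' hne hp
    rcases hcase w hiw with rfl | hiw
    · rcases hcase w' hiw' with rfl | hiw'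
      · exact absurd rfl hne
      · right
        rw [hbid]
        exact aux w' hw' hiw' hp
    · rcases hcase w' hiw' with rfl | hiw'
      · left
        rw [hbid]
        exact aux w hw hiw hp.symm
      · have e1 := hbidne w hw hiw.ne'
        have e2 := hbidne w' hw' hiw'.ne'
        simp only [Function.update_of_ne e1, Function.update_of_ne e2]
        exact hI.disj w w' hw hw' hiw hiw' hne hp
  · have h1 := hI.sum_le
    rw [Finset.sum_range_succ] at h1
    rw [Nat.sub_add_cancel hi0]
    have h2 : ∑ c ∈ Finset.range i,
        (Function.update (Function.update size i s) (P i) (size (P i) + s) c + rel c) =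
        ∑ c ∈ Finset.range i, (size c + rel c) + s := by
      rw [← sum_update_add hlt]
      refine Finset.sum_congr rfl fun c hc => ?_
      rw [Finset.mem_range] at hc
      by_cases hcp : c = P i
      · rw [hcp, Function.update_self, Function.update_self]
      · rw [Function.update_of_ne hcp, Function.update_of_ne hc.ne, Function.update_of_ne hcp]
    rw [h2, hT, hs]
    split_ifs at hs ⊢ <;> omega
  · rw [card_filter_pred hi0 hi, card_filter_pred hi0 hi, if_neg (not_not.2 hU),
      if_neg (show ¬ (cyc i ≠ 0 ∧ idx i = len (cyc i) / 2) from fun hh => hh.1 hc), hT, hI.count]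
    split_ifs
    · rw [Finset.card_insert_of_notMem]
      · ring
      · intro hmem
        exact absurd (hI.leaf i hmem).1 (lt_irrefl i)
    · ring
  · intro c hcL
    have old : c ∈ L → i - 1 < c ∧ c < n ∧ cyc c = 0 ∧ ∀ w, IsTop n P U cyc w → P w ≠ c := by
      intro hcL
      obtain ⟨h1, h2⟩ := hI.leaf c hcL
      exact ⟨by omega, h2⟩
    split_ifs at hcL with h0
    · rcases Finset.mem_insert.1 hcL with rfl | hcL
      -- Any block hanging at this vertex contains at least one slot and would have made its size
      -- positive.
      · refine ⟨by omega, hi, hc, ?_⟩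
        intro w hw hp
        have hiw : c < w := by
          have := h.tree.parent_lt w hw.1 hw.2.1
          omega
        have h1 := hI.fit w hw hiw
        rw [hp, h0] at h1
        by_cases hcw : cyc w = 0
        · have := hI.bridge w hiw hw.2.1 hcw
          rw [bid_of_bridge hcw] at h1
          omega
        · have h2 := hI.top w hiw hcw (hw.2.2.resolve_left hcw)
          have h3 := hI.rel_pos w hiw hcw
          rw [bid_of_cycle hcw, h2, nextSlot] at h1
          omega
      · exact old hcL
    · exact old hcL

/-- The common part of the two cases of a vertex on a cycle. -/
theorem rel_self_pos (h : Marked n P U cyc idx len)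
    (hI : SizeInv n P U cyc idx len i size rel base boff T tot L)
    (hc : cyc i ≠ 0) {r : ℕ} (hr : r = if U i ≠ 0 then 1 else rel i) : 1 ≤ r := by
  rw [hr]
  split_ifs with hU
  · exact le_rfl
  · have h2 : 2 ≤ idx i := by
      have h1 := (h.cover i hc).2.2.2.2
      by_contra hlt
      have h3 := h.eq_bottom i hc (by omega)
      have h4 := (h.cover i hc).2.1
      rw [h3] at h4
      exact hU h4
    obtain ⟨d, hd, hdi, -, hne⟩ := h.child i hc h2
    have hdc : cyc d ≠ 0 := hd ▸ hc
    have hid : i < d := hdi ▸ h.parent_lt hdc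
    have h3 := hI.step d hid hdc hne
    have h4 := hI.rel_pos d hid hdc
    rw [hdi, nextSlot] at h3
    omega

/-- The vertex passes on the first free slot behind it: to the offset `rel` of its parent if that is
still on the cycle, and to the size of the root otherwise. Offset `0` of the block is reserved for
the left side, charged at the lower end of the back edge, where `rel` starts with `1`. The right
side takes the slot after the vertex in position `len / 2`, and is charged there. Stating only the
values of the new arrays lets both cases share the proof. -/
theorem step_cycle (h : Marked n P U cyc idx len)
    (hI : SizeInv n P U cyc idx len i size rel base boff T tot L)
    (hc : cyc i ≠ 0) {r T' nx : ℕ} {size' rel' base' boff' tot' : ℕ → ℕ}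
    (hr : r = if U i ≠ 0 then 1 else rel i)
    (hnx : nx = r + size i + if idx i = len (cyc i) / 2 then 1 else 0)
    (hT : T' = T + (if U i ≠ 0 then 1 else 0) + if idx i = len (cyc i) / 2 then 1 else 0)
    (hb : boff' = if idx i = len (cyc i) / 2 then Function.update boff (cyc i) (r + size i)
      else boff)
    (hsize : ∀ c, c ≠ P i → size' c = size c) (hrel : ∀ c, c ≠ i → c ≠ P i → rel' c = rel c)
    (hreli : rel' i = r) (hbase : ∀ y, y ≠ cyc i → base' y = base y ∧ tot' y = tot y)
    (htop : P i + 1 = U (cyc i) → size' (P i) = size (P i) + nx ∧ rel' (P i) = rel (P i) ∧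
      base' (cyc i) = size (P i) ∧ tot' (cyc i) = nx)
    (hpush : P i + 1 ≠ U (cyc i) → size' (P i) = size (P i) ∧ rel' (P i) = nx ∧
      base' (cyc i) = base (cyc i) ∧ tot' (cyc i) = tot (cyc i)) :
    SizeInv n P U cyc idx len (i - 1) size' rel' base' boff' T' tot' L := by
  have hi0 := h.pos hc
  have hi := h.lt hc
  have hlt := h.parent_lt hc
  have hcase : ∀ c, i - 1 < c → c = i ∨ i < c := by intro c; omega
  have hrpos := hI.rel_self_pos h hc hr
  have hn : ∀ c, i < c → nextSlot cyc idx len size' rel' c = nextSlot cyc idx len size rel c := by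
    intro c hic
    rw [nextSlot, nextSlot, hsize c (by omega), hrel c (by omega) (by omega)]
  have hni : nextSlot cyc idx len size' rel' i = nx := by
    rw [nextSlot, hsize i hlt.ne', hreli, hnx]
  have hszle : ∀ c, size c ≤ size' c := by
    intro c
    by_cases hcp : c = P i
    · rw [hcp]
      by_cases hp : P i + 1 = U (cyc i)
      · rw [(htop hp).1]
        omega
      · rw [(hpush hp).1]
    · rw [hsize c hcp]
  have hbid : bid cyc i = cyc i := bid_of_cycle hc
  have hblock : ∀ w, IsTop n P U cyc w → w ≠ i → base' (bid cyc w) = base (bid cyc w) ∧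
      tot' (bid cyc w) = tot (bid cyc w) := by
    intro w hw hne
    by_cases he : bid cyc w = cyc i
    · by_cases hp : P i + 1 = U (cyc i)
      · exact absurd (h.top_unique hw ⟨hi0, hi, Or.inr hp⟩ (he.trans hbid.symm)) hne
      · rw [he]
        exact (hpush hp).2.2
    · exact hbase _ he
  refine ⟨?_, ?_, ?_, ?_, ?_, ?_, ?_, ?_, ?_, ?_, ?_⟩
  · intro c hic hcn hcc
    rcases hcase c hic with rfl | hic
    · exact absurd hcc hc
    · have h1 := (hblock c ⟨by omega, hcn, Or.inl hcc⟩ hic.ne').2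
      rw [bid_of_bridge hcc] at h1
      rw [hsize c (by omega), h1]
      exact hI.bridge c hic hcn hcc
  · intro c hic hcc hp
    rcases hcase c hic with rfl | hic
    · rw [hni]
      exact (hpush hp).2.1
    · rw [hn c hic, ← hI.step c hic hcc hp]
      obtain ⟨h1, h2⟩ := h.step c hcc hp
      by_cases hpi : P c = i
      -- The offset received from below must not be reset to `1`. A reset would require that `i` is
      -- the lower end of a back edge, in position `1`, whereas a vertex that receives an offset has
      -- position at least `2`.
      · rw [hpi, hreli, hr, if_neg]
        intro hU
        have h3 := (h.bottom i hi hU).2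
        have h4 := (h.cover c hcc).2.2.2.2
        rw [hpi] at h2
        omega
      · by_cases hpp : P c = P i
        · by_cases hpt : P i + 1 = U (cyc i)
          · rw [hpp]
            exact (htop hpt).2.1
          · obtain ⟨h3, h4⟩ := h.step i hc hpt
            rw [hpp] at h1 h2
            have := h.inj c i hcc (by rw [← h1, h3]) (by omega)
            omega
        · exact hrel _ hpi hpp
  · intro c hic hcc hp
    rcases hcase c hic with rfl | hic
    · rw [hni]
      exact (htop hp).2.2.2
    · rw [hn c hic, ← hI.top c hic hcc hp]
      have := (hblock c ⟨by omega, h.lt hcc, Or.inr hp⟩ hic.ne').2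
      rwa [bid_of_cycle hcc] at this
  · intro c hic hcn hcc
    rcases hcase c hic with rfl | hic
    · rw [hreli, hr, if_pos hcc]
    · rw [hrel c (by omega) (by omega)]
      exact hI.bottom c hic hcn hcc
  · intro c hic hcc
    rcases hcase c hic with rfl | hic
    · rw [hreli]
      exact hrpos
    · rw [hrel c (by omega) (by omega)]
      exact hI.rel_pos c hic hcc
  · intro c hic hcc hm
    rcases hcase c hic with rfl | hic
    · rw [hb, if_pos hm, Function.update_self, hreli, hsize c hlt.ne']
    · rw [hrel c (by omega) (by omega), hsize c (by omega), ← hI.mid c hic hcc hm, hb]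
      split_ifs with hm'
      · rw [Function.update_of_ne]
        intro he
        rw [he] at hm
        have := h.inj c i hcc he (by omega)
        omega
      · rfl
  · intro w hw hiw
    rcases hcase w hiw with rfl | hiw
    · obtain ⟨h1, -, h3, h4⟩ := htop (hw.2.2.resolve_left hc)
      rw [hbid, h1, h3, h4]
    · obtain ⟨h1, h2⟩ := hblock w hw hiw.ne'
      rw [h1, h2]
      exact (hI.fit w hw hiw).trans (hszle _)
  · have aux : ∀ w, IsTop n P U cyc w → i < w → IsTop n P U cyc i → P i = P w →
        base' (bid cyc w) + tot' (bid cyc w) ≤ base' (bid cyc i) := by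
      intro w hw hiw hti hp
      obtain ⟨h1, h2⟩ := hblock w hw hiw.ne'
      obtain ⟨-, -, h3, -⟩ := htop (hti.2.2.resolve_left hc)
      rw [h1, h2, hbid, h3, hp]
      exact hI.fit w hw hiw
    intro w w' hw hw' hiw hiw' hne hp
    rcases hcase w hiw with rfl | hiw
    · rcases hcase w' hiw' with rfl | hiw'
      · exact absurd rfl hne
      · exact Or.inr (aux w' hw' hiw' hw hp)
    · rcases hcase w' hiw' with rfl | hiw'
      · exact Or.inl (aux w hw hiw hw' hp.symm)
      · obtain ⟨e1, e2⟩ := hblock w hw hiw.ne'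
        obtain ⟨e3, e4⟩ := hblock w' hw' hiw'.ne'
        rw [e1, e2, e3, e4]
        exact hI.disj w w' hw hw' hiw hiw' hne hp
  · have h1 := hI.sum_le
    rw [Finset.sum_range_succ] at h1
    rw [Nat.sub_add_cancel hi0]
    have h2 : ∑ c ∈ Finset.range i, (size' c + rel' c) ≤
        ∑ c ∈ Finset.range i, (size c + rel c) + nx := by
      rw [← sum_update_add hlt]
      refine Finset.sum_le_sum fun c hc => ?_
      rw [Finset.mem_range] at hc
      by_cases hcp : c = P i
      · rw [hcp, Function.update_self]
        by_cases hp : P i + 1 = U (cyc i)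
        · obtain ⟨e1, e2, -, -⟩ := htop hp
          omega
        · obtain ⟨e1, e2, -, -⟩ := hpush hp
          omega
      · rw [Function.update_of_ne hcp, hsize c hcp, hrel c hc.ne hcp]
    have h3 : r ≤ rel i + if U i ≠ 0 then 1 else 0 := by
      rw [hr]
      split_ifs <;> omega
    omega
  · rw [card_filter_pred hi0 hi, card_filter_pred hi0 hi, hT, hI.count]
    have h1 : (if cyc i ≠ 0 ∧ idx i = len (cyc i) / 2 then 1 else 0) =
        if idx i = len (cyc i) / 2 then 1 else 0 := by simp [hc]
    rw [h1]
    ring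
  · intro c hcL
    obtain ⟨h1, h2⟩ := hI.leaf c hcL
    exact ⟨by omega, h2⟩

theorem step_top (h : Marked n P U cyc idx len)
    (hI : SizeInv n P U cyc idx len i size rel base boff T tot L)
    (hc : cyc i ≠ 0) (hp : P i + 1 = U (cyc i)) {r T' nx : ℕ} {boff' : ℕ → ℕ}
    (hr : r = if U i ≠ 0 then 1 else rel i)
    (hnx : nx = r + size i + if idx i = len (cyc i) / 2 then 1 else 0)
    (hT : T' = T + (if U i ≠ 0 then 1 else 0) + if idx i = len (cyc i) / 2 then 1 else 0)
    (hb : boff' = if idx i = len (cyc i) / 2 then Function.update boff (cyc i) (r + size i)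
      else boff) :
    SizeInv n P U cyc idx len (i - 1)
      (Function.update size (P i) (size (P i) + nx)) (Function.update rel i r)
      (Function.update base (cyc i) (size (P i))) boff' T' (Function.update tot (cyc i) nx) L := by
  have hlt := h.parent_lt hc
  refine hI.step_cycle h hc hr hnx hT hb ?_ ?_ ?_ ?_ ?_ ?_
  · intro c hcp
    rw [Function.update_of_ne hcp]
  · intro c hci _
    rw [Function.update_of_ne hci]
  · rw [Function.update_self]
  · intro y hy
    rw [Function.update_of_ne hy, Function.update_of_ne hy]
    exact ⟨rfl, rfl⟩
  · intro _
    rw [Function.update_self, Function.update_of_ne hlt.ne, Function.update_self,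
      Function.update_self]
    exact ⟨rfl, rfl, rfl, rfl⟩
  · intro hne
    exact absurd hp hne

theorem step_push (h : Marked n P U cyc idx len)
    (hI : SizeInv n P U cyc idx len i size rel base boff T tot L)
    (hc : cyc i ≠ 0) (hp : P i + 1 ≠ U (cyc i)) {r T' nx : ℕ} {boff' : ℕ → ℕ}
    (hr : r = if U i ≠ 0 then 1 else rel i)
    (hnx : nx = r + size i + if idx i = len (cyc i) / 2 then 1 else 0)
    (hT : T' = T + (if U i ≠ 0 then 1 else 0) + if idx i = len (cyc i) / 2 then 1 else 0)
    (hb : boff' = if idx i = len (cyc i) / 2 then Function.update boff (cyc i) (r + size i)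
      else boff) :
    SizeInv n P U cyc idx len (i - 1) size
      (Function.update (Function.update rel i r) (P i) nx) base boff' T' tot L := by
  have hlt := h.parent_lt hc
  refine hI.step_cycle h hc hr hnx hT hb ?_ ?_ ?_ ?_ ?_ ?_
  · intro c _
    rfl
  · intro c hci hcp
    rw [Function.update_of_ne hcp, Function.update_of_ne hci]
  · rw [Function.update_of_ne hlt.ne', Function.update_self]
  · intro y _
    exact ⟨rfl, rfl⟩
  · intro he
    exact absurd he hp
  · intro _
    rw [Function.update_self]
    exact ⟨rfl, rfl, rfl, rfl⟩

end SizeInv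

end Cactus

/-! ### The final slots and the bound `t + 2o` for their number. -/

namespace Cactus

/-- The final distribution of the slots. -/
structure Slotted (n : ℕ) (P U cyc idx len size rel base boff tot : ℕ → ℕ) : Prop where
  bridge : ∀ c, 0 < c → c < n → cyc c = 0 → 1 ≤ size c ∧ tot c = size c
  rel_pos : ∀ c, cyc c ≠ 0 → 1 ≤ rel c
  order : ∀ c c', cyc c ≠ 0 → cyc c = cyc c' → idx c < idx c' → rel c + size c ≤ rel c'
  left : ∀ c, cyc c ≠ 0 → idx c ≤ len (cyc c) / 2 → rel c + size c ≤ boff (cyc c)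
  right : ∀ c, cyc c ≠ 0 → len (cyc c) / 2 < idx c → boff (cyc c) + 1 ≤ rel c
  le_tot : ∀ c, cyc c ≠ 0 → rel c + size c ≤ tot (cyc c)
  boff_lt : ∀ c, cyc c ≠ 0 → boff (cyc c) + 1 ≤ tot (cyc c)
  boff_pos : ∀ c, cyc c ≠ 0 → 1 ≤ boff (cyc c)
  fit : ∀ w, IsTop n P U cyc w → base (bid cyc w) + tot (bid cyc w) ≤ size (P w)
  disj : ∀ w w', IsTop n P U cyc w → IsTop n P U cyc w' → w ≠ w' → P w = P w' →
    base (bid cyc w) + tot (bid cyc w) ≤ base (bid cyc w') ∨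
      base (bid cyc w') + tot (bid cyc w') ≤ base (bid cyc w)

variable {n T : ℕ} {P U cyc idx len size rel base boff tot : ℕ → ℕ} {L : Finset ℕ}

theorem Marked.exists_idx (h : Marked n P U cyc idx len) {c : ℕ} (hc : cyc c ≠ 0) {j : ℕ}
    (hj : 1 ≤ j) (hjl : j < len (cyc c)) : ∃ m, cyc m = cyc c ∧ idx m = j := by
  obtain ⟨t, ht, hti⟩ := h.exists_top hc
  have htl := h.top t (ht ▸ hc) (by rw [ht]; exact hti)
  rw [ht] at htl
  suffices ∀ d j, 1 ≤ j → j + d + 1 = len (cyc c) → ∃ m, cyc m = cyc c ∧ idx m = j from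
    this (len (cyc c) - j - 1) j hj (by omega)
  intro d
  induction d with
  | zero =>
    intro j h1 h2
    exact ⟨t, ht, by omega⟩
  | succ d ih =>
    intro j h1 h2
    obtain ⟨m, hm, hmi⟩ := ih (j + 1) (by omega) (by omega)
    obtain ⟨e, he, -, hei, -⟩ := h.child m (hm ▸ hc) (by omega)
    exact ⟨e, he.trans hm, by omega⟩

theorem SizeInv.nextSlot_le (h : Marked n P U cyc idx len)
    (hI : SizeInv n P U cyc idx len 0 size rel base boff T tot L) {c : ℕ} (hc : cyc c ≠ 0) (d : ℕ) :
    ∀ c', cyc c' = cyc c → idx c' = idx c + d + 1 → nextSlot cyc idx len size rel c ≤ rel c' := by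
  induction d with
  | zero =>
    intro c' hc' hi
    have := (h.cover c hc).2.2.2.2
    obtain ⟨e, he, hp, hei, hne⟩ := h.child c' (hc' ▸ hc) (by omega)
    obtain rfl := h.inj e c (by rw [he, hc']; exact hc) (he.trans hc') (by omega)
    have := hI.step e (h.pos hc) hc hne
    rw [hp] at this
    exact this.ge
  | succ d ih =>
    intro c' hc' hi
    obtain ⟨e, he, hp, hei, hne⟩ := h.child c' (hc' ▸ hc) (by omega)
    have hec : cyc e ≠ 0 := by rw [he, hc']; exact hc
    have h1 := ih e (he.trans hc') (by omega)
    have h2 := hI.step e (h.pos hec) hec hne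
    rw [hp, nextSlot] at h2
    omega

/-- The slots of a cycle appear in the order of the positions: left side, positions up to `len / 2`,
right side, remaining positions. All inequalities follow from the fact that the first free slot
behind a vertex is at most the offset of any later one. -/
theorem SizeInv.slotted (h : Marked n P U cyc idx len)
    (hI : SizeInv n P U cyc idx len 0 size rel base boff T tot L) :
    Slotted n P U cyc idx len size rel base boff tot := by
  have hord : ∀ c c', cyc c ≠ 0 → cyc c = cyc c' → idx c < idx c' →
      nextSlot cyc idx len size rel c ≤ rel c' := fun c c' hc he hlt =>
    hI.nextSlot_le h hc (idx c' - idx c - 1) c' he.symm (by omega)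
  have hle : ∀ c, rel c + size c ≤ nextSlot cyc idx len size rel c := fun c => Nat.le_add_right _ _
  have hmid : ∀ c, cyc c ≠ 0 → ∃ m, cyc m = cyc c ∧ idx m = len (cyc c) / 2 ∧
      boff (cyc c) = rel m + size m ∧ nextSlot cyc idx len size rel m = boff (cyc c) + 1 := by
    intro c hc
    have h3 := h.three_le_len hc
    obtain ⟨m, hm, hmi⟩ := h.exists_idx hc (j := len (cyc c) / 2) (by omega) (by omega)
    have hmc : cyc m ≠ 0 := hm ▸ hc
    have h1 := hI.mid m (h.pos hmc) hmc (by rw [hm, hmi])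
    rw [hm] at h1
    refine ⟨m, hm, hmi, h1, ?_⟩
    rw [nextSlot, hm, if_pos hmi, h1]
  have htot : ∀ c, cyc c ≠ 0 → nextSlot cyc idx len size rel c ≤ tot (cyc c) := by
    intro c hc
    obtain ⟨t, ht, hti⟩ := h.exists_top hc
    have htc : cyc t ≠ 0 := ht ▸ hc
    have h1 := hI.top t (h.pos htc) htc (by rw [ht]; exact hti)
    have h2 := h.top t htc (by rw [ht]; exact hti)
    have h3 := h.idx_lt_len hc
    rw [ht] at h1 h2
    rw [h1]
    by_cases he : idx c = idx t
    · rw [h.inj c t hc ht.symm he]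
    · have h4 := hord c t hc ht.symm (by omega)
      exact h4.trans (le_trans (Nat.le_add_right _ _) (hle t))
  refine ⟨fun c => hI.bridge c, fun c hc => hI.rel_pos c (h.pos hc) hc, fun c c' hc he hlt =>
    (hle c).trans (hord c c' hc he hlt), ?_, ?_, fun c hc => (hle c).trans (htot c hc), ?_, ?_,
    fun w hw => hI.fit w hw hw.1, fun w w' hw hw' => hI.disj w w' hw hw' hw.1 hw'.1⟩
  · intro c hc hci
    obtain ⟨m, hm, hmi, hb, -⟩ := hmid c hc
    rcases hci.lt_or_eq with hlt | heq
    · have := (hle c).trans (hord c m hc hm.symm (by omega))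
      omega
    · rw [h.inj c m hc hm.symm (by omega), ← hb, ← h.inj c m hc hm.symm (by omega)]
  · intro c hc hci
    obtain ⟨m, hm, hmi, hb, hn⟩ := hmid c hc
    have := hord m c (hm ▸ hc) hm (by omega)
    omega
  · intro c hc
    obtain ⟨m, hm, hmi, hb, hn⟩ := hmid c hc
    have := htot m (hm ▸ hc)
    rw [hm] at this
    omega
  · intro c hc
    obtain ⟨m, hm, hmi, hb, hn⟩ := hmid c hc
    have := hI.rel_pos m (h.pos (hm ▸ hc)) (hm ▸ hc)
    omega

theorem SizeInv.size_zero_le (hI : SizeInv n P U cyc idx len 0 size rel base boff T tot L) :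
    size 0 ≤ T := by
  have := hI.sum_le
  rw [zero_add, Finset.sum_range_one] at this
  omega

/-- Every cycle has just one vertex in its middle position, so `cyc` is injective on these vertices.
-/
theorem SizeInv.card_mid_le (h : Marked n P U cyc idx len) :
    ((Finset.range n).filter fun c => 0 < c ∧ cyc c ≠ 0 ∧ idx c = len (cyc c) / 2).card ≤
      ((Finset.range n).filter fun c => U c ≠ 0).card := by
  refine Finset.card_le_card_of_injOn cyc ?_ ?_
  · intro c hc
    rw [Finset.mem_coe, Finset.mem_filter] at hc ⊢
    obtain ⟨h1, h2, -⟩ := h.cover c hc.2.2.1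
    exact ⟨Finset.mem_range.2 h1, h2⟩
  · intro c hc c' hc' he
    rw [Finset.mem_coe, Finset.mem_filter] at hc hc'
    exact h.inj c c' hc.2.2.1 he (by rw [hc.2.2.2, hc'.2.2.2, he])

theorem SizeInv.slots_le_card (h : Marked n P U cyc idx len)
    (hI : SizeInv n P U cyc idx len 0 size rel base boff T tot L) :
    T ≤ L.card + 2 * ((Finset.range n).filter fun c => U c ≠ 0).card := by
  have h1 := hI.count
  have h2 := SizeInv.card_mid_le h
  have h3 : ((Finset.range n).filter fun c => 0 < c ∧ U c ≠ 0).card ≤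
      ((Finset.range n).filter fun c => U c ≠ 0).card :=
    Finset.card_le_card fun c hc =>
      Finset.mem_filter.2 ⟨(Finset.mem_filter.1 hc).1, (Finset.mem_filter.1 hc).2.2⟩
  omega

/-- Each cycle is charged at most twice and each element of `L` once. An element of `L` is adjacent
only to its parent: a child on a cycle through it would have left a mark on it, any other child is a
top hanging at it, and a back edge ending at it from below produces such a top as well. -/
theorem SizeInv.slots_le_numSlopes {V : Type*} [Finite V] {G : SimpleGraph V} {lab : ℕ → V}
    (hG : IsCactus G) (hp : IsPalmTree G n lab P U) (h : Marked n P U cyc idx len)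
    (hI : SizeInv n P U cyc idx len 0 size rel base boff T tot L) :
    T ≤ numSlopes G (lab 0) := by
  have h1 := hI.slots_le_card h
  have h2 : L.card ≤ numLeaves G (lab 0) := by
    refine hp.card_leaves_le L ?_
    intro i hi
    obtain ⟨hi0, hin, hci, hw⟩ := hI.leaf i hi
    refine ⟨hi0, hin, ?_⟩
    have hUi : U i = 0 := by
      by_contra hU
      have := (h.bottom i hin hU).1
      omega
    intro j hj hadj
    rcases lt_trichotomy i j with hlt | rfl | hlt
    · exfalso
      rcases hp.eq_parent_or_eq_up hG hlt hj hadj with he | he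
      · by_cases hcj : cyc j = 0
        · exact hw j ⟨by omega, hj, Or.inl hcj⟩ he.symm
        · by_cases ht : P j + 1 = U (cyc j)
          · exact hw j ⟨by omega, hj, Or.inr ht⟩ he.symm
          · have := (h.step j hcj ht).1
            rw [← he, hci] at this
            exact hcj this.symm
      · have hb := (h.bottom j hj (by omega)).1
        obtain ⟨t, ht, hti⟩ := h.exists_top (c := j) (by omega)
        have htc : cyc t ≠ 0 := by omega
        refine hw t ⟨h.pos htc, h.lt htc, Or.inr (by rw [ht]; exact hti)⟩ ?_
        rw [hb, he] at hti
        omega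
    · exact absurd hadj (G.loopless.irrefl _)
    · rcases hp.eq_parent_or_eq_up hG hlt hin hadj.symm with he | he
      · exact he
      · omega
  rw [numSlopes, hp.numCycles_eq hG]
  omega

end Cactus

/-! ### Nested cones: drawings whose blocks occupy separate cones have no crossings. -/

namespace Cactus

/-- The directions `(x, y)` with `y > 0` and `σ s ≤ x / y < σ e`. -/
def Cone (σ : ℕ → ℝ) (s e : ℕ) (p : ℝ × ℝ) : Prop :=
  0 < p.2 ∧ σ s * p.2 ≤ p.1 ∧ p.1 < σ e * p.2

namespace Cone

variable {σ : ℕ → ℝ} {s e s' e' : ℕ} {p q : ℝ × ℝ}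

theorem add (hp : Cone σ s e p) (hq : Cone σ s e q) : Cone σ s e (p + q) := by
  obtain ⟨h1, h2, h3⟩ := hp
  obtain ⟨h4, h5, h6⟩ := hq
  refine ⟨?_, ?_, ?_⟩ <;> simp only [Prod.fst_add, Prod.snd_add] <;> linarith

theorem smul (hp : Cone σ s e p) {a : ℝ} (ha : 0 < a) : Cone σ s e (a • p) := by
  obtain ⟨h1, h2, h3⟩ := hp
  refine ⟨?_, ?_, ?_⟩ <;> simp only [Prod.smul_fst, Prod.smul_snd, smul_eq_mul]
  · exact mul_pos ha h1
  · rw [mul_left_comm]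
    exact mul_le_mul_of_nonneg_left h2 ha.le
  · rw [mul_left_comm]
    exact mul_lt_mul_of_pos_left h3 ha

theorem mono (hσ : StrictMono σ) (hs : s' ≤ s) (he : e ≤ e') (hp : Cone σ s e p) :
    Cone σ s' e' p := by
  obtain ⟨h1, h2, h3⟩ := hp
  exact ⟨h1, le_trans (mul_le_mul_of_nonneg_right (hσ.monotone hs) h1.le) h2,
    lt_of_lt_of_le h3 (mul_le_mul_of_nonneg_right (hσ.monotone he) h1.le)⟩

theorem disjoint (hσ : StrictMono σ) (h : e ≤ s') (hp : Cone σ s e p) (hp' : Cone σ s' e' p) :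
    False := by
  have := mul_le_mul_of_nonneg_right (hσ.monotone h) hp.1.le
  linarith [hp.2.2, hp'.2.1]

theorem ne_zero (hp : Cone σ s e p) : p ≠ 0 := by
  rintro rfl
  exact lt_irrefl _ hp.1

theorem combo (hp : Cone σ s e p) (hq : Cone σ s e q) {a b : ℝ} (ha : 0 ≤ a) (hb : 0 ≤ b)
    (hab : a + b = 1) : Cone σ s e (a • p + b • q) := by
  rcases ha.eq_or_lt with rfl | ha
  · rw [zero_add] at hab
    rwa [hab, zero_smul, one_smul, zero_add]
  · rcases hb.eq_or_lt with rfl | hb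
    · rw [add_zero] at hab
      rwa [hab, zero_smul, one_smul, add_zero]
    · exact (hp.smul ha).add (hq.smul hb)

end Cone

/-- The region reserved for the vertex `c` and everything below it. -/
def Terr (σ : ℕ → ℝ) (start size : ℕ → ℕ) (pos : ℕ → ℝ × ℝ) (c : ℕ) : Set (ℝ × ℝ) :=
  {q | q = pos c ∨ Cone σ (start c) (start c + size c) (q - pos c)}

/-- A placement of the vertices of a tree of blocks: the vertex `c` belongs to the block `bid c`
with the root `B c`, and the block `b` uses the directions between `σ (lo b)` and `σ (hi b)`. -/
structure Layout (σ : ℕ → ℝ) (n : ℕ) (B bid start size lo hi : ℕ → ℕ) (pos : ℕ → ℝ × ℝ) :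
    Prop where
  mono : StrictMono σ
  root_lt : ∀ c, 0 < c → c < n → B c < c
  root_eq : ∀ c c', 0 < c → c < n → 0 < c' → c' < n → bid c = bid c' → B c = B c'
  lo_ge : ∀ c, 0 < c → c < n → start (B c) ≤ lo (bid c)
  hi_le : ∀ c, 0 < c → c < n → hi (bid c) ≤ start (B c) + size (B c)
  lo_le : ∀ c, 0 < c → c < n → lo (bid c) ≤ start c
  hi_ge : ∀ c, 0 < c → c < n → start c + size c ≤ hi (bid c)
  disj : ∀ c c', 0 < c → c < n → 0 < c' → c' < n → B c = B c' → bid c ≠ bid c' →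
    hi (bid c) ≤ lo (bid c') ∨ hi (bid c') ≤ lo (bid c)
  mem_cone : ∀ c, 0 < c → c < n → Cone σ (lo (bid c)) (hi (bid c)) (pos c - pos (B c))
  terr_disj : ∀ c c', 0 < c → c < n → 0 < c' → c' < n → c ≠ c' → bid c = bid c' →
    ∀ q ∈ Terr σ start size pos c, q ∉ Terr σ start size pos c'

/-- The vertex `a` is an iterated block root of the given one. -/
inductive Below (n : ℕ) (B : ℕ → ℕ) (a : ℕ) : ℕ → Prop
  | refl : Below n B a a
  | step {c : ℕ} : 0 < c → c < n → Below n B a (B c) → Below n B a c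

theorem Below.exists_child {n : ℕ} {B : ℕ → ℕ} {a c : ℕ} (h : Below n B a c) :
    a = c ∨ ∃ u, 0 < u ∧ u < n ∧ B u = a ∧ Below n B u c := by
  induction h with
  | refl => exact Or.inl rfl
  | @step c h1 h2 _ ih =>
    right
    rcases ih with rfl | ⟨u, hu, hun, hB, hb⟩
    · exact ⟨c, h1, h2, rfl, .refl⟩
    · exact ⟨u, hu, hun, hB, .step h1 h2 hb⟩

namespace Layout

variable {σ : ℕ → ℝ} {n : ℕ} {B bid start size lo hi : ℕ → ℕ} {pos : ℕ → ℝ × ℝ}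

theorem terr_cone (h : Layout σ n B bid start size lo hi pos) {c : ℕ} (h0 : 0 < c) (hn : c < n)
    {q : ℝ × ℝ} (hq : q ∈ Terr σ start size pos c) :
    Cone σ (lo (bid c)) (hi (bid c)) (q - pos (B c)) := by
  rcases hq with rfl | hq
  · exact h.mem_cone c h0 hn
  · have := (h.mem_cone c h0 hn).add (hq.mono h.mono (h.lo_le c h0 hn) (h.hi_ge c h0 hn))
    rwa [add_comm, sub_add_sub_cancel] at this

theorem terr_root (h : Layout σ n B bid start size lo hi pos) {c : ℕ} (h0 : 0 < c) (hn : c < n)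
    {q : ℝ × ℝ} (hq : q ∈ Terr σ start size pos c) : q ∈ Terr σ start size pos (B c) :=
  Or.inr ((h.terr_cone h0 hn hq).mono h.mono (h.lo_ge c h0 hn) (h.hi_le c h0 hn))

theorem terr_below (h : Layout σ n B bid start size lo hi pos) {a c : ℕ} (hb : Below n B a c)
    {q : ℝ × ℝ} (hq : q ∈ Terr σ start size pos c) : q ∈ Terr σ start size pos a := by
  induction hb with
  | refl => exact hq
  | step h1 h2 _ ih => exact ih (h.terr_root h1 h2 hq)

theorem below_le (h : Layout σ n B bid start size lo hi pos) {a c : ℕ} (hb : Below n B a c) :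
    a ≤ c := by
  induction hb with
  | refl => exact le_rfl
  | step h1 h2 _ ih => exact ih.trans (h.root_lt _ h1 h2).le

theorem cone_disj (h : Layout σ n B bid start size lo hi pos) {c c' : ℕ} (h0 : 0 < c) (hn : c < n)
    (h0' : 0 < c') (hn' : c' < n) (hB : B c = B c') (hb : bid c ≠ bid c') {p : ℝ × ℝ}
    (hp : Cone σ (lo (bid c)) (hi (bid c)) p) (hp' : Cone σ (lo (bid c')) (hi (bid c')) p) :
    False := by
  rcases h.disj c c' h0 hn h0' hn' hB hb with hle | hle
  · exact hp.disjoint h.mono hle hp'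
  · exact hp'.disjoint h.mono hle hp

theorem sibling_disj (h : Layout σ n B bid start size lo hi pos) {c c' : ℕ} (h0 : 0 < c)
    (hn : c < n) (h0' : 0 < c') (hn' : c' < n) (hne : c ≠ c') (hB : B c = B c') {q : ℝ × ℝ}
    (hq : q ∈ Terr σ start size pos c) (hq' : q ∈ Terr σ start size pos c') : False := by
  by_cases hb : bid c = bid c'
  · exact h.terr_disj c c' h0 hn h0' hn' hne hb q hq hq'
  · refine h.cone_disj h0 hn h0' hn' hB hb (h.terr_cone h0 hn hq) ?_
    rw [hB]
    exact h.terr_cone h0' hn' hq'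

/-- Regions are nested or disjoint. A common point also lies in the region of the block root `B c'`.
If `c` is before that root or equal to it, induction applies or the claim is immediate. Otherwise
induction places `c` under a child `u` of the same root with `u ≤ c < c'`, and the regions of the
siblings `u` and `c'` would meet. -/
theorem below_of_mem (h : Layout σ n B bid start size lo hi pos) {q : ℝ × ℝ} (c' : ℕ) :
    ∀ c, c < c' → c' < n → q ∈ Terr σ start size pos c → q ∈ Terr σ start size pos c' →
      Below n B c c' := by
  induction c' using Nat.strong_induction_on with
  | _ c' ih =>
    intro c hlt hn hq hq'
    have h0 : 0 < c' := by omega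
    have hB := h.root_lt c' h0 hn
    refine .step h0 hn ?_
    have hqB := h.terr_root h0 hn hq'
    rcases lt_trichotomy c (B c') with h1 | h1 | h1
    · exact ih (B c') hB c h1 (by omega) hq hqB
    · rw [← h1]
      exact .refl
    · exfalso
      rcases (ih c hlt (B c') h1 (by omega) hqB hq).exists_child with h2 | ⟨u, hu, hun, hBu, hb⟩
      · omega
      · have := h.below_le hb
        exact h.sibling_disj hu hun h0 hn (by omega) hBu (h.terr_below hb hq) hq'

theorem below_or_below (h : Layout σ n B bid start size lo hi pos) {q : ℝ × ℝ} {c c' : ℕ}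
    (hn : c < n) (hn' : c' < n) (hq : q ∈ Terr σ start size pos c)
    (hq' : q ∈ Terr σ start size pos c') : Below n B c c' ∨ Below n B c' c := by
  rcases lt_trichotomy c c' with h1 | rfl | h1
  · exact Or.inl (h.below_of_mem c' c h1 hn' hq hq')
  · exact Or.inl .refl
  · exact Or.inr (h.below_of_mem c c' h1 hn hq' hq)

theorem self_mem (c : ℕ) : pos c ∈ Terr σ start size pos c := Or.inl rfl

/-- Cones do not contain their apex, so the point of a vertex lies in no region strictly below it.
-/
theorem eq_of_pos_mem (h : Layout σ n B bid start size lo hi pos) {a c : ℕ} (hb : Below n B a c)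
    (hq : pos a ∈ Terr σ start size pos c) : a = c := by
  rcases hb.exists_child with rfl | ⟨u, hu, hun, hBu, hb⟩
  · rfl
  · have := (h.terr_cone hu hun (h.terr_below hb hq)).ne_zero
    rw [hBu, sub_self] at this
    exact absurd rfl this

theorem injective (h : Layout σ n B bid start size lo hi pos) {c c' : ℕ} (hn : c < n)
    (hn' : c' < n) (he : pos c = pos c') : c = c' := by
  have hm : pos c ∈ Terr σ start size pos c' := he ▸ self_mem c'
  rcases h.below_or_below hn hn' (self_mem c) hm with hb | hb
  · exact h.eq_of_pos_mem hb hm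
  · exact (h.eq_of_pos_mem hb (he ▸ self_mem c)).symm

end Layout

/-- A layout together with straight edges `i j` in the blocks `b`. -/
structure Drawing (σ : ℕ → ℝ) (n : ℕ) (B bid start size lo hi : ℕ → ℕ) (pos : ℕ → ℝ × ℝ)
    (E : ℕ → ℕ → ℕ → Prop) : Prop where
  layout : Layout σ n B bid start size lo hi pos
  edge : ∀ b i j, E b i j → i ≠ j ∧ ∃ c, 0 < c ∧ c < n ∧ bid c = b ∧
    (i = B c ∨ 0 < i ∧ i < n ∧ bid i = b) ∧ (j = B c ∨ 0 < j ∧ j < n ∧ bid j = b)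
  edge_terr : ∀ b i j w q, E b i j → 0 < w → w < n → bid w = b → q ∈ segment ℝ (pos i) (pos j) →
    q ∈ Terr σ start size pos w → q = pos w ∧ (w = i ∨ w = j)
  edge_edge : ∀ b i j i' j' q, E b i j → E b i' j' → s(i, j) ≠ s(i', j') →
    q ∈ segment ℝ (pos i) (pos j) → q ∈ segment ℝ (pos i') (pos j') →
    ∃ w, (w = i ∨ w = j) ∧ (w = i' ∨ w = j') ∧ q = pos w

namespace Drawing

variable {σ : ℕ → ℝ} {n : ℕ} {B bid start size lo hi : ℕ → ℕ} {pos : ℕ → ℝ × ℝ}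
  {E : ℕ → ℕ → ℕ → Prop}

/-- Seen from the root of the block, both ends of an edge lie in the cone of the block or at its
apex. By convexity every point of the edge other than the root lies in the cone. -/
theorem edge_root (h : Drawing σ n B bid start size lo hi pos E) {b i j : ℕ} (hE : E b i j) :
    ∃ c, 0 < c ∧ c < n ∧ bid c = b ∧ ∀ q ∈ segment ℝ (pos i) (pos j),
      (q = pos (B c) ∧ (B c = i ∨ B c = j)) ∨
        (q ≠ pos (B c) ∧ Cone σ (lo b) (hi b) (q - pos (B c))) := by
  obtain ⟨hne, c, h0, hn, hb, hi', hj'⟩ := h.edge b i j hE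
  refine ⟨c, h0, hn, hb, ?_⟩
  have key : ∀ k, 0 < k → k < n → bid k = b → Cone σ (lo b) (hi b) (pos k - pos (B c)) := by
    intro k hk0 hkn hkb
    rw [← h.layout.root_eq k c hk0 hkn h0 hn (hkb.trans hb.symm), ← hkb]
    exact h.layout.mem_cone k hk0 hkn
  rintro q ⟨s, t, hs, ht, hst, rfl⟩
  have hsub : s • pos i + t • pos j - pos (B c) =
      s • (pos i - pos (B c)) + t • (pos j - pos (B c)) := by
    have : pos (B c) = s • pos (B c) + t • pos (B c) := by rw [← add_smul, hst, one_smul]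
    rw [smul_sub, smul_sub]
    nth_rewrite 1 [this]
    abel
  have hcone : ∀ {q : ℝ × ℝ}, Cone σ (lo b) (hi b) (q - pos (B c)) →
      q ≠ pos (B c) ∧ Cone σ (lo b) (hi b) (q - pos (B c)) := by
    intro q hq
    exact ⟨fun he => hq.ne_zero (by rw [he, sub_self]), hq⟩
  rcases hi' with rfl | ⟨i0, hin, hib⟩
  · rcases hj' with rfl | ⟨j0, hjn, hjb⟩
    · exact absurd rfl hne
    · rcases ht.eq_or_lt with rfl | ht
      · left
        rw [add_zero] at hst
        refine ⟨?_, Or.inl rfl⟩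
        rw [hst, one_smul, zero_smul, add_zero]
      · right
        refine hcone ?_
        rw [hsub, sub_self, smul_zero, zero_add]
        exact (key j j0 hjn hjb).smul ht
  · rcases hj' with rfl | ⟨j0, hjn, hjb⟩
    · rcases hs.eq_or_lt with rfl | hs
      · left
        rw [zero_add] at hst
        refine ⟨?_, Or.inr rfl⟩
        rw [hst, one_smul, zero_smul, zero_add]
      · right
        refine hcone ?_
        rw [hsub, sub_self, smul_zero, add_zero]
        exact (key i i0 hin hib).smul hs
    · right
      refine hcone ?_
      rw [hsub]
      exact (key i i0 hin hib).combo (key j j0 hjn hjb) hs ht hst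

theorem edge_mem_terr (h : Drawing σ n B bid start size lo hi pos E) {c : ℕ} (h0 : 0 < c)
    (hn : c < n) {q : ℝ × ℝ} (hq : q = pos (B c) ∨ Cone σ (lo (bid c)) (hi (bid c)) (q - pos (B c))) :
    q ∈ Terr σ start size pos (B c) := by
  rcases hq with hq | hq
  · exact Or.inl hq
  · exact Or.inr (hq.mono h.layout.mono (h.layout.lo_ge c h0 hn) (h.layout.hi_le c h0 hn))

/-- A point of an edge in the region of a vertex strictly below the root of the block. -/
theorem edge_below (h : Drawing σ n B bid start size lo hi pos E) {b i j c u : ℕ} (hE : E b i j)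
    (h0 : 0 < c) (hn : c < n) (hb : bid c = b) {q : ℝ × ℝ} (hq : q ∈ segment ℝ (pos i) (pos j))
    (hc : q ≠ pos (B c) → Cone σ (lo b) (hi b) (q - pos (B c)))
    (hu : 0 < u) (hun : u < n) (hB : B u = B c) (hqu : q ∈ Terr σ start size pos u) :
    q = pos u ∧ (u = i ∨ u = j) := by
  by_cases hub : bid u = b
  · exact h.edge_terr b i j u q hE hu hun hub hq hqu
  · exfalso
    have h1 := h.layout.terr_cone hu hun hqu
    have h2 : q ≠ pos (B c) := by
      intro he
      apply h1.ne_zero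
      rw [he, hB, sub_self]
    have h3 := hc h2
    rw [← hb] at h3 hub
    rw [hB] at h1
    exact h.layout.cone_disj hu hun h0 hn hB hub h1 h3

/-- A vertex on the edge lies in the region of the block root and hence below that root. It is then
in the region of some vertex `u` whose block has this root, and the edge meets that region at most
in `u` itself. -/
theorem vertex_off_edge (h : Drawing σ n B bid start size lo hi pos E) {b i j w : ℕ}
    (hE : E b i j) (hw : w < n) (hwi : w ≠ i) (hwj : w ≠ j) :
    pos w ∉ segment ℝ (pos i) (pos j) := by
  intro hq
  obtain ⟨c, h0, hn, hb, hr⟩ := h.edge_root hE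
  have hr := hr _ hq
  have hB := h.layout.root_lt c h0 hn
  have hm : pos w ∈ Terr σ start size pos (B c) := by
    refine h.edge_mem_terr h0 hn ?_
    rw [hb]
    rcases hr with hr | hr
    · exact Or.inl hr.1
    · exact Or.inr hr.2
  have hroot : w ≠ B c := by
    rintro rfl
    rcases hr with ⟨-, hr | hr⟩ | hr
    · exact hwi hr
    · exact hwj hr
    · exact hr.1 rfl
  rcases h.layout.below_or_below hw (by omega) (Layout.self_mem w) hm with hbl | hbl
  · exact hroot (h.layout.eq_of_pos_mem hbl hm)
  · rcases hbl.exists_child with he | ⟨u, hu, hun, hBu, hbl⟩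
    · exact hroot he.symm
    · have h1 := h.layout.terr_below hbl (Layout.self_mem w)
      obtain ⟨h2, h3⟩ := h.edge_below hE h0 hn hb hq (fun hne => (hr.resolve_left
        fun hh => hne hh.1).2) hu hun hBu h1
      obtain rfl := h.layout.injective hw hun h2
      rcases h3 with h3 | h3
      · exact hwi h3
      · exact hwj h3

/-- If the two blocks have the same root, their cones are disjoint and only the root is left.
Otherwise the root of the second block lies in the region of a vertex `u` under the first root. The
first edge can meet this region only in `u`, and then `u` must be the root of the second block. -/
theorem crossing_of_below (h : Drawing σ n B bid start size lo hi pos E) {b i j b' i' j' c c' : ℕ}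
    (hE : E b i j) (h0 : 0 < c) (hn : c < n) (hb : bid c = b) (h0' : 0 < c') (hn' : c' < n)
    (hb' : bid c' = b') {q : ℝ × ℝ} (hq : q ∈ segment ℝ (pos i) (pos j))
    (hr : (q = pos (B c) ∧ (B c = i ∨ B c = j)) ∨
        (q ≠ pos (B c) ∧ Cone σ (lo b) (hi b) (q - pos (B c))))
    (hr' : (q = pos (B c') ∧ (B c' = i' ∨ B c' = j')) ∨
        (q ≠ pos (B c') ∧ Cone σ (lo b') (hi b') (q - pos (B c'))))
    (hbl : Below n B (B c) (B c')) (hne : b ≠ b') :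
    ∃ w, (w = i ∨ w = j) ∧ (w = i' ∨ w = j') ∧ q = pos w := by
  rcases hbl.exists_child with he | ⟨u, hu, hun, hBu, hbl⟩
  · rcases hr with hr | hr
    · rcases hr' with hr' | hr'
      · exact ⟨B c, hr.2, he ▸ hr'.2, hr.1⟩
      · exact absurd (hr.1.trans (by rw [he])) hr'.1
    · rcases hr' with hr' | hr'
      · exact absurd (hr'.1.trans (by rw [he])) hr.1
      · exfalso
        have h1 := hr.2
        have h2 := hr'.2
        rw [← hb] at h1 hne
        rw [← hb'] at h2 hne
        rw [← he] at h2
        exact h.layout.cone_disj h0 hn h0' hn' he hne h1 h2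
  · have h1 : q ∈ Terr σ start size pos (B c') := by
      refine h.edge_mem_terr h0' hn' ?_
      rw [hb']
      rcases hr' with hr' | hr'
      · exact Or.inl hr'.1
      · exact Or.inr hr'.2
    obtain ⟨h2, h3⟩ := h.edge_below hE h0 hn hb hq (fun hne => (hr.resolve_left
        fun hh => hne hh.1).2) hu hun hBu (h.layout.terr_below hbl h1)
    have h4 : u = B c' := h.layout.eq_of_pos_mem hbl (h2 ▸ h1)
    rcases hr' with hr' | hr'
    · exact ⟨u, h3, h4 ▸ hr'.2, h2⟩
    · exact absurd (h4 ▸ h2) hr'.1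

theorem crossing_free (h : Drawing σ n B bid start size lo hi pos E) {b i j b' i' j' : ℕ}
    (hE : E b i j) (hE' : E b' i' j') (hne : s(i, j) ≠ s(i', j')) {q : ℝ × ℝ}
    (hq : q ∈ segment ℝ (pos i) (pos j)) (hq' : q ∈ segment ℝ (pos i') (pos j')) :
    ∃ w, (w = i ∨ w = j) ∧ (w = i' ∨ w = j') ∧ q = pos w := by
  by_cases hbb : b = b'
  · subst hbb
    exact h.edge_edge b i j i' j' q hE hE' hne hq hq'
  obtain ⟨c, h0, hn, hb, hr⟩ := h.edge_root hE
  have hr := hr _ hq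
  obtain ⟨c', h0', hn', hb', hr'⟩ := h.edge_root hE'
  have hr' := hr' _ hq'
  have h1 : q ∈ Terr σ start size pos (B c) := by
    refine h.edge_mem_terr h0 hn ?_
    rw [hb]
    exact hr.imp And.left And.right
  have h2 : q ∈ Terr σ start size pos (B c') := by
    refine h.edge_mem_terr h0' hn' ?_
    rw [hb']
    exact hr'.imp And.left And.right
  have hB := h.layout.root_lt c h0 hn
  have hB' := h.layout.root_lt c' h0' hn'
  rcases h.layout.below_or_below (by omega) (by omega) h1 h2 with hbl | hbl
  · exact h.crossing_of_below hE h0 hn hb h0' hn' hb' hq hr hr' hbl hbb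
  · obtain ⟨w, hw, hw', hqw⟩ := h.crossing_of_below hE' h0' hn' hb' h0 hn hb hq' hr' hr hbl
      (Ne.symm hbb)
    exact ⟨w, hw', hw, hqw⟩

end Drawing

end Cactus

/-! ### The polygon of a cycle in the coordinates given by its two sides. -/

namespace Cactus

/-- The multiple of the left side of a cycle with `k` vertices used for its `j`-th vertex. -/
def coefA (k j : ℕ) : ℕ := if 1 ≤ j ∧ j ≤ k / 2 then 1 else 0

/-- The multiple of the right side of a cycle with `k` vertices used for its `j`-th vertex. -/
def coefB (k j : ℕ) : ℕ :=
  if k = 3 then if j = 2 then 1 else 0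
  else if j < k / 2 then j - 1 else if j = k / 2 then k - 1 - k / 2 else k - j

/-- In the coordinates given by the two sides, the point `(α, β)` lies on the `i`-th edge. -/
def OnEdge (k i : ℕ) (α β : ℝ) : Prop :=
  ∃ s t : ℝ, 0 ≤ s ∧ 0 ≤ t ∧ s + t = 1 ∧ α = s * coefA k i + t * coefA k (i + 1) ∧
    β = s * coefB k i + t * coefB k (i + 1)

/-- For `k ≠ 3` the polygon is the parallelogram with the corners `(0, 0)`, `(1, 0)`, `(1, h)`, `(0,
h)`, where `h = k - 1 - k / 2`, traversed in this order. The vertices are at unit steps along the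
two long boundaries, except that for odd `k` the left one, having a vertex less, ends with a double
step. For `k = 3` the second edge is instead the segment from `(1, 0)` to `(0, 1)`. The cases are
the lines carrying the edges. -/
theorem OnEdge.cases {k i : ℕ} {α β : ℝ} (hk : 3 ≤ k) (hi : i < k) (h : OnEdge k i α β) :
    0 ≤ α ∧ α ≤ 1 ∧ 0 ≤ β ∧ ((i = 0 ∧ β = 0) ∨
    (0 < i ∧ i < k / 2 ∧ α = 1 ∧ (coefB k i : ℝ) ≤ β ∧ β ≤ coefB k (i + 1)) ∨
    (k = 3 ∧ i = 1 ∧ α + β = 1) ∨ (k ≠ 3 ∧ i = k / 2 ∧ β = coefB k i) ∨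
    (k / 2 < i ∧ α = 0 ∧ (coefB k (i + 1) : ℝ) ≤ β ∧ β ≤ coefB k i)) := by
  obtain ⟨s, t, hs, ht, hst, rfl, rfl⟩ := h
  have hA : ∀ j, (coefA k j : ℝ) ≤ 1 := by
    intro j
    rw [coefA]
    split_ifs <;> simp
  refine ⟨by positivity, ?_, by positivity, ?_⟩
  · nlinarith [hA i, hA (i + 1)]
  rcases Nat.eq_zero_or_pos i with rfl | h0
  · left
    refine ⟨rfl, ?_⟩
    have h1 : coefB k 0 = 0 := by
      rw [coefB]
      split_ifs <;> omega
    have h2 : coefB k (0 + 1) = 0 := by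
      rw [coefB]
      split_ifs <;> omega
    rw [h1, h2]
    simp
  right
  rcases lt_trichotomy i (k / 2) with h1 | h1 | h1
  · left
    have e1 : coefA k i = 1 := if_pos ⟨h0, h1.le⟩
    have e2 : coefA k (i + 1) = 1 := if_pos ⟨by omega, h1⟩
    have e3 : coefB k i ≤ coefB k (i + 1) := by
      rw [coefB, coefB]
      split_ifs <;> omega
    have e3' : (coefB k i : ℝ) ≤ coefB k (i + 1) := by exact_mod_cast e3
    rw [e1, e2]
    refine ⟨h0, h1, ?_, ?_, ?_⟩
    · push_cast
      linarith
    · nlinarith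
    · nlinarith
  · right
    by_cases h3 : k = 3
    · left
      subst h3
      obtain rfl : i = 1 := by omega
      refine ⟨rfl, rfl, ?_⟩
      norm_num [coefA, coefB]
      linarith
    · right
      left
      refine ⟨h3, h1, ?_⟩
      have e : coefB k (i + 1) = coefB k i := by
        rw [coefB, coefB]
        split_ifs <;> omega
      rw [e, ← add_mul, hst, one_mul]
  · right
    right
    right
    have e1 : coefA k i = 0 := if_neg (by omega)
    have e2 : coefA k (i + 1) = 0 := if_neg (by omega)
    have e3 : coefB k (i + 1) ≤ coefB k i := by
      rw [coefB, coefB]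
      split_ifs <;> omega
    have e3' : (coefB k (i + 1) : ℝ) ≤ coefB k i := by exact_mod_cast e3
    rw [e1, e2]
    refine ⟨h1, ?_, ?_, ?_⟩
    · simp
    · nlinarith
    · nlinarith

theorem coefB_of_lt {k j : ℕ} (hk : k ≠ 3) (h : j < k / 2) : coefB k j = j - 1 := by
  rw [coefB, if_neg hk, if_pos h]

theorem coefB_mid {k : ℕ} (hk : k ≠ 3) : coefB k (k / 2) = k - 1 - k / 2 := by
  rw [coefB, if_neg hk, if_neg (lt_irrefl _), if_pos rfl]

theorem coefB_of_gt {k j : ℕ} (hk : k ≠ 3) (h : k / 2 < j) : coefB k j = k - j := by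
  rw [coefB, if_neg hk, if_neg (by omega), if_neg (by omega)]

theorem coefB_lt_coefB_left {k i j : ℕ} (h0 : 0 < i) (hij : i < j) (hj : j ≤ k / 2) :
    coefB k i < coefB k j := by
  have h3 : k ≠ 3 := by omega
  rw [coefB_of_lt h3 (by omega)]
  rcases hj.lt_or_eq with hj | rfl
  · rw [coefB_of_lt h3 hj]
    omega
  · rw [coefB_mid h3]
    omega

theorem coefB_lt_coefB_right {k i j : ℕ} (hi : k / 2 < i) (hij : i < j) (hj : j ≤ k) :
    coefB k j < coefB k i := by
  by_cases h3 : k = 3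
  · rw [coefB, coefB, if_pos h3, if_pos h3]
    split_ifs <;> omega
  · rw [coefB_of_gt h3 hi, coefB_of_gt h3 (by omega)]
    omega

/-- A vertex of the polygon lies only on the edges next to it. -/
theorem OnEdge.vertex {k i j : ℕ} (hk : 3 ≤ k) (hi : i < k) (hj : 0 < j) (hjk : j < k)
    (h : OnEdge k i (coefA k j) (coefB k j)) : j = i ∨ j = i + 1 := by
  obtain ⟨-, -, -, h⟩ := h.cases hk hi
  by_cases h3 : k = 3
  · subst h3
    have : j = 1 ∨ j = 2 := by omega
    have : i = 0 ∨ i = 1 ∨ i = 2 := by omega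
    rcases this with rfl | rfl | rfl
    · rcases ‹j = 1 ∨ j = 2› with rfl | rfl
      · omega
      · norm_num [coefB] at h
    · omega
    · rcases ‹j = 1 ∨ j = 2› with rfl | rfl
      · norm_num [coefA, coefB] at h
      · omega
  have hAl : j ≤ k / 2 → coefA k j = 1 := fun h => if_pos ⟨hj, h⟩
  have hAr : k / 2 < j → coefA k j = 0 := fun h => if_neg (by omega)
  rcases h with ⟨h1, h2⟩ | ⟨h1, h2, hA, h4, h5⟩ | ⟨h1, -, -⟩ | ⟨-, h1, h2⟩ | ⟨h1, hA, h4, h5⟩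
  · have h2 : coefB k j = 0 := by exact_mod_cast h2
    right
    rw [h1]
    rcases lt_trichotomy j (k / 2) with hlt | rfl | hlt
    · rw [coefB_of_lt h3 hlt] at h2
      omega
    · rw [coefB_mid h3] at h2
      omega
    · rw [coefB_of_gt h3 hlt] at h2
      omega
  · have hA : coefA k j = 1 := by exact_mod_cast hA
    have h4 : coefB k i ≤ coefB k j := by exact_mod_cast h4
    have h5 : coefB k j ≤ coefB k (i + 1) := by exact_mod_cast h5
    have hju : j ≤ k / 2 := by
      by_contra hlt
      rw [hAr (by omega)] at hA
      omega
    by_contra hne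
    rcases Nat.lt_or_ge j i with hlt | hge
    · have := coefB_lt_coefB_left (k := k) hj hlt (by omega)
      omega
    · have := coefB_lt_coefB_left (k := k) (by omega) (show i + 1 < j by omega) hju
      omega
  · exact absurd h1 h3
  · have h2 : coefB k j = coefB k i := by exact_mod_cast h2
    rw [h1, coefB_mid h3] at h2
    rw [h1]
    rcases lt_trichotomy j (k / 2) with hlt | rfl | hlt
    · rw [coefB_of_lt h3 hlt] at h2
      omega
    · exact Or.inl rfl
    · rw [coefB_of_gt h3 hlt] at h2
      omega
  · have hA : coefA k j = 0 := by exact_mod_cast hA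
    have h4 : coefB k (i + 1) ≤ coefB k j := by exact_mod_cast h4
    have h5 : coefB k j ≤ coefB k i := by exact_mod_cast h5
    have hju : k / 2 < j := by
      by_contra hlt
      rw [hAl (by omega)] at hA
      omega
    by_contra hne
    rcases Nat.lt_or_ge j i with hlt | hge
    · have := coefB_lt_coefB_right hju hlt hi.le
      omega
    · have := coefB_lt_coefB_right (show k / 2 < i + 1 by omega) (show i + 1 < j by omega) hjk.le
      omega

/-- Two edges of the polygon meet only in a common vertex. -/
theorem OnEdge.edge {k i j : ℕ} {α β : ℝ} (hk : 3 ≤ k) (hij : i < j) (hj : j < k)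
    (h : OnEdge k i α β) (h' : OnEdge k j α β) :
    (j = i + 1 ∧ α = coefA k j ∧ β = coefB k j) ∨ (i = 0 ∧ j + 1 = k ∧ α = 0 ∧ β = 0) := by
  obtain ⟨hα, hα1, hβ, h⟩ := h.cases hk (by omega)
  obtain ⟨-, -, -, h'⟩ := h'.cases hk hj
  by_cases h3 : k = 3
  · subst h3
    have : i = 0 ∧ j = 1 ∨ i = 0 ∧ j = 2 ∨ i = 1 ∧ j = 2 := by omega
    rcases this with ⟨rfl, rfl⟩ | ⟨rfl, rfl⟩ | ⟨rfl, rfl⟩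
    · norm_num [coefA, coefB] at h h' ⊢
      rw [h] at h' ⊢
      constructor
      · linarith
      · rfl
    · norm_num [coefA, coefB] at h h' ⊢
      exact ⟨h'.1, h⟩
    · norm_num [coefA, coefB] at h h' ⊢
      constructor <;> linarith
  have hAl : ∀ j, 0 < j → j ≤ k / 2 → (coefA k j : ℝ) = 1 := fun j hj h => by
    rw [coefA, if_pos ⟨hj, h⟩, Nat.cast_one]
  have hAr : ∀ j, k / 2 < j → (coefA k j : ℝ) = 0 := fun j h => by
    rw [coefA, if_neg (by omega), Nat.cast_zero]
  rcases h with ⟨h1, h2⟩ | ⟨h1, h2, hA, h4, h5⟩ | ⟨h1, -, -⟩ | ⟨-, h1, h2⟩ | ⟨h1, hA, h4, h5⟩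
  · rcases h' with ⟨g1, g2⟩ | ⟨g1, g2, gA, g4, g5⟩ | ⟨g1, -, -⟩ | ⟨-, g1, g2⟩ | ⟨g1, gA, g4, g5⟩
    · omega
    · rw [h2] at g4
      have g4 : coefB k j ≤ 0 := by exact_mod_cast g4
      have g6 := g4
      rw [coefB_of_lt h3 g2] at g6
      left
      refine ⟨by omega, by rw [gA, hAl j g1 g2.le], ?_⟩
      rw [Nat.le_zero.1 g4, h2, Nat.cast_zero]
    · exact absurd g1 h3
    · rw [h2, g1, coefB_mid h3] at g2
      have g2 : 0 = k - 1 - k / 2 := by exact_mod_cast g2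
      omega
    · rw [h2] at g4
      have g4 : coefB k (j + 1) ≤ 0 := by exact_mod_cast g4
      rw [coefB_of_gt h3 (by omega)] at g4
      exact Or.inr ⟨h1, by omega, gA, h2⟩
  · rcases h' with ⟨g1, g2⟩ | ⟨g1, g2, gA, g4, g5⟩ | ⟨g1, -, -⟩ | ⟨-, g1, g2⟩ | ⟨g1, gA, g4, g5⟩
    · omega
    · have h6 : coefB k j ≤ coefB k (i + 1) := by exact_mod_cast g4.trans h5
      have h7 : j = i + 1 := by
        by_contra hne
        have := coefB_lt_coefB_left (k := k) (by omega) (show i + 1 < j by omega) g2.le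
        omega
      left
      refine ⟨h7, by rw [gA, hAl j g1 g2.le], ?_⟩
      rw [← h7] at h5
      exact le_antisymm h5 g4
    · exact absurd g1 h3
    · rw [g2] at h5
      have h5 : coefB k j ≤ coefB k (i + 1) := by exact_mod_cast h5
      have h7 : j = i + 1 := by
        by_contra hne
        have := coefB_lt_coefB_left (k := k) (by omega) (show i + 1 < j by omega) g1.le
        omega
      left
      exact ⟨h7, by rw [hA, hAl j (by omega) g1.le], g2⟩
    · rw [hA] at gA
      norm_num at gA
  · exact absurd h1 h3
  · rcases h' with ⟨g1, g2⟩ | ⟨g1, g2, gA, g4, g5⟩ | ⟨g1, -, -⟩ | ⟨-, g1, g2⟩ | ⟨g1, gA, g4, g5⟩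
    · omega
    · omega
    · exact absurd g1 h3
    · omega
    · have e : coefB k i = coefB k (i + 1) := by
        rw [coefB_of_gt h3 (show k / 2 < i + 1 by omega), h1, coefB_mid h3]
        omega
      have h5 : coefB k (i + 1) ≤ coefB k j := by
        rw [h2, e] at g5
        exact_mod_cast g5
      have h7 : j = i + 1 := by
        by_contra hne
        have := coefB_lt_coefB_right (show k / 2 < i + 1 by omega) (show i + 1 < j by omega) hj.le
        omega
      left
      exact ⟨h7, by rw [gA, hAr j g1], by rw [h2, e, h7]⟩
  · rcases h' with ⟨g1, g2⟩ | ⟨g1, g2, gA, g4, g5⟩ | ⟨g1, -, -⟩ | ⟨-, g1, g2⟩ | ⟨g1, gA, g4, g5⟩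
    · omega
    · omega
    · exact absurd g1 h3
    · omega
    · have h5 : coefB k (i + 1) ≤ coefB k j := by exact_mod_cast h4.trans g5
      have h7 : j = i + 1 := by
        by_contra hne
        have := coefB_lt_coefB_right (show k / 2 < i + 1 by omega) (show i + 1 < j by omega) hj.le
        omega
      left
      refine ⟨h7, by rw [gA, hAr j g1], ?_⟩
      rw [← h7] at h4
      exact le_antisymm g5 h4

end Cactus

/-! ### A cycle in the plane and the regions of its vertices. -/

namespace Cactus

/-- The `j`-th vertex of a cycle with root `v` and sides `a`, `b`. -/
noncomputable def cyclePoint (k : ℕ) (v a b : ℝ × ℝ) (j : ℕ) : ℝ × ℝ :=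
  v + (coefA k j : ℝ) • a + (coefB k j : ℝ) • b

theorem cyclePoint_fst (k : ℕ) (v a b : ℝ × ℝ) (j : ℕ) :
    (cyclePoint k v a b j).1 = v.1 + coefA k j * a.1 + coefB k j * b.1 := rfl

theorem cyclePoint_snd (k : ℕ) (v a b : ℝ × ℝ) (j : ℕ) :
    (cyclePoint k v a b j).2 = v.2 + coefA k j * a.2 + coefB k j * b.2 := rfl

/-- The sides of a cycle have the directions `sa < sb`. -/
structure Sides (σ : ℕ → ℝ) (k sa sb : ℕ) (a b : ℝ × ℝ) : Prop where
  mono : StrictMono σ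
  three_le : 3 ≤ k
  lt : sa < sb
  a_pos : 0 < a.2
  a_dir : a.1 = σ sa * a.2
  b_pos : 0 < b.2
  b_dir : b.1 = σ sb * b.2

/-- The interval from `s` to `e` of directions is admissible for the `j`-th vertex. -/
def Admissible (k sa sb j s e : ℕ) : Prop :=
  0 < j ∧ j < k ∧ (j ≤ k / 2 → sa < s ∧ e ≤ sb) ∧ (k / 2 < j → sb < s)

namespace Sides

variable {σ : ℕ → ℝ} {k sa sb s e : ℕ} {v a b q : ℝ × ℝ}

theorem mem_cone (h : Sides σ k sa sb a b) {lo hi j : ℕ} (hlo : lo ≤ sa) (hhi : sb < hi)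
    (h0 : 0 < j) (hj : j < k) : Cone σ lo hi (cyclePoint k v a b j - v) := by
  have h1 := h.mono.monotone hlo
  have h2 := h.mono hhi
  have h3 := h.mono h.lt
  have hab : (coefA k j = 1 ∧ 0 ≤ coefB k j) ∨ (coefA k j = 0 ∧ 1 ≤ coefB k j) := by
    by_cases hju : j ≤ k / 2
    · exact Or.inl ⟨if_pos ⟨h0, hju⟩, Nat.zero_le _⟩
    · refine Or.inr ⟨if_neg (by omega), ?_⟩
      have := coefB_lt_coefB_right (k := k) (show k / 2 < j by omega) hj le_rfl
      omega
  have ha : Cone σ lo hi a := by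
    refine ⟨h.a_pos, ?_, ?_⟩ <;> rw [h.a_dir]
    · exact mul_le_mul_of_nonneg_right h1 h.a_pos.le
    · exact mul_lt_mul_of_pos_right (h3.trans h2) h.a_pos
  have hb : Cone σ lo hi b := by
    refine ⟨h.b_pos, ?_, ?_⟩ <;> rw [h.b_dir]
    · exact mul_le_mul_of_nonneg_right (h1.trans h3.le) h.b_pos.le
    · exact mul_lt_mul_of_pos_right h2 h.b_pos
  have he : cyclePoint k v a b j - v = (coefA k j : ℝ) • a + (coefB k j : ℝ) • b := by
    rw [cyclePoint]
    abel
  rw [he]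
  rcases hab with ⟨hA, hB⟩ | ⟨hA, hB⟩
  · rw [hA, Nat.cast_one, one_smul]
    rcases hB.lt_or_eq with hB | hB
    · exact ha.add (hb.smul (by exact_mod_cast hB))
    · rw [← hB, Nat.cast_zero, zero_smul, add_zero]
      exact ha
  · rw [hA, Nat.cast_zero, zero_smul, zero_add]
    exact hb.smul (by exact_mod_cast hB)

/-- The region of a vertex on the left lies to the left of the left side. -/
theorem left_le (h : Sides σ k sa sb a b) {j : ℕ} (hs : Admissible k sa sb j s e)
    (hj : j ≤ k / 2) (hq : q = cyclePoint k v a b j ∨ Cone σ s e (q - cyclePoint k v a b j)) :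
    q = cyclePoint k v a b j ∨
      q.1 - v.1 - σ sb * (q.2 - v.2) < -((σ sb - σ sa) * a.2) := by
  -- The expression `q.1 - v.1 - σ sb * (q.2 - v.2)` is the horizontal offset from the line through
  -- the root along `b`. The left boundary has the constant offset `-(σ sb - σ sa) * a.2`, and
  -- directions below `σ sb` only decrease it.
  refine hq.imp id fun hq => ?_
  obtain ⟨h1, -, h3⟩ := hq
  have h4 := h.mono.monotone (hs.2.2.1 hj).2
  have hA : coefA k j = 1 := if_pos ⟨hs.1, hj⟩
  have h5 := mul_le_mul_of_nonneg_right h4 h1.le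
  rw [Prod.fst_sub, cyclePoint_fst] at h3
  simp only [Prod.snd_sub, cyclePoint_snd] at h3 h5
  rw [hA, h.a_dir, h.b_dir] at h3
  rw [hA] at h5
  push_cast at h3 h5
  nlinarith

/-- The region of a vertex on the right lies to the right of the right side. -/
theorem right_ge (h : Sides σ k sa sb a b) {j : ℕ} (hs : Admissible k sa sb j s e)
    (hj : k / 2 < j) (hq : q = cyclePoint k v a b j ∨ Cone σ s e (q - cyclePoint k v a b j)) :
    q = cyclePoint k v a b j ∨ 0 < q.1 - v.1 - σ sb * (q.2 - v.2) := by
  refine hq.imp id fun hq => ?_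
  obtain ⟨h1, h2, -⟩ := hq
  have h4 := h.mono (hs.2.2.2 hj)
  have hA : coefA k j = 0 := if_neg (by omega)
  have h5 := mul_lt_mul_of_pos_right h4 h1
  rw [Prod.fst_sub, cyclePoint_fst] at h2
  simp only [Prod.snd_sub, cyclePoint_snd] at h2 h5
  rw [hA, h.b_dir] at h2
  rw [hA] at h5
  push_cast at h2 h5
  nlinarith

/-- Vertices on different boundaries are separated by the strip of the parallelogram. On the left,
the later vertex is higher along `b` and has larger slots: its region leaves the earlier vertex only
with directions at least `σ e`. On the right, the earlier vertex is higher, and its region leaves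
the later vertex only with directions below `σ s'`. In both cases the slots are ordered so that the
regions avoid each other. -/
theorem terr_disj (h : Sides σ k sa sb a b) {i j s' e' : ℕ} (hi : Admissible k sa sb i s e)
    (hj : Admissible k sa sb j s' e') (hij : i < j) (ho : e ≤ s')
    (hq : q = cyclePoint k v a b i ∨ Cone σ s e (q - cyclePoint k v a b i))
    (hq' : q = cyclePoint k v a b j ∨ Cone σ s' e' (q - cyclePoint k v a b j)) : False := by
  have h3 := h.mono h.lt
  have ha := h.a_pos
  have hb := h.b_pos
  have ho' := h.mono.monotone ho
  rcases Nat.lt_or_ge (k / 2) i with hiu | hiu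
  · -- both on the right
    have hA : coefA k i = 0 := if_neg (by omega)
    have hA' : coefA k j = 0 := if_neg (by omega)
    have hB : (coefB k j : ℝ) < coefB k i := by
      exact_mod_cast coefB_lt_coefB_right hiu hij hj.2.1.le
    have hsb := h.mono (hj.2.2.2 (by omega))
    have e1 : 0 ≤ (q - cyclePoint k v a b i).2 ∧
        (q - cyclePoint k v a b i).1 ≤ σ s' * (q - cyclePoint k v a b i).2 := by
      rcases hq with rfl | ⟨g1, g2, g3⟩
      · simp
      · exact ⟨g1.le, g3.le.trans (mul_le_mul_of_nonneg_right ho' g1.le)⟩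
    have e2 : 0 < (q - cyclePoint k v a b j).2 ∧
        (q - cyclePoint k v a b j).1 < σ s' * (q - cyclePoint k v a b j).2 := by
      simp only [Prod.fst_sub, Prod.snd_sub, cyclePoint_fst, cyclePoint_snd, hA, hA', h.b_dir]
        at e1 ⊢
      have := mul_pos (sub_pos.2 hB) hb
      have := mul_lt_mul_of_pos_right hsb this
      constructor <;> nlinarith
    rcases hq' with rfl | ⟨g1, g2, g3⟩
    · simp at e2
    · linarith [e2.2]
  · rcases Nat.lt_or_ge (k / 2) j with hju | hju
    · -- on different sides
      have hd := mul_pos (sub_pos.2 h3) ha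
      have e1 : q.1 - v.1 - σ sb * (q.2 - v.2) ≤ -((σ sb - σ sa) * a.2) := by
        rcases h.left_le hi hiu hq with rfl | hlt
        · have hA : coefA k i = 1 := if_pos ⟨hi.1, hiu⟩
          rw [cyclePoint_fst, cyclePoint_snd, hA, h.a_dir, h.b_dir]
          push_cast
          linarith
        · exact hlt.le
      rcases h.right_ge hj hju hq' with rfl | hlt
      · have hA : coefA k j = 0 := if_neg (by omega)
        rw [cyclePoint_fst, cyclePoint_snd, hA, h.b_dir] at e1
        push_cast at e1
        linarith
      · linarith
    · -- both on the left
      have hA : coefA k i = 1 := if_pos ⟨hi.1, hiu⟩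
      have hA' : coefA k j = 1 := if_pos ⟨hj.1, hju⟩
      have hB : (coefB k i : ℝ) < coefB k j := by
        exact_mod_cast coefB_lt_coefB_left hi.1 hij hju
      have hsb := h.mono.monotone (hi.2.2.1 hiu).2
      have e1 : 0 ≤ (q - cyclePoint k v a b j).2 ∧
          σ e * (q - cyclePoint k v a b j).2 ≤ (q - cyclePoint k v a b j).1 := by
        rcases hq' with rfl | ⟨g1, g2, g3⟩
        · simp
        · exact ⟨g1.le, (mul_le_mul_of_nonneg_right ho' g1.le).trans g2⟩
      have e2 : 0 < (q - cyclePoint k v a b i).2 ∧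
          σ e * (q - cyclePoint k v a b i).2 ≤ (q - cyclePoint k v a b i).1 := by
        simp only [Prod.fst_sub, Prod.snd_sub, cyclePoint_fst, cyclePoint_snd, hA, hA', h.b_dir]
          at e1 ⊢
        have h5 := mul_pos (sub_pos.2 hB) hb
        have := mul_le_mul_of_nonneg_right hsb h5.le
        constructor <;> nlinarith
      rcases hq with rfl | ⟨g1, g2, g3⟩
      · simp at e2
      · linarith [e2.2]

/-- The sides are coordinates of the plane. -/
theorem coord (h : Sides σ k sa sb a b) {α β α' β' : ℝ}
    (he : v + α • a + β • b = v + α' • a + β' • b) : α = α' ∧ β = β' := by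
  have h1 := congrArg Prod.fst he
  have h2 := congrArg Prod.snd he
  simp only [Prod.fst_add, Prod.snd_add, Prod.smul_fst, Prod.smul_snd, smul_eq_mul, h.a_dir,
    h.b_dir] at h1 h2
  have hd := sub_pos.2 (h.mono h.lt)
  have e1 : (α - α') * ((σ sb - σ sa) * a.2) = 0 := by linear_combination σ sb * h2 - h1
  have e2 : (β - β') * ((σ sb - σ sa) * b.2) = 0 := by linear_combination h1 - σ sa * h2
  have g1 := (mul_pos hd h.a_pos).ne'
  have g2 := (mul_pos hd h.b_pos).ne'
  exact ⟨sub_eq_zero.1 ((mul_eq_zero.1 e1).resolve_right g1),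
    sub_eq_zero.1 ((mul_eq_zero.1 e2).resolve_right g2)⟩

theorem exists_onEdge {i : ℕ} (hq : q ∈ segment ℝ (cyclePoint k v a b i) (cyclePoint k v a b (i + 1)))
    : ∃ α β : ℝ, OnEdge k i α β ∧ q = v + α • a + β • b := by
  obtain ⟨s, t, hs, ht, hst, rfl⟩ := hq
  refine ⟨_, _, ⟨s, t, hs, ht, hst, rfl, rfl⟩, ?_⟩
  have hv : v = s • v + t • v := by rw [← add_smul, hst, one_smul]
  nth_rewrite 3 [hv]
  simp only [cyclePoint]
  module

/-- The polygon lies in the closed strip between the two boundaries, and the regions lie strictly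
outside this strip except for their apices. So a common point is a vertex of the polygon, and the
coordinates decide which edges contain it. -/
theorem edge_terr (h : Sides σ k sa sb a b) {i j : ℕ} (hi : i < k)
    (hj : Admissible k sa sb j s e)
    (hq : q ∈ segment ℝ (cyclePoint k v a b i) (cyclePoint k v a b (i + 1)))
    (hq' : q = cyclePoint k v a b j ∨ Cone σ s e (q - cyclePoint k v a b j)) :
    q = cyclePoint k v a b j ∧ (j = i ∨ j = i + 1) := by
  obtain ⟨α, β, ho, rfl⟩ := exists_onEdge hq
  obtain ⟨hα, hα1, -, -⟩ := ho.cases h.three_le hi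
  have hd := mul_pos (sub_pos.2 (h.mono h.lt)) h.a_pos
  have hF : (v + α • a + β • b).1 - v.1 - σ sb * ((v + α • a + β • b).2 - v.2) =
      -(α * ((σ sb - σ sa) * a.2)) := by
    simp only [Prod.fst_add, Prod.snd_add, Prod.smul_fst, Prod.smul_snd, smul_eq_mul, h.a_dir,
      h.b_dir]
    ring
  have he : v + α • a + β • b = cyclePoint k v a b j := by
    rcases Nat.lt_or_ge (k / 2) j with hju | hju
    · refine (h.right_ge hj hju hq').resolve_right fun hlt => ?_
      rw [hF] at hlt
      have := mul_nonneg hα hd.le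
      linarith
    · refine (h.left_le hj hju hq').resolve_right fun hlt => ?_
      rw [hF] at hlt
      have := mul_le_mul_of_nonneg_right hα1 hd.le
      linarith
  refine ⟨he, ?_⟩
  obtain ⟨h1, h2⟩ := h.coord he
  rw [h1, h2] at ho
  exact ho.vertex h.three_le hi hj.1 hj.2.1

theorem cyclePoint_zero (h : 3 ≤ k) : cyclePoint k v a b 0 = v := by
  have h1 : coefA k 0 = 0 := if_neg (by omega)
  have h2 : coefB k 0 = 0 := by
    rw [coefB]
    split_ifs <;> omega
  rw [cyclePoint, h1, h2]
  simp

theorem cyclePoint_last (h : 3 ≤ k) : cyclePoint k v a b k = v := by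
  have h1 : coefA k k = 0 := if_neg (by omega)
  have h2 : coefB k k = 0 := by
    rw [coefB]
    split_ifs <;> omega
  rw [cyclePoint, h1, h2]
  simp

theorem edge_edge (h : Sides σ k sa sb a b) {i j : ℕ} (hij : i < j) (hj : j < k)
    (hq : q ∈ segment ℝ (cyclePoint k v a b i) (cyclePoint k v a b (i + 1)))
    (hq' : q ∈ segment ℝ (cyclePoint k v a b j) (cyclePoint k v a b (j + 1))) :
    (j = i + 1 ∧ q = cyclePoint k v a b j) ∨ (i = 0 ∧ j + 1 = k ∧ q = v) := by
  obtain ⟨α, β, ho, rfl⟩ := exists_onEdge hq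
  obtain ⟨α', β', ho', he⟩ := exists_onEdge hq'
  obtain ⟨rfl, rfl⟩ := h.coord he
  rcases ho.edge h.three_le hij hj ho' with ⟨h1, h2, h3⟩ | ⟨h1, h2, h3, h4⟩
  · left
    refine ⟨h1, ?_⟩
    rw [cyclePoint, ← h2, ← h3]
  · right
    refine ⟨h1, h2, ?_⟩
    rw [h3, h4]
    simp

end Sides

end Cactus

/-! ### The complete construction as a drawing. -/

namespace Cactus

/-- Directions with integer coordinates and integer lengths, in the order of their slopes. -/
structure Dirs (T X : ℕ) (Dx Dy : ℕ → ℕ) : Prop where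
  x_pos : ∀ i < T, 0 < Dx i
  y_pos : ∀ i < T, 0 < Dy i
  x_le : ∀ i < T, Dx i ≤ X
  y_le : ∀ i < T, Dy i ≤ X
  sorted : ∀ i j, i < j → j < T → Dx i * Dy j < Dx j * Dy i
  length : ∀ i < T, ∃ l, Dx i ^ 2 + Dy i ^ 2 = l ^ 2

/-- The slopes of the directions, continued to a strictly increasing sequence. -/
noncomputable def slope (T X : ℕ) (Dx Dy : ℕ → ℕ) (i : ℕ) : ℝ :=
  if i < T then (Dx i : ℝ) / Dy i else X + 1 + i

theorem Dirs.slope_mul {T X : ℕ} {Dx Dy : ℕ → ℕ} (h : Dirs T X Dx Dy) {i : ℕ} (hi : i < T) :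
    slope T X Dx Dy i * Dy i = Dx i := by
  have : (Dy i : ℝ) ≠ 0 := by exact_mod_cast (h.y_pos i hi).ne'
  rw [slope, if_pos hi, div_mul_cancel₀ _ this]

/-- The last interval of slots may end at `T` itself, so the cones need a value of the slope there;
monotonicity on all natural numbers avoids side conditions. -/
theorem Dirs.strictMono {T X : ℕ} {Dx Dy : ℕ → ℕ} (h : Dirs T X Dx Dy) :
    StrictMono (slope T X Dx Dy) := by
  intro i j hij
  rw [slope, slope]
  by_cases hj : j < T
  · have hi : i < T := by omega
    have h1 : (0 : ℝ) < Dy i := by exact_mod_cast h.y_pos i hi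
    have h2 : (0 : ℝ) < Dy j := by exact_mod_cast h.y_pos j hj
    rw [if_pos hi, if_pos hj, div_lt_div_iff₀ h1 h2]
    exact_mod_cast h.sorted i j hij hj
  -- The continuation exceeds every genuine slope, which is at most `X` because `Dx i ≤ X` and `Dy i
  -- ≥ 1`.
  · rw [if_neg hj]
    split_ifs with hi
    · have h1 : (1 : ℝ) ≤ Dy i := by exact_mod_cast h.y_pos i hi
      have h2 : (Dx i : ℝ) ≤ X := by exact_mod_cast h.x_le i hi
      have h3 : (Dx i : ℝ) / Dy i ≤ Dx i := div_le_self (Nat.cast_nonneg _) h1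
      have h4 : (0 : ℝ) ≤ j := Nat.cast_nonneg _
      linarith
    · have : (i : ℝ) < j := by exact_mod_cast hij
      linarith

/-- The root of the block containing the tree edge above `c`. -/
def broot (P U cyc : ℕ → ℕ) (c : ℕ) : ℕ := if cyc c = 0 then P c else U (cyc c) - 1

/-- The slot of the left side of the cycle `x`. -/
def leftSlot (U base start : ℕ → ℕ) (x : ℕ) : ℕ := start (U x - 1) + base x

/-- The slot of the right side of the cycle `x`. -/
def rightSlot (U base boff start : ℕ → ℕ) (x : ℕ) : ℕ := leftSlot U base start x + boff x

/-- The multiple of the direction of the left side: both sides of a triangle have equal height. -/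
def leftScale (U len base boff Dy start : ℕ → ℕ) (x : ℕ) : ℕ :=
  if len x = 3 then Dy (rightSlot U base boff start x) else 1

/-- The multiple of the direction of the right side. -/
def rightScale (U len base Dy start : ℕ → ℕ) (x : ℕ) : ℕ :=
  if len x = 3 then Dy (leftSlot U base start x) else 1

/-- The slots and coordinates `s`, `x`, `y` assigned to the vertex `c`. -/
def PlacedAt (P U cyc idx len rel base boff Dx Dy start px py : ℕ → ℕ) (c s x y : ℕ) : Prop :=
  (cyc c = 0 → s = start (P c) + base c ∧ x = px (P c) + Dx s ∧ y = py (P c) + Dy s) ∧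
  (cyc c ≠ 0 → s = leftSlot U base start (cyc c) + rel c ∧
    x = px (U (cyc c) - 1) + coefA (len (cyc c)) (idx c) *
      (leftScale U len base boff Dy start (cyc c) * Dx (leftSlot U base start (cyc c))) +
      coefB (len (cyc c)) (idx c) * (rightScale U len base Dy start (cyc c) *
        Dx (rightSlot U base boff start (cyc c))) ∧
    y = py (U (cyc c) - 1) + coefA (len (cyc c)) (idx c) *
      (leftScale U len base boff Dy start (cyc c) * Dy (leftSlot U base start (cyc c))) +
      coefB (len (cyc c)) (idx c) * (rightScale U len base Dy start (cyc c) *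
        Dy (rightSlot U base boff start (cyc c))))

/-- The coordinates of all vertices. -/
structure Placed (n : ℕ) (P U cyc idx len rel base boff Dx Dy start px py : ℕ → ℕ) : Prop where
  start_zero : start 0 = 0
  placed : ∀ c, 0 < c → c < n →
    PlacedAt P U cyc idx len rel base boff Dx Dy start px py c (start c) (px c) (py c)

/-- The point with the given natural coordinates. -/
noncomputable def natPoint (px py : ℕ → ℕ) (c : ℕ) : ℝ × ℝ := (px c, py c)

/-- The vertex `w` is the `m`-th one of the cycle `x`, counted from its root. -/
def OnCycle (U cyc idx len : ℕ → ℕ) (x m w : ℕ) : Prop :=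
  ((m = 0 ∨ m = len x) ∧ w = U x - 1) ∨ (cyc w = x ∧ idx w = m)

/-- The edges of the blocks. -/
def BlockEdge (n : ℕ) (P U cyc idx len : ℕ → ℕ) (b i j : ℕ) : Prop :=
  (0 < b ∧ b < n ∧ cyc b = 0 ∧ i = b ∧ j = P b) ∨
    (b < n ∧ U b ≠ 0 ∧ ∃ m < len b, OnCycle U cyc idx len b m i ∧ OnCycle U cyc idx len b (m + 1) j)

namespace Marked

variable {n : ℕ} {P U cyc idx len : ℕ → ℕ}

theorem broot_lt (h : Marked n P U cyc idx len) {c : ℕ} (h0 : 0 < c) (hn : c < n) :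
    broot P U cyc c < c := by
  rw [broot]
  split_ifs with hc
  · exact h.tree.parent_lt c h0 hn
  · have := h.cover c hc
    omega

theorem broot_bid (h : Marked n P U cyc idx len) (c : ℕ) :
    broot P U cyc (bid cyc c) = broot P U cyc c := by
  by_cases hc : cyc c = 0
  · rw [bid_of_bridge hc]
  · obtain ⟨h1, h2, -⟩ := h.cover c hc
    rw [bid_of_cycle hc, broot, broot, (h.bottom _ h1 h2).1, if_neg hc, if_neg hc]

theorem exists_isTop (h : Marked n P U cyc idx len) {c : ℕ} (h0 : 0 < c) (hn : c < n) :
    ∃ w, IsTop n P U cyc w ∧ bid cyc w = bid cyc c ∧ P w = broot P U cyc c := by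
  by_cases hc : cyc c = 0
  · exact ⟨c, ⟨h0, hn, Or.inl hc⟩, rfl, (if_pos hc).symm⟩
  · obtain ⟨w, hw, hw'⟩ := h.exists_top hc
    have hwc : cyc w ≠ 0 := hw ▸ hc
    refine ⟨w, ⟨h.pos hwc, h.lt hwc, Or.inr (hw ▸ hw')⟩, ?_, ?_⟩
    · rw [bid_of_cycle hc, bid_of_cycle hwc, hw]
    · rw [broot, if_neg hc]
      omega

theorem onCycle_unique (h : Marked n P U cyc idx len) {x m w w' : ℕ} (hx : x < n) (hU : U x ≠ 0)
    (hw : OnCycle U cyc idx len x m w) (hw' : OnCycle U cyc idx len x m w') : w = w' := by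
  have hx0 : x ≠ 0 := by
    have := h.tree.up_lt x hx hU
    omega
  have aux : ∀ w, cyc w = x → 1 ≤ idx w ∧ idx w < len x := by
    intro w hw
    have hwc : cyc w ≠ 0 := hw ▸ hx0
    have h1 := (h.cover w hwc).2.2.2.2
    have h2 := h.idx_lt_len hwc
    rw [hw] at h2
    omega
  rcases hw with ⟨h1, h2⟩ | ⟨h1, h2⟩
  · rcases hw' with ⟨h3, h4⟩ | ⟨h3, h4⟩
    · rw [h2, h4]
    · have := aux w' h3
      omega
  · rcases hw' with ⟨h3, h4⟩ | ⟨h3, h4⟩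
    · have := aux w h1
      omega
    · exact h.inj w w' (h1 ▸ hx0) (h1.trans h3.symm) (h2.trans h4.symm)

theorem onCycle_mem (h : Marked n P U cyc idx len) {x m w : ℕ} (hx : x < n) (hU : U x ≠ 0)
    (hw : OnCycle U cyc idx len x m w) :
    w = broot P U cyc x ∨ 0 < w ∧ w < n ∧ bid cyc w = x := by
  have hx0 : x ≠ 0 := by
    have := h.tree.up_lt x hx hU
    omega
  rcases hw with ⟨-, h2⟩ | ⟨h1, h2⟩
  · left
    rw [broot, (h.bottom x hx hU).1, if_neg hx0, h2]
  · right
    have hwc : cyc w ≠ 0 := h1 ▸ hx0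
    exact ⟨h.pos hwc, h.lt hwc, by rw [bid_of_cycle hwc, h1]⟩

theorem blockEdge_parent (h : Marked n P U cyc idx len) {c : ℕ} (h0 : 0 < c) (hn : c < n) :
    BlockEdge n P U cyc idx len (bid cyc c) c (P c) := by
  by_cases hc : cyc c = 0
  · rw [bid_of_bridge hc]
    exact Or.inl ⟨h0, hn, hc, rfl, rfl⟩
  · rw [bid_of_cycle hc]
    obtain ⟨h1, h2, -⟩ := h.cover c hc
    refine Or.inr ⟨h1, h2, idx c, h.idx_lt_len hc, Or.inr ⟨rfl, rfl⟩, ?_⟩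
    by_cases hp : P c + 1 = U (cyc c)
    · exact Or.inl ⟨Or.inr (h.top c hc hp).symm, by omega⟩
    · exact Or.inr (h.step c hc hp)

theorem blockEdge_up (h : Marked n P U cyc idx len) {x : ℕ} (hn : x < n) (hU : U x ≠ 0) :
    BlockEdge n P U cyc idx len x (U x - 1) x := by
  obtain ⟨h1, h2⟩ := h.bottom x hn hU
  have hx : cyc x ≠ 0 := by
    have := h.tree.up_lt x hn hU
    omega
  have h3 := h.three_le_len hx
  rw [h1] at h3
  exact Or.inr ⟨hn, hU, 0, by omega, Or.inl ⟨Or.inl rfl, rfl⟩, Or.inr ⟨h1, h2⟩⟩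

end Marked

/-- All data of the construction. -/
structure Construction (n T X : ℕ) (P U cyc idx len size rel base boff tot Dx Dy start px py : ℕ → ℕ) :
    Prop where
  marked : Marked n P U cyc idx len
  slotted : Slotted n P U cyc idx len size rel base boff tot
  size_le : size 0 ≤ T
  dirs : Dirs T X Dx Dy
  placed : Placed n P U cyc idx len rel base boff Dx Dy start px py

namespace Construction

variable {n T X : ℕ} {P U cyc idx len size rel base boff tot Dx Dy start px py : ℕ → ℕ}

/-- The interval of a vertex is contained in that of its block, and the latter in the interval of
the root of the block. Iterating this from the root of the tree keeps all slots below `T`. -/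
theorem start_le (h : Construction n T X P U cyc idx len size rel base boff tot Dx Dy start px py)
    {c : ℕ} (h0 : 0 < c) (hn : c < n) :
    start (broot P U cyc c) + base (bid cyc c) ≤ start c ∧
      start c + size c ≤ start (broot P U cyc c) + base (bid cyc c) + tot (bid cyc c) ∧
      base (bid cyc c) + tot (bid cyc c) ≤ size (broot P U cyc c) := by
  obtain ⟨w, hw, hwb, hwp⟩ := h.marked.exists_isTop h0 hn
  have hfit := h.slotted.fit w hw
  rw [hwb, hwp] at hfit
  obtain ⟨p1, p2⟩ := h.placed.placed c h0 hn
  by_cases hc : cyc c = 0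
  · obtain ⟨h1, -, -⟩ := p1 hc
    have h2 := (h.slotted.bridge c h0 hn hc).2
    rw [broot, if_pos hc, bid_of_bridge hc] at *
    omega
  · obtain ⟨h1, -, -⟩ := p2 hc
    rw [leftSlot] at h1
    have h2 := h.slotted.le_tot c hc
    rw [broot, if_neg hc, bid_of_cycle hc] at *
    omega

theorem start_add_size_le
    (h : Construction n T X P U cyc idx len size rel base boff tot Dx Dy start px py) (c : ℕ)
    (hn : c < n) : start c + size c ≤ T := by
  induction c using Nat.strong_induction_on with
  | _ c ih =>
    rcases Nat.eq_zero_or_pos c with rfl | h0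
    · have := h.placed.start_zero
      have := h.size_le
      omega
    · have hB := h.marked.broot_lt h0 hn
      have h1 := ih _ hB (by omega)
      have h2 := h.start_le h0 hn
      omega

theorem slots_lt (h : Construction n T X P U cyc idx len size rel base boff tot Dx Dy start px py)
    {x : ℕ} (hx : x < n) (hU : U x ≠ 0) :
    leftSlot U base start x < rightSlot U base boff start x ∧
      rightSlot U base boff start x < leftSlot U base start x + tot x ∧
      leftSlot U base start x + tot x ≤ T := by
  obtain ⟨h1, -⟩ := h.marked.bottom x hx hU
  have hlt := h.marked.tree.up_lt x hx hU
  have hc : cyc x ≠ 0 := by omega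
  have h2 := h.slotted.boff_lt x hc
  have h3 := h.slotted.boff_pos x hc
  have h4 := h.start_le (c := x) (by omega) hx
  have h5 := h.start_add_size_le (U x - 1) (by omega)
  rw [h1] at h2 h3
  rw [broot, if_neg hc, bid_of_cycle hc, h1] at h4
  rw [rightSlot, leftSlot]
  omega

theorem sides (h : Construction n T X P U cyc idx len size rel base boff tot Dx Dy start px py)
    {x : ℕ} (hx : x < n) (hU : U x ≠ 0) :
    Sides (slope T X Dx Dy) (len x) (leftSlot U base start x) (rightSlot U base boff start x)
      ((leftScale U len base boff Dy start x : ℝ) • natPoint Dx Dy (leftSlot U base start x))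
      ((rightScale U len base Dy start x : ℝ) •
        natPoint Dx Dy (rightSlot U base boff start x)) := by
  obtain ⟨h1, h2, h3⟩ := h.slots_lt hx hU
  obtain ⟨h4, -⟩ := h.marked.bottom x hx hU
  have hlt := h.marked.tree.up_lt x hx hU
  have hlen := h.marked.three_le_len (c := x) (by omega)
  rw [h4] at hlen
  have ya := h.dirs.y_pos (leftSlot U base start x) (by omega)
  have yb := h.dirs.y_pos (rightSlot U base boff start x) (by omega)
  have ma : 0 < leftScale U len base boff Dy start x := by
    rw [leftScale]
    split_ifs
    · exact yb
    · exact one_pos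
  have mb : 0 < rightScale U len base Dy start x := by
    rw [rightScale]
    split_ifs
    · exact ya
    · exact one_pos
  refine ⟨h.dirs.strictMono, hlen, h1, ?_, ?_, ?_, ?_⟩ <;>
    simp only [natPoint, Prod.smul_fst, Prod.smul_snd, smul_eq_mul]
  · exact_mod_cast Nat.mul_pos ma ya
  · rw [mul_left_comm, h.dirs.slope_mul (by omega)]
  · exact_mod_cast Nat.mul_pos mb yb
  · rw [mul_left_comm, h.dirs.slope_mul (by omega)]

theorem onCycle_point
    (h : Construction n T X P U cyc idx len size rel base boff tot Dx Dy start px py)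
    {x m w : ℕ} (hx : x < n) (hU : U x ≠ 0) (hw : OnCycle U cyc idx len x m w) :
    natPoint px py w = cyclePoint (len x) (natPoint px py (U x - 1))
      ((leftScale U len base boff Dy start x : ℝ) • natPoint Dx Dy (leftSlot U base start x))
      ((rightScale U len base Dy start x : ℝ) •
        natPoint Dx Dy (rightSlot U base boff start x)) m := by
  have h3 := (h.sides hx hU).three_le
  rcases hw with ⟨rfl | rfl, rfl⟩ | ⟨h1, h2⟩
  · rw [Sides.cyclePoint_zero h3]
  · rw [Sides.cyclePoint_last h3]
  · have hx0 : x ≠ 0 := by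
      have := h.marked.tree.up_lt x hx hU
      omega
    have hwc : cyc w ≠ 0 := h1 ▸ hx0
    obtain ⟨-, e1, e2⟩ := (h.placed.placed w (h.marked.pos hwc) (h.marked.lt hwc)).2 hwc
    rw [h1, h2] at e1 e2
    refine Prod.ext ?_ ?_
    · rw [cyclePoint_fst, natPoint, e1]
      simp only [natPoint, Prod.smul_fst, smul_eq_mul]
      push_cast
      ring
    · rw [cyclePoint_snd, natPoint, e2]
      simp only [natPoint, Prod.smul_snd, smul_eq_mul]
      push_cast
      ring

theorem admissible
    (h : Construction n T X P U cyc idx len size rel base boff tot Dx Dy start px py)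
    {c : ℕ} (hc : cyc c ≠ 0) :
    Admissible (len (cyc c)) (leftSlot U base start (cyc c)) (rightSlot U base boff start (cyc c))
      (idx c) (start c) (start c + size c) := by
  obtain ⟨e, -, -⟩ := (h.placed.placed c (h.marked.pos hc) (h.marked.lt hc)).2 hc
  have h1 := (h.marked.cover c hc).2.2.2.2
  have h2 := h.marked.idx_lt_len hc
  have h3 := h.slotted.rel_pos c hc
  refine ⟨h1, h2, fun hle => ?_, fun hlt => ?_⟩
  · have := h.slotted.left c hc hle
    rw [rightSlot]
    omega
  · have := h.slotted.right c hc hlt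
    rw [rightSlot]
    omega

theorem layout (h : Construction n T X P U cyc idx len size rel base boff tot Dx Dy start px py) :
    Layout (slope T X Dx Dy) n (broot P U cyc) (bid cyc) start size
      (fun b => start (broot P U cyc b) + base b)
      (fun b => start (broot P U cyc b) + base b + tot b) (natPoint px py) where
  mono := h.dirs.strictMono
  root_lt c h0 hn := h.marked.broot_lt h0 hn
  root_eq c c' _ _ _ _ he := by rw [← h.marked.broot_bid c, he, h.marked.broot_bid]
  lo_ge c h0 hn := by
    simp only [h.marked.broot_bid]
    omega
  hi_le c h0 hn := by
    simp only [h.marked.broot_bid]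
    have := h.start_le h0 hn
    omega
  lo_le c h0 hn := by
    simp only [h.marked.broot_bid]
    exact (h.start_le h0 hn).1
  hi_ge c h0 hn := by
    simp only [h.marked.broot_bid]
    exact (h.start_le h0 hn).2.1
  disj c c' h0 hn h0' hn' hB hb := by
    simp only [h.marked.broot_bid, hB]
    obtain ⟨w, hw, hwb, hwp⟩ := h.marked.exists_isTop h0 hn
    obtain ⟨w', hw', hwb', hwp'⟩ := h.marked.exists_isTop h0' hn'
    have hne : w ≠ w' := by
      rintro rfl
      exact hb (hwb.symm.trans hwb')
    have := h.slotted.disj w w' hw hw' hne (by rw [hwp, hwp', hB])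
    rw [hwb, hwb'] at this
    omega
  mem_cone c h0 hn := by
    simp only [h.marked.broot_bid]
    by_cases hc : cyc c = 0
    -- A bridge has the direction of the first slot of its block. The cones are closed at the lower
    -- end and open at the upper end, so this direction belongs to the cone.
    · obtain ⟨e1, e2, e3⟩ := (h.placed.placed c h0 hn).1 hc
      obtain ⟨h1, h2⟩ := h.slotted.bridge c h0 hn hc
      have h3 := h.start_add_size_le c hn
      rw [bid_of_bridge hc, broot, if_pos hc, ← e1, h2]
      have hx : (natPoint px py c - natPoint px py (P c)).1 = Dx (start c) := by
        simp only [natPoint, Prod.fst_sub, e2]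
        push_cast
        ring
      have hy : (natPoint px py c - natPoint px py (P c)).2 = Dy (start c) := by
        simp only [natPoint, Prod.snd_sub, e3]
        push_cast
        ring
      have hpos : (0 : ℝ) < Dy (start c) := by exact_mod_cast h.dirs.y_pos (start c) (by omega)
      have hs := h.dirs.slope_mul (i := start c) (by omega)
      refine ⟨?_, ?_, ?_⟩ <;> rw [hy]
      · exact hpos
      · rw [hx, hs]
      · rw [hx, ← hs]
        exact mul_lt_mul_of_pos_right (h.dirs.strictMono (by omega)) hpos
    · obtain ⟨h1, h2, -⟩ := h.marked.cover c hc
      obtain ⟨h3, h4, -⟩ := h.slots_lt h1 h2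
      rw [bid_of_cycle hc, broot, if_neg hc, h.onCycle_point h1 h2 (Or.inr ⟨rfl, rfl⟩)]
      exact (h.sides h1 h2).mem_cone le_rfl h4 (h.marked.cover c hc).2.2.2.2
        (h.marked.idx_lt_len hc)
  terr_disj c c' h0 hn h0' hn' hne hb q hq hq' := by
    by_cases hc : cyc c = 0
    · exact hne (h.marked.bid_eq_bid hb hc)
    · have hcc := h.marked.cyc_eq_of_bid_eq hb
      have hc' : cyc c' ≠ 0 := hcc ▸ hc
      obtain ⟨h1, h2, -⟩ := h.marked.cover c hc
      have e := h.placed.placed c h0 hn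
      have e := (e.2 hc).1
      have e' := h.placed.placed c' h0' hn'
      have e' := (e'.2 hc').1
      rw [Terr, Set.mem_ofPred_eq, h.onCycle_point h1 h2 (Or.inr ⟨rfl, rfl⟩)] at hq
      rw [Terr, Set.mem_ofPred_eq, h.onCycle_point h1 h2 (Or.inr ⟨hcc.symm, rfl⟩)] at hq'
      have ha := h.admissible hc
      have ha' := h.admissible hc'
      rw [← hcc] at ha' e'
      rcases lt_trichotomy (idx c) (idx c') with hlt | heq | hlt
      · have ho := h.slotted.order c c' hc hcc hlt
        exact (h.sides h1 h2).terr_disj ha ha' hlt (by omega) hq hq'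
      · exact hne (h.marked.inj c c' hc hcc heq)
      · have ho := h.slotted.order c' c hc' hcc.symm hlt
        exact (h.sides h1 h2).terr_disj ha' ha hlt (by omega) hq' hq

theorem drawing (h : Construction n T X P U cyc idx len size rel base boff tot Dx Dy start px py) :
    Drawing (slope T X Dx Dy) n (broot P U cyc) (bid cyc) start size
      (fun b => start (broot P U cyc b) + base b)
      (fun b => start (broot P U cyc b) + base b + tot b) (natPoint px py)
      (BlockEdge n P U cyc idx len) where
  layout := h.layout
  edge b i j hE := by
    rcases hE with ⟨h0, hn, hc, rfl, rfl⟩ | ⟨hn, hU, m, hm, hi, hj⟩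
    · exact ⟨(h.marked.tree.parent_lt _ h0 hn).ne', i, h0, hn, bid_of_bridge hc,
        Or.inr ⟨h0, hn, bid_of_bridge hc⟩, Or.inl (by rw [broot, if_pos hc])⟩
    · obtain ⟨hb, -⟩ := h.marked.bottom b hn hU
      have hlt := h.marked.tree.up_lt b hn hU
      have hbid : bid cyc b = b := by rw [bid_of_cycle (by omega), hb]
      refine ⟨?_, b, by omega, hn, hbid, h.marked.onCycle_mem hn hU hi,
        h.marked.onCycle_mem hn hU hj⟩
      rintro rfl
      have h3 := (h.sides hn hU).three_le
      have hcov := h.marked.cover i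
      rcases hi with ⟨h1, h2⟩ | ⟨h1, h2⟩ <;> rcases hj with ⟨h4, h5⟩ | ⟨h4, h5⟩
      · omega
      · rw [h4] at hcov
        have := hcov (by omega)
        omega
      · rw [h1] at hcov
        have := hcov (by omega)
        omega
      · omega
  edge_terr b i j w q hE h0 hn hb hq hqw := by
    rcases hE with ⟨b0, bn, hc, rfl, rfl⟩ | ⟨bn, hU, m, hm, hi, hj⟩
    · have hw : i = w := h.marked.bid_eq_bid (hb.trans (bid_of_bridge hc).symm).symm hc
      subst hw
      refine ⟨?_, Or.inl rfl⟩
      rcases hqw with hqw | hqw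
      · exact hqw
      -- The points of the bridge are not higher than its lower end in the tree, which is the upper
      -- end in the plane, whereas the cone at this end lies strictly above it.
      · exfalso
        obtain ⟨s, t, hs, ht, hst, rfl⟩ := hq
        have h1 := hqw.1
        obtain ⟨-, -, e3⟩ := (h.placed.placed i h0 hn).1 hc
        simp only [natPoint, Prod.snd_sub, Prod.snd_add, Prod.smul_snd, smul_eq_mul, e3] at h1
        push_cast at h1
        have h2 : (0 : ℝ) ≤ t * Dy (start i) := by positivity
        have h3 : s = 1 - t := by linarith
        rw [h3] at h1
        linarith
    · have hwc : cyc w = b := by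
        obtain ⟨hb', -⟩ := h.marked.bottom b bn hU
        have hlt := h.marked.tree.up_lt b bn hU
        rw [← hb']
        exact h.marked.cyc_eq_of_bid_eq (by rw [hb, bid_of_cycle (by omega), hb'])
      have hw0 : cyc w ≠ 0 := by
        have hlt := h.marked.tree.up_lt b bn hU
        omega
      have hwv : OnCycle U cyc idx len b (idx w) w := Or.inr ⟨hwc, rfl⟩
      rw [h.onCycle_point bn hU hi, h.onCycle_point bn hU hj] at hq
      rw [Terr, Set.mem_ofPred_eq, h.onCycle_point bn hU hwv] at hqw
      have ha := h.admissible hw0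
      rw [hwc] at ha
      obtain ⟨h1, h2⟩ := (h.sides bn hU).edge_terr hm ha hq hqw
      refine ⟨by rw [h1, h.onCycle_point bn hU hwv], ?_⟩
      rcases h2 with h2 | h2
      · rw [h2] at hwv
        exact Or.inl (h.marked.onCycle_unique bn hU hwv hi)
      · rw [h2] at hwv
        exact Or.inr (h.marked.onCycle_unique bn hU hwv hj)
  edge_edge b i j i' j' q hE hE' hne hq hq' := by
    rcases hE with ⟨b0, bn, hc, rfl, rfl⟩ | ⟨bn, hU, m, hm, hi, hj⟩
    · rcases hE' with ⟨-, -, -, rfl, rfl⟩ | ⟨bn', hU', -⟩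
      · exact absurd rfl hne
      · have := (h.marked.bottom i bn' hU').1
        omega
    rcases hE' with ⟨b0, -, hc, -⟩ | ⟨-, -, m', hm', hi', hj'⟩
    · have := (h.marked.bottom b bn hU).1
      omega
    have key : ∀ m m' i j i' j', m < m' → m' < len b → OnCycle U cyc idx len b m i →
        OnCycle U cyc idx len b (m + 1) j → OnCycle U cyc idx len b m' i' →
        OnCycle U cyc idx len b (m' + 1) j' →
        q ∈ segment ℝ (natPoint px py i) (natPoint px py j) →
        q ∈ segment ℝ (natPoint px py i') (natPoint px py j') →
        ∃ w, (w = i ∨ w = j) ∧ (w = i' ∨ w = j') ∧ q = natPoint px py w := by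
      intro m m' i j i' j' hlt hm' hi hj hi' hj' hq hq'
      rw [h.onCycle_point bn hU hi, h.onCycle_point bn hU hj] at hq
      rw [h.onCycle_point bn hU hi', h.onCycle_point bn hU hj'] at hq'
      rcases (h.sides bn hU).edge_edge hlt hm' hq hq' with ⟨rfl, h2⟩ | ⟨rfl, h2, h3⟩
      · refine ⟨j, Or.inr rfl, Or.inl (h.marked.onCycle_unique bn hU hj hi'), ?_⟩
        rw [h2, h.onCycle_point bn hU hj]
      · refine ⟨U b - 1, Or.inl ?_, Or.inr ?_, h3⟩
        · exact h.marked.onCycle_unique bn hU (Or.inl ⟨Or.inl rfl, rfl⟩) hi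
        · rw [h2] at hj'
          exact h.marked.onCycle_unique bn hU (Or.inl ⟨Or.inr rfl, rfl⟩) hj'
    rcases lt_trichotomy m m' with hlt | rfl | hlt
    · exact key m m' i j i' j' hlt hm' hi hj hi' hj' hq hq'
    · refine absurd ?_ hne
      rw [h.marked.onCycle_unique bn hU hi hi', h.marked.onCycle_unique bn hU hj hj']
    · obtain ⟨w, h1, h2, h3⟩ := key m' m i' j' i j hlt hm hi' hj' hi hj hq' hq
      exact ⟨w, h2, h1, h3⟩

end Construction

end Cactus

/-! ### Integer lengths and the transfer to the Euclidean plane. -/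

namespace Cactus

/-- Along an edge of the polygon only one of the two coefficients changes, except on the third side
of a triangle. The edge is then an integer multiple of a Pythagorean vector. -/
theorem coef_step {k m : ℕ} (hk : 3 ≤ k) (hm : m < k) (h : k ≠ 3 ∨ m ≠ 1) :
    coefA k m = coefA k (m + 1) ∨ coefB k m = coefB k (m + 1) := by
  rcases Nat.eq_zero_or_pos m with rfl | h0
  · right
    rw [coefB, coefB]
    split_ifs <;> omega
  rcases lt_trichotomy m (k / 2) with h1 | h1 | h1
  · left
    rw [coefA, coefA, if_pos ⟨h0, h1.le⟩, if_pos ⟨by omega, h1⟩]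
  · right
    have h3 : k ≠ 3 := by omega
    rw [coefB_of_gt h3 (show k / 2 < m + 1 by omega), h1, coefB_mid h3]
    omega
  · left
    rw [coefA, coefA, if_neg (by omega), if_neg (by omega)]

theorem exists_sq_of_multiple {x y : ℕ} (h : ∃ l, x ^ 2 + y ^ 2 = l ^ 2) (c : ℤ) {u w : ℝ}
    (hu : u = c * x) (hw : w = c * y) : ∃ l : ℕ, u ^ 2 + w ^ 2 = (l : ℝ) ^ 2 := by
  obtain ⟨l, hl⟩ := h
  refine ⟨c.natAbs * l, ?_⟩
  have hl' : (x : ℝ) ^ 2 + (y : ℝ) ^ 2 = (l : ℝ) ^ 2 := by exact_mod_cast hl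
  have hc : ((c.natAbs : ℕ) : ℝ) ^ 2 = (c : ℝ) ^ 2 := by
    rw [Nat.cast_natAbs, Int.cast_abs, sq_abs]
  rw [hu, hw, Nat.cast_mul, mul_pow, mul_pow, mul_pow, hc, ← mul_add, hl']

namespace Construction

variable {n T X : ℕ} {P U cyc idx len size rel base boff tot Dx Dy start px py : ℕ → ℕ}

theorem exists_length
    (h : Construction n T X P U cyc idx len size rel base boff tot Dx Dy start px py)
    {b i j : ℕ} (hE : BlockEdge n P U cyc idx len b i j) :
    ∃ l : ℕ, ((natPoint px py i).1 - (natPoint px py j).1) ^ 2 +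
      ((natPoint px py i).2 - (natPoint px py j).2) ^ 2 = (l : ℝ) ^ 2 := by
  rcases hE with ⟨h0, hn, hc, rfl, rfl⟩ | ⟨bn, hU, m, hm, hi, hj⟩
  · obtain ⟨e1, e2, e3⟩ := (h.placed.placed i h0 hn).1 hc
    obtain ⟨h1, h2⟩ := h.slotted.bridge i h0 hn hc
    have h3 := h.start_add_size_le i hn
    refine exists_sq_of_multiple (h.dirs.length (start i) (by omega)) 1 ?_ ?_
    · simp only [natPoint, e2]
      push_cast
      ring
    · simp only [natPoint, e3]
      push_cast
      ring
  · obtain ⟨h1, h2, h3⟩ := h.slots_lt bn hU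
    have hk := (h.sides bn hU).three_le
    rw [h.onCycle_point bn hU hi, h.onCycle_point bn hU hj]
    simp only [cyclePoint_fst, cyclePoint_snd, natPoint, Prod.smul_fst, Prod.smul_snd, smul_eq_mul]
    by_cases h31 : len b = 3 ∧ m = 1
    -- Each side of the triangle is scaled by the height of the other direction. Both sides end at
    -- the same height, so the third side is horizontal with an integer length.
    · obtain ⟨hl, rfl⟩ := h31
      rw [leftScale, if_pos hl, rightScale, if_pos hl, hl]
      simp only [coefA, coefB]
      norm_num
      refine ⟨((Dy (rightSlot U base boff start b) * Dx (leftSlot U base start b) : ℤ) -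
        Dy (leftSlot U base start b) * Dx (rightSlot U base boff start b)).natAbs, ?_⟩
      rw [Nat.cast_natAbs, Int.cast_abs, sq_abs]
      push_cast
      ring
    · rcases coef_step hk hm (by omega) with he | he
      · refine exists_sq_of_multiple (h.dirs.length (rightSlot U base boff start b) (by omega))
          (((coefB (len b) m : ℤ) - coefB (len b) (m + 1)) * rightScale U len base Dy start b)
          ?_ ?_
        · rw [he]
          push_cast
          ring
        · rw [he]
          push_cast
          ring
      · refine exists_sq_of_multiple (h.dirs.length (leftSlot U base start b) (by omega))
          (((coefA (len b) m : ℤ) - coefA (len b) (m + 1)) * leftScale U len base boff Dy start b)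
          ?_ ?_
        · rw [he]
          push_cast
          ring
        · rw [he]
          push_cast
          ring

end Construction

theorem toPlane_mem_segment {x y : ℤ × ℤ} {q : EuclideanSpace ℝ (Fin 2)}
    (h : q ∈ segment ℝ (toPlane x) (toPlane y)) :
    ((q 0, q 1) : ℝ × ℝ) ∈ segment ℝ ((x.1 : ℝ), (x.2 : ℝ)) ((y.1 : ℝ), (y.2 : ℝ)) := by
  obtain ⟨s, t, hs, ht, hst, rfl⟩ := h
  refine ⟨s, t, hs, ht, hst, ?_⟩
  simp [toPlane]

theorem eq_toPlane {z : ℤ × ℤ} {q : EuclideanSpace ℝ (Fin 2)}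
    (h : ((q 0, q 1) : ℝ × ℝ) = ((z.1 : ℝ), (z.2 : ℝ))) : q = toPlane z := by
  have h1 := congrArg Prod.fst h
  have h2 := congrArg Prod.snd h
  ext i
  fin_cases i
  · simpa [toPlane] using h1
  · simpa [toPlane] using h2

theorem Construction.isTrulyIntegralFary {V : Type*} [Finite V] {G : SimpleGraph V} {lab : ℕ → V}
    {n T X : ℕ} {P U cyc idx len size rel base boff tot Dx Dy start px py : ℕ → ℕ}
    (h : Construction n T X P U cyc idx len size rel base boff tot Dx Dy start px py)
    (hG : IsCactus G) (hp : IsPalmTree G n lab P U) {p : V → ℤ × ℤ}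
    (hpos : ∀ i < n, p (lab i) = ((px i : ℤ), (py i : ℤ))) : IsTrulyIntegralFary G p := by
  have hpt : ∀ i < n, (((p (lab i)).1 : ℝ), ((p (lab i)).2 : ℝ)) = natPoint px py i := by
    intro i hi
    rw [hpos i hi, natPoint]
    simp
  have hedge : ∀ i j, i < n → j < n → G.Adj (lab i) (lab j) →
      ∃ b, BlockEdge n P U cyc idx len b i j ∨ BlockEdge n P U cyc idx len b j i := by
    have aux : ∀ i j, i < j → j < n → G.Adj (lab i) (lab j) →
        ∃ b, BlockEdge n P U cyc idx len b i j ∨ BlockEdge n P U cyc idx len b j i := by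
      intro i j hij hj hadj
      rcases hp.eq_parent_or_eq_up hG hij hj hadj with rfl | he
      · exact ⟨_, Or.inr (h.marked.blockEdge_parent (by omega) hj)⟩
      · have := h.marked.blockEdge_up hj (by omega)
        rw [he, Nat.add_sub_cancel] at this
        exact ⟨_, Or.inl this⟩
    intro i j hi hj hadj
    rcases lt_trichotomy i j with hlt | rfl | hlt
    · exact aux i j hlt hj hadj
    · exact absurd hadj (G.loopless.irrefl _)
    · obtain ⟨b, hb⟩ := aux j i hlt hi hadj.symm
      exact ⟨b, hb.symm⟩
  have hd := h.drawing
  refine ⟨?_, ?_, ?_, ?_⟩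
  · intro u v huv
    obtain ⟨i, hi, rfl⟩ := hp.surj u
    obtain ⟨j, hj, rfl⟩ := hp.surj v
    have : natPoint px py i = natPoint px py j := by rw [← hpt i hi, ← hpt j hj, huv]
    rw [hd.layout.injective hi hj this]
  · intro u v hadj
    obtain ⟨i, hi, rfl⟩ := hp.surj u
    obtain ⟨j, hj, rfl⟩ := hp.surj v
    have hl : ∃ l : ℕ, ((natPoint px py i).1 - (natPoint px py j).1) ^ 2 +
        ((natPoint px py i).2 - (natPoint px py j).2) ^ 2 = (l : ℝ) ^ 2 := by
      obtain ⟨b, hb | hb⟩ := hedge i j hi hj hadj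
      · exact h.exists_length hb
      · obtain ⟨l, hl⟩ := h.exists_length hb
        refine ⟨l, ?_⟩
        rw [← hl]
        ring
    obtain ⟨l, hl⟩ := hl
    refine ⟨l, ?_⟩
    rw [EuclideanSpace.dist_eq, Fin.sum_univ_two, Real.dist_eq, Real.dist_eq, sq_abs, sq_abs]
    rw [← hpt i hi, ← hpt j hj] at hl
    rw [show (toPlane (p (lab i))) 0 = ((p (lab i)).1 : ℝ) from rfl,
      show (toPlane (p (lab i))) 1 = ((p (lab i)).2 : ℝ) from rfl,
      show (toPlane (p (lab j))) 0 = ((p (lab j)).1 : ℝ) from rfl,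
      show (toPlane (p (lab j))) 1 = ((p (lab j)).2 : ℝ) from rfl, hl]
    exact Real.sqrt_sq (Nat.cast_nonneg l)
  · intro u v w hadj hwu hwv hmem
    obtain ⟨i, hi, rfl⟩ := hp.surj u
    obtain ⟨j, hj, rfl⟩ := hp.surj v
    obtain ⟨k, hk, rfl⟩ := hp.surj w
    have hm := toPlane_mem_segment hmem
    rw [hpt i hi, hpt j hj, show ((toPlane (p (lab k)) 0, toPlane (p (lab k)) 1) : ℝ × ℝ) =
      natPoint px py k from hpt k hk] at hm
    have h1 : k ≠ i := fun he => hwu (by rw [he])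
    have h2 : k ≠ j := fun he => hwv (by rw [he])
    obtain ⟨b, hb | hb⟩ := hedge i j hi hj hadj
    · exact hd.vertex_off_edge hb hk h1 h2 hm
    · rw [segment_symm] at hm
      exact hd.vertex_off_edge hb hk h2 h1 hm
  · intro u v x y hadj hadj' hne q hq hq'
    obtain ⟨i, hi, rfl⟩ := hp.surj u
    obtain ⟨j, hj, rfl⟩ := hp.surj v
    obtain ⟨i', hi', rfl⟩ := hp.surj x
    obtain ⟨j', hj', rfl⟩ := hp.surj y
    have hq := toPlane_mem_segment hq
    have hq' := toPlane_mem_segment hq'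
    rw [hpt i hi, hpt j hj] at hq
    rw [hpt i' hi', hpt j' hj'] at hq'
    have hne' : s(i, j) ≠ s(i', j') := by
      intro he
      apply hne
      have := congrArg (Sym2.map lab) he
      simpa using this
    have key : ∃ w, (w = i ∨ w = j) ∧ (w = i' ∨ w = j') ∧ (q 0, q 1) = natPoint px py w := by
      obtain ⟨b, hb | hb⟩ := hedge i j hi hj hadj <;>
        obtain ⟨b', hb' | hb'⟩ := hedge i' j' hi' hj' hadj'
      · exact hd.crossing_free hb hb' hne' hq hq'
      · rw [segment_symm] at hq'
        rw [Sym2.eq_swap (a := i')] at hne'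
        obtain ⟨w, h1, h2, h3⟩ := hd.crossing_free hb hb' hne' hq hq'
        exact ⟨w, h1, h2.symm, h3⟩
      · rw [segment_symm] at hq
        rw [Sym2.eq_swap (a := i)] at hne'
        obtain ⟨w, h1, h2, h3⟩ := hd.crossing_free hb hb' hne' hq hq'
        exact ⟨w, h1.symm, h2, h3⟩
      · rw [segment_symm] at hq hq'
        rw [Sym2.eq_swap (a := i), Sym2.eq_swap (a := i')] at hne'
        obtain ⟨w, h1, h2, h3⟩ := hd.crossing_free hb hb' hne' hq hq'
        exact ⟨w, h1.symm, h2.symm, h3⟩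
    obtain ⟨w, h1, h2, h3⟩ := key
    refine ⟨lab w, h1.imp (congrArg lab) (congrArg lab), h2.imp (congrArg lab) (congrArg lab), ?_⟩
    refine eq_toPlane ?_
    rw [h3, hpt w (by omega)]

end Cactus

/-! ### The size of the coordinates. -/

namespace Cactus

/-- Sum of the weights `w` on the way to the root in the tree given by `B`. -/
def level (B w : ℕ → ℕ) (c : ℕ) : ℕ := if B c < c then level B w (B c) + w c else 0
termination_by c

/-- The distance of `c` from the root of its block. -/
def blockDist (cyc idx len : ℕ → ℕ) (c : ℕ) : ℕ :=
  if cyc c = 0 then 1 else min (idx c) (len (cyc c) - idx c)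

namespace Marked

variable {n : ℕ} {P U cyc idx len : ℕ → ℕ}

theorem level_eq (h : Marked n P U cyc idx len) {c : ℕ} (h0 : 0 < c) (hn : c < n) :
    level (broot P U cyc) (blockDist cyc idx len) c =
      level (broot P U cyc) (blockDist cyc idx len) (broot P U cyc c) +
        blockDist cyc idx len c := by
  conv_lhs => rw [level]
  rw [if_pos (h.broot_lt h0 hn)]

/-- Along a tree edge inside a cycle the cyclic distance from the cycle's root changes by at most
one, and along a bridge the level changes by exactly one. With the same property of back edges the
level becomes a Lipschitz potential and is bounded by the diameter. -/
theorem level_parent (h : Marked n P U cyc idx len) {c : ℕ} (h0 : 0 < c) (hn : c < n) :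
    level (broot P U cyc) (blockDist cyc idx len) c ≤
        level (broot P U cyc) (blockDist cyc idx len) (P c) + 1 ∧
      level (broot P U cyc) (blockDist cyc idx len) (P c) ≤
        level (broot P U cyc) (blockDist cyc idx len) c + 1 := by
  have h1 := h.level_eq h0 hn
  rw [h1]
  by_cases hc : cyc c = 0
  · rw [broot, if_pos hc, blockDist, if_pos hc]
    omega
  · have h2 := h.idx_lt_len hc
    have h3 := (h.cover c hc).2.2.2.2
    rw [broot, if_neg hc, blockDist, if_neg hc]
    by_cases hp : P c + 1 = U (cyc c)
    · have h4 := h.top c hc hp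
      rw [show P c = U (cyc c) - 1 by omega]
      omega
    · obtain ⟨h4, h5⟩ := h.step c hc hp
      have hpc : cyc (P c) ≠ 0 := h4 ▸ hc
      rw [h.level_eq (h.pos hpc) (h.lt hpc), broot, if_neg hpc, blockDist, if_neg hpc, h4, h5]
      omega

theorem level_up (h : Marked n P U cyc idx len) {x : ℕ} (hn : x < n) (hU : U x ≠ 0) :
    level (broot P U cyc) (blockDist cyc idx len) x =
      level (broot P U cyc) (blockDist cyc idx len) (U x - 1) + 1 := by
  have hlt := h.tree.up_lt x hn hU
  obtain ⟨h1, h2⟩ := h.bottom x hn hU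
  have hc : cyc x ≠ 0 := by omega
  have h3 := h.three_le_len hc
  rw [h.level_eq (by omega) hn, broot, if_neg hc, blockDist, if_neg hc, h2]
  rw [h1] at h3 ⊢
  rw [min_eq_left (by omega)]

theorem level_le_diam {V : Type*} [Finite V] {G : SimpleGraph V} {lab : ℕ → V}
    (h : Marked n P U cyc idx len) (hG : IsCactus G) (hp : IsPalmTree G n lab P U) {c : ℕ}
    (hc : c < n) : level (broot P U cyc) (blockDist cyc idx len) c ≤ G.diam := by
  refine hp.le_diam_of_lipschitz hG ?_ ?_ hc
  · rw [level, if_neg (Nat.not_lt_zero _)]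
  · intro i hi j hj hadj
    rcases lt_trichotomy i j with hij | rfl | hij
    · rcases hp.eq_parent_or_eq_up hG hij hj hadj with rfl | he
      · exact (h.level_parent (by omega) hj).1
      · have := h.level_up hj (by omega)
        rw [he, Nat.add_sub_cancel] at this
        omega
    · exact absurd hadj (G.loopless.irrefl _)
    · rcases hp.eq_parent_or_eq_up hG hij hi hadj.symm with rfl | he
      · exact (h.level_parent (by omega) hi).2
      · have := h.level_up hi (by omega)
        rw [he, Nat.add_sub_cancel] at this
        omega

theorem up_of_len (h : Marked n P U cyc idx len) {x : ℕ} (hn : x < n) (hU : U x ≠ 0)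
    (hl : len x = 3) : U x = P (P x) + 1 := by
  have hlt := h.tree.up_lt x hn hU
  have hne := h.tree.up_ne x hn hU
  obtain ⟨h1, h2⟩ := h.bottom x hn hU
  obtain ⟨h3, h4⟩ := h.step x (by omega) (by rw [h1]; omega)
  have h5 := h.top_of_idx (c := P x) (by omega) (by rw [h3, h1]; omega)
  rw [h5, h3, h1]

end Marked

/-- The extra unit pays for the double step of odd cycles and for the crossing from one boundary to
the other. It is charged once per cycle and becomes the summand `o` in `d + o`. -/
theorem coef_add_le {k j : ℕ} (h3 : k ≠ 3) (h0 : 0 < j) (hj : j < k) :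
    coefA k j + coefB k j ≤ min j (k - j) + 1 := by
  rcases lt_trichotomy j (k / 2) with h | rfl | h
  · rw [coefA, if_pos ⟨h0, h.le⟩, coefB_of_lt h3 h]
    omega
  · rw [coefA, if_pos ⟨h0, le_rfl⟩, coefB_mid h3]
    omega
  · rw [coefA, if_neg (by omega), coefB_of_gt h3 h]
    omega

theorem coef_three {j : ℕ} (h0 : 0 < j) (hj : j < 3) :
    coefA 3 j = 1 ∧ coefB 3 j = 0 ∨ coefA 3 j = 0 ∧ coefB 3 j = 1 := by
  have : j = 1 ∨ j = 2 := by omega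
  rcases this with rfl | rfl <;> simp [coefA, coefB]

/-- A cycle is counted at its other vertices but not at its root, since the count asks for strictly
smaller root indices. This pays for the extra unit, or for the `X²` of a triangle. -/
theorem card_filter_lt_succ_le {n v c x : ℕ} (Q : ℕ → Prop) [DecidablePred Q] (f : ℕ → ℕ)
    (hx : x < n) (hQ : Q x) (hf : f x = v) (hv : v < c) :
    ((Finset.range n).filter fun y => Q y ∧ f y < v).card + 1 ≤
      ((Finset.range n).filter fun y => Q y ∧ f y < c).card := by
  rw [← Finset.card_insert_of_notMem (a := x)]
  · refine Finset.card_le_card ?_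
    intro y hy
    rw [Finset.mem_filter]
    rcases Finset.mem_insert.1 hy with rfl | hy
    · exact ⟨Finset.mem_range.2 hx, hQ, by omega⟩
    · obtain ⟨h1, h2, h3⟩ := Finset.mem_filter.1 hy
      exact ⟨h1, h2, by omega⟩
  · intro hmem
    have := (Finset.mem_filter.1 hmem).2.2
    omega

theorem card_filter_lt_le {n v c : ℕ} (Q : ℕ → Prop) [DecidablePred Q] (f : ℕ → ℕ) (hv : v ≤ c) :
    ((Finset.range n).filter fun y => Q y ∧ f y < v).card ≤
      ((Finset.range n).filter fun y => Q y ∧ f y < c).card := by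
  refine Finset.card_le_card ?_
  intro y hy
  obtain ⟨h1, h2, h3⟩ := Finset.mem_filter.1 hy
  exact Finset.mem_filter.2 ⟨h1, h2, by omega⟩

namespace Construction

variable {n T X : ℕ} {P U cyc idx len size rel base boff tot Dx Dy start px py : ℕ → ℕ}

theorem offset_le {k j ma mb da db ya yb D : ℕ} (h0 : 0 < j) (hj : j < k)
    (hma : ma = if k = 3 then yb else 1) (hmb : mb = if k = 3 then ya else 1)
    (hda : da ≤ D) (hdb : db ≤ D) (hya : ya ≤ D) (hyb : yb ≤ D) :
    coefA k j * (ma * da) + coefB k j * (mb * db) ≤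
      if k = 3 then D ^ 2 else (min j (k - j) + 1) * D := by
  split_ifs at * with h3
  · subst h3
    rcases coef_three h0 hj with ⟨h1, h2⟩ | ⟨h1, h2⟩
    · rw [h1, h2, hma, one_mul, zero_mul, add_zero, pow_two]
      exact Nat.mul_le_mul hyb hda
    · rw [h1, h2, hmb, one_mul, zero_mul, zero_add, pow_two]
      exact Nat.mul_le_mul hya hdb
  · rw [hma, hmb, one_mul, one_mul]
    calc _ ≤ coefA k j * D + coefB k j * D :=
          Nat.add_le_add (Nat.mul_le_mul_left _ hda) (Nat.mul_le_mul_left _ hdb)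
      _ = (coefA k j + coefB k j) * D := by ring
      _ ≤ _ := Nat.mul_le_mul_right _ (coef_add_le h3 h0 hj)

theorem add_offset_le {a o l d N N' M M' D e f : ℕ} (ha : a ≤ (l + N) * D + M * D ^ 2)
    (ho : o ≤ (d + e) * D + f * D ^ 2) (hN : N + e ≤ N') (hM : M + f ≤ M') :
    a + o ≤ (l + d + N') * D + M' * D ^ 2 := by
  calc a + o ≤ (l + d + (N + e)) * D + (M + f) * D ^ 2 := by linarith
    _ ≤ _ := by gcongr

/-- Each vertex is compared with the root of its block. A bridge adds at most `X`, a cycle other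
than a triangle at most `X` times one more than the distance in the cycle, and a triangle at most
`X²`, since its sides are scaled by a height at most `X`. For simplicity all cycles with a root
index below `c` are counted, not only those on the way to `c`. -/
theorem coord_le (h : Construction n T X P U cyc idx len size rel base boff tot Dx Dy start px py)
    (h00 : px 0 = 0 ∧ py 0 = 0) (c : ℕ) (hn : c < n) :
    max (px c) (py c) ≤ (level (broot P U cyc) (blockDist cyc idx len) c +
        ((Finset.range n).filter fun x => U x ≠ 0 ∧ U x - 1 < c).card) * X +
      ((Finset.range n).filter fun x => (U x ≠ 0 ∧ len x = 3) ∧ U x - 1 < c).card * X ^ 2 := by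
  induction c using Nat.strong_induction_on with
  | _ c ih =>
    rcases Nat.eq_zero_or_pos c with rfl | h0
    · rw [h00.1, h00.2]
      simp
    · have hB := h.marked.broot_lt h0 hn
      have h1 := ih _ hB (by omega)
      rw [h.marked.level_eq h0 hn]
      set l := level (broot P U cyc) (blockDist cyc idx len) (broot P U cyc c)
      have hN := card_filter_lt_le (n := n) (fun x => U x ≠ 0) (fun x => U x - 1) hB.le
      have hM := card_filter_lt_le (n := n) (fun x => U x ≠ 0 ∧ len x = 3) (fun x => U x - 1) hB.le
      obtain ⟨p1, p2⟩ := h.placed.placed c h0 hn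
      by_cases hc : cyc c = 0
      · obtain ⟨e1, e2, e3⟩ := p1 hc
        have h2 := (h.slotted.bridge c h0 hn hc).1
        have h3 := h.start_add_size_le c hn
        have hx := h.dirs.x_le (start c) (by omega)
        have hy := h.dirs.y_le (start c) (by omega)
        rw [broot, if_pos hc] at h1 hN hM
        rw [blockDist, if_pos hc, e2, e3]
        have h6 := max_le_iff.1 h1
        exact max_le (add_offset_le (e := 0) (f := 0) h6.1 (by omega) hN hM)
          (add_offset_le (e := 0) (f := 0) h6.2 (by omega) hN hM)
      · obtain ⟨-, e2, e3⟩ := p2 hc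
        obtain ⟨hx, hU, hle, -, hi⟩ := h.marked.cover c hc
        obtain ⟨g1, g2, g3⟩ := h.slots_lt hx hU
        have hlen := h.marked.idx_lt_len hc
        have xa := h.dirs.x_le (leftSlot U base start (cyc c)) (by omega)
        have ya := h.dirs.y_le (leftSlot U base start (cyc c)) (by omega)
        have xb := h.dirs.x_le (rightSlot U base boff start (cyc c)) (by omega)
        have yb := h.dirs.y_le (rightSlot U base boff start (cyc c)) (by omega)
        have ox := offset_le (k := len (cyc c)) hi hlen
          (ma := leftScale U len base boff Dy start (cyc c))
          (mb := rightScale U len base Dy start (cyc c)) rfl rfl xa xb ya yb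
        have oy := offset_le (k := len (cyc c)) hi hlen
          (ma := leftScale U len base boff Dy start (cyc c))
          (mb := rightScale U len base Dy start (cyc c)) rfl rfl ya yb ya yb
        rw [broot, if_neg hc] at h1 hN hM
        rw [blockDist, if_neg hc, e2, e3]
        have h6 := max_le_iff.1 h1
        by_cases h3 : len (cyc c) = 3
        · rw [if_pos h3] at ox oy
          have hM' := card_filter_lt_succ_le (n := n) (c := c) (fun x => U x ≠ 0 ∧ len x = 3)
            (fun x => U x - 1) hx ⟨hU, h3⟩ rfl (by omega)
          rw [add_assoc, add_assoc]
          exact max_le (add_offset_le (e := 0) (f := 1) h6.1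
            (ox.trans ((one_mul (X ^ 2)).ge.trans (Nat.le_add_left _ _))) hN hM')
            (add_offset_le (e := 0) (f := 1) h6.2
              (oy.trans ((one_mul (X ^ 2)).ge.trans (Nat.le_add_left _ _))) hN hM')
        · rw [if_neg h3] at ox oy
          have hN' := card_filter_lt_succ_le (n := n) (c := c) (fun x => U x ≠ 0)
            (fun x => U x - 1) hx hU rfl (by omega)
          rw [add_assoc (px _), add_assoc (py _)]
          exact max_le (add_offset_le (e := 1) (f := 0) h6.1 (ox.trans (Nat.le_add_right _ _)) hN' hM)
            (add_offset_le (e := 1) (f := 0) h6.2 (oy.trans (Nat.le_add_right _ _)) hN' hM)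

theorem coord_le_gridSide {V : Type*} [Finite V] {G : SimpleGraph V} {lab : ℕ → V}
    (h : Construction n T X P U cyc idx len size rel base boff tot Dx Dy start px py)
    (hG : IsCactus G) (hp : IsPalmTree G n lab P U) (h00 : px 0 = 0 ∧ py 0 = 0)
    (hX : 2 * X ≤ 9 * numSlopes G (lab 0)) {c : ℕ} (hn : c < n) :
    ((max (px c) (py c) : ℕ) : ℝ) ≤ gridSide G (lab 0) := by
  have h1 := h.coord_le h00 c hn
  have h2 := h.marked.level_le_diam hG hp hn
  have h3 : ((Finset.range n).filter fun x => U x ≠ 0 ∧ U x - 1 < c).card ≤ numCycles G := by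
    rw [hp.numCycles_eq hG]
    refine Finset.card_le_card fun y hy => ?_
    obtain ⟨g1, g2, -⟩ := Finset.mem_filter.1 hy
    exact Finset.mem_filter.2 ⟨g1, g2⟩
  have h4 : ((Finset.range n).filter fun x => (U x ≠ 0 ∧ len x = 3) ∧ U x - 1 < c).card ≤
      numTriangles G := by
    refine le_trans (Finset.card_le_card fun y hy => ?_) hp.card_triangles_le
    obtain ⟨g1, g2, -⟩ := Finset.mem_filter.1 hy
    exact Finset.mem_filter.2 ⟨g1, g2.1, h.marked.up_of_len (Finset.mem_range.1 g1) g2.1 g2.2⟩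
  have h5 : max (px c) (py c) ≤ (G.diam + numCycles G) * X + numTriangles G * X ^ 2 :=
    h1.trans (Nat.add_le_add (Nat.mul_le_mul_right _ (Nat.add_le_add h2 h3))
      (Nat.mul_le_mul_right _ h4))
  have h6 : ((max (px c) (py c) : ℕ) : ℝ) ≤
      ((G.diam : ℝ) + numCycles G) * X + numTriangles G * (X : ℝ) ^ 2 := by exact_mod_cast h5
  refine h6.trans ?_
  rw [gridSide]
  have hX' : 2 * (X : ℝ) ≤ 9 * numSlopes G (lab 0) := by exact_mod_cast hX
  -- With `π² ≥ 9.6` one has `π²/3 ≥ 3.2`, and `2 · 3.2² = 20.48` still exceeds `(9/2)² = 20.25`.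
  -- This is the tighter of the two comparisons with the grid side.
  have hpi : (9.6 : ℝ) ≤ Real.pi ^ 2 := by nlinarith [Real.pi_gt_d2]
  have hτ : (0 : ℝ) ≤ numSlopes G (lab 0) := Nat.cast_nonneg _
  have hX0 : (0 : ℝ) ≤ X := Nat.cast_nonneg _
  have e1 : (X : ℝ) ≤ 2 * Real.pi ^ 2 / 3 * numSlopes G (lab 0) := by nlinarith
  have e2 : (X : ℝ) ^ 2 ≤ 2 * (Real.pi ^ 2 / 3 * numSlopes G (lab 0)) ^ 2 := by
    have g1 : 3.2 * (numSlopes G (lab 0) : ℝ) ≤ Real.pi ^ 2 / 3 * numSlopes G (lab 0) := by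
      nlinarith
    have g2 : (3.2 * (numSlopes G (lab 0) : ℝ)) ^ 2 ≤
        (Real.pi ^ 2 / 3 * numSlopes G (lab 0)) ^ 2 := pow_le_pow_left₀ (by positivity) g1 2
    nlinarith
  refine add_le_add ?_ ?_
  · calc _ ≤ ((G.diam : ℝ) + numCycles G) * (2 * Real.pi ^ 2 / 3 * numSlopes G (lab 0)) :=
        mul_le_mul_of_nonneg_left e1 (by positivity)
      _ = _ := by ring
  · exact mul_le_mul_of_nonneg_left e2 (by positivity)

end Construction

end Cactus

/-! ### Weakest preconditions for the random access machine. -/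

namespace RAM

instance : Add Exp := ⟨Exp.op .add⟩
instance : Sub Exp := ⟨Exp.op .sub⟩
instance : Mul Exp := ⟨Exp.op .mul⟩
instance : Div Exp := ⟨Exp.op .div⟩
instance : Mod Exp := ⟨Exp.op .mod⟩

namespace Exp

variable (s : State) (e e₁ e₂ : Exp)

theorem eval_reg (i : ℕ) : (reg i).eval s = s.reg i := rfl
theorem eval_load (a : ℕ) : (load a e).eval s = s.mem a (e.eval s) := rfl
theorem eval_add : (e₁ + e₂).eval s = e₁.eval s + e₂.eval s := rfl
theorem eval_sub : (e₁ - e₂).eval s = e₁.eval s - e₂.eval s := rfl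
theorem eval_mul : (e₁ * e₂).eval s = e₁.eval s * e₂.eval s := rfl
theorem eval_div : (e₁ / e₂).eval s = e₁.eval s / e₂.eval s := rfl
theorem eval_mod : (e₁ % e₂).eval s = e₁.eval s % e₂.eval s := rfl
theorem eval_lt : (op .lt e₁ e₂).eval s = if e₁.eval s < e₂.eval s then 1 else 0 := rfl
theorem eval_eq : (op .eq e₁ e₂).eval s = if e₁.eval s = e₂.eval s then 1 else 0 := rfl

/-- The largest constant. -/
def lits : Exp → ℕ
  | lit k => k
  | reg _ => 0
  | load _ e => e.lits
  | op _ e₁ e₂ => max e₁.lits e₂.lits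

/-- The constants and the evaluation time are at most `κ`. -/
def Small (κ : ℕ) (e : Exp) : Prop := e.cost ≤ κ ∧ e.lits ≤ κ

instance (κ : ℕ) (e : Exp) : Decidable (Small κ e) := inferInstanceAs (Decidable (_ ∧ _))

end Exp

/-- All values in the memory are at most `M`. -/
def Bounded (M : ℕ) (s : State) : Prop := (∀ i, s.reg i ≤ M) ∧ ∀ a j, s.mem a j ≤ M

namespace State

variable (s : State) {i j a b x y : ℕ}

theorem setReg_reg_self : (s.setReg i x).reg i = x := Function.update_self ..
theorem setReg_reg_of_ne (h : i ≠ j) : (s.setReg j x).reg i = s.reg i :=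
  Function.update_of_ne h ..
theorem setReg_mem : (s.setReg i x).mem = s.mem := rfl
theorem setMem_reg : (s.setMem a j x).reg = s.reg := rfl
theorem setMem_mem_self : (s.setMem a j x).mem a = Function.update (s.mem a) j x :=
  Function.update_self ..
theorem setMem_mem_of_ne (h : a ≠ b) : (s.setMem b j x).mem a = s.mem a :=
  Function.update_of_ne h ..

end State

theorem Bounded.setReg {M : ℕ} {s : State} (h : Bounded M s) {i x : ℕ} (hx : x ≤ M) :
    Bounded M (s.setReg i x) := by
  refine ⟨fun j => ?_, h.2⟩
  by_cases hj : j = i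
  · subst hj
    rwa [State.setReg_reg_self]
  · rw [State.setReg_reg_of_ne _ hj]
    exact h.1 j

theorem Bounded.setMem {M : ℕ} {s : State} (h : Bounded M s) {a j x : ℕ} (hx : x ≤ M) :
    Bounded M (s.setMem a j x) := by
  refine ⟨h.1, fun b l => ?_⟩
  by_cases hb : b = a
  · subst hb
    rw [State.setMem_mem_self]
    by_cases hl : l = j
    · subst hl
      rwa [Function.update_self]
    · rw [Function.update_of_ne hl]
      exact h.2 b l
  · rw [State.setMem_mem_of_ne _ hb]
    exact h.2 b l

/-- An operation on values at most `M ^ p` and `M ^ q` gives at most `M ^ (p + q + 1)`, with `M ≥ 2`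
needed for sums. As the expressions of the program have bounded cost, polynomially bounded memory
implies polynomially bounded intermediate values. -/
theorem Exp.eval_le {M : ℕ} {s : State} (hM : 2 ≤ M) (hs : Bounded M s) (e : Exp)
    (he : e.lits ≤ M) : e.eval s ≤ M ^ e.cost := by
  induction e with
  | lit k => rw [cost, pow_one]; exact he
  | reg i => rw [cost, pow_one]; exact hs.1 i
  | load a e _ => exact (hs.2 a _).trans (Nat.le_self_pow (Nat.succ_ne_zero _) M)
  | op o e₁ e₂ ih₁ ih₂ =>
    have h1 := ih₁ ((le_max_left _ _).trans he)
    have h2 := ih₂ ((le_max_right _ _).trans he)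
    have hM1 : 1 ≤ M := by omega
    have p1 : M ^ e₁.cost ≤ M ^ (e₁.cost + e₂.cost) := Nat.pow_le_pow_right hM1 (by omega)
    have p2 : M ^ e₂.cost ≤ M ^ (e₁.cost + e₂.cost) := Nat.pow_le_pow_right hM1 (by omega)
    have p3 : 1 ≤ M ^ (e₁.cost + e₂.cost) := Nat.one_le_pow _ _ hM1
    have p4 : M ^ (e₁.cost + e₂.cost) * 2 ≤ M ^ (e₁.cost + e₂.cost + 1) := by
      rw [pow_succ]
      exact Nat.mul_le_mul_left _ hM
    have p5 : e₁.eval s * e₂.eval s ≤ M ^ (e₁.cost + e₂.cost) := by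
      rw [pow_add]
      exact Nat.mul_le_mul h1 h2
    change o.apply (e₁.eval s) (e₂.eval s) ≤ M ^ (e₁.cost + e₂.cost + 1)
    cases o <;> simp only [Op.apply]
    · omega
    · omega
    · omega
    · exact (Nat.div_le_self _ _).trans (by omega)
    · exact (Nat.mod_le _ _).trans (by omega)
    · split_ifs <;> omega
    · split_ifs <;> omega

theorem Exp.fits_of_bounded {W M κ : ℕ} {s : State} (hM : 2 ≤ M) (hκ : κ ≤ M) (hW : M ^ κ ≤ W)
    (hs : Bounded M s) {e : Exp} (he : e.Small κ) : e.Fits W s := by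
  have main : ∀ e : Exp, e.Small κ → e.eval s ≤ W := fun e he =>
    (e.eval_le hM hs (he.2.trans hκ)).trans ((Nat.pow_le_pow_right (by omega) he.1).trans hW)
  induction e with
  | lit k => exact main _ he
  | reg i => exact main _ he
  | load a e ih => exact ⟨ih ⟨by have := he.1; rw [cost] at this; omega, he.2⟩, main _ he⟩
  | op o e₁ e₂ ih₁ ih₂ =>
    have := he.1
    rw [cost] at this
    exact ⟨ih₁ ⟨by omega, (le_max_left _ _).trans he.2⟩,
      ih₂ ⟨by omega, (le_max_right _ _).trans he.2⟩, main _ he⟩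

namespace Prog

/-- All expressions have constants and evaluation times at most `κ`. -/
def Small (κ : ℕ) : Prog → Prop
  | skip => True
  | assign _ e => e.Small κ
  | store _ j e => j.Small κ ∧ e.Small κ
  | seq P Q => P.Small κ ∧ Q.Small κ
  | branch e P Q => e.Small κ ∧ P.Small κ ∧ Q.Small κ
  | loop e P => e.Small κ ∧ P.Small κ

instance decidableSmall (κ : ℕ) : ∀ P : Prog, Decidable (P.Small κ)
  | skip => inferInstanceAs (Decidable True)
  | assign _ e => inferInstanceAs (Decidable (e.Small κ))
  | store _ j e => inferInstanceAs (Decidable (j.Small κ ∧ e.Small κ))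
  | seq P Q =>
    have := decidableSmall κ P
    have := decidableSmall κ Q
    inferInstanceAs (Decidable (P.Small κ ∧ Q.Small κ))
  | branch e P Q =>
    have := decidableSmall κ P
    have := decidableSmall κ Q
    inferInstanceAs (Decidable (e.Small κ ∧ P.Small κ ∧ Q.Small κ))
  | loop e P =>
    have := decidableSmall κ P
    inferInstanceAs (Decidable (e.Small κ ∧ P.Small κ))

/-- An upper bound for the running time of a program without loops. -/
def time : Prog → ℕ
  | skip => 1
  | assign _ e => e.cost + 1
  | store _ j e => j.cost + e.cost + 1
  | seq P Q => P.time + Q.time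
  | branch e P Q => e.cost + 1 + max P.time Q.time
  | loop _ _ => 0

/-- The weakest precondition of a program without loops for the postcondition `Q`, where only
values at most `M` are stored. -/
def wp (M : ℕ) : Prog → (State → Prop) → State → Prop
  | skip, Q, s => Q s
  | assign i e, Q, s => e.eval s ≤ M ∧ Q (s.setReg i (e.eval s))
  | store a j e, Q, s => e.eval s ≤ M ∧ Q (s.setMem a (j.eval s) (e.eval s))
  | seq P R, Q, s => P.wp M (fun t => R.wp M Q t) s
  | branch e P R, Q, s => (e.eval s ≠ 0 → P.wp M Q s) ∧ (e.eval s = 0 → R.wp M Q s)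
  | loop _ _, _, _ => False

end Prog

/-- Started in `s`, the program halts within time `c` in a state satisfying `Q`, where all values
in the memory are at most `M`. -/
def Runs (W M : ℕ) (P : Prog) (s : State) (c : ℕ) (Q : State → Prop) : Prop :=
  ∃ T s', Exec W P s T s' ∧ T ≤ c ∧ Bounded M s' ∧ Q s'

/-- The word size `W` suffices for programs with parameter `κ` on values at most `M`. -/
structure Words (W M κ : ℕ) : Prop where
  two_le : 2 ≤ M
  le : κ ≤ M
  pow_le : M ^ κ ≤ W

namespace Runs

variable {W M κ : ℕ} {P P' : Prog} {s : State} {c c' : ℕ} {Q R : State → Prop}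

theorem mono (h : Runs W M P s c Q) (hc : c ≤ c') (hQ : ∀ t, Q t → R t) : Runs W M P s c' R := by
  obtain ⟨T, s', h1, h2, h3, h4⟩ := h
  exact ⟨T, s', h1, h2.trans hc, h3, hQ s' h4⟩

theorem seq (h : Runs W M P s c Q) (h' : ∀ t, Bounded M t → Q t → Runs W M P' t c' R) :
    Runs W M (P.seq P') s (c + c') R := by
  obtain ⟨T, s', h1, h2, h3, h4⟩ := h
  obtain ⟨T', s'', h1', h2', h3', h4'⟩ := h' s' h3 h4
  exact ⟨T + T', s'', .seq h1 h1', Nat.add_le_add h2 h2', h3', h4'⟩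

/-- The words are large enough for every expression over a bounded memory, so only stored values
have to be compared with `M`; intermediate values need no attention. -/
theorem of_wp (hW : Words W M κ) : ∀ {P : Prog} {s : State} {Q : State → Prop},
    Bounded M s → P.Small κ → P.wp M Q s → Runs W M P s P.time Q := by
  intro P
  induction P with
  | skip => exact fun {s Q} hs _ h => ⟨1, s, .skip s, le_rfl, hs, h⟩
  | assign i e =>
    exact fun {s Q} hs hP h => ⟨_, _, .assign s i e
      (Exp.fits_of_bounded hW.two_le hW.le hW.pow_le hs hP), le_rfl, hs.setReg h.1, h.2⟩
  | store a j e =>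
    exact fun {s Q} hs hP h => ⟨_, _, .store s a j e
      (Exp.fits_of_bounded hW.two_le hW.le hW.pow_le hs hP.1)
      (Exp.fits_of_bounded hW.two_le hW.le hW.pow_le hs hP.2), le_rfl, hs.setMem h.1, h.2⟩
  | seq P R ih ih' =>
    exact fun {s Q} hs hP h => (ih hs hP.1 h).seq fun t ht hQ => ih' ht hP.2 hQ
  | branch e P R ih ih' =>
    intro s Q hs hP h
    have hf := Exp.fits_of_bounded hW.two_le hW.le hW.pow_le hs hP.1
    by_cases he : e.eval s = 0
    · obtain ⟨T, s', h1, h2, h3⟩ := ih' hs hP.2.2 (h.2 he)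
      exact ⟨_, s', .branch_false hf he h1,
        Nat.add_le_add_left (h2.trans (le_max_right _ _)) _, h3⟩
    · obtain ⟨T, s', h1, h2, h3⟩ := ih hs hP.2.1 (h.1 he)
      exact ⟨_, s', .branch_true hf he h1,
        Nat.add_le_add_left (h2.trans (le_max_left _ _)) _, h3⟩
  | loop e P _ => exact fun {s Q} _ _ h => h.elim

/-- A loop with the invariant `I k`, where `k` bounds the number of the remaining rounds. -/
theorem loop (hW : Words W M κ) {e : Exp} (hP : (Prog.loop e P).Small κ) (I : ℕ → State → Prop)
    (hstep : ∀ k t, Bounded M t → I k t → e.eval t ≠ 0 → P.wp M (fun t' => ∃ l < k, I l t') t)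
    (k : ℕ) : ∀ s, Bounded M s → I k s →
      Runs W M (Prog.loop e P) s ((k + 1) * (e.cost + 1 + P.time))
        (fun t => e.eval t = 0 ∧ ∃ l, I l t) := by
  induction k using Nat.strong_induction_on with
  | _ k ih =>
    intro s hs hI
    have hf := Exp.fits_of_bounded hW.two_le hW.le hW.pow_le hs hP.1
    by_cases he : e.eval s = 0
    · refine ⟨_, s, .loop_false hf he, ?_, hs, he, k, hI⟩
      calc e.cost + 1 ≤ 1 * (e.cost + 1 + P.time) := by omega
        _ ≤ _ := Nat.mul_le_mul_right _ (by omega)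
    · obtain ⟨T, t, h1, h2, h3, l, hl, h4⟩ := of_wp hW hs hP.2 (hstep k s hs hI he)
      obtain ⟨T', t', h1', h2', h3'⟩ := ih l hl t h3 h4
      refine ⟨_, t', .loop_true hf he h1 h1', ?_, h3'⟩
      calc e.cost + 1 + T + T' ≤ (e.cost + 1 + P.time) + (l + 1) * (e.cost + 1 + P.time) := by omega
        _ = (l + 1 + 1) * (e.cost + 1 + P.time) := by ring
        _ ≤ _ := Nat.mul_le_mul_right _ (by omega)

end Runs

end RAM

/-! ### The program that marks the cycles. -/

namespace RAM

open Exp Prog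

instance : Append Prog := ⟨Prog.seq⟩

theorem Exp.eval_lit (s : State) (k : ℕ) : (lit k).eval s = k := rfl

theorem Prog.wp_append (M : ℕ) (P R : Prog) (Q : State → Prop) (s : State) :
    (P ++ R).wp M Q s = P.wp M (fun t => R.wp M Q t) s := rfl

theorem Prog.wp_mono {M : ℕ} : ∀ {P : Prog} {Q R : State → Prop} {s : State}, P.wp M Q s →
    (∀ t, Q t → R t) → P.wp M R s := by
  intro P
  induction P with
  | skip => exact fun h hQ => hQ _ h
  | assign i e => exact fun h hQ => ⟨h.1, hQ _ h.2⟩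
  | store a j e => exact fun h hQ => ⟨h.1, hQ _ h.2⟩
  | seq P R ih ih' => exact fun h hQ => ih h fun t ht => ih' ht hQ
  | branch e P R ih ih' => exact fun h hQ => ⟨fun he => ih (h.1 he) hQ, fun he => ih' (h.2 he) hQ⟩
  | loop e P _ => exact fun h _ => h

theorem Prog.wp_bounded {M : ℕ} : ∀ {P : Prog} {Q : State → Prop} {s : State}, Bounded M s →
    P.wp M Q s → P.wp M (fun t => Bounded M t ∧ Q t) s := by
  intro P
  induction P with
  | skip => exact fun hs h => ⟨hs, h⟩
  | assign i e => exact fun hs h => ⟨h.1, hs.setReg h.1, h.2⟩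
  | store a j e => exact fun hs h => ⟨h.1, hs.setMem h.1, h.2⟩
  | seq P R ih ih' => exact fun hs h => wp_mono (P := P) (ih hs h) fun t ht => ih' ht.1 ht.2
  | branch e P R ih ih' => exact fun hs h => ⟨fun he => ih hs (h.1 he), fun he => ih' hs (h.2 he)⟩
  | loop e P _ => exact fun _ h => h

theorem Prog.wp_cut {M : ℕ} {P P' : Prog} {Q : State → Prop} {s : State} (R : State → Prop)
    (h : P.wp M R s) (h' : ∀ t, R t → P'.wp M Q t) : (P ++ P').wp M Q s :=
  Prog.wp_mono (P := P) h h'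

theorem Runs.append {W M c c' : ℕ} {P P' : Prog} {s : State} {Q R : State → Prop}
    (h : Runs W M P s c Q) (h' : ∀ t, Bounded M t → Q t → Runs W M P' t c' R) :
    Runs W M (P ++ P') s (c + c') R := h.seq h'

theorem ite_one_zero_ne_zero {p : Prop} [Decidable p] : (if p then 1 else 0) ≠ 0 ↔ p := by
  split_ifs <;> simp [*]

theorem ite_one_zero_eq_zero {p : Prop} [Decidable p] : (if p then 1 else 0) = 0 ↔ ¬ p := by
  split_ifs <;> simp [*]

/-- Marks the lower end of a back edge. -/
def markBottom : Prog :=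
  branch (load 8 (reg 2)) (store 9 (reg 2) (reg 2) ++ store 10 (reg 2) (lit 1)) skip

/-- Passes the mark of a vertex on to its parent. -/
def markStep : Prog :=
  assign 5 (load 9 (reg 2)) ++
  branch (reg 5)
    (branch (op .eq (load 7 (reg 2) + lit 1) (load 8 (reg 5)))
      (store 11 (reg 5) (load 10 (reg 2) + lit 1))
      (store 9 (load 7 (reg 2)) (reg 5) ++ store 10 (load 7 (reg 2)) (load 10 (reg 2) + lit 1)))
    skip ++
  assign 2 (reg 2 - lit 1)

/-- The marking of the cycles. -/
def markProg : Prog := assign 2 (reg 0 - lit 1) ++ loop (reg 2) (markBottom ++ markStep)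

open Cactus

/-- The state during the marking of the cycles. -/
structure MarkState (n : ℕ) (P U : ℕ → ℕ) (s₀ t : State) : Prop where
  inv : MarkInv n P U (t.reg 2) (t.mem 9) (t.mem 10) (t.mem 11)
  lt : t.reg 2 < n
  reg : t.reg 0 = n
  par : t.mem 7 = P
  up : t.mem 8 = U
  frame : ∀ a, a ≠ 9 → a ≠ 10 → a ≠ 11 → t.mem a = s₀.mem a

theorem markBottom_wp {n M : ℕ} {P U : ℕ → ℕ} {s₀ t : State} (ht : CactusTree n P U)
    (hM : n + 2 ≤ M) (h : MarkState n P U s₀ t) :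
    markBottom.wp M (fun t' => MarkState n P U s₀ t' ∧ t'.reg 2 = t.reg 2 ∧
      (U (t.reg 2) ≠ 0 → t'.mem 9 (t.reg 2) = t.reg 2 ∧ t'.mem 10 (t.reg 2) = 1)) t := by
  have hlt := h.lt
  simp (disch := decide) only [markBottom, wp_append, wp, eval_reg, eval_load, eval_lit,
    State.setMem_reg, State.setMem_mem_self, State.setMem_mem_of_ne, h.up]
  refine ⟨fun hU => ⟨by omega, by omega, ⟨?_, h.lt, h.reg, ?_, ?_, ?_⟩, trivial, fun _ => ?_⟩,
    fun hU => ⟨h, trivial, fun hne => absurd hU hne⟩⟩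
  · exact h.inv.mark_bottom ht h.lt hU
  · exact h.par
  · exact h.up
  · intro a h9 h10 h11
    rw [State.setMem_mem_of_ne _ h10, State.setMem_mem_of_ne _ h9, h.frame a h9 h10 h11]
  · rw [Function.update_self, Function.update_self]
    exact ⟨rfl, rfl⟩

/-- Positions are stored in memory and must fit into words. -/
theorem _root_.Cactus.MarkInv.idx_le {n i : ℕ} {P U cyc idx len : ℕ → ℕ} (ht : CactusTree n P U)
    (hI : MarkInv n P U i cyc idx len) {c : ℕ} (hc : cyc c ≠ 0) : idx c ≤ n := by
  obtain ⟨j, hj, hi⟩ := hI.sound c hc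
  -- While the climb has not reached `0`, each step lowers the index by at least one, so the number
  -- of steps is bounded by the starting index.
  have key : ∀ j x, x < n → 0 < P^[j] x → P^[j] x + j ≤ x := by
    intro j
    induction j with
    | zero => exact fun x _ _ => le_rfl
    | succ j ih =>
      intro x hx h0
      rw [Function.iterate_succ_apply] at h0 ⊢
      have hx0 : 0 < x := by
        rcases Nat.eq_zero_or_pos x with rfl | hx0
        · rw [ht.parent_zero] at h0
          have := ht.iterate_le j hx
          omega
        · exact hx0
      have h1 := ht.parent_lt x hx0 hx
      have := ih (P x) (by omega) h0
      omega
  have h1 := key j (cyc c) hj.1 (by rw [hj.2.2.1]; exact hj.pos)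
  have h2 := hj.1
  omega

theorem markStep_wp {n M : ℕ} {P U : ℕ → ℕ} {s₀ t : State} (ht : CactusTree n P U)
    (hM : n + 2 ≤ M) (hB : Bounded M t) (h : MarkState n P U s₀ t) (h0 : t.reg 2 ≠ 0)
    (hb : U (t.reg 2) ≠ 0 → t.mem 9 (t.reg 2) = t.reg 2 ∧ t.mem 10 (t.reg 2) = 1) :
    markStep.wp M (fun t' => MarkState n P U s₀ t' ∧ t'.reg 2 < t.reg 2) t := by
  have hlt := h.lt
  have hfr := h.frame
  simp (disch := decide) only [markStep, wp_append, wp, eval_reg, eval_load, eval_lit, eval_add,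
    eval_sub, eval_eq, State.setReg_reg_self, State.setReg_reg_of_ne, State.setReg_mem,
    State.setMem_reg, State.setMem_mem_of_ne, ite_one_zero_ne_zero, ite_one_zero_eq_zero, h.up,
    h.par]
  have hidx : t.mem 9 (t.reg 2) ≠ 0 → t.mem 10 (t.reg 2) + 1 ≤ M := fun hc =>
    (Nat.succ_le_succ (h.inv.idx_le ht hc)).trans (by omega)
  refine ⟨hB.2 9 _, fun hc => ⟨fun hp => ⟨hidx hc, by omega, ⟨?_, ?_, ?_, ?_, ?_, ?_⟩, ?_⟩,
    fun hp => ⟨hB.2 9 _, hidx hc, by omega, ⟨?_, ?_, ?_, ?_, ?_, ?_⟩, ?_⟩⟩,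
    fun hc => ⟨by omega, ⟨?_, ?_, ?_, ?_, ?_, ?_⟩, ?_⟩⟩
  all_goals try simp (disch := decide) only [State.setReg_reg_self, State.setReg_reg_of_ne,
    State.setReg_mem, State.setMem_reg, State.setMem_mem_self, State.setMem_mem_of_ne, h.up, h.par,
    h.reg]
  all_goals try omega
  · exact h.inv.step_top ht (by omega) hb hc hp
  · intro a h9 h10 h11
    rw [State.setMem_mem_of_ne _ h11, State.setReg_mem, hfr a h9 h10 h11]
  · exact h.inv.step_push ht (by omega) hb hc hp
  · intro a h9 h10 h11
    rw [State.setMem_mem_of_ne _ h10, State.setMem_mem_of_ne _ h9, State.setReg_mem,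
      hfr a h9 h10 h11]
  · exact h.inv.step_zero ht (by omega) hb hc

theorem markProg_runs {n W M : ℕ} {P U : ℕ → ℕ} {s : State} (hW : Words W M 20)
    (ht : CactusTree n P U) (hM : n + 2 ≤ M) (hn : 0 < n) (hB : Bounded M s) (h0 : s.reg 0 = n)
    (h7 : s.mem 7 = P) (h8 : s.mem 8 = U) (h9 : s.mem 9 = fun _ => 0) :
    Runs W M markProg s (100 * n) (fun t => t.reg 0 = n ∧
      (∀ a, a ≠ 9 → a ≠ 10 → a ≠ 11 → t.mem a = s.mem a) ∧
      Marked n P U (t.mem 9) (t.mem 10) (t.mem 11)) := by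
  have hstart : Runs W M (assign 2 (reg 0 - lit 1)) s 10 (MarkState n P U s) := by
    refine (Runs.of_wp hW hB (by decide) (Q := MarkState n P U s) ?_).mono (by decide)
      fun _ h => h
    simp (disch := decide) only [wp, eval_reg, eval_lit, eval_sub, h0]
    refine ⟨by omega, ?_, ?_, ?_, h7, h8, fun a _ _ _ => rfl⟩
    · simp only [State.setReg_reg_self, State.setReg_mem, h9]
      exact MarkInv.initial ht _ _
    · rw [State.setReg_reg_self]
      omega
    · rwa [State.setReg_reg_of_ne _ (by decide)]
  have hloop : ∀ t, Bounded M t → MarkState n P U s t →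
      Runs W M (loop (reg 2) (markBottom ++ markStep)) t (80 * n) (fun t => t.reg 0 = n ∧
        (∀ a, a ≠ 9 → a ≠ 10 → a ≠ 11 → t.mem a = s.mem a) ∧
        Marked n P U (t.mem 9) (t.mem 10) (t.mem 11)) := by
    intro t hBt hI
    refine (Runs.loop hW (by decide) (fun k t => k = t.reg 2 ∧ MarkState n P U s t) ?_ (t.reg 2) t
      hBt ⟨rfl, hI⟩).mono ?_ ?_
    · rintro k t hBt ⟨rfl, hI⟩ he
      refine wp_cut (fun t' => Bounded M t' ∧ (MarkState n P U s t' ∧ t'.reg 2 = t.reg 2 ∧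
        (U (t.reg 2) ≠ 0 → t'.mem 9 (t.reg 2) = t.reg 2 ∧ t'.mem 10 (t.reg 2) = 1)))
        (wp_bounded hBt (markBottom_wp ht hM hI)) ?_
      rintro t' ⟨hB', hI', h2, hb⟩
      rw [← h2] at hb
      refine wp_mono (markStep_wp ht hM hB' hI' (h2 ▸ he) hb) ?_
      rintro t'' ⟨hI'', hlt⟩
      exact ⟨_, by rw [h2] at hlt; exact hlt, rfl, hI''⟩
    · have := hI.lt
      calc _ ≤ (n - 1 + 1) * (Exp.cost (reg 2) + 1 + (markBottom ++ markStep).time) :=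
            Nat.mul_le_mul_right _ (by omega)
        _ ≤ n * 80 := Nat.mul_le_mul (by omega) (by decide)
        _ = 80 * n := Nat.mul_comm _ _
    · rintro t ⟨he, k, -, hI⟩
      refine ⟨hI.reg, hI.frame, ?_⟩
      have h1 := hI.inv
      rw [show t.reg 2 = 0 from he] at h1
      exact h1.marked ht
  exact (hstart.append hloop).mono (by omega) fun _ h => h

end RAM

/-! ### The program that allocates the slots. -/

namespace Cactus.SizeInv

variable {n i T : ℕ} {P U cyc idx len size rel base boff tot : ℕ → ℕ} {L : Finset ℕ}

/-- A crude bound at every stage of the pass, for the word size and the running time: one slot for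
each vertex in `L`, and at most two charges for each vertex. -/
theorem slots_le_of_inv (hI : SizeInv n P U cyc idx len i size rel base boff T tot L) :
    T ≤ 3 * n := by
  have h1 := hI.count
  have h2 : L.card ≤ n := by
    have : L ⊆ Finset.range n := fun c hc => Finset.mem_range.2 (hI.leaf c hc).2.1
    simpa using Finset.card_le_card this
  have h3 := Finset.card_filter_le (Finset.range n) fun c => i < c ∧ U c ≠ 0
  have h4 := Finset.card_filter_le (Finset.range n)
    fun c => i < c ∧ cyc c ≠ 0 ∧ idx c = len (cyc c) / 2
  rw [Finset.card_range] at h3 h4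
  omega

theorem size_add_rel_le (hI : SizeInv n P U cyc idx len i size rel base boff T tot L) {c : ℕ}
    (hc : c ≤ i) : size c + rel c ≤ T :=
  (Finset.single_le_sum (f := fun c => size c + rel c) (fun _ _ => Nat.zero_le _)
    (Finset.mem_range.2 (by omega))).trans hI.sum_le

end Cactus.SizeInv

namespace RAM

open Exp Prog Cactus

/-- Allocates the slots for the lower end of a bridge. -/
def sizeBridge : Prog :=
  branch (load 12 (reg 2)) skip (store 12 (reg 2) (lit 1) ++ assign 4 (reg 4 + lit 1)) ++
  store 14 (reg 2) (load 12 (reg 6)) ++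
  store 12 (reg 6) (load 12 (reg 6) + load 12 (reg 2))

/-- Allocates the slot of the left side of a cycle. -/
def sizeLeft : Prog :=
  branch (load 8 (reg 2)) (store 13 (reg 2) (lit 1) ++ assign 4 (reg 4 + lit 1)) skip

/-- Allocates the slot of the right side of a cycle. -/
def sizeRight : Prog :=
  assign 7 (load 13 (reg 2) + load 12 (reg 2)) ++
  branch (op .eq (load 10 (reg 2)) (load 11 (reg 5) / lit 2))
    (store 15 (reg 5) (reg 7) ++ assign 7 (reg 7 + lit 1) ++ assign 4 (reg 4 + lit 1)) skip

/-- Passes the number of the used slots on to the parent. -/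
def sizeUp : Prog :=
  branch (op .eq (reg 6 + lit 1) (load 8 (reg 5)))
    (store 14 (reg 5) (load 12 (reg 6)) ++ store 12 (reg 6) (load 12 (reg 6) + reg 7))
    (store 13 (reg 6) (reg 7))

/-- One round of the allocation of the slots. -/
def sizeBody : Prog :=
  assign 5 (load 9 (reg 2)) ++ assign 6 (load 7 (reg 2)) ++
  branch (reg 5) (sizeLeft ++ (sizeRight ++ sizeUp)) sizeBridge ++
  assign 2 (reg 2 - lit 1)

/-- The allocation of the slots. -/
def sizeProg : Prog := assign 4 (lit 0) ++ assign 2 (reg 0 - lit 1) ++ loop (reg 2) sizeBody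

/-- The state during the allocation of the slots. -/
structure SizeState (n : ℕ) (P U cyc idx len : ℕ → ℕ) (s₀ t : State) (i : ℕ) : Prop where
  inv : ∃ tot L, SizeInv n P U cyc idx len i (t.mem 12) (t.mem 13) (t.mem 14) (t.mem 15) (t.reg 4)
    tot L
  lt : i < n
  reg : t.reg 0 = n
  frame : ∀ a, a ≠ 12 → a ≠ 13 → a ≠ 14 → a ≠ 15 → t.mem a = s₀.mem a

/-- The arrays used in the allocation of the slots. -/
structure SizeInput (P U cyc idx len : ℕ → ℕ) (s : State) : Prop where
  par : s.mem 7 = P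
  up : s.mem 8 = U
  cyc : s.mem 9 = cyc
  idx : s.mem 10 = idx
  len : s.mem 11 = len

variable {n M : ℕ} {P U cyc idx len : ℕ → ℕ} {s₀ t : State}

theorem SizeState.input {i : ℕ} (h : SizeState n P U cyc idx len s₀ t i)
    (hs : SizeInput P U cyc idx len s₀) : SizeInput P U cyc idx len t := by
  have := h.frame
  refine ⟨?_, ?_, ?_, ?_, ?_⟩
  · rw [h.frame 7 (by decide) (by decide) (by decide) (by decide), hs.par]
  · rw [h.frame 8 (by decide) (by decide) (by decide) (by decide), hs.up]
  · rw [h.frame 9 (by decide) (by decide) (by decide) (by decide), hs.cyc]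
  · rw [h.frame 10 (by decide) (by decide) (by decide) (by decide), hs.idx]
  · rw [h.frame 11 (by decide) (by decide) (by decide) (by decide), hs.len]

theorem sizeBridge_wp {i : ℕ} (hm : Marked n P U cyc idx len) (hM : 9 * n + 10 ≤ M)
    (h : SizeState n P U cyc idx len s₀ t i) (hi : 0 < i)
    (h2 : t.reg 2 = i) (h6 : t.reg 6 = P i) (hc : cyc i = 0) :
    sizeBridge.wp M (fun t' => SizeState n P U cyc idx len s₀ t' (i - 1) ∧ t'.reg 2 = i) t := by
  obtain ⟨tot, L, hI⟩ := h.inv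
  have hlt := h.lt
  have hp := hm.tree.parent_lt i hi hlt
  have hT := hI.slots_le_of_inv
  have e1 := hI.size_add_rel_le le_rfl
  have e2 := hI.size_add_rel_le hp.le
  have hstep := hI.step_bridge hm hi hlt hc rfl rfl
  simp (disch := decide) only [sizeBridge, wp_append, wp, eval_reg, eval_load, eval_lit, eval_add,
    State.setReg_reg_of_ne, State.setReg_mem, State.setMem_reg,
    State.setMem_mem_self, State.setMem_mem_of_ne, h2, h6]
  refine ⟨fun hz => ⟨by omega, by omega, ⟨?_, by omega, h.reg, ?_⟩, trivial⟩,
    fun hz => ⟨by omega, by omega, ?_, ?_, ⟨?_, by omega, ?_, ?_⟩, trivial⟩⟩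
  · rw [if_neg hz, if_neg hz, Function.update_eq_self] at hstep
    simp (disch := decide) only [State.setMem_reg, State.setMem_mem_self, State.setMem_mem_of_ne]
    exact ⟨_, _, hstep⟩
  · intro a h12 h13 h14 h15
    rw [State.setMem_mem_of_ne _ h12, State.setMem_mem_of_ne _ h14, h.frame a h12 h13 h14 h15]
  · rw [Function.update_of_ne hp.ne]
    omega
  · rw [Function.update_of_ne hp.ne, Function.update_self]
    omega
  · rw [if_pos hz, if_pos hz] at hstep
    simp (disch := decide) only [State.setMem_reg, State.setMem_mem_self, State.setMem_mem_of_ne,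
      State.setReg_mem, State.setReg_reg_self, Function.update_of_ne hp.ne, Function.update_self]
    exact ⟨_, _, hstep⟩
  · simp (disch := decide) only [State.setMem_reg, State.setReg_reg_of_ne, h.reg]
  · intro a h12 h13 h14 h15
    rw [State.setMem_mem_of_ne _ h12, State.setMem_mem_of_ne _ h14, State.setReg_mem,
      State.setMem_mem_of_ne _ h12, h.frame a h12 h13 h14 h15]

theorem sizeLeft_wp {i : ℕ} (h2 : t.reg 2 = i) (hM : t.reg 4 + 1 ≤ M) :
    sizeLeft.wp M (fun t' =>
      (t'.mem 13 = Function.update (t.mem 13) i (if t.mem 8 i ≠ 0 then 1 else t.mem 13 i) ∧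
      ∀ a, a ≠ 13 → t'.mem a = t.mem a) ∧
      t'.reg 4 = t.reg 4 + (if t.mem 8 i ≠ 0 then 1 else 0) ∧
      ∀ j, j ≠ 4 → t'.reg j = t.reg j) t := by
  simp (disch := decide) only [sizeLeft, wp_append, wp, eval_reg, eval_load, eval_lit, eval_add,
    State.setMem_reg, h2]
  refine ⟨fun hz => ⟨by omega, hM, ⟨?_, ?_⟩, ?_, ?_⟩, fun hz => ⟨⟨?_, ?_⟩, ?_, ?_⟩⟩
  · rw [if_pos hz, State.setReg_mem, State.setMem_mem_self]
  · intro a ha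
    rw [State.setReg_mem, State.setMem_mem_of_ne _ ha]
  · rw [if_pos hz, State.setReg_reg_self]
  · intro j hj
    rw [State.setReg_reg_of_ne _ hj, State.setMem_reg]
  · rw [if_neg (not_not.2 hz), Function.update_eq_self]
  · exact fun _ _ => trivial
  · rw [if_neg (not_not.2 hz), Nat.add_zero]
  · exact fun _ _ => trivial

theorem sizeRight_wp {i x : ℕ} (h2 : t.reg 2 = i) (h5 : t.reg 5 = x)
    (hM : t.mem 13 i + t.mem 12 i + 1 ≤ M) (hM' : t.reg 4 + 1 ≤ M) :
    sizeRight.wp M (fun t' =>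
      (t'.mem 15 = (if t.mem 10 i = t.mem 11 x / 2 then
        Function.update (t.mem 15) x (t.mem 13 i + t.mem 12 i) else t.mem 15) ∧
      ∀ a, a ≠ 15 → t'.mem a = t.mem a) ∧
      t'.reg 7 = t.mem 13 i + t.mem 12 i + (if t.mem 10 i = t.mem 11 x / 2 then 1 else 0) ∧
      t'.reg 4 = t.reg 4 + (if t.mem 10 i = t.mem 11 x / 2 then 1 else 0) ∧
      ∀ j, j ≠ 4 → j ≠ 7 → t'.reg j = t.reg j) t := by
  simp (disch := decide) only [sizeRight, wp_append, wp, eval_reg, eval_load, eval_lit, eval_add,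
    eval_div, eval_eq, State.setReg_reg_self, State.setReg_reg_of_ne, State.setReg_mem,
    State.setMem_reg, ite_one_zero_ne_zero, ite_one_zero_eq_zero, h2, h5]
  refine ⟨by omega, fun hz => ⟨by omega, hM, hM', ⟨?_, ?_⟩, ?_, ?_, ?_⟩,
    fun hz => ⟨⟨?_, ?_⟩, ?_, ?_, ?_⟩⟩
  · rw [if_pos hz, State.setMem_mem_self, State.setReg_mem]
  · intro a ha
    rw [State.setMem_mem_of_ne _ ha, State.setReg_mem]
  · rw [if_pos hz]
  · rw [if_pos hz]
  · intro j h4 h7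
    rw [State.setReg_reg_of_ne _ h4, State.setReg_reg_of_ne _ h7, State.setMem_reg,
      State.setReg_reg_of_ne _ h7]
  · rw [if_neg hz]
  · exact fun _ _ => trivial
  · rw [if_neg hz, Nat.add_zero]
  · rw [if_neg hz, Nat.add_zero]
  · intro j _ h7
    rw [State.setReg_reg_of_ne _ h7]

theorem sizeCycle_wp {i : ℕ} (hm : Marked n P U cyc idx len) (hM : 9 * n + 10 ≤ M)
    (hs : SizeInput P U cyc idx len s₀) (h : SizeState n P U cyc idx len s₀ t i)
    (h2 : t.reg 2 = i) (h5 : t.reg 5 = cyc i) (h6 : t.reg 6 = P i) (hc : cyc i ≠ 0) :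
    (sizeLeft ++ (sizeRight ++ sizeUp)).wp M
      (fun t' => SizeState n P U cyc idx len s₀ t' (i - 1) ∧ t'.reg 2 = i) t := by
  obtain ⟨tot, L, hI⟩ := h.inv
  have hlt := h.lt
  have hp := hm.parent_lt hc
  have hT := hI.slots_le_of_inv
  have e1 := hI.size_add_rel_le le_rfl
  have e2 := hI.size_add_rel_le hp.le
  have hin := h.input hs
  refine wp_cut _ (sizeLeft_wp h2 (by omega)) ?_
  rintro t₁ ⟨⟨m13, mo⟩, r4, ro⟩
  have hr : (if t.mem 8 i ≠ 0 then 1 else t.mem 13 i) ≤ t.mem 13 i + 1 := by split_ifs <;> omega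
  have hr' : (if t.mem 8 i ≠ 0 then 1 else 0) ≤ 1 := by split_ifs <;> omega
  refine wp_cut _ (sizeRight_wp (i := i) (x := cyc i) (by rw [ro 2 (by decide), h2])
    (by rw [ro 5 (by decide), h5]) ?_ ?_) ?_
  · rw [m13, Function.update_self, mo 12 (by decide)]
    omega
  · rw [r4]
    omega
  rintro t₂ ⟨⟨m15, mo'⟩, r7, r4', ro'⟩
  rw [m13, Function.update_self, mo 10 (by decide), mo 11 (by decide), mo 12 (by decide), hin.idx,
    hin.len, hin.up] at r7 m15
  rw [mo 10 (by decide), mo 11 (by decide), r4, hin.idx, hin.len, hin.up] at r4'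
  rw [mo 15 (by decide)] at m15
  have m13' := (mo' 13 (by decide)).trans m13
  rw [hin.up] at m13' hr
  have m12 := (mo' 12 (by decide)).trans (mo 12 (by decide))
  have m14 := (mo' 14 (by decide)).trans (mo 14 (by decide))
  have m8 := ((mo' 8 (by decide)).trans (mo 8 (by decide))).trans hin.up
  have g2 := ((ro' 2 (by decide) (by decide)).trans (ro 2 (by decide))).trans h2
  have g5 := ((ro' 5 (by decide) (by decide)).trans (ro 5 (by decide))).trans h5
  have g6 := ((ro' 6 (by decide) (by decide)).trans (ro 6 (by decide))).trans h6
  have g0 := ((ro' 0 (by decide) (by decide)).trans (ro 0 (by decide))).trans h.reg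
  have hfr : ∀ a, a ≠ 12 → a ≠ 13 → a ≠ 14 → a ≠ 15 → t₂.mem a = s₀.mem a := by
    intro a h12 h13 h14 h15
    rw [mo' a h15, mo a h13, h.frame a h12 h13 h14 h15]
  have hnx : t₂.reg 7 ≤ 3 * n + 2 := by
    rw [r7]
    have : (if idx i = len (cyc i) / 2 then 1 else 0) ≤ 1 := by split_ifs <;> omega
    omega
  simp (disch := decide) only [sizeUp, wp_append, wp, eval_reg, eval_load, eval_lit, eval_add,
    eval_eq, State.setMem_reg, State.setMem_mem_of_ne, ite_one_zero_ne_zero, ite_one_zero_eq_zero,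
    g5, g6, g2, m8, m12]
  refine ⟨fun hz => ⟨by omega, by omega, ⟨?_, by omega, g0, ?_⟩, trivial⟩,
    fun hz => ⟨by omega, ⟨?_, by omega, g0, ?_⟩, trivial⟩⟩
  · simp (disch := decide) only [State.setMem_reg, State.setMem_mem_self, State.setMem_mem_of_ne,
      m12, m13', m14]
    exact ⟨_, _, hI.step_top hm hc hz rfl r7 r4' m15⟩
  · intro a h12 h13 h14 h15
    rw [State.setMem_mem_of_ne _ h12, State.setMem_mem_of_ne _ h14, hfr a h12 h13 h14 h15]
  · simp (disch := decide) only [State.setMem_reg, State.setMem_mem_self, State.setMem_mem_of_ne,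
      m12, m13', m14]
    exact ⟨_, _, hI.step_push hm hc hz rfl r7 r4' m15⟩
  · intro a h12 h13 h14 h15
    rw [State.setMem_mem_of_ne _ h13, hfr a h12 h13 h14 h15]

theorem sizeBody_wp {i : ℕ} (hm : Marked n P U cyc idx len) (hM : 9 * n + 10 ≤ M)
    (hB : Bounded M t)
    (hs : SizeInput P U cyc idx len s₀) (h : SizeState n P U cyc idx len s₀ t i) (hi : 0 < i)
    (h2 : t.reg 2 = i) :
    sizeBody.wp M (fun t' => SizeState n P U cyc idx len s₀ t' (i - 1) ∧ t'.reg 2 = i - 1) t := by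
  have hin := h.input hs
  have hlt := h.lt
  refine wp_cut (fun t' => SizeState n P U cyc idx len s₀ t' (i - 1) ∧ t'.reg 2 = i) ?_ ?_
  · refine wp_cut (P := assign 5 (load 9 (reg 2)) ++ assign 6 (load 7 (reg 2))) (fun t' =>
      SizeState n P U cyc idx len s₀ t' i ∧ t'.reg 2 = i ∧ t'.reg 5 = cyc i ∧ t'.reg 6 = P i) ?_ ?_
    · simp (disch := decide) only [wp_append, wp, eval_reg, eval_load, State.setReg_reg_of_ne,
        State.setReg_reg_self, State.setReg_mem, h2, hin.cyc, hin.par]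
      refine ⟨hin.cyc ▸ hB.2 9 i, hin.par ▸ hB.2 7 i, ⟨?_, h.lt, ?_, h.frame⟩, trivial, trivial,
        trivial⟩
      · simp (disch := decide) only [State.setReg_reg_of_ne, State.setReg_mem]
        exact h.inv
      · simp (disch := decide) only [State.setReg_reg_of_ne, h.reg]
    · rintro t' ⟨h', g2, g5, g6⟩
      refine ⟨fun he => ?_, fun he => ?_⟩
      · rw [eval_reg, g5] at he
        exact sizeCycle_wp hm hM hs h' g2 g5 g6 he
      · rw [eval_reg, g5] at he
        exact sizeBridge_wp hm hM h' hi g2 g6 he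
  · rintro t' ⟨h', g2⟩
    simp (disch := decide) only [wp, eval_reg, eval_lit, eval_sub, State.setReg_reg_self, g2]
    refine ⟨by omega, ⟨?_, h'.lt, ?_, h'.frame⟩, trivial⟩
    · simp (disch := decide) only [State.setReg_reg_of_ne, State.setReg_mem]
      exact h'.inv
    · simp (disch := decide) only [State.setReg_reg_of_ne, h'.reg]

theorem sizeProg_runs {W : ℕ} {s : State} (hW : Words W M 20) (hm : Marked n P U cyc idx len)
    (hM : 9 * n + 10 ≤ M) (hn : 0 < n) (hB : Bounded M s) (h0 : s.reg 0 = n)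
    (hs : SizeInput P U cyc idx len s) (h12 : s.mem 12 = fun _ => 0)
    (h13 : s.mem 13 = fun _ => 0) :
    Runs W M sizeProg s (200 * n) (fun t => t.reg 0 = n ∧
      (∀ a, a ≠ 12 → a ≠ 13 → a ≠ 14 → a ≠ 15 → t.mem a = s.mem a) ∧
      ∃ tot L, SizeInv n P U cyc idx len 0 (t.mem 12) (t.mem 13) (t.mem 14) (t.mem 15) (t.reg 4)
        tot L) := by
  have hstart : Runs W M (assign 4 (lit 0) ++ assign 2 (reg 0 - lit 1)) s 10
      (fun t => SizeState n P U cyc idx len s t (t.reg 2)) := by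
    refine (Runs.of_wp hW hB (by decide) ?_).mono (by decide) fun _ h => h
    simp (disch := decide) only [wp_append, wp, eval_reg, eval_lit, eval_sub,
      State.setReg_reg_of_ne, State.setReg_reg_self, h0]
    refine ⟨by omega, by omega, ⟨fun _ => 0, ∅, ?_⟩, by omega, ?_, fun a _ _ _ _ => rfl⟩
    · simp (disch := decide) only [State.setReg_reg_of_ne, State.setReg_reg_self, State.setReg_mem,
        h12, h13]
      exact SizeInv.initial hm _ _ _
    · simp (disch := decide) only [State.setReg_reg_of_ne, h0]
  refine (hstart.append (c' := 150 * n) (R := fun t => t.reg 0 = n ∧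
      (∀ a, a ≠ 12 → a ≠ 13 → a ≠ 14 → a ≠ 15 → t.mem a = s.mem a) ∧
      ∃ tot L, SizeInv n P U cyc idx len 0 (t.mem 12) (t.mem 13) (t.mem 14) (t.mem 15) (t.reg 4)
        tot L) ?_).mono (by omega) fun _ h => h
  intro t hBt hI
  refine (Runs.loop hW (by decide) (fun k t => k = t.reg 2 ∧ SizeState n P U cyc idx len s t k) ?_
    (t.reg 2) t hBt ⟨rfl, hI⟩).mono ?_ ?_
  · rintro k t hBt ⟨rfl, hI⟩ he
    rw [eval_reg] at he
    refine wp_mono (sizeBody_wp hm hM hBt hs hI (Nat.pos_of_ne_zero he) rfl) ?_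
    rintro t' ⟨hI', h2⟩
    exact ⟨t.reg 2 - 1, by omega, h2.symm, hI'⟩
  · have := hI.lt
    calc _ ≤ (n - 1 + 1) * (Exp.cost (reg 2) + 1 + sizeBody.time) :=
          Nat.mul_le_mul_right _ (by omega)
      _ ≤ n * 150 := Nat.mul_le_mul (by omega) (by decide)
      _ = 150 * n := Nat.mul_comm _ _
  · rintro t ⟨he, k, hk, hI⟩
    rw [eval_reg] at he
    obtain rfl : k = 0 := by omega
    exact ⟨hI.reg, hI.frame, hI.inv⟩

end RAM

/-! ### The program that generates the directions. -/

namespace RAM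

open Exp Prog Cactus Slopes

theorem Exp.eval_lt_ne_zero (s : State) (e₁ e₂ : Exp) :
    (op .lt e₁ e₂).eval s ≠ 0 ↔ e₁.eval s < e₂.eval s := ite_one_zero_ne_zero

theorem Exp.eval_lt_eq_zero (s : State) (e₁ e₂ : Exp) :
    (op .lt e₁ e₂).eval s = 0 ↔ ¬ e₁.eval s < e₂.eval s := ite_one_zero_eq_zero

theorem Exp.eval_eq_ne_zero (s : State) (e₁ e₂ : Exp) :
    (op .eq e₁ e₂).eval s ≠ 0 ↔ e₁.eval s = e₂.eval s := ite_one_zero_ne_zero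

theorem Exp.eval_eq_eq_zero (s : State) (e₁ e₂ : Exp) :
    (op .eq e₁ e₂).eval s = 0 ↔ ¬ e₁.eval s = e₂.eval s := ite_one_zero_eq_zero

/-- The bound for the parameters of the directions. -/
def rootProg : Prog :=
  assign 8 (lit 9 * reg 4 / lit 2) ++ assign 9 (lit 1) ++
  loop (op .lt ((reg 9 + lit 1) * (reg 9 + lit 1)) (lit 2 * reg 8 + lit 1))
    (assign 9 (reg 9 + lit 1))

/-- Computes a direction from its parameters. -/
def vecProg : Prog :=
  assign 14 (lit 2 - (reg 13 + reg 12) % lit 2) ++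
  assign 15 (lit 2 * reg 13 * reg 12 / reg 14) ++
  assign 16 ((reg 13 * reg 13 - reg 12 * reg 12) / reg 14)

/-- Stores a direction if it is short enough. -/
def keepProg : Prog :=
  branch (op .lt (reg 15) (reg 8 + lit 1) * op .lt (reg 16) (reg 8 + lit 1))
    (store 16 (reg 2) (reg 15) ++ store 17 (reg 2) (reg 16) ++ assign 2 (reg 2 + lit 1)) skip

/-- Passes to the next fraction. -/
def nextProg : Prog :=
  assign 14 ((reg 9 + reg 11) / reg 13) ++
  assign 15 (reg 14 * reg 12 - reg 10) ++ assign 10 (reg 12) ++ assign 12 (reg 15) ++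
  assign 15 (reg 14 * reg 13 - reg 11) ++ assign 11 (reg 13) ++ assign 13 (reg 15)

/-- The generation of the directions in the order of their slopes. -/
def slopeProg : Prog :=
  rootProg ++ (assign 10 (lit 0) ++ assign 11 (lit 1) ++ assign 12 (lit 1) ++ assign 13 (reg 9) ++
    assign 2 (lit 0)) ++ loop (op .lt (reg 2) (reg 4)) (vecProg ++ (keepProg ++ nextProg))

variable {W M : ℕ} {s t : State}

/-- A linear search for the root is fast enough, since `O(T)` rounds are allowed. The search starts
with `1` in order to make the order of the Farey sequence positive even for `T = 0`, which explains
the bound `2X + 1` instead of `2X`. -/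
theorem rootProg_runs (hW : Words W M 20) (hB : Bounded M s) (hM : 9 * s.reg 4 + 2 ≤ M) :
    Runs W M rootProg s (200 * (s.reg 4 + 1)) (fun t => t.reg 0 = s.reg 0 ∧ t.reg 4 = s.reg 4 ∧
      t.mem = s.mem ∧ t.reg 8 = 9 * s.reg 4 / 2 ∧ 1 ≤ t.reg 9 ∧
      t.reg 9 * t.reg 9 ≤ 2 * t.reg 8 + 1 ∧ 2 * t.reg 8 < (t.reg 9 + 1) * (t.reg 9 + 1)) := by
  set I : ℕ → State → Prop := fun k t => t.reg 0 = s.reg 0 ∧ t.reg 4 = s.reg 4 ∧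
      t.mem = s.mem ∧ t.reg 8 = 9 * s.reg 4 / 2 ∧ 1 ≤ t.reg 9 ∧
      t.reg 9 * t.reg 9 ≤ 2 * t.reg 8 + 1 ∧ k + t.reg 9 = 9 * s.reg 4 + 2 with hI
  have hstart : Runs W M (assign 8 (lit 9 * reg 4 / lit 2) ++ assign 9 (lit 1)) s 10
      (I (9 * s.reg 4 + 1)) := by
    refine (Runs.of_wp hW hB (by decide) ?_).mono (by decide) fun _ h => h
    simp (disch := decide) only [wp_append, wp, eval_reg, eval_lit, eval_mul, eval_div, hI,
      State.setReg_reg_of_ne, State.setReg_reg_self, State.setReg_mem]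
    exact ⟨by omega, by omega, trivial, trivial, trivial, trivial, le_rfl, by omega, trivial⟩
  refine (hstart.append fun t hBt hIt => (Runs.loop hW (by decide) I ?_ _ t hBt hIt).mono
    le_rfl fun _ h => h).mono ?_ ?_
  · rintro k t hBt ⟨h0, h4, hm, h8, h1, h9, hk⟩ he
    simp only [eval_lt_ne_zero, eval_add, eval_mul, eval_reg, eval_lit] at he
    have hlt : t.reg 9 + 1 ≤ (t.reg 9 + 1) * (t.reg 9 + 1) := Nat.le_mul_self _
    simp (disch := decide) only [wp, eval_reg, eval_lit, eval_add, hI,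
      State.setReg_reg_of_ne, State.setReg_reg_self, State.setReg_mem]
    exact ⟨by omega, k - 1, by omega, h0, h4, hm, h8, by omega, by omega, by omega⟩
  · calc _ ≤ 10 + (9 * s.reg 4 + 1 + 1) * 20 :=
          Nat.add_le_add_left (Nat.mul_le_mul_left _ (by decide)) _
      _ ≤ _ := by omega
  · rintro t ⟨he, k, h0, h4, hm, h8, h1, h9, hk⟩
    simp only [eval_lt_eq_zero, eval_add, eval_mul, eval_reg, eval_lit] at he
    exact ⟨h0, h4, hm, h8, h1, h9, by omega⟩

/-- The state during the generation of the directions. -/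
structure FareyState (s t : State) (k : ℕ) : Prop where
  inv : FareyInv (t.reg 8) (t.reg 9) (t.reg 10) (t.reg 11) (t.reg 12) (t.reg 13) (t.reg 2)
    (t.mem 16) (t.mem 17)
  reg_zero : t.reg 0 = s.reg 0
  reg_four : t.reg 4 = s.reg 4
  reg_eight : t.reg 8 = 9 * s.reg 4 / 2
  le : t.reg 9 * t.reg 9 ≤ 2 * t.reg 8 + 1
  lt : 2 * t.reg 8 < (t.reg 9 + 1) * (t.reg 9 + 1)
  potential : t.reg 9 ^ 2 * t.reg 11 ≤ t.reg 10 * t.reg 9 ^ 2 + k * t.reg 11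
  frame : ∀ a, a ≠ 16 → a ≠ 17 → t.mem a = s.mem a

theorem vecProg_wp (hc : t.reg 12 ≤ t.reg 13) (hM : 2 * (t.reg 13 * t.reg 13) + 2 ≤ M) :
    vecProg.wp M (fun t' => t'.mem = t.mem ∧ t'.reg 15 = vecX (t.reg 13) (t.reg 12) ∧
      t'.reg 16 = vecY (t.reg 13) (t.reg 12) ∧ ∀ j, j < 14 → t'.reg j = t.reg j) t := by
  simp (disch := decide) only [vecProg, wp_append, wp, eval_reg, eval_lit, eval_mul, eval_div,
    eval_sub, eval_mod, eval_add, State.setReg_reg_of_ne, State.setReg_reg_self, State.setReg_mem]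
  have h1 : 2 * t.reg 13 * t.reg 12 ≤ 2 * (t.reg 13 * t.reg 13) := by
    rw [mul_assoc]
    exact Nat.mul_le_mul_left _ (Nat.mul_le_mul_left _ hc)
  refine ⟨by omega, (Nat.div_le_self _ _).trans (by omega),
    (Nat.div_le_self _ _).trans (by omega), trivial, rfl, rfl, ?_⟩
  intro j hj
  rw [State.setReg_reg_of_ne _ (by omega), State.setReg_reg_of_ne _ (by omega),
    State.setReg_reg_of_ne _ (by omega)]

theorem keepProg_wp (hB : Bounded M t) (hM : t.reg 2 + 1 ≤ M) :
    keepProg.wp M (fun t' => (∀ a, a ≠ 16 → a ≠ 17 → t'.mem a = t.mem a) ∧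
      (∀ j, j ≠ 2 → t'.reg j = t.reg j) ∧
      ((t.reg 15 ≤ t.reg 8 ∧ t.reg 16 ≤ t.reg 8) ∧ t'.reg 2 = t.reg 2 + 1 ∧
        t'.mem 16 = Function.update (t.mem 16) (t.reg 2) (t.reg 15) ∧
        t'.mem 17 = Function.update (t.mem 17) (t.reg 2) (t.reg 16) ∨
      ¬ (t.reg 15 ≤ t.reg 8 ∧ t.reg 16 ≤ t.reg 8) ∧ t'.reg 2 = t.reg 2 ∧
        t'.mem 16 = t.mem 16 ∧ t'.mem 17 = t.mem 17)) t := by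
  simp (disch := decide) only [keepProg, wp_append, wp, eval_reg, eval_lit, eval_mul, eval_add,
    eval_lt_ne_zero, eval_lt_eq_zero, mul_ne_zero_iff, mul_eq_zero,
    State.setMem_reg, State.setReg_reg_self, State.setReg_mem, State.setMem_mem_self,
    State.setMem_mem_of_ne]
  refine ⟨fun he => ⟨hB.1 15, hB.1 16, hM, ?_, ?_, Or.inl ⟨by omega, trivial, trivial, trivial⟩⟩,
    fun he => ⟨fun _ _ _ => trivial, fun _ _ => trivial, Or.inr ⟨by omega, trivial, trivial, trivial⟩⟩⟩
  · intro a h1 h2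
    rw [State.setMem_mem_of_ne _ h2, State.setMem_mem_of_ne _ h1]
  · intro j hj
    rw [State.setReg_reg_of_ne _ hj, State.setMem_reg, State.setMem_reg]

theorem nextProg_wp (hB : Bounded M t) (hM : t.reg 9 + t.reg 11 ≤ M)
    (h1 : (t.reg 9 + t.reg 11) / t.reg 13 * t.reg 12 - t.reg 10 ≤ M)
    (h2 : (t.reg 9 + t.reg 11) / t.reg 13 * t.reg 13 - t.reg 11 ≤ M) :
    nextProg.wp M (fun t' => t'.mem = t.mem ∧ (∀ j, j < 10 → t'.reg j = t.reg j) ∧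
      t'.reg 10 = t.reg 12 ∧ t'.reg 11 = t.reg 13 ∧
      t'.reg 12 = (t.reg 9 + t.reg 11) / t.reg 13 * t.reg 12 - t.reg 10 ∧
      t'.reg 13 = (t.reg 9 + t.reg 11) / t.reg 13 * t.reg 13 - t.reg 11) t := by
  simp (disch := decide) only [nextProg, wp_append, wp, eval_reg, eval_mul, eval_div,
    eval_sub, eval_add, State.setReg_reg_of_ne, State.setReg_reg_self, State.setReg_mem]
  refine ⟨(Nat.div_le_self _ _).trans hM, h1, hB.1 12, h1, h2, hB.1 13, h2, trivial, ?_, trivial,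
    trivial, trivial, trivial⟩
  intro j hj
  simp only [State.setReg_reg_of_ne _ (show j ≠ 14 by omega),
    State.setReg_reg_of_ne _ (show j ≠ 15 by omega), State.setReg_reg_of_ne _ (show j ≠ 10 by omega),
    State.setReg_reg_of_ne _ (show j ≠ 12 by omega), State.setReg_reg_of_ne _ (show j ≠ 11 by omega),
    State.setReg_reg_of_ne _ (show j ≠ 13 by omega)]

/-- As long as fewer than `T` vectors are stored, `le_card_params` guarantees a missing one. The
current fraction is then below `1`, the next one exists, and the potential drops. -/
theorem fareyBody_wp {k : ℕ} (hB : Bounded M t) (hM : 18 * s.reg 4 + 6 ≤ M)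
    (h : FareyState s t k) (hlt : t.reg 2 < t.reg 4) :
    (vecProg ++ (keepProg ++ nextProg)).wp M (fun t' => ∃ l < k, FareyState s t' l) t := by
  have hI := h.inv
  have h8 := h.reg_eight
  have h4 := h.reg_four
  have hle := h.le
  have hcard : s.reg 4 ≤ (params (t.reg 8) (t.reg 9)).card := by
    rw [h8]
    exact le_card_params (h8 ▸ h.lt)
  have hcd := hI.lt_of_count_lt (by omega)
  obtain ⟨g1, g2, g3, g4, g5, g6, g7⟩ := hI.next_fraction hcd
  obtain ⟨k', rfl, hk'⟩ := hI.potential hcd h.potential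
  have hN : t.reg 9 ≤ t.reg 9 * t.reg 9 := Nat.le_mul_self _
  have hd : t.reg 13 * t.reg 13 ≤ t.reg 9 * t.reg 9 := Nat.mul_le_mul hI.d_le hI.d_le
  have hb := hI.b_le
  refine wp_cut _ (wp_bounded hB (vecProg_wp hcd.le (by omega))) ?_
  rintro t₁ ⟨hB₁, m₁, r15, r16, ro₁⟩
  refine wp_cut _ (wp_bounded hB₁ (keepProg_wp hB₁ (by rw [ro₁ 2 (by decide)]; omega))) ?_
  rintro t₂ ⟨hB₂, m₂, ro₂, hk⟩
  have e : ∀ j, j < 14 → j ≠ 2 → t₂.reg j = t.reg j := fun j h1 h2 =>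
    (ro₂ j h2).trans (ro₁ j h1)
  have e9 := e 9 (by decide) (by decide)
  have e10 := e 10 (by decide) (by decide)
  have e11 := e 11 (by decide) (by decide)
  have e12 := e 12 (by decide) (by decide)
  have e13 := e 13 (by decide) (by decide)
  have e8 := e 8 (by decide) (by decide)
  refine wp_mono (nextProg_wp hB₂ (by omega) (by rw [e9, e10, e11, e12, e13]; omega)
    (by rw [e9, e11, e13]; omega)) ?_
  rintro t₃ ⟨m₃, ro₃, f10, f11, f12, f13⟩
  rw [e9, e10, e11, e12, e13] at f12
  rw [e9, e11, e13] at f13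
  have f8 := (ro₃ 8 (by decide)).trans e8
  have f9 := (ro₃ 9 (by decide)).trans e9
  refine ⟨k', Nat.lt_succ_self _, ?_, ?_, ?_, ?_, ?_, ?_, ?_, ?_⟩
  · rw [f8, f9, f10, f11, f12, f13, e12, e13, ro₃ 2 (by decide), m₃]
    rw [r15, r16, ro₁ 8 (by decide), ro₁ 2 (by decide), m₁] at hk
    rcases hk with ⟨⟨hx, hy⟩, k2, k16, k17⟩ | ⟨hn, k2, k16, k17⟩
    · rw [k2, k16, k17]
      exact hI.step_keep hcd hx hy
    · rw [k2, k16, k17]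
      exact hI.step_skip hcd hn
  · rw [ro₃ 0 (by decide), e 0 (by decide) (by decide), h.reg_zero]
  · rw [ro₃ 4 (by decide), e 4 (by decide) (by decide), h.reg_four]
  · rw [f8, h.reg_eight]
  · rw [f8, f9]
    exact h.le
  · rw [f8, f9]
    exact h.lt
  · rw [f9, f10, f11, e12, e13]
    exact hk'
  · intro a h16 h17
    rw [m₃, m₂ a h16 h17, m₁, h.frame a h16 h17]

theorem FareyState.dirs {k : ℕ} (h : FareyState s t k) (hi : ¬ t.reg 2 < t.reg 4) :
    Dirs (s.reg 4) (9 * s.reg 4 / 2) (t.mem 16) (t.mem 17) := by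
  have hI := h.inv
  rw [h.reg_four] at hi
  rw [← h.reg_eight]
  have key : ∀ i < s.reg 4, ∃ m k, (m, k) ∈ params (t.reg 8) (t.reg 9) ∧ t.mem 16 i = vecX m k ∧
      t.mem 17 i = vecY m k := by
    intro i hlt
    obtain ⟨m, k, h1, h2, h3, -⟩ := hI.stored i (by omega)
    exact ⟨m, k, h1, h2, h3⟩
  refine ⟨?_, ?_, ?_, ?_, fun i j hij hj => hI.sorted i j hij (by omega), ?_⟩ <;> intro i hlt <;>
    obtain ⟨m, k, h1, h2, h3⟩ := key i hlt <;>
    obtain ⟨-, g2, g3, -, g5, g6⟩ := mem_params.1 h1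
  · rw [h2]
    exact vecX_pos g2 g3
  · rw [h3]
    exact vecY_pos g3
  · rwa [h2]
  · rwa [h3]
  · rw [h2, h3]
    exact vec_length m k g3

/-- Starting from `0/1`, the potential is `N² ≤ 2X + 1 ≤ 9T + 1`, where `N` is the order of the
sequence. So the number of rounds is linear in `T`, and no sorting is needed. -/
theorem slopeProg_runs (hW : Words W M 20) (hB : Bounded M s) (hM : 18 * s.reg 4 + 6 ≤ M) :
    Runs W M slopeProg s (2000 * (s.reg 4 + 1)) (fun t => t.reg 0 = s.reg 0 ∧
      (∀ a, a ≠ 16 → a ≠ 17 → t.mem a = s.mem a) ∧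
      Dirs (s.reg 4) (9 * s.reg 4 / 2) (t.mem 16) (t.mem 17)) := by
  refine (((rootProg_runs hW hB (by omega)).append (c' := 20)
    (R := fun t => ∃ k, k ≤ 9 * s.reg 4 + 1 ∧ FareyState s t k) ?_).append
    (c' := 100 * (9 * s.reg 4 + 2)) ?_).mono (by omega) fun _ h => h
  · rintro t hBt ⟨h0, h4, hm, h8, h1, h9, h10⟩
    refine (Runs.of_wp hW hBt (by decide) ?_).mono (by decide) fun _ h => h
    simp (disch := decide) only [wp_append, wp, eval_reg, eval_lit, State.setReg_reg_of_ne]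
    have := hW.two_le
    refine ⟨by omega, by omega, by omega, hBt.1 9, by omega, t.reg 9 * t.reg 9, by omega, ?_⟩
    constructor <;> simp (disch := decide) only [State.setReg_reg_of_ne, State.setReg_reg_self,
      State.setReg_mem]
    · exact FareyInv.start h1 _ _ _
    · exact h0
    · exact h4
    · exact h8
    · exact h9
    · exact h10
    · rw [pow_two]
      omega
    · exact fun a _ _ => congrFun hm a
  · rintro t hBt ⟨k, hk, hI⟩
    refine (Runs.loop hW (by decide) (fun k t => FareyState s t k) ?_ k t hBt hI).mono ?_ ?_
    · intro k t hBt hI he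
      simp only [eval_lt_ne_zero, eval_reg] at he
      exact fareyBody_wp hBt hM hI he
    · calc _ ≤ (9 * s.reg 4 + 1 + 1) * 100 := Nat.mul_le_mul (by omega) (by decide)
        _ = _ := Nat.mul_comm _ _
    · rintro t ⟨he, k, hI⟩
      simp only [eval_lt_eq_zero, eval_reg] at he
      exact ⟨hI.reg_zero, hI.frame, hI.dirs he⟩

end RAM

/-! ### The program that places the vertices. -/

namespace Cactus

variable {n i : ℕ} {P U cyc idx len rel base boff Dx Dy start px py start' px' py' : ℕ → ℕ}

/-- The place of a vertex depends on other places only through the root of its block. That root has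
a smaller index, so later placements change nothing. -/
theorem PlacedAt.congr {c s x y : ℕ}
    (h : PlacedAt P U cyc idx len rel base boff Dx Dy start px py c s x y)
    (hs : start' (broot P U cyc c) = start (broot P U cyc c))
    (hx : px' (broot P U cyc c) = px (broot P U cyc c))
    (hy : py' (broot P U cyc c) = py (broot P U cyc c)) :
    PlacedAt P U cyc idx len rel base boff Dx Dy start' px' py' c s x y := by
  rw [broot] at hs hx hy
  refine ⟨fun hc => ?_, fun hc => ?_⟩
  · rw [if_pos hc] at hs hx hy
    rw [hs, hx, hy]
    exact h.1 hc
  · rw [if_neg hc] at hs hx hy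
    rw [rightScale, leftScale, rightSlot, leftSlot, hs, hx, hy]
    exact h.2 hc

theorem Placed.step {s x y : ℕ} (hm : Marked n P U cyc idx len)
    (h : Placed i P U cyc idx len rel base boff Dx Dy start px py) (h0 : 0 < i) (hi : i < n)
    (hp : PlacedAt P U cyc idx len rel base boff Dx Dy start px py i s x y) :
    Placed (i + 1) P U cyc idx len rel base boff Dx Dy (Function.update start i s)
      (Function.update px i x) (Function.update py i y) := by
  refine ⟨by rw [Function.update_of_ne h0.ne, h.start_zero], fun c hc hci => ?_⟩
  have hb := hm.broot_lt hc (by omega)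
  have key : PlacedAt P U cyc idx len rel base boff Dx Dy start px py c
      (Function.update start i s c) (Function.update px i x c) (Function.update py i y c) := by
    by_cases hic : c = i
    · subst hic
      simpa only [Function.update_self] using hp
    · simp only [Function.update_of_ne hic]
      exact h.placed c hc (by omega)
  refine key.congr ?_ ?_ ?_ <;> rw [Function.update_of_ne (by omega)]

theorem coefA_le (k j : ℕ) : coefA k j ≤ 1 := by
  rw [coefA]
  split_ifs <;> omega

theorem coefB_le {k D : ℕ} (hk : k ≤ D) (hD : 1 ≤ D) {j : ℕ} (hj : j ≤ D) : coefB k j ≤ D := by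
  rw [coefB]
  split_ifs <;> omega

end Cactus

namespace RAM

open Exp Prog Cactus

/-- Computes the multiples of the two sides of a cycle. -/
def coefProg : Prog :=
  branch (op .lt (lit 0) (reg 12) * op .lt (reg 12) (reg 11 / lit 2 + lit 1))
    (assign 13 (lit 1)) (assign 13 (lit 0)) ++
  branch (op .eq (reg 11) (lit 3))
    (branch (op .eq (reg 12) (lit 2)) (assign 14 (lit 1)) (assign 14 (lit 0)))
    (branch (op .lt (reg 12) (reg 11 / lit 2)) (assign 14 (reg 12 - lit 1))
      (branch (op .eq (reg 12) (reg 11 / lit 2)) (assign 14 (reg 11 - lit 1 - reg 11 / lit 2))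
        (assign 14 (reg 11 - reg 12))))

/-- Finds the root and the two sides of a cycle. -/
def sideProg : Prog :=
  assign 6 (load 8 (reg 5) - lit 1) ++ assign 7 (load 18 (reg 6) + load 14 (reg 5)) ++
  assign 8 (reg 7 + load 15 (reg 5)) ++ assign 11 (load 11 (reg 5)) ++
  assign 12 (load 10 (reg 2)) ++
  branch (op .eq (reg 11) (lit 3)) (assign 9 (load 17 (reg 8)) ++ assign 10 (load 17 (reg 7)))
    (assign 9 (lit 1) ++ assign 10 (lit 1))

/-- Places a vertex of a cycle. -/
def posCycle : Prog :=
  sideProg ++ (coefProg ++ (store 18 (reg 2) (reg 7 + load 13 (reg 2)) ++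
  store 19 (reg 2) (load 19 (reg 6) + reg 13 * (reg 9 * load 16 (reg 7)) +
    reg 14 * (reg 10 * load 16 (reg 8))) ++
  store 20 (reg 2) (load 20 (reg 6) + reg 13 * (reg 9 * load 17 (reg 7)) +
    reg 14 * (reg 10 * load 17 (reg 8)))))

/-- Places the lower end of a bridge. -/
def posBridge : Prog :=
  assign 6 (load 7 (reg 2)) ++ assign 7 (load 18 (reg 6) + load 14 (reg 2)) ++
  store 18 (reg 2) (reg 7) ++ store 19 (reg 2) (load 19 (reg 6) + load 16 (reg 7)) ++
  store 20 (reg 2) (load 20 (reg 6) + load 17 (reg 7))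

/-- Places a vertex and stores its coordinates. -/
def posBody : Prog :=
  assign 5 (load 9 (reg 2)) ++ (branch (reg 5) posCycle posBridge ++
  (store 2 (load 6 (reg 2)) (load 19 (reg 2)) ++ store 3 (load 6 (reg 2)) (load 20 (reg 2)) ++
  assign 2 (reg 2 + lit 1)))

/-- The placement of all vertices. -/
def posProg : Prog := assign 2 (lit 1) ++ loop (op .lt (reg 2) (reg 0)) posBody

variable {M D : ℕ} {s t : State}

theorem coefProg_wp (hM : 1 ≤ M) (h1 : t.reg 11 ≤ M) (h2 : t.reg 12 ≤ M) :
    coefProg.wp M (fun t' => t'.mem = t.mem ∧ t'.reg 13 = coefA (t.reg 11) (t.reg 12) ∧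
      t'.reg 14 = coefB (t.reg 11) (t.reg 12) ∧ ∀ j, j < 13 → t'.reg j = t.reg j) t := by
  have key : ∀ t₁ : State, t₁.mem = t.mem → (∀ j, j < 13 → t₁.reg j = t.reg j) →
      t₁.reg 13 = coefA (t.reg 11) (t.reg 12) → ∀ x, x = coefB (t.reg 11) (t.reg 12) →
      (t₁.setReg 14 x).mem = t.mem ∧ (t₁.setReg 14 x).reg 13 = coefA (t.reg 11) (t.reg 12) ∧
        (t₁.setReg 14 x).reg 14 = coefB (t.reg 11) (t.reg 12) ∧
        ∀ j, j < 13 → (t₁.setReg 14 x).reg j = t.reg j := by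
    intro t₁ hm hr h13 x hx
    refine ⟨hm, ?_, ?_, fun j hj => ?_⟩
    · rw [State.setReg_reg_of_ne _ (by decide), h13]
    · rw [State.setReg_reg_self, hx]
    · rw [State.setReg_reg_of_ne _ (by omega), hr j hj]
  refine wp_cut (fun t' => t'.mem = t.mem ∧ t'.reg 13 = coefA (t.reg 11) (t.reg 12) ∧
    ∀ j, j < 13 → t'.reg j = t.reg j) ?_ ?_
  · simp (disch := decide) only [wp, eval_reg, eval_lit, eval_mul, eval_add, eval_div,
      eval_lt_ne_zero, eval_lt_eq_zero, mul_ne_zero_iff, mul_eq_zero, State.setReg_reg_self,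
      State.setReg_mem]
    rw [coefA]
    refine ⟨fun h => ⟨hM, trivial, (if_pos (by omega)).symm, fun j hj => ?_⟩,
      fun h => ⟨by omega, trivial, (if_neg (by omega)).symm, fun j hj => ?_⟩⟩ <;>
    rw [State.setReg_reg_of_ne _ (by omega)]
  · rintro t₁ ⟨hm, h13, hr⟩
    simp (disch := decide) only [wp, eval_reg, eval_lit, eval_sub, eval_div,
      eval_lt_ne_zero, eval_lt_eq_zero, eval_eq_ne_zero, eval_eq_eq_zero, hr 11 (by decide),
      hr 12 (by decide)]
    have e : coefB (t.reg 11) (t.reg 12) = _ := rfl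
    rw [coefB] at e
    refine ⟨fun a => ⟨fun b => ⟨by omega, key t₁ hm hr h13 _ ?_⟩,
      fun b => ⟨by omega, key t₁ hm hr h13 _ ?_⟩⟩,
      fun a => ⟨fun b => ⟨by omega, key t₁ hm hr h13 _ ?_⟩,
      fun b => ⟨fun c => ⟨by omega, key t₁ hm hr h13 _ ?_⟩,
      fun c => ⟨by omega, key t₁ hm hr h13 _ ?_⟩⟩⟩⟩ <;> rw [coefB]
    · rw [if_pos a, if_pos b]
    · rw [if_pos a, if_neg b]
    · rw [if_neg a, if_pos b]
    · rw [if_neg a, if_neg b, if_pos c]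
    · rw [if_neg a, if_neg b, if_neg c]

/-- The place of a vertex computed from the arrays. -/
def PlacedIn (t : State) (c s x y : ℕ) : Prop :=
  PlacedAt (t.mem 7) (t.mem 8) (t.mem 9) (t.mem 10) (t.mem 11) (t.mem 13) (t.mem 14) (t.mem 15)
    (t.mem 16) (t.mem 17) (t.mem 18) (t.mem 19) (t.mem 20) c s x y

/-- The state `t'` arises from `t` by the placement of vertex `c`. -/
structure Places (D : ℕ) (t t' : State) (c : ℕ) : Prop where
  placed : PlacedIn t c (t'.mem 18 c) (t'.mem 19 c) (t'.mem 20 c)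
  start_le : t'.mem 18 c ≤ t.mem 18 (broot (t.mem 7) (t.mem 8) (t.mem 9) c) + 2 * D
  x_le : t'.mem 19 c ≤ t.mem 19 (broot (t.mem 7) (t.mem 8) (t.mem 9) c) + 2 * D ^ 3
  y_le : t'.mem 20 c ≤ t.mem 20 (broot (t.mem 7) (t.mem 8) (t.mem 9) c) + 2 * D ^ 3
  start_eq : t'.mem 18 = Function.update (t.mem 18) c (t'.mem 18 c)
  x_eq : t'.mem 19 = Function.update (t.mem 19) c (t'.mem 19 c)
  y_eq : t'.mem 20 = Function.update (t.mem 20) c (t'.mem 20 c)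
  frame : ∀ a, a ≠ 18 → a ≠ 19 → a ≠ 20 → t'.mem a = t.mem a
  reg_zero : t'.reg 0 = t.reg 0
  reg_two : t'.reg 2 = t.reg 2

theorem places_of_stores {t₁ : State} {c x y z : ℕ} (hm : t₁.mem = t.mem)
    (h0 : t₁.reg 0 = t.reg 0) (h2 : t₁.reg 2 = t.reg 2) (hp : PlacedIn t c x y z)
    (hx : x ≤ t.mem 18 (broot (t.mem 7) (t.mem 8) (t.mem 9) c) + 2 * D)
    (hy : y ≤ t.mem 19 (broot (t.mem 7) (t.mem 8) (t.mem 9) c) + 2 * D ^ 3)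
    (hz : z ≤ t.mem 20 (broot (t.mem 7) (t.mem 8) (t.mem 9) c) + 2 * D ^ 3) :
    Places D t (((t₁.setMem 18 c x).setMem 19 c y).setMem 20 c z) c := by
  refine ⟨?_, ?_, ?_, ?_, ?_, ?_, ?_, fun a h18 h19 h20 => ?_, h0, h2⟩
  on_goal 8 => rw [State.setMem_mem_of_ne _ h20, State.setMem_mem_of_ne _ h19,
    State.setMem_mem_of_ne _ h18, hm]
  all_goals simp (disch := decide) only [State.setMem_mem_self, State.setMem_mem_of_ne,
    Function.update_self, hm]
  · exact hp
  · exact hx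
  · exact hy
  · exact hz

/-- The bounds for the placement of a vertex with predecessor `v`. -/
structure PosBounds (M D : ℕ) (t : State) (v : ℕ) : Prop where
  one_le : 1 ≤ D
  le : ∀ a j, 4 ≤ a ∧ a < 18 → t.mem a j ≤ D
  start_le : t.mem 18 v + 2 * D ≤ M
  x_le : t.mem 19 v + 2 * D ^ 3 ≤ M
  y_le : t.mem 20 v + 2 * D ^ 3 ≤ M

theorem PosBounds.le_cube {v : ℕ} (_ : PosBounds M D t v) : D ≤ D ^ 3 :=
  Nat.le_self_pow (by decide) D

theorem posBridge_wp {i : ℕ} (h2 : t.reg 2 = i) (hc : t.mem 9 i = 0)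
    (h : PosBounds M D t (t.mem 7 i)) :
    posBridge.wp M (fun t' => Places D t t' i) t := by
  have e : broot (t.mem 7) (t.mem 8) (t.mem 9) i = t.mem 7 i := if_pos hc
  have b := h.le
  have b1 := h.start_le
  have b2 := h.x_le
  have b3 := h.y_le
  have b4 := h.le_cube
  have c1 := b 7 i (by decide)
  have c2 := b 14 i (by decide)
  have c3 := b 16 (t.mem 18 (t.mem 7 i) + t.mem 14 i) (by decide)
  have c4 := b 17 (t.mem 18 (t.mem 7 i) + t.mem 14 i) (by decide)
  simp (disch := decide) only [posBridge, wp_append, wp, eval_reg, eval_load, eval_add,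
    State.setReg_reg_self, State.setReg_reg_of_ne, State.setReg_mem, State.setMem_reg,
    State.setMem_mem_of_ne, h2]
  refine ⟨by omega, by omega, by omega, by omega, by omega, places_of_stores rfl ?_ ?_
    ⟨fun _ => ⟨rfl, rfl, rfl⟩, fun h => absurd hc h⟩ ?_ ?_ ?_⟩
  · rw [State.setReg_reg_of_ne _ (by decide), State.setReg_reg_of_ne _ (by decide)]
  · rw [State.setReg_reg_of_ne _ (by decide), State.setReg_reg_of_ne _ (by decide)]
  · rw [e]
    omega
  · rw [e]
    omega
  · rw [e]
    omega

theorem sideProg_wp {i x : ℕ} (h2 : t.reg 2 = i) (h5 : t.reg 5 = x)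
    (h : PosBounds M D t (t.mem 8 x - 1)) :
    sideProg.wp M (fun t' => t'.mem = t.mem ∧ t'.reg 0 = t.reg 0 ∧ t'.reg 2 = i ∧
      t'.reg 6 = t.mem 8 x - 1 ∧ t'.reg 7 = leftSlot (t.mem 8) (t.mem 14) (t.mem 18) x ∧
      t'.reg 8 = rightSlot (t.mem 8) (t.mem 14) (t.mem 15) (t.mem 18) x ∧
      t'.reg 9 = leftScale (t.mem 8) (t.mem 11) (t.mem 14) (t.mem 15) (t.mem 17) (t.mem 18) x ∧
      t'.reg 10 = rightScale (t.mem 8) (t.mem 11) (t.mem 14) (t.mem 17) (t.mem 18) x ∧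
      t'.reg 11 = t.mem 11 x ∧ t'.reg 12 = t.mem 10 i) t := by
  have b := h.le
  have b0 := h.one_le
  have b1 := h.start_le
  have b2 := h.x_le
  have b4 := h.le_cube
  have c0 := b 8 x (by decide)
  have c1 := b 14 x (by decide)
  have c2 := b 15 x (by decide)
  have c3 := b 11 x (by decide)
  have c4 := b 10 i (by decide)
  have c5 := b 17 (t.mem 18 (t.mem 8 x - 1) + t.mem 14 x + t.mem 15 x) (by decide)
  have c6 := b 17 (t.mem 18 (t.mem 8 x - 1) + t.mem 14 x) (by decide)
  simp (disch := decide) only [sideProg, wp_append, wp, eval_reg, eval_load, eval_add, eval_sub,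
    eval_lit, eval_eq_ne_zero, eval_eq_eq_zero,
    State.setReg_reg_self, State.setReg_reg_of_ne, State.setReg_mem, h2, h5]
  rw [leftScale, rightScale, rightSlot, leftSlot]
  refine ⟨by omega, by omega, by omega, by omega, by omega, fun h3 => ?_, fun h3 => ?_⟩
  · rw [if_pos h3, if_pos h3]
    exact ⟨by omega, by omega, trivial, trivial, trivial, trivial, rfl, rfl, rfl, rfl, trivial,
      trivial⟩
  · rw [if_neg h3, if_neg h3]
    exact ⟨by omega, by omega, trivial, trivial, trivial, trivial, rfl, rfl, rfl, rfl, trivial,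
      trivial⟩

theorem posCycle_wp {i : ℕ} (h2 : t.reg 2 = i) (hc : t.mem 9 i ≠ 0) (h5 : t.reg 5 = t.mem 9 i)
    (h : PosBounds M D t (t.mem 8 (t.mem 9 i) - 1)) :
    posCycle.wp M (fun t' => Places D t t' i) t := by
  have e : broot (t.mem 7) (t.mem 8) (t.mem 9) i = t.mem 8 (t.mem 9 i) - 1 := if_neg hc
  have b := h.le
  have b0 := h.one_le
  have b1 := h.start_le
  have b2 := h.x_le
  have b3 := h.y_le
  have b4 := h.le_cube
  have c3 := b 11 (t.mem 9 i) (by decide)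
  have c4 := b 10 i (by decide)
  refine wp_cut _ (sideProg_wp h2 h5 h) ?_
  rintro t₁ ⟨m, r0, r2, r6, r7, r8, r9, r10, r11, r12⟩
  refine wp_cut _ (coefProg_wp (by omega) (by omega) (by omega)) ?_
  rintro t₂ ⟨m', r13, r14, ro⟩
  rw [r11, r12] at r13 r14
  simp (disch := decide) only [wp_append, wp, eval_reg, eval_load, eval_add, eval_mul,
    State.setMem_reg, State.setMem_mem_of_ne, r13, r14, ro 2 (by decide), ro 6 (by decide),
    ro 7 (by decide), ro 8 (by decide), ro 9 (by decide), ro 10 (by decide), r2, r6, r7, r8, r9,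
    r10, m', m]
  have hA := coefA_le (t.mem 11 (t.mem 9 i)) (t.mem 10 i)
  have hB := coefB_le c3 b0 c4
  have hl : leftScale (t.mem 8) (t.mem 11) (t.mem 14) (t.mem 15) (t.mem 17) (t.mem 18)
      (t.mem 9 i) ≤ D := by
    rw [leftScale]
    split_ifs
    · exact b _ _ (by decide)
    · exact b0
  have hr : rightScale (t.mem 8) (t.mem 11) (t.mem 14) (t.mem 17) (t.mem 18) (t.mem 9 i) ≤ D := by
    rw [rightScale]
    split_ifs
    · exact b _ _ (by decide)
    · exact b0
  -- A coefficient, a scale and a coordinate of a direction are each at most `D`, so each of the two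
  -- sides contributes at most `D³`.
  have key : ∀ {A B p q r w : ℕ}, A ≤ 1 → B ≤ D → p ≤ D → q ≤ D → r ≤ D → w ≤ D →
      A * (p * q) + B * (r * w) ≤ 2 * D ^ 3 := by
    intro A B p q r w h1 h2 h3 h4 h5 h6
    have g1 : A * (p * q) ≤ D * (D * D) :=
      Nat.mul_le_mul (h1.trans b0) (Nat.mul_le_mul h3 h4)
    have g2 : B * (r * w) ≤ D * (D * D) := Nat.mul_le_mul h2 (Nat.mul_le_mul h5 h6)
    calc _ ≤ D * (D * D) + D * (D * D) := Nat.add_le_add g1 g2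
      _ = _ := by ring
  have kx := key hA hB hl (b 16 (leftSlot (t.mem 8) (t.mem 14) (t.mem 18) (t.mem 9 i)) (by decide))
    hr (b 16 (rightSlot (t.mem 8) (t.mem 14) (t.mem 15) (t.mem 18) (t.mem 9 i)) (by decide))
  have ky := key hA hB hl (b 17 (leftSlot (t.mem 8) (t.mem 14) (t.mem 18) (t.mem 9 i)) (by decide))
    hr (b 17 (rightSlot (t.mem 8) (t.mem 14) (t.mem 15) (t.mem 18) (t.mem 9 i)) (by decide))
  have ks : leftSlot (t.mem 8) (t.mem 14) (t.mem 18) (t.mem 9 i) + t.mem 13 i ≤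
      t.mem 18 (t.mem 8 (t.mem 9 i) - 1) + 2 * D := by
    rw [leftSlot]
    have := b 13 i (by decide)
    have := b 14 (t.mem 9 i) (by decide)
    omega
  refine ⟨by omega, by omega, by omega, places_of_stores (m'.trans m)
    ((ro 0 (by decide)).trans r0) (((ro 2 (by decide)).trans r2).trans h2.symm)
    ⟨fun h => absurd h hc, fun _ => ⟨rfl, rfl, rfl⟩⟩ ?_ ?_ ?_⟩
  · rw [e]
    omega
  · rw [e]
    omega
  · rw [e]
    omega

variable {n : ℕ} {P U cyc idx len rel base boff Dx Dy ord : ℕ → ℕ}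

/-- The arrays used for the placement. -/
structure PosInput (P U cyc idx len rel base boff Dx Dy ord : ℕ → ℕ) (s : State) : Prop where
  par : s.mem 7 = P
  up : s.mem 8 = U
  cyc : s.mem 9 = cyc
  idx : s.mem 10 = idx
  len : s.mem 11 = len
  rel : s.mem 13 = rel
  base : s.mem 14 = base
  boff : s.mem 15 = boff
  dx : s.mem 16 = Dx
  dy : s.mem 17 = Dy
  ord : s.mem 6 = ord

/-- The state during the placement. -/
structure PosState (n D : ℕ) (P U cyc idx len rel base boff Dx Dy ord : ℕ → ℕ) (i : ℕ) (t : State) :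
    Prop where
  input : PosInput P U cyc idx len rel base boff Dx Dy ord t
  placed : Placed i P U cyc idx len rel base boff Dx Dy (t.mem 18) (t.mem 19) (t.mem 20)
  reg_zero : t.reg 0 = n
  reg_two : t.reg 2 = i
  pos : 0 < i
  le : ∀ a j, 4 ≤ a ∧ a < 18 → t.mem a j ≤ D
  start_le : ∀ c < i, t.mem 18 c ≤ c * (2 * D)
  x_le : ∀ c < i, t.mem 19 c ≤ c * (2 * D ^ 3)
  y_le : ∀ c < i, t.mem 20 c ≤ c * (2 * D ^ 3)
  root : t.mem 19 0 = 0 ∧ t.mem 20 0 = 0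
  out_x : ∀ c < i, t.mem 2 (ord c) = t.mem 19 c
  out_y : ∀ c < i, t.mem 3 (ord c) = t.mem 20 c

end RAM

namespace RAM

open Exp Prog Cactus

variable {M D n : ℕ} {t : State} {P U cyc idx len rel base boff Dx Dy ord : ℕ → ℕ}

theorem PosInput.of_frame {t' : State} (h : PosInput P U cyc idx len rel base boff Dx Dy ord t)
    (hf : ∀ a, 4 ≤ a ∧ a < 18 → t'.mem a = t.mem a) :
    PosInput P U cyc idx len rel base boff Dx Dy ord t' := by
  obtain ⟨h1, h2, h3, h4, h5, h6, h7, h8, h9, h10, h11⟩ := h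
  constructor <;> rw [hf _ (by decide)] <;> assumption

theorem PosState.posBounds {i v : ℕ}
    (h : PosState n D P U cyc idx len rel base boff Dx Dy ord i t) (hD : 1 ≤ D)
    (hM : n * (2 * D ^ 3) ≤ M) (hi : i < n) (hv : v < i) : PosBounds M D t v := by
  have h3 : D ≤ D ^ 3 := Nat.le_self_pow (by decide) D
  have key : ∀ {x w : ℕ}, w ≤ D ^ 3 → x ≤ v * (2 * w) → x + 2 * w ≤ M := by
    intro x w hw hx
    calc x + 2 * w ≤ (v + 1) * (2 * w) := by
          rw [Nat.add_mul, Nat.one_mul]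
          omega
      _ ≤ n * (2 * D ^ 3) := Nat.mul_le_mul (by omega) (by omega)
      _ ≤ M := hM
  exact ⟨hD, h.le, key h3 (h.start_le v hv), key le_rfl (h.x_le v hv), key le_rfl (h.y_le v hv)⟩

/-- The bounds `c * (2 * D)` and `c * (2 * D ^ 3)` propagate because the root of the block has an
index at most `c - 1`. They serve the word size only; the bound by the grid side is proved
separately. -/
theorem PosState.step {i : ℕ} {t₁ t₂ : State} (hm : Marked n P U cyc idx len)
    (hord : ∀ c c', c < n → c' < n → ord c = ord c' → c = c')
    (h : PosState n D P U cyc idx len rel base boff Dx Dy ord i t) (hi : i < n)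
    (hp : Places D t t₁ i)
    (h2 : t₂.mem 2 = Function.update (t₁.mem 2) (ord i) (t₁.mem 19 i))
    (h3 : t₂.mem 3 = Function.update (t₁.mem 3) (ord i) (t₁.mem 20 i))
    (hf : ∀ a, a ≠ 2 → a ≠ 3 → t₂.mem a = t₁.mem a) (r0 : t₂.reg 0 = t₁.reg 0)
    (r2 : t₂.reg 2 = i + 1) :
    PosState n D P U cyc idx len rel base boff Dx Dy ord (i + 1) t₂ := by
  have hfr : ∀ a, 4 ≤ a ∧ a < 18 → t₂.mem a = t.mem a := fun a ha => by
    rw [hf a (by omega) (by omega), hp.frame a (by omega) (by omega) (by omega)]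
  have hbr := hm.broot_lt h.pos hi
  have hin := h.input
  have h0 := h.pos
  have e18 := (hf 18 (by decide) (by decide)).trans hp.start_eq
  have e19 := (hf 19 (by decide) (by decide)).trans hp.x_eq
  have e20 := (hf 20 (by decide) (by decide)).trans hp.y_eq
  have l18 := hp.start_le
  have l19 := hp.x_le
  have l20 := hp.y_le
  have hpl := hp.placed
  rw [PlacedIn] at hpl
  rw [hin.par, hin.up, hin.cyc] at l18 l19 l20
  rw [hin.par, hin.up, hin.cyc, hin.idx, hin.len, hin.rel, hin.base, hin.boff, hin.dx, hin.dy] at hpl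
  have key : ∀ {f : ℕ → ℕ} {x w : ℕ}, (∀ c < i, f c ≤ c * w) →
      x ≤ f (broot P U cyc i) + w → ∀ c < i + 1, Function.update f i x c ≤ c * w := by
    intro f x w hc hx c hci
    by_cases hcc : c = i
    · subst hcc
      rw [Function.update_self]
      calc x ≤ broot P U cyc c * w + w := hx.trans (Nat.add_le_add_right (hc _ hbr) _)
        _ = (broot P U cyc c + 1) * w := by ring
        _ ≤ c * w := Nat.mul_le_mul_right _ hbr
    · rw [Function.update_of_ne hcc]
      exact hc c (by omega)
  have out : ∀ {g f f' : ℕ → ℕ} {x : ℕ}, (∀ c < i, g (ord c) = f c) →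
      f' = Function.update f i x → ∀ c < i + 1, Function.update g (ord i) x (ord c) = f' c := by
    rintro g f f' x hg rfl c hci
    by_cases hcc : c = i
    · subst hcc
      rw [Function.update_self, Function.update_self]
    · rw [Function.update_of_ne hcc, Function.update_of_ne, hg c (by omega)]
      exact fun he => hcc (hord c i (by omega) hi he)
  refine ⟨hin.of_frame hfr, ?_, ?_, r2, by omega, fun a j ha => ?_, ?_, ?_, ?_, ?_, ?_, ?_⟩
  · rw [e18, e19, e20]
    exact h.placed.step hm h.pos hi hpl
  · rw [r0, hp.reg_zero, h.reg_zero]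
  · rw [hfr a ha]
    exact h.le a j ha
  · rw [e18]
    exact key h.start_le l18
  · rw [e19]
    exact key h.x_le l19
  · rw [e20]
    exact key h.y_le l20
  · rw [e19, e20, Function.update_of_ne h0.ne, Function.update_of_ne h0.ne]
    exact h.root
  · rw [h2, hp.frame 2 (by decide) (by decide) (by decide)]
    exact out h.out_x e19
  · rw [h3, hp.frame 3 (by decide) (by decide) (by decide)]
    exact out h.out_y e20

theorem posBody_wp {i : ℕ} (hB : Bounded M t) (hm : Marked n P U cyc idx len)
    (hord : ∀ c c', c < n → c' < n → ord c = ord c' → c = c') (hD : 1 ≤ D)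
    (hM : n * (2 * D ^ 3) ≤ M) (hnM : n ≤ M)
    (h : PosState n D P U cyc idx len rel base boff Dx Dy ord i t) (hi : i < n) :
    posBody.wp M (PosState n D P U cyc idx len rel base boff Dx Dy ord (i + 1)) t := by
  have hbr := hm.broot_lt h.pos hi
  have hin := h.input
  refine wp_cut (fun t' => Bounded M t' ∧
    PosState n D P U cyc idx len rel base boff Dx Dy ord i t' ∧ t'.reg 5 = cyc i)
    (wp_bounded hB ?_) ?_
  · simp only [wp, eval_reg, eval_load, h.reg_two, hin.cyc, State.setReg_reg_self]
    refine ⟨hin.cyc ▸ hB.2 9 i, ⟨hin.of_frame fun _ _ => rfl, h.placed, ?_, ?_, h.pos, h.le,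
      h.start_le, h.x_le, h.y_le, h.root, h.out_x, h.out_y⟩, trivial⟩
    · rw [State.setReg_reg_of_ne _ (by decide), h.reg_zero]
    · rw [State.setReg_reg_of_ne _ (by decide), h.reg_two]
  · rintro t ⟨hB, h, h5⟩
    have hin := h.input
    have hb := h.posBounds hD hM hi hbr
    rw [broot] at hb
    refine wp_cut (fun t' => Bounded M t' ∧ Places D t t' i) (wp_bounded hB ?_) ?_
    · refine ⟨fun he => ?_, fun he => ?_⟩ <;> rw [eval_reg, h5] at he
      · rw [if_neg he, ← hin.up, ← hin.cyc] at hb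
        exact posCycle_wp h.reg_two (hin.cyc ▸ he) (hin.cyc ▸ h5) hb
      · rw [if_pos he, ← hin.par] at hb
        exact posBridge_wp h.reg_two (hin.cyc ▸ he) hb
    · rintro t₁ ⟨hB₁, hp⟩
      have e6 := (hp.frame 6 (by decide) (by decide) (by decide)).trans hin.ord
      have r2 := hp.reg_two.trans h.reg_two
      simp (disch := decide) only [wp_append, wp, eval_reg, eval_load, eval_lit, eval_add,
        State.setMem_reg, State.setMem_mem_of_ne, r2, e6]
      refine ⟨hB₁.2 19 i, hB₁.2 20 i, by omega, h.step hm hord hi hp ?_ ?_ ?_ ?_ ?_⟩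
      · rw [State.setReg_mem, State.setMem_mem_of_ne _ (by decide), State.setMem_mem_self]
      · rw [State.setReg_mem, State.setMem_mem_self, State.setMem_mem_of_ne _ (by decide)]
      · intro a h2 h3
        rw [State.setReg_mem, State.setMem_mem_of_ne _ h3, State.setMem_mem_of_ne _ h2]
      · rw [State.setReg_reg_of_ne _ (by decide), State.setMem_reg, State.setMem_reg]
      · rw [State.setReg_reg_self]

theorem posProg_runs {W : ℕ} {s : State} (hW : Words W M 20) (hm : Marked n P U cyc idx len)
    (hord : ∀ c c', c < n → c' < n → ord c = ord c' → c = c') (hD : Bounded D s) (hD1 : 1 ≤ D)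
    (hDM : D ≤ M) (hM : n * (2 * D ^ 3) ≤ M) (hn : 0 < n) (h0 : s.reg 0 = n)
    (hin : PosInput P U cyc idx len rel base boff Dx Dy ord s)
    (hz : ∀ a, a = 2 ∨ a = 3 ∨ 18 ≤ a → s.mem a = fun _ => 0) :
    Runs W M posProg s (200 * n) (PosState n D P U cyc idx len rel base boff Dx Dy ord n) := by
  have hB : Bounded M s := ⟨fun i => (hD.1 i).trans hDM, fun a j => (hD.2 a j).trans hDM⟩
  have hnM : n ≤ M := h0 ▸ hB.1 0
  have e2 := hz 2 (by decide)
  have e3 := hz 3 (by decide)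
  have e18 := hz 18 (by decide)
  have e19 := hz 19 (by decide)
  have e20 := hz 20 (by decide)
  have hstart : Runs W M (assign 2 (lit 1)) s 2
      (PosState n D P U cyc idx len rel base boff Dx Dy ord 1) := by
    refine (Runs.of_wp hW hB (by decide) ?_).mono (by decide) fun _ h => h
    simp only [wp, eval_lit]
    refine ⟨by omega, hin.of_frame fun _ _ => rfl, ?_, ?_, ?_, by decide,
      fun a j _ => hD.2 a j, ?_, ?_, ?_, ?_, ?_, ?_⟩ <;>
      simp (disch := decide) only [State.setReg_mem, State.setReg_reg_of_ne, State.setReg_reg_self,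
        e2, e3, e18, e19, e20, h0, Nat.zero_le, implies_true, and_self]
    exact ⟨rfl, fun c h1 h2 => by omega⟩
  refine (hstart.append (c' := 150 * n) (R := PosState n D P U cyc idx len rel base boff Dx Dy ord n)
    ?_).mono (by omega) fun _ h => h
  intro t hBt hI
  refine (Runs.loop hW (by decide) (fun k t => ∃ i, k + i = n ∧
    PosState n D P U cyc idx len rel base boff Dx Dy ord i t) ?_ (n - 1) t hBt
    ⟨1, by omega, hI⟩).mono ?_ ?_
  · rintro k t hBt ⟨i, hk, hI⟩ he
    rw [eval_lt_ne_zero, eval_reg, eval_reg, hI.reg_two, hI.reg_zero] at he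
    refine wp_mono (posBody_wp hBt hm hord hD1 hM hnM hI he) fun t' h' => ?_
    exact ⟨k - 1, by omega, i + 1, by omega, h'⟩
  · calc _ ≤ (n - 1 + 1) * 150 := Nat.mul_le_mul_left _ (by decide)
      _ = _ := by omega
  · rintro t ⟨he, k, i, hk, hI⟩
    rw [eval_lt_eq_zero, eval_reg, eval_reg, hI.reg_two, hI.reg_zero] at he
    obtain rfl : i = n := by omega
    exact hI

end RAM

/-! ### The invariant of the depth-first search. -/

namespace Cactus

/-- The arrays `off` and `adj` hold adjacency lists of the relation `A` on `0, …, n - 1`. -/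
structure ListsOf (n : ℕ) (A : ℕ → ℕ → Prop) (off adj : ℕ → ℕ) : Prop where
  off_le : ∀ v < n, off v ≤ off (v + 1)
  mem_iff : ∀ v < n, ∀ w, A v w ↔ ∃ q, off v + q < off (v + 1) ∧ adj (off v + q) = w
  lt : ∀ v w, A v w → v < n ∧ w < n
  symm : ∀ v w, A v w → A w v
  irrefl : ∀ v, ¬ A v v

/-- The state of a depth-first search: `cnt` vertices have been reached, vertex number `i` is
`ord i`, the search is at vertex number `cur`, and `sc v` entries of the list of `v` have been
scanned. -/
structure SearchInv (n : ℕ) (A : ℕ → ℕ → Prop) (off adj : ℕ → ℕ) (cur cnt : ℕ)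
    (num sc ord P U : ℕ → ℕ) : Prop where
  cur_lt : cur < cnt
  num_ord : ∀ i < cnt, num (ord i) = i + 1
  ord_num : ∀ v, num v ≠ 0 → num v ≤ cnt ∧ ord (num v - 1) = v
  ord_lt : ∀ i < cnt, ord i < n
  parent_zero : P 0 = 0
  parent_lt : ∀ i, 0 < i → i < cnt → P i < i
  parent_adj : ∀ i, 0 < i → i < cnt → A (ord (P i)) (ord i)
  done : ∀ i < cnt, (∃ t, P^[t] cur = i) ∨ off (ord i) + sc (ord i) = off (ord i + 1)
  sc_le : ∀ v < n, off v + sc v ≤ off (v + 1)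
  scanned : ∀ v < n, ∀ q < sc v, num v ≠ 0 ∧ num (adj (off v + q)) ≠ 0
  up_of_scanned : ∀ i < cnt, ∀ q < sc (ord i), ∀ j < i, adj (off (ord i) + q) = ord j → j ≠ P i →
    U i ≠ 0
  up : ∀ i, U i ≠ 0 → i < cnt ∧ U i - 1 < i ∧ U i - 1 ≠ P i ∧ A (ord (U i - 1)) (ord i)
  ancestor : ∀ i j, i < j → j < cnt → A (ord i) (ord j) → ∃ t, P^[t] j = i

theorem iterate_lt_of_parent_lt {cnt : ℕ} {P : ℕ → ℕ} (h0 : P 0 = 0)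
    (hP : ∀ i, 0 < i → i < cnt → P i < i) (t : ℕ) {i : ℕ} (hi : i < cnt) : P^[t] i < cnt := by
  induction t generalizing i with
  | zero => exact hi
  | succ t ih =>
    rw [Function.iterate_succ_apply]
    refine ih ?_
    rcases Nat.eq_zero_or_pos i with rfl | h
    · rwa [h0]
    · exact (hP i h hi).trans hi

theorem iterate_update {cnt x : ℕ} {P : ℕ → ℕ} (h0 : P 0 = 0)
    (hP : ∀ i, 0 < i → i < cnt → P i < i) (t : ℕ) {i : ℕ} (hi : i < cnt) :
    (Function.update P cnt x)^[t] i = P^[t] i := by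
  induction t generalizing i with
  | zero => rfl
  | succ t ih =>
    rw [Function.iterate_succ_apply, Function.iterate_succ_apply, Function.update_of_ne hi.ne]
    exact ih (iterate_lt_of_parent_lt h0 hP 1 hi)

namespace SearchInv

variable {n : ℕ} {A : ℕ → ℕ → Prop} {off adj : ℕ → ℕ} {cur cnt : ℕ} {num sc ord P U : ℕ → ℕ}

theorem cnt_le (h : SearchInv n A off adj cur cnt num sc ord P U) : cnt ≤ n := by
  have : (Finset.range cnt).card ≤ (Finset.range n).card := by
    refine Finset.card_le_card_of_injOn ord (fun i hi => ?_) fun i hi j hj hij => ?_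
    · simp only [Finset.coe_range, Set.mem_Iio] at hi ⊢
      exact h.ord_lt i hi
    · simp only [Finset.coe_range, Set.mem_Iio] at hi hj
      have h1 := h.num_ord i hi
      rw [hij, h.num_ord j hj] at h1
      omega
  simpa using this

theorem initial (hl : ListsOf n A off adj) {r : ℕ} (hr : r < n) {num sc ord P U : ℕ → ℕ}
    (hnum : num = fun _ => 0) (hsc : sc = fun _ => 0) (hP : P = fun _ => 0) (hU : U = fun _ => 0) :
    SearchInv n A off adj 0 1 (Function.update num r 1) sc (Function.update ord 0 r) P U := by
  subst hnum hsc hP hU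
  have h1 : ∀ i < 1, Function.update ord 0 r i = r := fun i hi => by
    rw [Nat.lt_one_iff.1 hi, Function.update_self]
  constructor
  · exact Nat.one_pos
  · intro i hi
    rw [h1 i hi, Function.update_self, Nat.lt_one_iff.1 hi]
  · intro v hv
    by_cases hvr : v = r
    · subst hvr
      rw [Function.update_self, Function.update_self]
      exact ⟨le_rfl, rfl⟩
    · rw [Function.update_of_ne hvr] at hv
      exact absurd rfl hv
  · intro i hi
    rw [h1 i hi]
    exact hr
  · rfl
  · exact fun i h0 hi => by omega
  · exact fun i h0 hi => by omega
  · exact fun i hi => Or.inl ⟨0, (Nat.lt_one_iff.1 hi).symm⟩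
  · exact fun v hv => hl.off_le v hv
  · exact fun v _ q hq => absurd hq (Nat.not_lt_zero q)
  · exact fun i _ q hq => absurd hq (Nat.not_lt_zero q)
  · exact fun i hi => absurd rfl hi
  · exact fun i j hij hj => by omega

/-- When the current vertex leaves the search path, its list has been scanned completely, which is
the other alternative in `done`. -/
theorem step_pop (h : SearchInv n A off adj cur cnt num sc ord P U)
    (hd : ¬ off (ord cur) + sc (ord cur) < off (ord cur + 1)) (h0 : cur ≠ 0) :
    SearchInv n A off adj (P cur) cnt num sc ord P U := by
  have h1 := h.parent_lt cur (Nat.pos_of_ne_zero h0) h.cur_lt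
  refine { h with cur_lt := h1.trans h.cur_lt, done := fun i hi => ?_ }
  rcases h.done i hi with ⟨t, ht⟩ | hr
  · cases t with
    | zero =>
      rw [Function.iterate_zero_apply] at ht
      subst ht
      have := h.sc_le (ord cur) (h.ord_lt cur h.cur_lt)
      exact Or.inr (by omega)
    | succ t => exact Or.inl ⟨t, ht⟩
  · exact Or.inr hr

/-- The scan of an entry with a vertex that was reached before. -/
theorem step_back (hl : ListsOf n A off adj)
    (h : SearchInv n A off adj cur cnt num sc ord P U) {w : ℕ} {U' : ℕ → ℕ}
    (hd : off (ord cur) + sc (ord cur) < off (ord cur + 1))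
    (hw : adj (off (ord cur) + sc (ord cur)) = w) (hk : num w ≠ 0)
    (hU : num w ≤ cur ∧ num w ≠ P cur + 1 ∧ U' = Function.update U cur (num w) ∨
      ¬ (num w ≤ cur ∧ num w ≠ P cur + 1) ∧ U' = U) :
    SearchInv n A off adj cur cnt num (Function.update sc (ord cur) (sc (ord cur) + 1)) ord P U' := by
  have hord : ∀ i < cnt, i ≠ cur → ord i ≠ ord cur := by
    intro i hi hne he
    have h1 := h.num_ord i hi
    rw [he, h.num_ord cur h.cur_lt] at h1
    omega
  have hcn := h.ord_lt cur h.cur_lt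
  have hadj : A (ord cur) w := (hl.mem_iff _ hcn w).2 ⟨_, hd, hw⟩
  have hU0 : ∀ i, U i ≠ 0 → U' i ≠ 0 := by
    intro i hi
    rcases hU with ⟨-, -, rfl⟩ | ⟨-, rfl⟩
    · by_cases hic : i = cur
      · rw [hic, Function.update_self]
        exact hk
      · rwa [Function.update_of_ne hic]
    · exact hi
  refine { h with done := fun i hi => ?_, sc_le := fun v hv => ?_, scanned := fun v hv q hq => ?_,
                  up_of_scanned := fun i hi q hq j hj he hne => ?_, up := fun i hi => ?_ }
  · by_cases hic : i = cur
    · exact Or.inl ⟨0, hic.symm⟩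
    · rw [Function.update_of_ne (hord i hi hic)]
      exact h.done i hi
  · by_cases hvc : v = ord cur
    · rw [hvc, Function.update_self]
      omega
    · rw [Function.update_of_ne hvc]
      exact h.sc_le v hv
  · by_cases hvc : v = ord cur
    · subst hvc
      rw [Function.update_self] at hq
      rcases Nat.lt_succ_iff_lt_or_eq.1 hq with hq | rfl
      · exact h.scanned _ hv q hq
      · rw [hw, h.num_ord cur h.cur_lt]
        exact ⟨Nat.succ_ne_zero _, hk⟩
    · rw [Function.update_of_ne hvc] at hq
      exact h.scanned v hv q hq
  · by_cases hic : i = cur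
    · subst hic
      rw [Function.update_self] at hq
      rcases Nat.lt_succ_iff_lt_or_eq.1 hq with hq | rfl
      · exact hU0 i (h.up_of_scanned i hi q hq j hj he hne)
      · rw [hw] at he
        subst he
        -- The scanned neighbour has index `j < i`, so its number `j + 1` is at most `i`, and since
        -- it is not the parent, the entry has just been stored.
        have := h.num_ord j (by omega)
        rcases hU with ⟨-, -, rfl⟩ | ⟨hn, -⟩
        · rw [Function.update_self]
          exact hk
        · exact absurd ⟨by omega, by omega⟩ hn
    · rw [Function.update_of_ne (hord i hi hic)] at hq
      exact hU0 i (h.up_of_scanned i hi q hq j hj he hne)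
  · rcases hU with ⟨h1, h2, rfl⟩ | ⟨-, rfl⟩
    · by_cases hic : i = cur
      · subst hic
        rw [Function.update_self, (h.ord_num w hk).2]
        exact ⟨h.cur_lt, by omega, by omega, hl.symm _ _ hadj⟩
      · rw [Function.update_of_ne hic] at hi ⊢
        exact h.up i hi
    · exact h.up i hi

/-- The scan of an entry with a new vertex. -/
theorem step_new (hl : ListsOf n A off adj)
    (h : SearchInv n A off adj cur cnt num sc ord P U) {w : ℕ}
    (hd : off (ord cur) + sc (ord cur) < off (ord cur + 1))
    (hw : adj (off (ord cur) + sc (ord cur)) = w) (hk : num w = 0) :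
    SearchInv n A off adj cnt (cnt + 1) (Function.update num w (cnt + 1))
      (Function.update sc (ord cur) (sc (ord cur) + 1)) (Function.update ord cnt w)
      (Function.update P cnt cur) U := by
  have hcl := h.cur_lt
  have hcn := h.ord_lt cur h.cur_lt
  have hadj : A (ord cur) w := (hl.mem_iff _ hcn w).2 ⟨_, hd, hw⟩
  have hwn := (hl.lt _ _ hadj).2
  have hord : ∀ i < cnt, i ≠ cur → ord i ≠ ord cur := by
    intro i hi hne he
    have h1 := h.num_ord i hi
    rw [he, h.num_ord cur h.cur_lt] at h1
    omega
  have hwo : ∀ i < cnt, ord i ≠ w := by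
    intro i hi he
    have h1 := h.num_ord i hi
    rw [he, hk] at h1
    omega
  -- Lists are scanned only for vertices that were reached, so the scan of a new vertex starts at
  -- the beginning of its list.
  have hsc : sc w = 0 := by
    by_contra h0
    exact (h.scanned w hwn 0 (Nat.pos_of_ne_zero h0)).1 hk
  have ho : ∀ i < cnt, Function.update ord cnt w i = ord i := fun i hi =>
    Function.update_of_ne hi.ne _ _
  have hp : ∀ i < cnt, Function.update P cnt cur i = P i := fun i hi =>
    Function.update_of_ne hi.ne _ _
  have hit : ∀ t, ∀ i < cnt, (Function.update P cnt cur)^[t] i = P^[t] i := fun t i hi =>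
    iterate_update h.parent_zero h.parent_lt t hi
  have hpl : ∀ i < cnt, P i < cnt := fun i hi =>
    iterate_lt_of_parent_lt h.parent_zero h.parent_lt 1 hi
  have hnum : ∀ v, num v ≠ 0 → Function.update num w (cnt + 1) v ≠ 0 := by
    intro v hv
    rwa [Function.update_of_ne]
    rintro rfl
    exact hv hk
  have hon : ∀ i t, P^[t] cur = i → (Function.update P cnt cur)^[t + 1] cnt = i := by
    intro i t ht
    rw [Function.iterate_succ_apply, Function.update_self, hit t cur hcl, ht]
  constructor
  · exact Nat.lt_succ_self _
  · intro i hi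
    rcases Nat.lt_succ_iff_lt_or_eq.1 hi with hi | rfl
    · rw [ho i hi, Function.update_of_ne (hwo i hi), h.num_ord i hi]
    · rw [Function.update_self, Function.update_self]
  · intro v hv
    by_cases hvw : v = w
    · subst hvw
      rw [Function.update_self, Nat.add_sub_cancel, Function.update_self]
      exact ⟨le_rfl, rfl⟩
    · rw [Function.update_of_ne hvw] at hv ⊢
      have h1 := h.ord_num v hv
      rw [ho _ (by omega)]
      exact ⟨by omega, h1.2⟩
  · intro i hi
    rcases Nat.lt_succ_iff_lt_or_eq.1 hi with hi | rfl
    · rw [ho i hi]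
      exact h.ord_lt i hi
    · rwa [Function.update_self]
  · rw [hp 0 (by omega)]
    exact h.parent_zero
  · intro i h0 hi
    rcases Nat.lt_succ_iff_lt_or_eq.1 hi with hi | rfl
    · rw [hp i hi]
      exact h.parent_lt i h0 hi
    · rwa [Function.update_self]
  · intro i h0 hi
    rcases Nat.lt_succ_iff_lt_or_eq.1 hi with hi | rfl
    · rw [hp i hi, ho i hi, ho _ (hpl i hi)]
      exact h.parent_adj i h0 hi
    · rw [Function.update_self, Function.update_self, ho cur hcl]
      exact hadj
  · intro i hi
    rcases Nat.lt_succ_iff_lt_or_eq.1 hi with hi | rfl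
    · rw [ho i hi]
      by_cases hic : i = cur
      · exact Or.inl ⟨1, hon i 0 hic.symm⟩
      · rw [Function.update_of_ne (hord i hi hic)]
        rcases h.done i hi with ⟨t, ht⟩ | hr
        · exact Or.inl ⟨t + 1, hon i t ht⟩
        · exact Or.inr hr
    · exact Or.inl ⟨0, rfl⟩
  · intro v hv
    by_cases hvc : v = ord cur
    · rw [hvc, Function.update_self]
      omega
    · rw [Function.update_of_ne hvc]
      exact h.sc_le v hv
  · intro v hv q hq
    by_cases hvc : v = ord cur
    · subst hvc
      rw [Function.update_self] at hq
      rcases Nat.lt_succ_iff_lt_or_eq.1 hq with hq | rfl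
      · have := h.scanned _ hv q hq
        exact ⟨hnum _ this.1, hnum _ this.2⟩
      · rw [hw, Function.update_self]
        refine ⟨hnum _ ?_, Nat.succ_ne_zero _⟩
        rw [h.num_ord cur h.cur_lt]
        exact Nat.succ_ne_zero _
    · rw [Function.update_of_ne hvc] at hq
      have := h.scanned v hv q hq
      exact ⟨hnum _ this.1, hnum _ this.2⟩
  · intro i hi q hq j hj he hne
    rcases Nat.lt_succ_iff_lt_or_eq.1 hi with hi | rfl
    · rw [ho i hi] at hq he
      rw [ho j (by omega)] at he
      rw [hp i hi] at hne
      by_cases hic : i = cur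
      · subst hic
        rw [Function.update_self] at hq
        rcases Nat.lt_succ_iff_lt_or_eq.1 hq with hq | rfl
        · exact h.up_of_scanned i hi q hq j hj he hne
        · exact absurd (he.symm.trans hw) (hwo j (by omega))
      · rw [Function.update_of_ne (hord i hi hic)] at hq
        exact h.up_of_scanned i hi q hq j hj he hne
    · rw [Function.update_self, Function.update_of_ne (hwo cur hcl).symm, hsc] at hq
      exact absurd hq (Nat.not_lt_zero q)
  · intro i hi
    obtain ⟨h1, h2, h3, h4⟩ := h.up i hi
    rw [hp i h1, ho i h1, ho _ (by omega)]
    exact ⟨by omega, h2, h3, h4⟩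
  · intro i j hij hj ha
    rw [ho i (by omega)] at ha
    rcases Nat.lt_succ_iff_lt_or_eq.1 hj with hj | rfl
    · rw [ho j hj] at ha
      obtain ⟨t, ht⟩ := h.ancestor i j hij hj ha
      exact ⟨t, by rw [hit t j hj, ht]⟩
    · rw [Function.update_self] at ha
      -- An earlier neighbour of the new vertex that is not on the search path has been scanned
      -- completely and would have reached the new vertex before. Hence all earlier neighbours are
      -- ancestors.
      rcases h.done i hij with ⟨t, ht⟩ | hr
      · exact ⟨t + 1, hon i t ht⟩
      · have hin := h.ord_lt i hij
        obtain ⟨q, hq, hqw⟩ := (hl.mem_iff _ hin w).1 ha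
        have := (h.scanned _ hin q (by omega)).2
        rw [hqw] at this
        exact absurd hk this

end SearchInv

end Cactus

/-! ### The adjacency lists of the input and the outcome of the search. -/

namespace RAM

open Cactus

variable {V : Type*} {n : ℕ} {G : SimpleGraph V} {num : Fin n ≃ V} {adj : Fin n → List (Fin n)}

/-- The adjacency of the numbers of the vertices. -/
def numAdj (G : SimpleGraph V) (num : Fin n ≃ V) (v w : ℕ) : Prop :=
  ∃ (hv : v < n) (hw : w < n), G.Adj (num ⟨v, hv⟩) (num ⟨w, hw⟩)

theorem inputState_mem_zero (r : Fin n) {j : ℕ} (hj : j ≤ n) :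
    (inputState adj r).mem 0 j = (((List.ofFn adj).take j).map List.length).sum := by
  change (if j ≤ n then _ else _) = _
  rw [if_pos hj]

theorem inputState_mem_zero_succ (r v : Fin n) : (inputState adj r).mem 0 (v + 1) =
    (inputState adj r).mem 0 v + (adj v).length := by
  rw [inputState_mem_zero r v.2, inputState_mem_zero r v.2.le,
    List.take_succ_eq_append_getElem (by rw [List.length_ofFn]; exact v.2), List.map_append,
    List.sum_append, List.getElem_ofFn]
  simp

theorem inputState_mem_zero_eq_sum (r : Fin n) {j : ℕ} (hj : j ≤ n) :
    (inputState adj r).mem 0 j = ∑ v : Fin n with v.1 < j, (adj v).length := by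
  induction j with
  | zero => simp [inputState_mem_zero]
  | succ j ih =>
    rw [inputState_mem_zero_succ r ⟨j, hj⟩, ih (by omega)]
    have : (Finset.univ.filter fun v : Fin n => v.1 < j + 1) =
        insert ⟨j, hj⟩ (Finset.univ.filter fun v : Fin n => v.1 < j) := by
      ext v
      simp only [Finset.mem_filter, Finset.mem_univ, true_and, Finset.mem_insert, Fin.ext_iff]
      omega
    rw [this, Finset.sum_insert (by simp), add_comm]

theorem inputState_mem_one (r v : Fin n) {q : ℕ} (hq : q < (adj v).length) :
    (inputState adj r).mem 1 ((inputState adj r).mem 0 v + q) = ((adj v)[q] : ℕ) := by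
  change (((List.ofFn adj).flatten).map Fin.val).getD _ 0 = _
  rw [inputState_mem_zero r v.2.le, List.getD_eq_getElem?_getD, List.getElem?_map,
    ← List.getElem?_drop, List.map_take, List.drop_sum_flatten,
    List.drop_eq_getElem_cons (by rw [List.length_ofFn]; exact v.2), List.flatten_cons,
    List.getElem_ofFn, List.getElem?_append_left hq, List.getElem?_eq_getElem hq]
  rfl

theorem listsOf_inputState (h : IsAdjacencyLists G num adj) (r : Fin n) :
    ListsOf n (numAdj G num) ((inputState adj r).mem 0) ((inputState adj r).mem 1) := by
  refine ⟨fun v hv => ?_, fun v hv w => ?_, fun v w h => ⟨h.1, h.2.1⟩,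
    fun v w ⟨h1, h2, h3⟩ => ⟨h2, h1, h3.symm⟩, fun v ⟨_, _, h⟩ => G.loopless.irrefl _ h⟩
  · exact (inputState_mem_zero_succ (adj := adj) r ⟨v, hv⟩).symm ▸ Nat.le_add_right _ _
  · have e := inputState_mem_zero_succ (adj := adj) r ⟨v, hv⟩
    dsimp only at e
    constructor
    · rintro ⟨_, hw, ha⟩
      obtain ⟨q, hq, he⟩ := List.mem_iff_getElem.1 (((h ⟨v, hv⟩).2 ⟨w, hw⟩).2 ha)
      refine ⟨q, by omega, ?_⟩
      rw [inputState_mem_one r ⟨v, hv⟩ hq, he]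
    · rintro ⟨q, hq, he⟩
      have hq' : q < (adj ⟨v, hv⟩).length := by omega
      rw [inputState_mem_one r ⟨v, hv⟩ hq'] at he
      subst he
      exact ⟨hv, Fin.is_lt _, ((h ⟨v, hv⟩).2 _).1 (List.getElem_mem hq')⟩

theorem card_numAdj_le (h : IsAdjacencyLists G num adj) (r : Fin n) {j : ℕ} (hj : j ≤ n) :
    (inputState adj r).mem 0 j ≤ n * n := by
  rw [inputState_mem_zero_eq_sum r hj]
  calc _ ≤ ∑ v : Fin n, (adj v).length :=
        Finset.sum_le_sum_of_subset (Finset.filter_subset _ _)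
    _ ≤ ∑ _v : Fin n, n := Finset.sum_le_sum fun v _ => by
        simpa using (h v).1.length_le_card
    _ = n * n := by simp

theorem bounded_inputState (h : IsAdjacencyLists G num adj) (r : Fin n) :
    Bounded (n * n) (inputState adj r) := by
  have hn : n ≤ n * n := Nat.le_mul_self n
  refine ⟨fun i => ?_, fun a j => ?_⟩
  · change (if i = 0 then n else if i = 1 then (r : ℕ) else 0) ≤ _
    split_ifs <;> omega
  · change (if a = 0 then if j ≤ n then _ else 0 else if a = 1 then _ else 0) ≤ _
    split_ifs with h0 hj h1
    · rw [← inputState_mem_zero r hj]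
      exact card_numAdj_le h r hj
    · omega
    · rw [List.getD_eq_getElem?_getD, List.getElem?_map]
      cases (List.ofFn adj).flatten[j]? with
      | none => exact Nat.zero_le _
      | some x => exact x.2.le.trans hn
    · omega

end RAM

namespace Cactus.SearchInv

open RAM

variable {n : ℕ} {A : ℕ → ℕ → Prop} {off adj : ℕ → ℕ} {cnt : ℕ} {num sc ord P U : ℕ → ℕ}

/-- When the search is back at the root and the list of the root is exhausted, every ancestor of the
current vertex is the root, so all lists of reached vertices are exhausted. The set of the reached
vertices is thus closed under adjacency. -/
theorem num_ne_zero_of_adj (hl : ListsOf n A off adj)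
    (h : SearchInv n A off adj 0 cnt num sc ord P U)
    (hd : ¬ off (ord 0) + sc (ord 0) < off (ord 0 + 1)) {v w : ℕ} (hv : num v ≠ 0) (ha : A v w) :
    num w ≠ 0 ∧ ∃ q < sc v, adj (off v + q) = w := by
  obtain ⟨h1, h2⟩ := h.ord_num v hv
  have hvn := (hl.lt v w ha).1
  obtain ⟨q, hq, hqw⟩ := (hl.mem_iff v hvn w).1 ha
  have hfull : off v + sc v = off (v + 1) := by
    rcases h.done (num v - 1) (by omega) with ⟨t, ht⟩ | hr
    · have h0 : num v - 1 = 0 := by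
        rw [← ht, Function.iterate_fixed h.parent_zero]
      rw [h0] at h2
      rw [h2] at hd
      have := h.sc_le v hvn
      omega
    · rwa [h2] at hr
  have hqs : q < sc v := by omega
  exact ⟨hqw ▸ (h.scanned v hvn q hqs).2, q, hqs, hqw⟩

/-- Connectedness makes the closed set of reached vertices everything. Exhausted lists then turn the
conditional statement about scanned entries into the full condition on back edges. -/
theorem isPalmTree {V : Type*} {G : SimpleGraph V} {numb : Fin n ≃ V} {lab : ℕ → V}
    (hG : G.Connected) (hl : ListsOf n (numAdj G numb) off adj)
    (h : SearchInv n (numAdj G numb) off adj 0 cnt num sc ord P U)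
    (hd : ¬ off (ord 0) + sc (ord 0) < off (ord 0 + 1))
    (hlab : ∀ i (hi : ord i < n), lab i = numb ⟨ord i, hi⟩) :
    cnt = n ∧ IsPalmTree G n lab P U := by
  have h0 := h.cur_lt
  have hr := h.ord_lt 0 h0
  have hall : ∀ v, num (numb.symm v) ≠ 0 := by
    intro v
    have hre := (SimpleGraph.reachable_iff_reflTransGen _ _).1 (hG.preconnected (numb ⟨ord 0, hr⟩) v)
    induction hre with
    | refl =>
      rw [numb.symm_apply_apply, h.num_ord 0 h0]
      exact Nat.succ_ne_zero _
    | tail _ ha ih =>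
      refine (h.num_ne_zero_of_adj hl hd ih ⟨Fin.is_lt _, Fin.is_lt _, ?_⟩).1
      simpa using ha
  have hcnt : cnt = n := by
    refine le_antisymm h.cnt_le ?_
    have : (Finset.range n).card ≤ (Finset.range cnt).card := by
      refine Finset.card_le_card_of_injOn (fun v => num v - 1) (fun v hv => ?_) fun v hv w hw he => ?_
      · simp only [Finset.coe_range, Set.mem_Iio] at hv ⊢
        have h1 := hall (numb ⟨v, hv⟩)
        rw [numb.symm_apply_apply] at h1
        have := (h.ord_num v h1).1
        have h1 : num v ≠ 0 := h1
        omega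
      · simp only [Finset.coe_range, Set.mem_Iio] at hv hw
        have h1 := hall (numb ⟨v, hv⟩)
        have h2 := hall (numb ⟨w, hw⟩)
        rw [numb.symm_apply_apply] at h1 h2
        rw [← (h.ord_num v h1).2, ← (h.ord_num w h2).2]
        exact congrArg ord he
    simpa using this
  subst hcnt
  have hlab' : ∀ i, (hi : i < cnt) → lab i = numb ⟨ord i, h.ord_lt i hi⟩ := fun i hi => hlab i _
  have hAdj : ∀ i j, i < cnt → j < cnt → (G.Adj (lab i) (lab j) ↔ numAdj G numb (ord i) (ord j)) := by
    intro i j hi hj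
    rw [hlab' i hi, hlab' j hj]
    exact ⟨fun ha => ⟨_, _, ha⟩, fun ⟨_, _, ha⟩ => ha⟩
  refine ⟨rfl, ?_, fun v => ?_, h.parent_zero, h.parent_lt, fun i hi0 hi => ?_, fun i j hij hj ha => ?_,
    fun j hj hU => ?_, fun i j hij hj ha hne => ?_⟩
  · intro i hi j hj he
    rw [hlab' i hi, hlab' j hj] at he
    have he' : ord i = ord j := congrArg Fin.val (numb.injective he)
    have h1 := h.num_ord i hi
    rw [he', h.num_ord j hj] at h1
    omega
  · have h1 := hall v
    obtain ⟨h2, h3⟩ := h.ord_num _ h1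
    refine ⟨num (numb.symm v) - 1, by omega, ?_⟩
    rw [hlab' _ (by omega)]
    simp only [h3, Fin.eta, Equiv.apply_symm_apply]
  · have := h.parent_lt i hi0 hi
    rw [hAdj _ _ (by omega) hi]
    exact h.parent_adj i hi0 hi
  · rw [hAdj _ _ (by omega) hj] at ha
    exact h.ancestor i j hij hj ha
  · obtain ⟨h1, h2, h3, h4⟩ := h.up j hU
    rw [hAdj _ _ (by omega) hj]
    exact ⟨h2, h3, h4⟩
  · rw [hAdj _ _ (by omega) hj] at ha
    have hnj := h.num_ord j hj
    obtain ⟨-, q, hq, hqw⟩ := h.num_ne_zero_of_adj hl hd (by omega) (hl.symm _ _ ha)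
    exact h.up_of_scanned j hj q hq i hij hqw hne

end Cactus.SearchInv

/-! ### The program of the depth-first search. -/

namespace Cactus

/-- The number of the entries that have not been scanned. -/
def unscanned (n : ℕ) (off sc : ℕ → ℕ) : ℕ := ∑ v ∈ Finset.range n, (off (v + 1) - (off v + sc v))

theorem unscanned_update {n v : ℕ} {off sc : ℕ → ℕ} (hv : v < n) (h : off v + sc v < off (v + 1)) :
    unscanned n off (Function.update sc v (sc v + 1)) + 1 = unscanned n off sc := by
  rw [unscanned, unscanned, ← Finset.add_sum_erase _ _ (Finset.mem_range.2 hv),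
    ← Finset.add_sum_erase (Finset.range n) (fun v => off (v + 1) - (off v + sc v))
      (Finset.mem_range.2 hv), Function.update_self,
    Finset.sum_congr rfl fun w hw => by rw [Function.update_of_ne (Finset.ne_of_mem_erase hw)]]
  omega

theorem ListsOf.unscanned_zero {n : ℕ} {A : ℕ → ℕ → Prop} {off adj : ℕ → ℕ}
    (hl : ListsOf n A off adj) (h0 : off 0 = 0) : unscanned n off (fun _ => 0) = off n := by
  have : ∀ m ≤ n, unscanned m off (fun _ => 0) = off m := by
    intro m
    induction m with
    | zero => exact fun _ => h0.symm
    | succ m ih =>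
      intro hm
      have h1 := ih (by omega)
      have h2 := hl.off_le m (by omega)
      rw [unscanned] at h1 ⊢
      rw [Finset.sum_range_succ, h1]
      omega
  exact this n le_rfl

end Cactus

namespace RAM

open Exp Prog Cactus

/-- Enters a new vertex. -/
def searchNew : Prog :=
  store 6 (reg 2) (reg 6) ++ store 4 (reg 6) (reg 2 + lit 1) ++ store 7 (reg 2) (reg 3) ++
  assign 3 (reg 2) ++ assign 2 (reg 2 + lit 1)

/-- Stores a back edge. -/
def searchBack : Prog :=
  branch (op .lt (reg 7) (reg 3 + lit 1))
    (branch (op .eq (reg 7) (load 7 (reg 3) + lit 1)) skip (store 8 (reg 3) (reg 7))) skip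

/-- Scans an entry of a list. -/
def searchScan : Prog :=
  assign 6 (load 1 (reg 8)) ++ store 5 (reg 5) (load 5 (reg 5) + lit 1) ++
  assign 7 (load 4 (reg 6)) ++ branch (reg 7) searchBack searchNew

/-- Returns to the parent. -/
def searchPop : Prog := branch (reg 3) (assign 3 (load 7 (reg 3))) (assign 4 (lit 0))

/-- One step of the search. -/
def searchBody : Prog :=
  assign 5 (load 6 (reg 3)) ++ assign 8 (load 0 (reg 5) + load 5 (reg 5)) ++
  branch (op .lt (reg 8) (load 0 (reg 5 + lit 1))) searchScan searchPop

/-- The depth-first search. -/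
def searchProg : Prog :=
  store 6 (lit 0) (reg 1) ++ store 4 (reg 1) (lit 1) ++ assign 2 (lit 1) ++ assign 3 (lit 0) ++
  assign 4 (lit 1) ++ loop (reg 4) searchBody

/-- The state during the search. -/
structure SearchState (n : ℕ) (A : ℕ → ℕ → Prop) (off adj : ℕ → ℕ) (s₀ t : State) : Prop where
  inv : SearchInv n A off adj (t.reg 3) (t.reg 2) (t.mem 4) (t.mem 5) (t.mem 6) (t.mem 7) (t.mem 8)
  off_eq : t.mem 0 = off
  adj_eq : t.mem 1 = adj
  reg : t.reg 0 = s₀.reg 0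
  root : t.mem 6 0 = s₀.reg 1
  run_le : t.reg 4 ≤ 1
  halt : t.reg 4 = 0 → t.reg 3 = 0 ∧
    ¬ off (t.mem 6 0) + t.mem 5 (t.mem 6 0) < off (t.mem 6 0 + 1)
  frame : ∀ a, a ≠ 4 → a ≠ 5 → a ≠ 6 → a ≠ 7 → a ≠ 8 → t.mem a = s₀.mem a

/-- The search terminates in at most `k` steps. -/
def SearchBound (n : ℕ) (off : ℕ → ℕ) (t : State) (k : ℕ) : Prop :=
  ∃ d, (t.mem 7)^[d] (t.reg 3) = 0 ∧ k = 2 * unscanned n off (t.mem 5) + d + t.reg 4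

variable {n M k : ℕ} {A : ℕ → ℕ → Prop} {off adj : ℕ → ℕ} {s₀ t : State}

/-- The measure is twice the number of unscanned entries plus the length of a climb from the current
vertex to the root plus the run flag. Scanning an entry gains two and costs at most one for a longer
climb, a return shortens the climb, and at the root the flag is cleared. -/
theorem searchPop_wp (hB : Bounded M t) (h : SearchState n A off adj s₀ t)
    (hk : SearchBound n off t k) (h4 : t.reg 4 ≠ 0)
    (hd : ¬ off (t.mem 6 (t.reg 3)) + t.mem 5 (t.mem 6 (t.reg 3)) < off (t.mem 6 (t.reg 3) + 1)) :
    searchPop.wp M (fun t' => SearchState n A off adj s₀ t' ∧ ∃ l < k, SearchBound n off t' l) t := by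
  obtain ⟨d, hd0, rfl⟩ := hk
  simp (disch := decide) only [searchPop, wp, eval_reg, eval_load, eval_lit]
  refine ⟨fun h0 => ⟨hB.2 7 _, ⟨?_, h.off_eq, h.adj_eq, ?_, h.root, ?_, ?_, h.frame⟩, ?_⟩,
    fun h0 => ⟨Nat.zero_le _, ⟨?_, h.off_eq, h.adj_eq, ?_, h.root, ?_, ?_, h.frame⟩, ?_⟩⟩ <;>
  simp (disch := decide) only [State.setReg_reg_self, State.setReg_reg_of_ne, State.setReg_mem,
    SearchBound]
  · exact h.inv.step_pop hd h0
  · exact h.reg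
  · exact h.run_le
  · exact fun h => absurd h h4
  · cases d with
    | zero => exact absurd hd0 h0
    | succ d => exact ⟨2 * unscanned n off (t.mem 5) + d + t.reg 4, by omega, d, hd0, rfl⟩
  · exact h.inv
  · exact h.reg
  · exact Nat.zero_le _
  · rw [h0] at hd
    exact fun _ => ⟨h0, hd⟩
  · exact ⟨_, by omega, d, hd0, rfl⟩

theorem searchScan_wp (hl : ListsOf n A off adj) (hM : n + 2 ≤ M) (hB : Bounded M t)
    (h : SearchState n A off adj s₀ t) (hk : SearchBound n off t k) (h4 : t.reg 4 ≠ 0) (h5 : t.reg 5 = t.mem 6 (t.reg 3))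
    (h8 : t.reg 8 = off (t.mem 6 (t.reg 3)) + t.mem 5 (t.mem 6 (t.reg 3)))
    (hd : off (t.mem 6 (t.reg 3)) + t.mem 5 (t.mem 6 (t.reg 3)) < off (t.mem 6 (t.reg 3) + 1)) :
    searchScan.wp M (fun t' => SearchState n A off adj s₀ t' ∧ ∃ l < k, SearchBound n off t' l)
      t := by
  obtain ⟨d, hd0, rfl⟩ := hk
  have hI := h.inv
  have hcn := hI.cnt_le
  have hcl := hI.cur_lt
  have hoff := hB.2 0 (t.mem 6 (t.reg 3) + 1)
  rw [h.off_eq] at hoff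
  have hun := unscanned_update (hI.ord_lt _ hcl) hd
  have hB4 := hB.2 4 (adj (off (t.mem 6 (t.reg 3)) + t.mem 5 (t.mem 6 (t.reg 3))))
  have hB1 := hB.2 1 (off (t.mem 6 (t.reg 3)) + t.mem 5 (t.mem 6 (t.reg 3)))
  rw [h.adj_eq] at hB1
  simp (disch := decide) only [searchScan, searchBack, searchNew, wp_append, wp, eval_reg, eval_load,
    eval_lit, eval_add, eval_lt_ne_zero, eval_lt_eq_zero, eval_eq_ne_zero, eval_eq_eq_zero,
    State.setReg_reg_self, State.setReg_reg_of_ne, State.setReg_mem, State.setMem_reg,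
    State.setMem_mem_of_ne, h5, h8, h.adj_eq]
  refine ⟨hB1, by omega, hB4, fun hk => ⟨fun hlt => ⟨fun he => ⟨⟨?_, ?_, ?_, ?_, ?_, ?_, ?_, ?_⟩, ?_⟩,
    fun he => ⟨hB4, ⟨?_, ?_, ?_, ?_, ?_, ?_, ?_, ?_⟩, ?_⟩⟩,
    fun hlt => ⟨⟨?_, ?_, ?_, ?_, ?_, ?_, ?_, ?_⟩, ?_⟩⟩,
    fun hk => ⟨hB1, by omega, by omega, by omega, by omega,
      ⟨?_, ?_, ?_, ?_, ?_, ?_, ?_, ?_⟩, ?_⟩⟩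
  case refine_8 | refine_17 | refine_26 | refine_35 =>
    intro a a4 a5 a6 a7 a8
    simp only [State.setReg_mem, State.setMem_mem_of_ne _ a4, State.setMem_mem_of_ne _ a5,
      State.setMem_mem_of_ne _ a6, State.setMem_mem_of_ne _ a7, State.setMem_mem_of_ne _ a8,
      h.frame a a4 a5 a6 a7 a8]
  all_goals simp (disch := decide) only [State.setReg_reg_self, State.setReg_reg_of_ne,
    State.setReg_mem, State.setMem_reg, State.setMem_mem_of_ne, State.setMem_mem_self, SearchBound]
  all_goals first
    | exact h.off_eq
    | exact h.adj_eq
    | exact h.reg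
    | exact h.root
    | exact h.run_le
    | exact fun h => absurd h h4
    | exact ⟨_, by omega, d, hd0, rfl⟩
    | skip
  · exact hI.step_back hl hd rfl hk (Or.inr ⟨by omega, rfl⟩)
  · exact hI.step_back hl hd rfl hk (Or.inl ⟨by omega, by omega, rfl⟩)
  · exact hI.step_back hl hd rfl hk (Or.inr ⟨by omega, rfl⟩)
  · exact hI.step_new hl hd rfl hk
  · rw [Function.update_of_ne (by omega)]
    exact h.root
  · refine ⟨_, ?_, d + 1, ?_, rfl⟩
    · omega
    · rw [Function.iterate_succ_apply, Function.update_self,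
        iterate_update hI.parent_zero hI.parent_lt d hcl, hd0]

theorem searchBody_wp (hl : ListsOf n A off adj) (hM : n + 2 ≤ M) (hB : Bounded M t)
    (h : SearchState n A off adj s₀ t) (hk : SearchBound n off t k) (h4 : t.reg 4 ≠ 0) :
    searchBody.wp M (fun t' => SearchState n A off adj s₀ t' ∧ ∃ l < k, SearchBound n off t' l)
      t := by
  have hI := h.inv
  have hb := hB.2 0 (t.mem 6 (t.reg 3) + 1)
  rw [h.off_eq] at hb
  have hsc := hI.sc_le _ (hI.ord_lt _ hI.cur_lt)
  refine wp_cut (P := assign 5 (load 6 (reg 3)) ++ assign 8 (load 0 (reg 5) + load 5 (reg 5)))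
    (fun t' => Bounded M t' ∧ t'.mem = t.mem ∧
    t'.reg 8 = off (t.mem 6 (t.reg 3)) + t.mem 5 (t.mem 6 (t.reg 3)) ∧
    t'.reg 5 = t.mem 6 (t.reg 3) ∧ ∀ j, j < 5 → t'.reg j = t.reg j) (wp_bounded hB ?_) ?_
  · simp (disch := decide) only [wp_append, wp, eval_reg, eval_load, eval_add,
      State.setReg_reg_self, State.setReg_reg_of_ne, State.setReg_mem, h.off_eq]
    refine ⟨hB.2 6 _, by omega, trivial, trivial, trivial, fun j hj => ?_⟩
    rw [State.setReg_reg_of_ne _ (by omega), State.setReg_reg_of_ne _ (by omega)]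
  · rintro t' ⟨hB', hm, h8, h5, hr⟩
    have r3 := hr 3 (by decide)
    have r4 := hr 4 (by decide)
    have r2 := hr 2 (by decide)
    have h' : SearchState n A off adj s₀ t' := by
      refine ⟨?_, ?_, ?_, ?_, ?_, ?_, ?_, ?_⟩
      · rw [hm, r3, r2]
        exact hI
      · rw [hm, h.off_eq]
      · rw [hm, h.adj_eq]
      · rw [hr 0 (by decide), h.reg]
      · rw [hm, h.root]
      · rw [r4]
        exact h.run_le
      · rw [hm, r3, r4]
        exact h.halt
      · rw [hm]
        exact h.frame
    have hk' : SearchBound n off t' k := by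
      rw [SearchBound, hm, r3, r4]
      exact hk
    rw [← hm, ← r3] at h8 h5
    rw [← r4] at h4
    refine ⟨fun he => ?_, fun he => ?_⟩
    · simp only [eval_lt_ne_zero, eval_reg, eval_load, eval_add, eval_lit, h8, h5, h'.off_eq] at he
      exact searchScan_wp hl hM hB' h' hk' h4 h5 h8 he
    · simp only [eval_lt_eq_zero, eval_reg, eval_load, eval_add, eval_lit, h8, h5, h'.off_eq] at he
      exact searchPop_wp hB' h' hk' h4 he

theorem searchProg_runs {W : ℕ} {s : State} (hW : Words W M 20) (hl : ListsOf n A off adj)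
    (hM : n + 2 ≤ M) (hB : Bounded M s) (h0 : s.mem 0 = off) (h1 : s.mem 1 = adj)
    (hr : s.reg 1 < n) (hoff : off 0 = 0) (hz : ∀ a, 2 ≤ a → s.mem a = fun _ => 0) :
    Runs W M searchProg s (200 * (off n + 1)) (fun t => t.reg 0 = s.reg 0 ∧ t.mem 6 0 = s.reg 1 ∧
      (∀ a, a ≠ 4 → a ≠ 5 → a ≠ 6 → a ≠ 7 → a ≠ 8 → t.mem a = s.mem a) ∧
      ∃ cnt, SearchInv n A off adj 0 cnt (t.mem 4) (t.mem 5) (t.mem 6) (t.mem 7) (t.mem 8) ∧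
        ¬ off (t.mem 6 0) + t.mem 5 (t.mem 6 0) < off (t.mem 6 0 + 1)) := by
  have e4 := hz 4 (by decide)
  have e5 := hz 5 (by decide)
  have e6 := hz 6 (by decide)
  have e7 := hz 7 (by decide)
  have e8 := hz 8 (by decide)
  have hstart : Runs W M (store 6 (lit 0) (reg 1) ++ store 4 (reg 1) (lit 1) ++ assign 2 (lit 1) ++
      assign 3 (lit 0) ++ assign 4 (lit 1)) s 20
      (fun t => SearchState n A off adj s t ∧ SearchBound n off t (2 * off n + 1)) := by
    refine (Runs.of_wp hW hB (by decide) ?_).mono (by decide) fun _ h => h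
    simp (disch := decide) only [wp_append, wp, eval_reg, eval_lit, State.setMem_reg]
    refine ⟨by omega, by omega, by omega, by omega, by omega, ⟨?_, h0, h1, ?_, ?_, ?_, ?_, ?_⟩, ?_⟩
    case refine_6 =>
      intro a a4 a5 a6 a7 a8
      simp only [State.setReg_mem, State.setMem_mem_of_ne _ a4, State.setMem_mem_of_ne _ a6]
    all_goals simp (disch := decide) only [State.setReg_reg_self, State.setReg_reg_of_ne,
      State.setReg_mem, State.setMem_reg, State.setMem_mem_of_ne, State.setMem_mem_self, SearchBound]
    · exact SearchInv.initial hl hr e4 e5 e7 e8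
    · rw [Function.update_self]
    · exact le_rfl
    · exact fun h => absurd h (by decide)
    · refine ⟨0, rfl, ?_⟩
      rw [e5, hl.unscanned_zero hoff]
  refine (hstart.append (c' := 180 * (off n + 1)) ?_).mono (by omega) fun _ h => h
  rintro t hBt ⟨hI, hk⟩
  refine (Runs.loop hW (by decide) (fun k t => SearchState n A off adj s t ∧ SearchBound n off t k)
    ?_ _ t hBt ⟨hI, hk⟩).mono ?_ ?_
  · rintro k t hBt ⟨hI, hk⟩ he
    refine wp_mono (searchBody_wp hl hM hBt hI hk he) ?_
    rintro t' ⟨h1, l, h2, h3⟩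
    exact ⟨l, h2, h1, h3⟩
  · calc _ ≤ (2 * off n + 1 + 1) * 90 := Nat.mul_le_mul_left _ (by decide)
      _ = _ := by ring
  · rintro t ⟨he, k, hI, -⟩
    obtain ⟨h3, h4⟩ := hI.halt he
    refine ⟨hI.reg, hI.root, hI.frame, t.reg 2, ?_, h4⟩
    have := hI.inv
    rwa [h3] at this

end RAM

/-! ### Linear bounds for the parameters of a cactus. -/

namespace Cactus

variable {V : Type*} {G : SimpleGraph V} {n : ℕ} {lab : ℕ → V} {P U : ℕ → ℕ}

theorem IsPalmTree.cactusTree [Finite V] (h : IsPalmTree G n lab P U) (hG : IsCactus G) :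
    CactusTree n P U where
  parent_zero := h.parent_zero
  parent_lt := h.parent_lt
  up_lt x hx hU := (h.up x hx hU).1
  up_ne x hx hU := (h.up x hx hU).2.1
  up_ancestor x hx hU := h.ancestor _ _ (h.up x hx hU).1 hx (h.up x hx hU).2.2
  cover_unique _ hx _ hx' _ _ _ hU hU' ht hc ht' hc' :=
    h.cover_unique hG hx hU hx' hU' ht hc ht' hc'

/-- A cactus has at most `4 n` pairs of adjacent vertices. -/
theorem IsPalmTree.card_adj_le [Finite V] (h : IsPalmTree G n lab P U) (hG : IsCactus G)
    (S : Finset (V × V)) (hS : ∀ p ∈ S, G.Adj p.1 p.2) : S.card ≤ 4 * n := by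
  classical
  have hsub : S ⊆ ((Finset.range n).image (fun j => (lab (P j), lab j)) ∪
      (Finset.range n).image (fun j => (lab j, lab (P j)))) ∪
      ((Finset.range n).image (fun j => (lab (U j - 1), lab j)) ∪
      (Finset.range n).image (fun j => (lab j, lab (U j - 1)))) := by
    rintro ⟨u, v⟩ hp
    have ha := hS _ hp
    dsimp only at ha
    obtain ⟨i, hi, rfl⟩ := h.surj u
    obtain ⟨j, hj, rfl⟩ := h.surj v
    simp only [Finset.mem_union, Finset.mem_image, Finset.mem_range, Prod.mk.injEq]
    rcases lt_trichotomy i j with hij | rfl | hij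
    · rcases h.eq_parent_or_eq_up hG hij hj ha with hp | hp
      · exact Or.inl (Or.inl ⟨j, hj, by rw [hp], rfl⟩)
      · exact Or.inr (Or.inl ⟨j, hj, by rw [hp, Nat.add_sub_cancel], rfl⟩)
    · exact absurd rfl ha.ne
    · rcases h.eq_parent_or_eq_up hG hij hi ha.symm with hp | hp
      · exact Or.inl (Or.inr ⟨i, hi, rfl, by rw [hp]⟩)
      · exact Or.inr (Or.inr ⟨i, hi, rfl, by rw [hp, Nat.add_sub_cancel]⟩)
  have hc : ∀ f : ℕ → V × V, ((Finset.range n).image f).card ≤ n := fun f => by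
    simpa using Finset.card_image_le (s := Finset.range n) (f := f)
  refine (Finset.card_le_card hsub).trans ((Finset.card_union_le _ _).trans ?_)
  have h1 := Finset.card_union_le ((Finset.range n).image (fun j => (lab (P j), lab j)))
    ((Finset.range n).image (fun j => (lab j, lab (P j))))
  have h2 := Finset.card_union_le ((Finset.range n).image (fun j => (lab (U j - 1), lab j)))
    ((Finset.range n).image (fun j => (lab j, lab (U j - 1))))
  have := hc fun j => (lab (P j), lab j)
  have := hc fun j => (lab j, lab (P j))
  have := hc fun j => (lab (U j - 1), lab j)
  have := hc fun j => (lab j, lab (U j - 1))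
  omega

theorem diam_le [Finite V] (hG : G.Connected) : G.diam ≤ Nat.card V := by
  have := Fintype.ofFinite V
  have := hG.nonempty
  obtain ⟨u, v, huv⟩ := G.exists_dist_eq_diam
  obtain ⟨p, hp, hl⟩ := (hG.preconnected u v).exists_path_of_dist
  rw [← huv, ← hl, Nat.card_eq_fintype_card]
  exact hp.length_lt.le

theorem IsPalmTree.numCycles_le [Finite V] (h : IsPalmTree G n lab P U) (hG : IsCactus G) :
    numCycles G ≤ n := by
  rw [h.numCycles_eq hG]
  simpa using Finset.card_filter_le (Finset.range n) fun x => U x ≠ 0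

theorem numTriangles_le_numCycles [Finite V] (G : SimpleGraph V) :
    numTriangles G ≤ numCycles G :=
  Set.ncard_le_ncard (fun _ h => h.1) (Set.toFinite _)

theorem numLeaves_le [Finite V] (G : SimpleGraph V) (r : V) : numLeaves G r ≤ Nat.card V := by
  rw [numLeaves, ← Set.ncard_univ]
  exact Set.ncard_le_ncard (Set.subset_univ _) Set.finite_univ

/-- The diameter, the number of cycles and the number of triangles are at most `n`, and `t + 2o ≤
3n`. With `π² ≤ 10` the grid side is at most `40 n² + 200 n³`, which gives the constant `240`. -/
theorem IsPalmTree.gridSide_le [Finite V] (h : IsPalmTree G n lab P U) (hG : IsCactus G)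
    (hn : Nat.card V = n) (h0 : 0 < n) (r : V) : gridSide G r ≤ 240 * (n : ℝ) ^ 3 := by
  have hd : (G.diam : ℝ) ≤ n := by exact_mod_cast hn ▸ diam_le hG.1
  have hc : (numCycles G : ℝ) ≤ n := by exact_mod_cast h.numCycles_le hG
  have ht : (numTriangles G : ℝ) ≤ n := by
    exact_mod_cast (numTriangles_le_numCycles G).trans (h.numCycles_le hG)
  have hs : (numSlopes G r : ℝ) ≤ 3 * n := by
    have h1 := h.numCycles_le hG
    have h2 := hn ▸ numLeaves_le G r
    rw [numSlopes]
    exact_mod_cast (by omega : numLeaves G r + 2 * numCycles G ≤ 3 * n)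
  have hn1 : (1 : ℝ) ≤ n := by exact_mod_cast h0
  have hpi : Real.pi ^ 2 ≤ 10 := by
    have h1 := Real.pi_lt_d2
    have h2 := Real.pi_pos
    nlinarith
  have hpi0 : 0 ≤ Real.pi ^ 2 := sq_nonneg _
  rw [gridSide]
  calc _ ≤ 2 * 10 / 3 * ((n : ℝ) + n) * (3 * n) + n * (2 * (10 / 3 * (3 * n)) ^ 2) := by gcongr
    _ = 40 * (n : ℝ) ^ 2 + 200 * (n : ℝ) ^ 3 := by ring
    _ ≤ _ := by nlinarith [sq_nonneg (n : ℝ), mul_nonneg (sq_nonneg (n : ℝ)) (sub_nonneg.2 hn1)]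

end Cactus

/-! ### Assembly of the algorithm. -/

namespace RAM

open Cactus Exp Prog

variable {V : Type*} {n : ℕ} {G : SimpleGraph V} {num : Fin n ≃ V} {adj : Fin n → List (Fin n)}

theorem exists_isAdjacencyLists (G : SimpleGraph V) (num : Fin n ≃ V) :
    ∃ adj : Fin n → List (Fin n), IsAdjacencyLists G num adj := by
  classical
  refine ⟨fun i => (Finset.univ.filter fun j => G.Adj (num i) (num j)).toList,
    fun i => ⟨Finset.nodup_toList _, fun j => ?_⟩⟩
  simp

/-- The labelling of the vertices by an array. -/
def labels (num : Fin n ≃ V) (r : Fin n) (ord : ℕ → ℕ) (i : ℕ) : V :=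
  if h : ord i < n then num ⟨ord i, h⟩ else num r

theorem labels_of_lt (r : Fin n) {ord : ℕ → ℕ} {i : ℕ} (h : ord i < n) :
    labels num r ord i = num ⟨ord i, h⟩ := dif_pos h

theorem Runs.mono_bound {W M M' c : ℕ} {P : Prog} {s : State} {Q : State → Prop}
    (h : Runs W M P s c Q) (hM : M ≤ M') : Runs W M' P s c (fun t => Bounded M t ∧ Q t) := by
  obtain ⟨T, t, h1, h2, h3, h4⟩ := h
  exact ⟨T, t, h1, h2, ⟨fun i => (h3.1 i).trans hM, fun a j => (h3.2 a j).trans hM⟩, h3, h4⟩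

/-- The result of the search. -/
structure Searched (G : SimpleGraph V) (num : Fin n ≃ V) (r : Fin n) (t : State) : Prop where
  reg : t.reg 0 = n
  root : labels num r (t.mem 6) 0 = num r
  tree : IsPalmTree G n (labels num r (t.mem 6)) (t.mem 7) (t.mem 8)
  ord_lt : ∀ i < n, t.mem 6 i < n
  ord_inj : ∀ i j, i < n → j < n → t.mem 6 i = t.mem 6 j → i = j
  zero : ∀ a, a = 2 ∨ a = 3 ∨ 9 ≤ a → t.mem a = fun _ => 0

theorem inputState_mem_of_two_le (r : Fin n) {a : ℕ} (ha : 2 ≤ a) :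
    (inputState adj r).mem a = fun _ => 0 := by
  funext j
  change (if a = 0 then _ else if a = 1 then _ else 0) = _
  rw [if_neg (by omega), if_neg (by omega)]

theorem search_runs {W M : ℕ} (hW : Words W M 20) (hG : G.Connected)
    (h : IsAdjacencyLists G num adj) (r : Fin n) (hM : n + 2 ≤ M) (hM' : n * n ≤ M) :
    Runs W M searchProg (inputState adj r) (200 * ((inputState adj r).mem 0 n + 1))
      (Searched G num r) := by
  have hB : Bounded M (inputState adj r) :=
    ⟨fun i => ((bounded_inputState h r).1 i).trans hM',
      fun a j => ((bounded_inputState h r).2 a j).trans hM'⟩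
  refine (searchProg_runs hW (listsOf_inputState h r) hM hB rfl rfl r.2 ?_
    fun a ha => inputState_mem_of_two_le r ha).mono le_rfl ?_
  · rw [inputState_mem_zero r (Nat.zero_le _)]
    rfl
  · rintro t ⟨h0, hr, hf, cnt, hI, hd⟩
    obtain ⟨rfl, hp⟩ := hI.isPalmTree hG (listsOf_inputState h r) hd
      (lab := labels num r (t.mem 6)) fun i hi => labels_of_lt r hi
    have hr' : t.mem 6 0 = r := hr
    refine ⟨h0, ?_, hp, hI.ord_lt, fun i j hi hj he => ?_, fun a ha => ?_⟩
    · rw [labels_of_lt r (hr' ▸ r.2)]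
      exact congrArg num (Fin.ext hr')
    · have h1 := hI.num_ord i hi
      rw [he, hI.num_ord j hj] at h1
      omega
    · rw [hf a (by omega) (by omega) (by omega) (by omega) (by omega)]
      exact inputState_mem_of_two_le r (by omega)

/-- The verified search is itself the existence proof: it is run with words that are large enough,
and its result is read off. -/
theorem exists_isPalmTree (hG : G.Connected) (h : IsAdjacencyLists G num adj) (r : Fin n) :
    ∃ lab P U, IsPalmTree G n lab P U := by
  have hW : Words ((n * n + n + 20) ^ 20) (n * n + n + 20) 20 := ⟨by omega, by omega, le_rfl⟩
  obtain ⟨_, t, -, -, -, ht⟩ := search_runs hW hG h r (by omega) (by omega)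
  exact ⟨_, _, _, ht.tree⟩

/-- The total length of the lists is the number of ordered pairs of adjacent vertices, and each such
pair belongs to a tree edge or to the only back edge at its lower end. This makes the search linear
in `n`. -/
theorem inputState_total_le (hG : IsCactus G) (h : IsAdjacencyLists G num adj) (r : Fin n) :
    (inputState adj r).mem 0 n ≤ 4 * n := by
  classical
  have := Finite.of_equiv _ num
  obtain ⟨lab, P, U, hp⟩ := exists_isPalmTree hG.1 h r
  have e : (inputState adj r).mem 0 n =
      ((Finset.univ.sigma fun v : Fin n => (adj v).toFinset).image
        fun p => (num p.1, num p.2)).card := by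
    rw [Finset.card_image_of_injective, Finset.card_sigma, inputState_mem_zero_eq_sum r le_rfl]
    · refine Finset.sum_congr (Finset.filter_true_of_mem fun v _ => v.2) fun v _ => ?_
      rw [List.toFinset_card_of_nodup (h v).1]
    · rintro ⟨a, b⟩ ⟨c, d⟩ he
      simp only [Prod.mk.injEq, EmbeddingLike.apply_eq_iff_eq] at he
      obtain ⟨rfl, rfl⟩ := he
      rfl
  rw [e]
  refine hp.card_adj_le hG _ fun p hp => ?_
  obtain ⟨⟨v, w⟩, hm, rfl⟩ := Finset.mem_image.1 hp
  rw [Finset.mem_sigma, List.mem_toFinset] at hm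
  exact ((h v).2 w).1 hm.2

end RAM

namespace RAM

open Cactus Exp Prog

variable {V : Type*} {n : ℕ} {G : SimpleGraph V} {num : Fin n ≃ V} {adj : Fin n → List (Fin n)}

/-- The preparation of the drawing. -/
def prepareProg : Prog := searchProg ++ (markProg ++ (sizeProg ++ slopeProg))

/-- The drawing algorithm for cacti. -/
def drawProg : Prog := prepareProg ++ posProg

/-- The state before the vertices are placed. -/
structure Prepared (G : SimpleGraph V) (num : Fin n ≃ V) (r : Fin n) (t : State) : Prop where
  reg : t.reg 0 = n
  root : labels num r (t.mem 6) 0 = num r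
  tree : IsPalmTree G n (labels num r (t.mem 6)) (t.mem 7) (t.mem 8)
  ord_lt : ∀ i < n, t.mem 6 i < n
  ord_inj : ∀ i j, i < n → j < n → t.mem 6 i = t.mem 6 j → i = j
  zero : ∀ a, a = 2 ∨ a = 3 ∨ 18 ≤ a → t.mem a = fun _ => 0
  marked : Marked n (t.mem 7) (t.mem 8) (t.mem 9) (t.mem 10) (t.mem 11)
  slotted : ∃ T tot, T ≤ numSlopes G (num r) ∧ t.mem 12 0 ≤ T ∧ Slotted n (t.mem 7) (t.mem 8)
    (t.mem 9) (t.mem 10) (t.mem 11) (t.mem 12) (t.mem 13) (t.mem 14) (t.mem 15) tot ∧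
    Dirs T (9 * T / 2) (t.mem 16) (t.mem 17)

/-- The term `54 n` bounds `18 T` for `T ≤ 3n`, as needed for the generation of the directions, and
`n * n` bounds the offsets in the input. -/
theorem prepareProg_runs {W M : ℕ} (hW : Words W M 20) (hG : IsCactus G)
    (h : IsAdjacencyLists G num adj) (r : Fin n) (hM : 54 * n + 20 ≤ M) (hM' : n * n ≤ M) :
    Runs W M prepareProg (inputState adj r) (10000 * n) (Prepared G num r) := by
  have := Finite.of_equiv _ num
  have hn : 0 < n := r.pos
  have hE := inputState_total_le hG h r
  refine ((search_runs hW hG.1 h r (by omega) hM').append (c' := 8900 * n) (R := Prepared G num r)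
    ?_).mono (by omega) fun _ h => h
  intro t₀ hB₀ h₀
  refine ((markProg_runs hW (h₀.tree.cactusTree hG) (by omega) hn hB₀ h₀.reg rfl rfl
    (h₀.zero 9 (by decide))).append (c' := 8500 * n) (R := Prepared G num r) ?_).mono (by omega)
    fun _ h => h
  rintro t₁ hB₁ ⟨r₁, f₁, hm⟩
  refine ((sizeProg_runs hW hm (by omega) hn hB₁ r₁ ⟨f₁ 7 (by decide) (by decide) (by decide),
    f₁ 8 (by decide) (by decide) (by decide), rfl, rfl, rfl⟩ ?_ ?_).append (c' := 8000 * n)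
    (R := Prepared G num r) ?_).mono (by omega) fun _ h => h
  · rw [f₁ 12 (by decide) (by decide) (by decide), h₀.zero 12 (by decide)]
  · rw [f₁ 13 (by decide) (by decide) (by decide), h₀.zero 13 (by decide)]
  rintro t₂ hB₂ ⟨r₂, f₂, tot, L, hI⟩
  have hT := hI.slots_le_of_inv
  have hT' := hI.slots_le_numSlopes hG h₀.tree hm
  rw [h₀.root] at hT'
  refine (slopeProg_runs hW hB₂ (by omega)).mono ?_ ?_
  · omega
  rintro t₃ ⟨r₃, f₃, hdirs⟩
  have f : ∀ a, a < 9 ∨ 18 ≤ a → t₃.mem a = t₀.mem a := fun a ha => by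
    rw [f₃ a (by omega) (by omega), f₂ a (by omega) (by omega) (by omega) (by omega),
      f₁ a (by omega) (by omega) (by omega)]
  have g : ∀ a, a < 12 → t₃.mem a = t₁.mem a := fun a ha => by
    rw [f₃ a (by omega) (by omega), f₂ a (by omega) (by omega) (by omega) (by omega)]
  have e : ∀ a, a < 16 → t₃.mem a = t₂.mem a := fun a ha => f₃ a (by omega) (by omega)
  have e6 := f 6 (by decide)
  have e7 := f 7 (by decide)
  have e8 := f 8 (by decide)
  refine ⟨r₃.trans r₂, ?_, ?_, ?_, ?_, fun a ha => ?_, ?_, t₂.reg 4, tot, hT', ?_, ?_, hdirs⟩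
  · rw [e6, h₀.root]
  · rw [e6, e7, e8]
    exact h₀.tree
  · rw [e6]
    exact h₀.ord_lt
  · rw [e6]
    exact h₀.ord_inj
  · rw [f a (by omega), h₀.zero a (by omega)]
  · rw [e7, e8, g 9 (by decide), g 10 (by decide), g 11 (by decide)]
    exact hm
  · rw [e 12 (by decide)]
    exact hI.size_zero_le
  · rw [e7, e8, g 9 (by decide), g 10 (by decide), g 11 (by decide), e 12 (by decide),
      e 13 (by decide), e 14 (by decide), e 15 (by decide)]
    exact hI.slotted hm

/-- The final state holds a drawing of the cactus on the grid. -/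
def Drawn (G : SimpleGraph V) (num : Fin n ≃ V) (r : Fin n) (t : State) : Prop :=
  IsTrulyIntegralFary G (outputDrawing num t) ∧ ∀ v,
    0 ≤ (outputDrawing num t v).1 ∧ 0 ≤ (outputDrawing num t v).2 ∧
    ((outputDrawing num t v).1 : ℝ) ≤ gridSide G (num r) ∧
    ((outputDrawing num t v).2 : ℝ) ≤ gridSide G (num r)

/-- Two bounds for the memory are used. All values before the placement are at most `D`, and the
placement multiplies up to three of them and adds up over at most `n` vertices, which requires the
larger bound `M`. -/
theorem drawProg_runs {W D M : ℕ} (hD : Words W D 20) (hW : Words W M 20) (hG : IsCactus G)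
    (h : IsAdjacencyLists G num adj) (r : Fin n) (hn : 54 * n + 20 ≤ D) (hn' : n * n ≤ D)
    (hDM : D ≤ M) (hM : n * (2 * D ^ 3) ≤ M) :
    Runs W M drawProg (inputState adj r) (10200 * n) (Drawn G num r) := by
  have := Finite.of_equiv _ num
  refine (((prepareProg_runs hD hG h r hn hn').mono_bound hDM).append (c' := 200 * n)
    (R := Drawn G num r) ?_).mono (by omega) fun _ h => h
  rintro t - ⟨hB, ht⟩
  obtain ⟨T, tot, hT, hsz, hsl, hdirs⟩ := ht.slotted
  refine (posProg_runs hW ht.marked ht.ord_inj hB (by omega) hDM hM r.pos ht.reg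
    ⟨rfl, rfl, rfl, rfl, rfl, rfl, rfl, rfl, rfl, rfl, rfl⟩ ht.zero).mono le_rfl ?_
  intro t' h'
  have hc : Construction n T (9 * T / 2) (t.mem 7) (t.mem 8) (t.mem 9) (t.mem 10) (t.mem 11)
      (t.mem 12) (t.mem 13) (t.mem 14) (t.mem 15) tot (t.mem 16) (t.mem 17) (t'.mem 18) (t'.mem 19)
      (t'.mem 20) := ⟨ht.marked, hsl, hsz, hdirs, h'.placed⟩
  have hpos : ∀ i < n, outputDrawing num t' (labels num r (t.mem 6) i) =
      ((t'.mem 19 i : ℤ), (t'.mem 20 i : ℤ)) := by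
    intro i hi
    rw [labels_of_lt r (ht.ord_lt i hi), outputDrawing, Equiv.symm_apply_apply]
    dsimp only
    rw [h'.out_x i hi, h'.out_y i hi]
  refine ⟨hc.isTrulyIntegralFary hG ht.tree hpos, fun v => ⟨Int.natCast_nonneg _,
    Int.natCast_nonneg _, ?_⟩⟩
  obtain ⟨i, hi, rfl⟩ := ht.tree.surj v
  have hle := hc.coord_le_gridSide hG ht.tree h'.root (by rw [ht.root]; omega) hi
  rw [ht.root] at hle
  rw [hpos i hi]
  refine ⟨le_trans ?_ hle, le_trans ?_ hle⟩
  · push_cast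
    exact le_max_left _ _
  · push_cast
    exact le_max_right _ _

theorem words_pow (n : ℕ) {j k : ℕ} (hj : 5 ≤ j) (hk : j * 20 ≤ k) :
    Words ((n + 2) ^ k) ((n + 2) ^ j) 20 := by
  have h : 2 ^ 5 ≤ (n + 2) ^ j :=
    (Nat.pow_le_pow_left (by omega) 5).trans (Nat.pow_le_pow_right (by omega) hj)
  refine ⟨by omega, by omega, ?_⟩
  rw [← pow_mul]
  exact Nat.pow_le_pow_right (by omega) hk

end RAM

open RAM Cactus in
/-- The drawing algorithm in time and space bounds that depend on the number of vertices only. -/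
theorem RAM.exec_drawProg {V : Type*} {G : SimpleGraph V} {n : ℕ} {num : Fin n ≃ V}
    {adj : Fin n → List (Fin n)} (hG : IsCactus G) (h : IsAdjacencyLists G num adj) (r : Fin n) :
    ∃ T s, Exec ((n + 2) ^ 800) drawProg (inputState adj r) T s ∧ T ≤ 10200 * n ∧
      Drawn G num r s := by
  have h6 : 2 ^ 6 ≤ (n + 2) ^ 6 := Nat.pow_le_pow_left (by omega) 6
  have h7 : 2 ^ 6 * (n + 2) ≤ (n + 2) ^ 7 := Nat.mul_le_mul_right _ h6
  have h8 : (n + 2) ^ 7 ≤ (n + 2) ^ 8 := Nat.pow_le_pow_right (by omega) (by decide)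
  have hsq : n * n ≤ (n + 2) ^ 8 :=
    calc n * n ≤ (n + 2) ^ 2 := by rw [pow_two]; exact Nat.mul_le_mul (by omega) (by omega)
      _ ≤ _ := Nat.pow_le_pow_right (by omega) (by decide)
  have hcube : n * (2 * ((n + 2) ^ 8) ^ 3) ≤ (n + 2) ^ 40 :=
    calc n * (2 * ((n + 2) ^ 8) ^ 3) ≤ (n + 2) * ((n + 2) * (n + 2) ^ 24) := by
          rw [← pow_mul]
          exact Nat.mul_le_mul (by omega) (Nat.mul_le_mul_right _ (by omega))
      _ = (n + 2) ^ 26 := by ring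
      _ ≤ _ := Nat.pow_le_pow_right (by omega) (by decide)
  -- The bounds are `D = (n + 2) ^ 8` and `M = (n + 2) ^ 40`, the latter generous since `n * (2 * D
  -- ^ 3)` is below `(n + 2) ^ 26`. Expressions of cost at most `20` then need words up to `M ^ 20`,
  -- whence the exponent `800`.
  obtain ⟨T, s, h1, h2, -, h3⟩ := drawProg_runs (words_pow n (j := 8) (k := 800) (by decide) (by decide))
    (words_pow n (j := 40) (k := 800) (by decide) (by decide)) hG h r (by omega) hsq
    (Nat.pow_le_pow_right (by omega) (by decide)) hcube
  exact ⟨T, s, h1, h2, h3⟩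

/-- There are one program and constants `c`, `C`, `k` that serve all rooted cacti: on adjacency
lists of the cactus `G` with `n` vertices, the program computes in time `c (n + (t + 2o)^{3/2})`,
with words of at most `k log₂ (n + 2)` bits, a truly integral Fáry embedding of `G` on the grid
`[0, S]²`, where `S = gridSide G r ≤ C n³`. -/
theorem theorem3 :
    ∃ (P : RAM.Prog) (c C : ℝ) (k : ℕ),
      ∀ (V : Type*) (G : SimpleGraph V) (r : V) (n : ℕ) (num : Fin n ≃ V),
        Cactus.IsCactus G →
        Cactus.gridSide G r ≤ C * (n : ℝ) ^ 3 ∧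
        ∀ adj : Fin n → List (Fin n), RAM.IsAdjacencyLists G num adj →
          ∃ (T : ℕ) (s : RAM.State),
            RAM.Exec ((n + 2) ^ k) P (RAM.inputState adj (num.symm r)) T s ∧
            (T : ℝ) ≤ c * ((n : ℝ) + (Cactus.numSlopes G r : ℝ) ^ (3 / 2 : ℝ)) ∧
            Cactus.IsTrulyIntegralFary G (RAM.outputDrawing num s) ∧
            ∀ v : V,
              0 ≤ (RAM.outputDrawing num s v).1 ∧ 0 ≤ (RAM.outputDrawing num s v).2 ∧
              ((RAM.outputDrawing num s v).1 : ℝ) ≤ Cactus.gridSide G r ∧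
              ((RAM.outputDrawing num s v).2 : ℝ) ≤ Cactus.gridSide G r := by
  refine ⟨RAM.drawProg, 10200, 240, 800, fun V G r n num hG => ⟨?_, fun adj h => ?_⟩⟩
  · have := Finite.of_equiv _ num
    obtain ⟨adj, h⟩ := RAM.exists_isAdjacencyLists G num
    obtain ⟨lab, P, U, hp⟩ := RAM.exists_isPalmTree hG.1 h (num.symm r)
    refine hp.gridSide_le hG ?_ (num.symm r).pos r
    rw [Nat.card_congr num.symm, Nat.card_eq_fintype_card, Fintype.card_fin]
  · obtain ⟨T, s, h1, h2, h3, h4⟩ := RAM.exec_drawProg hG h (num.symm r)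
    rw [num.apply_symm_apply] at h4
    refine ⟨T, s, h1, ?_, h3, h4⟩
    calc (T : ℝ) ≤ 10200 * n := by exact_mod_cast h2
      -- The running time is already linear in `n`; of the term with the exponent `3/2` only the
      -- sign matters.
      _ ≤ _ := by
        have : 0 ≤ (Cactus.numSlopes G r : ℝ) ^ (3 / 2 : ℝ) := Real.rpow_nonneg (Nat.cast_nonneg _) _
        linarith
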